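/- Let $f:\mathbb R^n\to\mathbb R^n$ and $g:\mathbb R^n\to\mathbb R^{n\times k}$ be continuous, with $f(0)=0$, and suppose that both are given by convergent power series in a neighbourhood of $0$. Consider $\dot x=f(x)+g(x)u$ with the cost $\int_0^\infty (x^TQ_1x+u^TRu)\,dt$, where $Q_1$ and $R$ are symmetric positive definite; controls are locally integrable functions on $[0,\infty)$. *Lifted system.* Let $\psi(x)=(x^\alpha)_{\alpha}$ be the infinite vector of all distinct monomials of degree $|\alpha|\ge 1$. The Carleman lift of the system is $\dot\psi=\mathcal A\psi+B_\psi u$, where $\mathcal A$ is the infinite matrix whose row $\alpha$ consists of the power series coefficients of $D(x^\alpha)f(x)$, and where the entry $(\alpha,j)$ of $B_\psi$ is the power series of $D(x^\alpha)g_j(x)$, with $g_j$ the $j$-th column of $g$. Let $Q=\mathrm{diag}(Q_1,0)$. For a gain $K\in\mathbb R^{k\times\infty}$ let $\mathcal A_{cl}(K)$ be the constant infinite matrix with $\mathcal A_{cl}(K)\psi=\mathcal A\psi-B_\psi K\psi$. It is block upper triangular with respect to the degree, and $K$ is called stabilizing if its degree-one diagonal block is Hurwitz. A cost matrix of $K$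 is a symmetric infinite matrix $P$ with $$\mathcal A_{cl}(K)^TP+P\mathcal A_{cl}(K)=-(Q+K^TRK).$$ For a matrix $P$ let $\Pi(P)$ denote the gain with $\Pi(P)\psi=R^{-1}B_\psi^TP\psi$ (comparison of coefficients), and let $\bar p$ be the vectorization of $P$, i.e. $\psi^TP\psi=\bar p^T\psi$. For $r>0$ put $\|P\|_r=\sum_{\alpha,\beta}|P_{\alpha\beta}|r^{|\alpha|+|\beta|}$ and $\|\bar p\|_r=\sum_\gamma|\bar p_\gamma|r^{|\gamma|}$. *Policy iteration.* Let $K_0$ be a stabilizing gain for which $K_0\psi(x)$ converges near $0$. For $i=0,1,2,\dots$ let $P_i$ be a cost matrix of $K_i$, and let $u=-K_{i+1}\psi$ with $K_{i+1}=\Pi(P_i)$ be the next control. In the data-driven form of the iteration the condition on $P_i$ is instead that $P_i$ is symmetric, that $\|P_i\|_{r_i}<\infty$ for some $r_i>0$, and that $$\bar p_i^T\big(\psi(t)-\psi(t+\tau)\big)=\int_t^{t+\tau}\big(x^TQ_1x+\psi^TK_i^TRK_i\psi\big)\,ds$$ along all closed-loop trajectories of $u=-K_i\psi$ in some neighbourhood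 of $0$. **Theorem.** 1. There is exactly one optimal gain $K^*$, that is, a gain such that $K^*\psi(x)$ converges near $0$ and such that, from every sufficiently small initial state, the feedback $u=-K^*\psi$ has a trajectory that tends to $0$, has finite cost, and attains the minimum of the cost over all controls. It has exactly one cost matrix $P^*$ (the optimal cost matrix), $K^*=\Pi(P^*)$, and $\psi(x_0)^TP^*\psi(x_0)$ is the minimal cost from $x_0$ for all sufficiently small $x_0$. 2. The sequence $(P_i,K_i)$ of the iteration exists and is unique, and it satisfies the data-driven form of the iteration. 3. There is $r>0$ with $\|P^*\|_r<\infty$, $\|P_i\|_r<\infty$ for all $i$, and $\|P_i-P^*\|_r\to 0$. In particular, for every $T\in(0,\infty)$ and every curve $x:[0,T]\to\{|x|_\infty\le r\}$, $\psi(x(t))^TP_i\psi(x(t))\to\psi(x(t))^TP^*\psi(x(t))$ uniformly on $[0,T]$. For every sequence $(P_i,K_i)$ that satisfies the data-driven form of the iteration with the same $K_0$ one has $\|\bar p_i\|_r<\infty$ for all $i$ and $\|\bar p_i-\bar p^*\|_r\to0$. -/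

import Mathlib

open scoped ENNReal

namespace Carleman

noncomputable section

/-- Indices of the lifted state: the nonzero multi-indices, i.e. the distinct monomials of positive
degree in `n` variables. -/
abbrev Idx (n : ℕ) : Type := {α : Fin n →₀ ℕ // α ≠ 0}

/-- The monomial `x ^ α`. -/
def mono {n : ℕ} (x : Fin n → ℝ) (α : Fin n →₀ ℕ) : ℝ := ∏ i, x i ^ α i

/-- The infinite lifted state `ψ(x) = col(x, x^[2], x^[3], …)`. -/
def lift {n : ℕ} (x : Fin n → ℝ) (α : Idx n) : ℝ := mono x α.1

/-- An input-affine system `ẋ = f(x) + g(x) u` with equilibrium `x = 0`, `u = 0`, whose drift and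
input matrix are continuous and are given near the equilibrium by their power series. -/
structure System (n k : ℕ) where
  f : (Fin n → ℝ) → (Fin n → ℝ)
  g : (Fin n → ℝ) → Matrix (Fin n) (Fin k) ℝ
  continuous_f : Continuous f
  continuous_g : Continuous g
  f_zero : f 0 = 0
  fSeries : Fin n → MvPowerSeries (Fin n) ℝ
  gSeries : Fin n → Fin k → MvPowerSeries (Fin n) ℝ
  hasSum_f : ∀ᶠ x in nhds (0 : Fin n → ℝ), ∀ l,
    HasSum (fun α => MvPowerSeries.coeff α (fSeries l) * mono x α) (f x l)
  hasSum_g : ∀ᶠ x in nhds (0 : Fin n → ℝ), ∀ l j,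
    HasSum (fun α => MvPowerSeries.coeff α (gSeries l j) * mono x α) (g x l j)

/-- The power series of `(∂/∂x)(x ^ α) · v(x)`, the rate of change of the monomial `x ^ α` along
the vector field with component series `v`. -/
def monoRate {n : ℕ} (v : Fin n → MvPowerSeries (Fin n) ℝ) (α : Fin n →₀ ℕ) :
    MvPowerSeries (Fin n) ℝ :=
  ∑ l, MvPowerSeries.monomial (α - Finsupp.single l 1) (α l : ℝ) * v l

/-- The power series `∑ r_α x ^ α` (no constant term), i.e. the linear form `rᵀ ψ(x)`. -/
def rowSeries {n : ℕ} (r : Idx n → ℝ) : MvPowerSeries (Fin n) ℝ :=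
  fun α => if h : α ≠ 0 then r ⟨α, h⟩ else 0

namespace System

variable {n k : ℕ} (S : System n k)

/-- The infinite state matrix `𝒜` of the lifted system. -/
def stateMatrix : Matrix (Idx n) (Idx n) ℝ :=
  fun α β => MvPowerSeries.coeff β.1 (monoRate S.fSeries α.1)

/-- The constant part of the `j`-th column of `B_ψ`. -/
def inputConst (α : Idx n) (j : Fin k) : ℝ :=
  MvPowerSeries.coeff 0 (monoRate (fun l => S.gSeries l j) α.1)

/-- The matrix `N_j` such that the `j`-th column of `B_ψ` is its constant part plus `N_j ψ`. -/
def inputMatrix (j : Fin k) : Matrix (Idx n) (Idx n) ℝ :=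
  fun α β => MvPowerSeries.coeff β.1 (monoRate (fun l => S.gSeries l j) α.1)

/-- The entry `(α, j)` of `B_ψ`, as a power series in `x`. -/
def inputSeries (α : Idx n) (j : Fin k) : MvPowerSeries (Fin n) ℝ :=
  MvPowerSeries.C (S.inputConst α j) + rowSeries (S.inputMatrix j α)

/-- The constant closed-loop matrix `𝒜_cl`, defined by `𝒜_cl ψ = 𝒜 ψ - B_ψ K ψ`. -/
def closedLoop (K : Matrix (Fin k) (Idx n) ℝ) : Matrix (Idx n) (Idx n) ℝ :=
  fun α β => S.stateMatrix α β -
    ∑ j, MvPowerSeries.coeff β.1 (S.inputSeries α j * rowSeries (K j))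

/-- The gain `K` with `K ψ = R⁻¹ B_ψᵀ P ψ`, by comparison of coefficients. Only the `α` with
`|α| ≤ |γ|` contribute to the sum. -/
def gain (R : Matrix (Fin k) (Fin k) ℝ) (P : Matrix (Idx n) (Idx n) ℝ) :
    Matrix (Fin k) (Idx n) ℝ :=
  R⁻¹ * Matrix.of fun j γ =>
    ∑ᶠ α : Idx n, MvPowerSeries.coeff γ.1 (S.inputSeries α j * rowSeries (P α))

/-- The degree-one diagonal block of `𝒜_cl`, i.e. the Jacobian of the closed loop at `0`. -/
def closedLoopLinear (K : Matrix (Fin k) (Idx n) ℝ) : Matrix (Fin n) (Fin n) ℝ :=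
  fun l m => S.closedLoop K ⟨Finsupp.single l 1, by simp⟩ ⟨Finsupp.single m 1, by simp⟩

/-- `𝒜_cl` is stable. It is block upper triangular and its diagonal blocks are Kronecker sums of
copies of the first one, so this says that the first one is Hurwitz. -/
def Stabilizing (K : Matrix (Fin k) (Idx n) ℝ) : Prop :=
  ∀ μ ∈ spectrum ℂ ((S.closedLoopLinear K).map (algebraMap ℝ ℂ)), μ.re < 0

end System

section Weights

variable {n k : ℕ}

/-- The lifted weight `Q = diag(Q₁, 0)`. -/
def liftWeight (Q₁ : Matrix (Fin n) (Fin n) ℝ) : Matrix (Idx n) (Idx n) ℝ :=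
  fun α β => ∑ i, ∑ j,
    if α.1 = Finsupp.single i 1 ∧ β.1 = Finsupp.single j 1 then Q₁ i j else 0

/-- The feedback `u = -K ψ(x)`. -/
def feedback (K : Matrix (Fin k) (Idx n) ℝ) (x : Fin n → ℝ) : Fin k → ℝ :=
  fun j => -∑' α, K j α * lift x α

/-- `K ψ(x)` is a convergent power series near `0`. -/
def GainConverges (K : Matrix (Fin k) (Idx n) ℝ) : Prop :=
  ∃ r > 0, ∀ j, Summable fun α : Idx n => |K j α| * r ^ α.1.degree

/-- The matrix `M` has finite `r`-norm. -/
def MatSummable (r : ℝ) (M : Matrix (Idx n) (Idx n) ℝ) : Prop :=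
  Summable fun p : Idx n × Idx n => |M p.1 p.2| * r ^ (p.1.1.degree + p.2.1.degree)

/-- The `r`-norm of an infinite matrix. -/
def matNorm (r : ℝ) (M : Matrix (Idx n) (Idx n) ℝ) : ℝ :=
  ∑' p : Idx n × Idx n, |M p.1 p.2| * r ^ (p.1.1.degree + p.2.1.degree)

/-- The quadratic form `ψ(x)ᵀ P ψ(x)`. -/
def quadForm (P : Matrix (Idx n) (Idx n) ℝ) (x : Fin n → ℝ) : ℝ :=
  ∑' p : Idx n × Idx n, lift x p.1 * P p.1 p.2 * lift x p.2

/-- The vectorization `p̄` of `P`, for which `ψᵀ P ψ = p̄ᵀ ψ`. -/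
def vectorize (P : Matrix (Idx n) (Idx n) ℝ) (γ : Idx n) : ℝ :=
  ∑ p ∈ Finset.HasAntidiagonal.antidiagonal γ.1,
    if h : p.1 ≠ 0 ∧ p.2 ≠ 0 then P ⟨p.1, h.1⟩ ⟨p.2, h.2⟩ else 0

/-- The vector `v` has finite `r`-norm. -/
def VecSummable (r : ℝ) (v : Idx n → ℝ) : Prop :=
  Summable fun γ : Idx n => |v γ| * r ^ γ.1.degree

/-- The `r`-norm of an infinite vector. -/
def vecNorm (r : ℝ) (v : Idx n → ℝ) : ℝ :=
  ∑' γ : Idx n, |v γ| * r ^ γ.1.degree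

/-- The running cost `xᵀ Q₁ x + uᵀ R u`. -/
def runningCost (Q₁ : Matrix (Fin n) (Fin n) ℝ) (R : Matrix (Fin k) (Fin k) ℝ)
    (x : Fin n → ℝ) (u : Fin k → ℝ) : ℝ :=
  x ⬝ᵥ Q₁.mulVec x + u ⬝ᵥ R.mulVec u

/-- The total cost `∫₀^∞ (xᵀ Q₁ x + uᵀ R u) dt`, possibly infinite. -/
def cost (Q₁ : Matrix (Fin n) (Fin n) ℝ) (R : Matrix (Fin k) (Fin k) ℝ)
    (x : ℝ → Fin n → ℝ) (u : ℝ → Fin k → ℝ) : ℝ≥0∞ :=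
  ∫⁻ t in Set.Ioi (0 : ℝ), ENNReal.ofReal (runningCost Q₁ R (x t) (u t))

end Weights

namespace System

variable {n k : ℕ} (S : System n k)

/-- `u` is a locally integrable control on `[0, ∞)` and `x` a corresponding (Carathéodory)
trajectory that starts at `x₀`. -/
structure Admissible (x₀ : Fin n → ℝ) (x : ℝ → Fin n → ℝ) (u : ℝ → Fin k → ℝ) : Prop where
  continuousOn : ContinuousOn x (Set.Ici 0)
  integrable : ∀ t ≥ 0, IntervalIntegrable u MeasureTheory.volume 0 t
  eq_integral : ∀ t ≥ 0, x t = x₀ + ∫ s in (0 : ℝ)..t, (S.f (x s) + (S.g (x s)).mulVec (u s))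

/-- The feedback `u = -K ψ` is optimal: from every small initial state it has a trajectory that
tends to `0`, has finite cost, and costs no more than any admissible pair. -/
def IsOptimalGain (Q₁ : Matrix (Fin n) (Fin n) ℝ) (R : Matrix (Fin k) (Fin k) ℝ)
    (K : Matrix (Fin k) (Idx n) ℝ) : Prop :=
  GainConverges K ∧ ∃ ρ > 0, ∀ x₀ : Fin n → ℝ, ‖x₀‖ < ρ → ∃ x : ℝ → Fin n → ℝ,
    (∀ t ≥ 0, ∀ j, Summable fun α => K j α * lift (x t) α) ∧
    S.Admissible x₀ x (fun t => feedback K (x t)) ∧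
    Filter.Tendsto x Filter.atTop (nhds 0) ∧
    cost Q₁ R x (fun t => feedback K (x t)) < ⊤ ∧
    ∀ x' u', S.Admissible x₀ x' u' →
      cost Q₁ R x (fun t => feedback K (x t)) ≤ cost Q₁ R x' u'

/-- `P` is a cost matrix of the gain `K`: a symmetric solution of
`𝒜_clᵀ P + P 𝒜_cl = -(Q + Kᵀ R K)`. Column `α` of `𝒜_cl` vanishes in rows of degree larger than
`|α|`, so all sums are finite. -/
def IsCostMatrix (Q₁ : Matrix (Fin n) (Fin n) ℝ) (R : Matrix (Fin k) (Fin k) ℝ)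
    (K : Matrix (Fin k) (Idx n) ℝ) (P : Matrix (Idx n) (Idx n) ℝ) : Prop :=
  P.IsSymm ∧ ∀ α β : Idx n,
    (∑ᶠ γ, S.closedLoop K γ α * P γ β) + (∑ᶠ γ, P α γ * S.closedLoop K γ β) =
      -(liftWeight Q₁ α β + (K.transpose * R * K) α β)

/-- Policy iteration with the Lyapunov equation as evaluation step:
`P_i` is a cost matrix of `K_i`, and `K_{i+1} ψ = R⁻¹ B_ψᵀ P_i ψ`. -/
structure LyapunovIteration (Q₁ : Matrix (Fin n) (Fin n) ℝ) (R : Matrix (Fin k) (Fin k) ℝ)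
    (K₀ : Matrix (Fin k) (Idx n) ℝ) (P : ℕ → Matrix (Idx n) (Idx n) ℝ)
    (K : ℕ → Matrix (Fin k) (Idx n) ℝ) : Prop where
  start : K 0 = K₀
  evaluate : ∀ i, S.IsCostMatrix Q₁ R (K i) (P i)
  improve : ∀ i, K (i + 1) = S.gain R (P i)

/-- `x` solves the closed loop `ẋ = f(x) - g(x) K ψ(x)` on `[t, t + τ]`. -/
def ClosedLoopTrajectory (K : Matrix (Fin k) (Idx n) ℝ) (x : ℝ → Fin n → ℝ) (t τ : ℝ) : Prop :=
  ∀ s ∈ Set.Icc t (t + τ), HasDerivWithinAt x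
    (S.f (x s) + (S.g (x s)).mulVec (feedback K (x s))) (Set.Icc t (t + τ)) s

/-- `P` fits the closed-loop data of the gain `K`: it is symmetric, `ψᵀ P ψ` converges near `0`,
and along all closed-loop trajectories near `0`
`p̄ᵀ (ψ(t) - ψ(t + τ)) = ∫_t^{t+τ} (xᵀ Q₁ x + ψᵀ Kᵀ R K ψ) ds`. -/
def FitsData (Q₁ : Matrix (Fin n) (Fin n) ℝ) (R : Matrix (Fin k) (Fin k) ℝ)
    (K : Matrix (Fin k) (Idx n) ℝ) (P : Matrix (Idx n) (Idx n) ℝ) : Prop :=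
  P.IsSymm ∧ (∃ r > 0, MatSummable r P) ∧ ∃ ρ > 0, ∀ (x : ℝ → Fin n → ℝ) (t τ : ℝ), 0 < τ →
    S.ClosedLoopTrajectory K x t τ → (∀ s ∈ Set.Icc t (t + τ), ‖x s‖ < ρ) →
    ∑' γ, vectorize P γ * (lift (x t) γ - lift (x (t + τ)) γ) =
      ∫ s in t..(t + τ), runningCost Q₁ R (x s) (feedback K (x s))

/-- Policy iteration with the data-driven evaluation step. -/
structure DataIteration (Q₁ : Matrix (Fin n) (Fin n) ℝ) (R : Matrix (Fin k) (Fin k) ℝ)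
    (K₀ : Matrix (Fin k) (Idx n) ℝ) (P : ℕ → Matrix (Idx n) (Idx n) ℝ)
    (K : ℕ → Matrix (Fin k) (Idx n) ℝ) : Prop where
  start : K 0 = K₀
  evaluate : ∀ i, S.FitsData Q₁ R (K i) (P i)
  improve : ∀ i, K (i + 1) = S.gain R (P i)

end System

end

end Carleman

/-! Encoding. A matrix `P` is read as the power series W(x,y) = ψ(x)ᵀPψ(y) in two groups of
variables (`biSeries`). Its restriction to y = x is the value function V = p̄ᵀψ. If F is the series
of the closed-loop field and κ = Kψ, the equation of a cost matrix becomes a first-order linear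
equation: the derivative of W along (F(x), F(y)) equals -(xᵀQ₁y + κ(x)ᵀRκ(y)) (`costEquation_iff`).
For symmetric `P` the improved gain is ½R⁻¹gᵀ∇V (`gainSeries_gain_eq_policy`).

Linear theory. Along a diagonal linear field with eigenvalues Λ, Re Λ ≤ -μ, the derivative
multiplies the coefficient of x^α by α·Λ, and |α·Λ| ≥ μ|α|. There are no small divisors, and the
inverse gains one derivative in the weighted ℓ¹ norm of a polydisc. The rest of the field is
absorbed once its norm on the polydisc of radius r is at most (μ/2)r. A Hurwitz matrix is nearly
diagonal in suitable complex coordinates, so the same holds for every field whose linear part is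
close to it, with constants independent of the field and of r (`exists_adaptedNorm`). This gives
existence, uniqueness and convergence of cost matrices.

Policy iteration is Newton's method. Completing the square, the derivative of V_i - V_{i+1} along
the new field is -(κ_i - κ_{i+1})ᵀR(κ_i - κ_{i+1}) (`lie_field_policy`). With the gained derivative
this yields r‖κ_{i+1} - κ_{i+2}‖ ≤ D‖κ_i - κ_{i+1}‖² (`nu_policy_sub_le`). The danger is that the
polydiscs shrink with i. The linear parts of the gains follow Kleinman's iteration, which converges
by monotonicity (`exists_tendsto_kleinman`). So an index i₀ can be chosen at which the linear part
of the difference is small, and then a radius r at which the higher-order part is small as well. The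
difference is then at most ηr, and from there on it halves in every step on the same polydisc
(`exists_tail`). The limit and its cost matrix are obtained on that polydisc
(`LyapunovIteration.exists_limit`); the finitely many earlier iterates only cost a smaller radius.

Optimality. The limit solves the Hamilton–Jacobi–Bellman equation near 0 (`eventually_gradient_eq`).
V is only defined locally, but a competitor that costs at most V(x₀) cannot leave the ball
(`LocalValue.forall_norm_lt`), and finite cost brings it arbitrarily close to 0. Hence V is the
minimal cost. Any other optimal feedback must agree with K* at time 0 from every small x₀, so the
two power series coincide.

Data. Differentiating the data identity at the initial time gives the equation of V on the diagonal
y = x. It determines p̄ but not `P`. Since the gain of a symmetric `P` depends on p̄ only, both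
forms of the iteration produce the same gains. -/

open scoped ENNReal NNReal
namespace Carleman
noncomputable section
open MvPowerSeries

/-! ### Weighted ℓ¹ norms of power series, with values in [0,∞]. -/

section Norm

variable {σ 𝕜 : Type*} [NormedField 𝕜]

/-- The weighted `ℓ¹`-norm of the coefficients of a power series. -/
def wnorm (w : (σ →₀ ℕ) → ℝ≥0∞) (p : MvPowerSeries σ 𝕜) : ℝ≥0∞ := ∑' α, w α * ‖coeff α p‖ₑ

/-- The weight `r ^ |α|`. -/
def radial (r : ℝ≥0) (α : σ →₀ ℕ) : ℝ≥0∞ := (r : ℝ≥0∞) ^ α.degree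

/-- The norm `∑ |p_α| r ^ |α|` of a power series on the polydisc of radius `r`. -/
abbrev pnorm (r : ℝ≥0) (p : MvPowerSeries σ 𝕜) : ℝ≥0∞ := wnorm (radial r) p

theorem wnorm_zero (w : (σ →₀ ℕ) → ℝ≥0∞) : wnorm w (0 : MvPowerSeries σ 𝕜) = 0 := by
  simp [wnorm]

theorem wnorm_neg (w : (σ →₀ ℕ) → ℝ≥0∞) (p : MvPowerSeries σ 𝕜) : wnorm w (-p) = wnorm w p := by
  simp [wnorm]

theorem wnorm_add_le (w : (σ →₀ ℕ) → ℝ≥0∞) (p q : MvPowerSeries σ 𝕜) :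
    wnorm w (p + q) ≤ wnorm w p + wnorm w q := by
  rw [wnorm, wnorm, wnorm, ← ENNReal.tsum_add]
  refine ENNReal.tsum_le_tsum fun α => ?_
  rw [← mul_add, map_add]
  gcongr
  exact enorm_add_le _ _

theorem wnorm_sub_le (w : (σ →₀ ℕ) → ℝ≥0∞) (p q : MvPowerSeries σ 𝕜) :
    wnorm w (p - q) ≤ wnorm w p + wnorm w q := by
  rw [sub_eq_add_neg, ← wnorm_neg w q]
  exact wnorm_add_le w p _

theorem wnorm_sum_le {ι : Type*} (w : (σ →₀ ℕ) → ℝ≥0∞) (s : Finset ι)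
    (p : ι → MvPowerSeries σ 𝕜) : wnorm w (∑ i ∈ s, p i) ≤ ∑ i ∈ s, wnorm w (p i) := by
  classical
  induction s using Finset.induction_on with
  | empty => simp [wnorm_zero]
  | insert a s ha ih =>
    rw [Finset.sum_insert ha, Finset.sum_insert ha]
    exact (wnorm_add_le _ _ _).trans (by gcongr)

theorem wnorm_C_mul (w : (σ →₀ ℕ) → ℝ≥0∞) (c : 𝕜) (p : MvPowerSeries σ 𝕜) :
    wnorm w (C c * p) = ‖c‖ₑ * wnorm w p := by
  rw [wnorm, wnorm, ← ENNReal.tsum_mul_left]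
  refine tsum_congr fun α => ?_
  rw [coeff_C_mul, enorm_mul]
  ring

theorem wnorm_le_of_coeff_le {𝕜' : Type*} [NormedField 𝕜'] {w v : (σ →₀ ℕ) → ℝ≥0∞}
    {p : MvPowerSeries σ 𝕜} {q : MvPowerSeries σ 𝕜'}
    (h : ∀ α, w α * ‖coeff α p‖ₑ ≤ v α * ‖coeff α q‖ₑ) : wnorm w p ≤ wnorm v q :=
  ENNReal.tsum_le_tsum h

theorem wnorm_mono {w v : (σ →₀ ℕ) → ℝ≥0∞} (h : ∀ α, w α ≤ v α) (p : MvPowerSeries σ 𝕜) :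
    wnorm w p ≤ wnorm v p :=
  wnorm_le_of_coeff_le fun α => by gcongr; exact h α

theorem pnorm_mono {r s : ℝ≥0} (h : r ≤ s) (p : MvPowerSeries σ 𝕜) : pnorm r p ≤ pnorm s p :=
  wnorm_mono (fun α => by unfold radial; gcongr) p

theorem le_wnorm (w : (σ →₀ ℕ) → ℝ≥0∞) (p : MvPowerSeries σ 𝕜) (α : σ →₀ ℕ) :
    w α * ‖coeff α p‖ₑ ≤ wnorm w p :=
  ENNReal.le_tsum α

/-- Three different weights are allowed, and the inequality between them is needed only on the
support of `p`. Weights that are cut off at a degree satisfy it only for exponents α ≠ 0, that is,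
for `p` without constant term. -/
theorem wnorm_mul_le {w u v : (σ →₀ ℕ) → ℝ≥0∞} {p q : MvPowerSeries σ 𝕜}
    (h : ∀ α β, coeff α p ≠ 0 → w (α + β) ≤ u α * v β) :
    wnorm w (p * q) ≤ wnorm u p * wnorm v q := by
  classical
  have key : ∀ γ : σ →₀ ℕ, w γ * ‖coeff γ (p * q)‖ₑ ≤
      ∑ x ∈ Finset.HasAntidiagonal.antidiagonal γ,
        (u x.1 * ‖coeff x.1 p‖ₑ) * (v x.2 * ‖coeff x.2 q‖ₑ) := fun γ => by
    rw [coeff_mul]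
    refine (mul_le_mul_right (enorm_sum_le _ _) _).trans ?_
    rw [Finset.mul_sum]
    refine Finset.sum_le_sum fun x hx => ?_
    rw [enorm_mul]
    by_cases h0 : coeff x.1 p = 0
    · simp [h0]
    · have := h x.1 x.2 h0
      rw [Finset.HasAntidiagonal.mem_antidiagonal.1 hx] at this
      calc w γ * (‖coeff x.1 p‖ₑ * ‖coeff x.2 q‖ₑ)
          ≤ (u x.1 * v x.2) * (‖coeff x.1 p‖ₑ * ‖coeff x.2 q‖ₑ) := by gcongr
        _ = _ := by ring
  calc wnorm w (p * q) ≤ ∑' γ : σ →₀ ℕ, ∑ x ∈ Finset.HasAntidiagonal.antidiagonal γ,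
        (u x.1 * ‖coeff x.1 p‖ₑ) * (v x.2 * ‖coeff x.2 q‖ₑ) := ENNReal.tsum_le_tsum key
    _ = ∑' γ : σ →₀ ℕ, ∑' x : Finset.HasAntidiagonal.antidiagonal γ,
        (u x.1.1 * ‖coeff x.1.1 p‖ₑ) * (v x.1.2 * ‖coeff x.1.2 q‖ₑ) := by
      refine tsum_congr fun γ => ?_
      rw [Finset.tsum_subtype (Finset.HasAntidiagonal.antidiagonal γ)
        (fun x => (u x.1 * ‖coeff x.1 p‖ₑ) * (v x.2 * ‖coeff x.2 q‖ₑ))]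
    _ = ∑' x : Σ γ : σ →₀ ℕ, Finset.HasAntidiagonal.antidiagonal γ,
        (u x.2.1.1 * ‖coeff x.2.1.1 p‖ₑ) * (v x.2.1.2 * ‖coeff x.2.1.2 q‖ₑ) :=
      (ENNReal.tsum_sigma _).symm
    _ = ∑' x : (σ →₀ ℕ) × (σ →₀ ℕ),
        (u x.1 * ‖coeff x.1 p‖ₑ) * (v x.2 * ‖coeff x.2 q‖ₑ) :=
      Finset.HasAntidiagonal.sigmaAntidiagonalEquivProd.tsum_eq
        (fun x : (σ →₀ ℕ) × (σ →₀ ℕ) => (u x.1 * ‖coeff x.1 p‖ₑ) * (v x.2 * ‖coeff x.2 q‖ₑ))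
    _ = wnorm u p * wnorm v q := by
      rw [ENNReal.tsum_prod (f := fun α β => (u α * ‖coeff α p‖ₑ) * (v β * ‖coeff β q‖ₑ)),
        wnorm, wnorm, ← ENNReal.tsum_mul_right]
      refine tsum_congr fun α => ?_
      rw [ENNReal.tsum_mul_left]

theorem radial_add (r : ℝ≥0) (α β : σ →₀ ℕ) : radial r (α + β) = radial r α * radial r β := by
  simp [radial, pow_add]

theorem pnorm_mul_le (r : ℝ≥0) (p q : MvPowerSeries σ 𝕜) :
    pnorm r (p * q) ≤ pnorm r p * pnorm r q :=
  wnorm_mul_le fun α β _ => (radial_add r α β).le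

theorem wnorm_monomial (w : (σ →₀ ℕ) → ℝ≥0∞) (α : σ →₀ ℕ) (c : 𝕜) :
    wnorm w (monomial α c) = w α * ‖c‖ₑ := by
  classical
  rw [wnorm, tsum_eq_single α]
  · simp
  · intro β hβ
    simp [coeff_monomial, hβ]

theorem pnorm_C (r : ℝ≥0) (c : 𝕜) : pnorm r (C c : MvPowerSeries σ 𝕜) = ‖c‖ₑ := by
  rw [← monomial_zero_eq_C_apply, pnorm, wnorm_monomial]
  simp [radial]

theorem pnorm_one (r : ℝ≥0) : pnorm r (1 : MvPowerSeries σ 𝕜) = 1 := by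
  rw [← map_one C, pnorm_C]
  simp

theorem pnorm_X (r : ℝ≥0) (s : σ) : pnorm r (X s : MvPowerSeries σ 𝕜) = r := by
  rw [X_def, pnorm, wnorm_monomial]
  simp [radial]

theorem pnorm_pow_le (r : ℝ≥0) (p : MvPowerSeries σ 𝕜) (m : ℕ) :
    pnorm r (p ^ m) ≤ pnorm r p ^ m := by
  induction m with
  | zero => simp [pnorm_one]
  | succ m ih =>
    rw [pow_succ, pow_succ]
    exact (pnorm_mul_le _ _ _).trans (by gcongr)

theorem pnorm_prod_le {ι : Type*} (r : ℝ≥0) (s : Finset ι) (p : ι → MvPowerSeries σ 𝕜) :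
    pnorm r (∏ i ∈ s, p i) ≤ ∏ i ∈ s, pnorm r (p i) := by
  classical
  induction s using Finset.induction_on with
  | empty => simp [pnorm_one]
  | insert a s ha ih =>
    rw [Finset.prod_insert ha, Finset.prod_insert ha]
    exact (pnorm_mul_le _ _ _).trans (by gcongr)

theorem wnorm_map {𝕜' : Type*} [NormedField 𝕜'] (φ : 𝕜 →+* 𝕜') (hφ : ∀ c, ‖φ c‖ = ‖c‖)
    (w : (σ →₀ ℕ) → ℝ≥0∞) (p : MvPowerSeries σ 𝕜) : wnorm w (map φ p) = wnorm w p := by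
  refine tsum_congr fun α => ?_
  rw [coeff_map, ← ofReal_norm, hφ, ofReal_norm]

theorem eq_zero_of_wnorm_eq_zero {w : (σ →₀ ℕ) → ℝ≥0∞} {p : MvPowerSeries σ 𝕜}
    (h : wnorm w p = 0) {α : σ →₀ ℕ} (hw : w α ≠ 0) : coeff α p = 0 := by
  rw [wnorm, ENNReal.tsum_eq_zero] at h
  simpa [hw] using h α

theorem eq_zero_of_pnorm_eq_zero {r : ℝ≥0} (hr : 0 < r) {p : MvPowerSeries σ 𝕜}
    (h : pnorm r p = 0) : p = 0 := by
  ext α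
  exact eq_zero_of_wnorm_eq_zero h (by simp [radial, hr.ne'])

/-- Fatou's lemma: every finite partial sum of the norm passes to the limit, so coefficientwise
convergence is enough to keep a bound. -/
theorem wnorm_le_of_tendsto {w : (σ →₀ ℕ) → ℝ≥0∞} (hw : ∀ α, w α ≠ ⊤)
    {p : ℕ → MvPowerSeries σ 𝕜} {q : MvPowerSeries σ 𝕜}
    (h : ∀ α, Filter.Tendsto (fun i => coeff α (p i)) Filter.atTop (nhds (coeff α q)))
    {c : ℝ≥0∞} (hc : ∀ᶠ i in Filter.atTop, wnorm w (p i) ≤ c) : wnorm w q ≤ c := by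
  rw [wnorm, ENNReal.tsum_eq_iSup_sum]
  refine iSup_le fun s => ?_
  have : Filter.Tendsto (fun i => ∑ α ∈ s, w α * ‖coeff α (p i)‖ₑ) Filter.atTop
      (nhds (∑ α ∈ s, w α * ‖coeff α q‖ₑ)) :=
    tendsto_finsetSum _ fun α _ =>
      ENNReal.Tendsto.const_mul ((continuous_enorm.tendsto _).comp (h α)) (Or.inr (hw α))
  refine le_of_tendsto this ?_
  filter_upwards [hc] with i hi
  exact (ENNReal.sum_le_tsum s).trans hi

/-- A series without terms of degree less than `d` is of order `r ^ d` on small polydiscs. -/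
theorem pnorm_le_of_order {d : ℕ} {p : MvPowerSeries σ 𝕜}
    (hp : ∀ α : σ →₀ ℕ, α.degree < d → coeff α p = 0) {t r : ℝ≥0} (ht : t ≤ 1) :
    pnorm (t * r) p ≤ (t : ℝ≥0∞) ^ d * pnorm r p := by
  rw [pnorm, wnorm, pnorm, wnorm, ← ENNReal.tsum_mul_left]
  refine ENNReal.tsum_le_tsum fun α => ?_
  by_cases h : α.degree < d
  · simp [hp α h]
  · rw [← mul_assoc]
    gcongr
    rw [radial, radial, ENNReal.coe_mul, mul_pow]
    gcongr ?_ * _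
    exact pow_le_pow_right_of_le_one' (by exact_mod_cast ht) (not_lt.1 h)

theorem tendsto_coeff_of_tendsto_wnorm {w : (σ →₀ ℕ) → ℝ≥0∞} {p : ℕ → MvPowerSeries σ 𝕜}
    {q : MvPowerSeries σ 𝕜} {α : σ →₀ ℕ} (hw : w α ≠ 0) (hw' : w α ≠ ⊤)
    (h : Filter.Tendsto (fun i => wnorm w (p i - q)) Filter.atTop (nhds 0)) :
    Filter.Tendsto (fun i => coeff α (p i)) Filter.atTop (nhds (coeff α q)) := by
  rw [tendsto_iff_edist_tendsto_0]
  have h2 : Filter.Tendsto (fun i => (w α)⁻¹ * wnorm w (p i - q)) Filter.atTop (nhds 0) := by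
    simpa using ENNReal.Tendsto.const_mul h (Or.inr (ENNReal.inv_ne_top.2 hw))
  refine tendsto_of_tendsto_of_tendsto_of_le_of_le tendsto_const_nhds h2
    (fun _ => zero_le) fun i => ?_
  have := le_wnorm w (p i - q) α
  rw [edist_eq_enorm_sub, ← map_sub]
  calc ‖coeff α (p i - q)‖ₑ = (w α)⁻¹ * (w α * ‖coeff α (p i - q)‖ₑ) := by
        rw [← mul_assoc, ENNReal.inv_mul_cancel hw hw', one_mul]
    _ ≤ _ := by gcongr

end Norm

end
end Carleman

open scoped ENNReal NNReal
namespace Carleman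
noncomputable section
open MvPowerSeries

/-! ### Substitution of power series and the chain rule. -/

section Subst

variable {σ τ R : Type*} [Finite σ] [CommRing R]

/-- Substitution of power series without constant terms, as an algebra homomorphism. -/
def csub (a : σ → MvPowerSeries τ R) (ha : ∀ s, constantCoeff (a s) = 0) :
    MvPowerSeries σ R →ₐ[R] MvPowerSeries τ R :=
  substAlgHom (hasSubst_of_constantCoeff_zero ha)

theorem csub_eq_subst {a : σ → MvPowerSeries τ R} (ha : ∀ s, constantCoeff (a s) = 0)
    (f : MvPowerSeries σ R) : csub a ha f = subst a f :=
  substAlgHom_apply _ _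

theorem csub_X {a : σ → MvPowerSeries τ R} (ha : ∀ s, constantCoeff (a s) = 0) (s : σ) :
    csub a ha (X s) = a s :=
  substAlgHom_X _ _

theorem csub_C {a : σ → MvPowerSeries τ R} (ha : ∀ s, constantCoeff (a s) = 0) (c : R) :
    csub a ha (C c) = C c :=
  (csub a ha).commutes c

theorem constantCoeff_csub {a : σ → MvPowerSeries τ R} (ha : ∀ s, constantCoeff (a s) = 0)
    {f : MvPowerSeries σ R} (hf : constantCoeff f = 0) : constantCoeff (csub a ha f) = 0 := by
  rw [csub_eq_subst]
  exact constantCoeff_subst_eq_zero (hasSubst_of_constantCoeff_zero ha) ha hf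

/-- A series of large order stays of large order after a substitution without constant terms. -/
theorem coeff_csub_eq_zero_of_order {a : σ → MvPowerSeries τ R}
    (ha : ∀ s, constantCoeff (a s) = 0) {f : MvPowerSeries σ R} {N : ℕ}
    (hf : ∀ d : σ →₀ ℕ, d.degree < N → coeff d f = 0) {e : τ →₀ ℕ} (he : e.degree < N) :
    coeff e (csub a ha f) = 0 := by
  rw [csub_eq_subst, coeff_subst (hasSubst_of_constantCoeff_zero ha),
    finsum_eq_zero_of_forall_eq_zero]
  intro d
  by_cases hd : d.degree < N
  · simp [hf d hd]
  · have : coeff e (d.prod fun s k => a s ^ k) = 0 := by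
      refine coeff_of_lt_order (lt_of_lt_of_le (b := (d.degree : ℕ∞)) ?_ ?_)
      · exact_mod_cast lt_of_lt_of_le he (not_lt.1 hd)
      · refine le_trans ?_ (le_order_prod (fun s => a s ^ d s) d.support)
        rw [Finsupp.degree_apply]
        push_cast
        exact Finset.sum_le_sum fun s _ => le_order_pow_of_constantCoeff_eq_zero _ (ha s)
    simp [this]

/-- The chain rule for polynomials, by induction on their construction. It extends to series because
each coefficient sees only a truncation. -/
theorem pderiv_csub_coe [Fintype σ] {a : σ → MvPowerSeries τ R}
    (ha : ∀ s, constantCoeff (a s) = 0) (P : MvPolynomial σ R) (m : τ) :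
    pderiv R m (csub a ha (P : MvPowerSeries σ R)) =
      ∑ l, csub a ha (pderiv R l (P : MvPowerSeries σ R)) * pderiv R m (a l) := by
  classical
  induction P using MvPolynomial.induction_on with
  | C c => simp [csub_C]
  | add p q hp hq =>
    simp only [MvPolynomial.coe_add, map_add, hp, hq, add_mul, Finset.sum_add_distrib]
  | mul_X p i hp =>
    simp only [MvPolynomial.coe_mul, MvPolynomial.coe_X, map_mul, csub_X,
      Derivation.leibniz, hp, map_add, smul_eq_mul, add_mul, Finset.sum_add_distrib,
      Finset.mul_sum]
    congr 1
    · rw [Finset.sum_eq_single i]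
      · simp
      · intro b _ hb
        rw [pderiv_X_of_ne (Ne.symm hb)]
        simp
      · simp
    · exact Finset.sum_congr rfl fun l _ => by ring

/-- Chain rule for the substitution of power series without constant terms. -/
theorem pderiv_csub [Fintype σ] {a : σ → MvPowerSeries τ R} (ha : ∀ s, constantCoeff (a s) = 0)
    (f : MvPowerSeries σ R) (m : τ) :
    pderiv R m (csub a ha f) = ∑ l, csub a ha (pderiv R l f) * pderiv R m (a l) := by
  classical
  ext e
  -- The remainder `h` vanishes in all degrees below `N + 1`, one more than `N`, because
  -- differentiation lowers the order by one. All its contributions to the coefficient of `e` then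
  -- vanish.
  set N := e.degree + 1 with hN
  obtain ⟨P, h, rfl, hh⟩ : ∃ (P : MvPolynomial σ R) (h : MvPowerSeries σ R),
      f = (P : MvPowerSeries σ R) + h ∧ ∀ d : σ →₀ ℕ, d.degree < N + 1 → coeff d h = 0 := by
    refine ⟨truncTotal (N + 1) f, f - truncTotal (N + 1) f, by simp, fun d hd => ?_⟩
    rw [map_sub, MvPolynomial.coeff_coe, coeff_truncTotal _ hd, sub_self]
  have h1 : coeff e (pderiv R m (csub a ha h)) = 0 := by
    rw [coeff_pderiv, coeff_csub_eq_zero_of_order ha hh (by simp [hN]), zero_mul]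
  have h2 : ∀ l, coeff e (csub a ha (pderiv R l h) * pderiv R m (a l)) = 0 := fun l => by
    rw [coeff_mul]
    refine Finset.sum_eq_zero fun x hx => ?_
    rw [coeff_csub_eq_zero_of_order ha (N := N), zero_mul]
    · intro d hd
      rw [coeff_pderiv, hh _ (by simpa using hd), zero_mul]
    · have := congrArg Finsupp.degree (Finset.HasAntidiagonal.mem_antidiagonal.1 hx)
      rw [map_add] at this
      omega
  simp only [map_add, add_mul, Finset.sum_add_distrib, pderiv_csub_coe ha, h1,
    map_sum, h2, add_zero, Finset.sum_const_zero]

end Subst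

/-! ### Norms of substitutions and of derivatives. -/

section NormEstimates

variable {σ τ 𝕜 : Type*} [RCLike 𝕜]

/-- The monomial of exponent d is replaced by a product of norm at most ρ^|d|; the sums over
exponents are interchanged, all terms being nonnegative. -/
theorem pnorm_csub_le [Finite σ] {a : σ → MvPowerSeries τ 𝕜} (ha : ∀ s, constantCoeff (a s) = 0)
    {r ρ : ℝ≥0} (h : ∀ s, pnorm r (a s) ≤ ρ) (f : MvPowerSeries σ 𝕜) :
    pnorm r (csub a ha f) ≤ pnorm ρ f := by
  rw [csub_eq_subst]
  classical
  have hs := hasSubst_of_constantCoeff_zero ha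
  have hm : ∀ d : σ →₀ ℕ, pnorm r (d.prod fun s k => a s ^ k) ≤ radial ρ d := fun d => by
    refine (pnorm_prod_le _ _ _).trans ?_
    rw [radial, Finsupp.degree_apply, ← Finset.prod_pow_eq_pow_sum]
    exact Finset.prod_le_prod' fun s _ => (pnorm_pow_le _ _ _).trans (by gcongr; exact h s)
  have key : ∀ e : τ →₀ ℕ, radial r e * ‖coeff e (subst a f)‖ₑ ≤
      ∑' d : σ →₀ ℕ, ‖coeff d f‖ₑ * (radial r e * ‖coeff e (d.prod fun s k => a s ^ k)‖ₑ) := by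
    intro e
    have hfin := coeff_subst_finite hs f e
    rw [coeff_subst hs, finsum_eq_sum _ hfin]
    refine (mul_le_mul_right (enorm_sum_le _ _) _).trans ?_
    rw [Finset.mul_sum]
    refine le_trans (Finset.sum_le_sum fun d _ => ?_) (ENNReal.sum_le_tsum _)
    rw [smul_eq_mul, enorm_mul]
    exact le_of_eq (by ring)
  calc pnorm r (subst a f) ≤ ∑' e : τ →₀ ℕ, ∑' d : σ →₀ ℕ,
        ‖coeff d f‖ₑ * (radial r e * ‖coeff e (d.prod fun s k => a s ^ k)‖ₑ) :=
      ENNReal.tsum_le_tsum key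
    _ = ∑' d : σ →₀ ℕ, ‖coeff d f‖ₑ * pnorm r (d.prod fun s k => a s ^ k) := by
      rw [ENNReal.tsum_comm]
      exact tsum_congr fun d => ENNReal.tsum_mul_left
    _ ≤ pnorm ρ f := by
      refine ENNReal.tsum_le_tsum fun d => ?_
      rw [mul_comm]
      gcongr
      exact hm d

/-- Shifting the index by e_l turns the factor β_l + 1 of the derivative into α_l, and the exponents
outside the range of the shift have α_l = 0. The pair of weights covers the radial weight as well as
its cut-offs. -/
theorem wnorm_pderiv {w v : (σ →₀ ℕ) → ℝ≥0∞} {r : ℝ≥0} (l : σ)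
    (h : ∀ β, w (β + Finsupp.single l 1) = r * v β) (W : MvPowerSeries σ 𝕜) :
    r * wnorm v (pderiv 𝕜 l W) = ∑' α : σ →₀ ℕ, (α l : ℝ≥0∞) * (w α * ‖coeff α W‖ₑ) := by
  classical
  have hinj : Function.Injective fun β : σ →₀ ℕ => β + Finsupp.single l 1 :=
    add_left_injective _
  rw [← hinj.tsum_eq (f := fun α : σ →₀ ℕ => (α l : ℝ≥0∞) * (w α * ‖coeff α W‖ₑ)), wnorm,
    ← ENNReal.tsum_mul_left]
  · refine tsum_congr fun β => ?_
    have h1 : ‖((β l : 𝕜) + 1)‖ₑ = (β l : ℝ≥0∞) + 1 := by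
      have : ((β l : 𝕜) + 1) = ((β l + 1 : ℕ) : 𝕜) := by push_cast; ring
      rw [this, ← ofReal_norm, RCLike.norm_natCast, ENNReal.ofReal_natCast]
      push_cast
      ring
    rw [coeff_pderiv, enorm_mul, h1, h β]
    simp only [Finsupp.add_apply, Finsupp.single_eq_same, Nat.cast_add, Nat.cast_one]
    ring
  · intro α hα
    have hl : α l ≠ 0 := by
      rintro h0
      simp [h0] at hα
    refine ⟨α - Finsupp.single l 1, ?_⟩
    exact tsub_add_cancel_of_le (by simpa [Nat.one_le_iff_ne_zero] using hl)

/-- Euler's identity at the level of norms: control of the coefficients with an extra factor |α| is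
control of r times the gradient. This is the derivative gained below. -/
theorem sum_wnorm_pderiv [Fintype σ] {w v : (σ →₀ ℕ) → ℝ≥0∞} {r : ℝ≥0}
    (h : ∀ β l, w (β + Finsupp.single l 1) = r * v β) (W : MvPowerSeries σ 𝕜) :
    ∑ l, r * wnorm v (pderiv 𝕜 l W) = wnorm (fun α => (α.degree : ℝ≥0∞) * w α) W := by
  simp_rw [fun l => wnorm_pderiv l (fun β => h β l) W]
  rw [← Summable.tsum_finsetSum (fun l _ => ENNReal.summable), wnorm]
  refine tsum_congr fun α => ?_
  rw [← Finset.sum_mul, Finsupp.degree_eq_sum, Nat.cast_sum, mul_assoc]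

/-- The derivative of a series on a smaller polydisc. -/
theorem pnorm_pderiv_lt_top {r s : ℝ≥0} (hrs : r < s) (l : σ) {p : MvPowerSeries σ 𝕜}
    (hp : pnorm s p < ⊤) : pnorm r (pderiv 𝕜 l p) < ⊤ := by
  classical
  rcases eq_or_ne r 0 with rfl | hr
  · have : pnorm 0 (pderiv 𝕜 l p) ≤ ‖coeff 0 (pderiv 𝕜 l p)‖ₑ := by
      rw [pnorm, wnorm, tsum_eq_single 0]
      · simp [radial]
      · intro α hα
        have : α.degree ≠ 0 := fun h0 => hα ((Finsupp.degree_eq_zero_iff α).1 h0)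
        simp [radial, this]
    exact this.trans_lt enorm_lt_top
  have h1 := wnorm_pderiv (w := radial r) (v := radial r) (r := r) l
    (fun β => by simp [radial, pow_succ, mul_comm]) p
  -- Differentiation costs a factor of at most the degree m, and m(r/s)^m is bounded since r < s.
  obtain ⟨C, hC⟩ : ∃ C : ℝ≥0, ∀ m : ℕ, (m : ℝ≥0) * r ^ m ≤ C * s ^ m := by
    have hs : 0 < s := lt_of_le_of_lt zero_le hrs
    have ht : Filter.Tendsto (fun m : ℕ => (m : ℝ) * ((r / s : ℝ≥0) : ℝ) ^ m) Filter.atTop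
        (nhds 0) := by
      refine tendsto_self_mul_const_pow_of_lt_one (by positivity) ?_
      exact_mod_cast (div_lt_one hs).2 hrs
    obtain ⟨C, hC⟩ := ht.bddAbove_range
    refine ⟨C.toNNReal, fun m => ?_⟩
    have h2 : (m : ℝ) * ((r / s : ℝ≥0) : ℝ) ^ m ≤ C := hC ⟨m, rfl⟩
    have hC0 : 0 ≤ C := le_trans (by positivity) h2
    rw [← NNReal.coe_le_coe]
    push_cast at h2 ⊢
    rw [Real.coe_toNNReal _ hC0]
    have hs' : (0 : ℝ) < s := hs
    rw [div_pow, mul_div_assoc', div_le_iff₀ (by positivity)] at h2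
    exact h2
  have h2 : r * pnorm r (pderiv 𝕜 l p) ≤ C * pnorm s p := by
    rw [pnorm, h1, pnorm, wnorm, ← ENNReal.tsum_mul_left]
    refine ENNReal.tsum_le_tsum fun α => ?_
    rw [← mul_assoc, ← mul_assoc]
    refine mul_le_mul_left ?_ _
    have h3 : (α l : ℝ≥0) * r ^ α.degree ≤ C * s ^ α.degree := by
      refine le_trans ?_ (hC α.degree)
      gcongr
      exact_mod_cast Finsupp.le_degree l α
    unfold radial
    exact_mod_cast h3
  have h3 : r * pnorm r (pderiv 𝕜 l p) < ⊤ := h2.trans_lt (ENNReal.mul_lt_top ENNReal.coe_lt_top hp)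
  by_contra hne
  rw [not_lt, top_le_iff] at hne
  rw [hne, ENNReal.mul_top (by simpa using hr)] at h3
  exact lt_irrefl _ h3

end NormEstimates

end
end Carleman

open scoped ENNReal NNReal
namespace Carleman
noncomputable section
open MvPowerSeries

/-! ### Derivatives along formal vector fields. -/

section Lie

variable {σ R : Type*} [CommRing R]

theorem coeff_X_mul_pderiv (l : σ) (W : MvPowerSeries σ R) (α : σ →₀ ℕ) :
    coeff α (X l * pderiv R l W) = (α l : R) * coeff α W := by
  classical
  rw [X_def, coeff_monomial_mul]
  split_ifs with h
  · have h1 : 1 ≤ α l := by simpa using h l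
    rw [coeff_pderiv, one_mul, tsub_add_cancel_of_le h, mul_comm]
    congr 1
    rw [Finsupp.tsub_apply, Finsupp.single_eq_same, Nat.cast_sub h1]
    simp
  · have : α l = 0 := by
      by_contra h0
      exact h (by simpa [Nat.one_le_iff_ne_zero] using h0)
    simp [this]

variable [Fintype σ]

/-- The derivative `∑ F_l ∂_l W` of a formal power series along a formal vector field. -/
def lie (F : σ → MvPowerSeries σ R) (W : MvPowerSeries σ R) : MvPowerSeries σ R :=
  ∑ l, F l * pderiv R l W

theorem lie_add_left (F G : σ → MvPowerSeries σ R) (W : MvPowerSeries σ R) :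
    lie (F + G) W = lie F W + lie G W := by
  simp [lie, add_mul, Finset.sum_add_distrib]

theorem lie_sub (F : σ → MvPowerSeries σ R) (V W : MvPowerSeries σ R) :
    lie F (V - W) = lie F V - lie F W := by
  simp [lie, mul_sub, Finset.sum_sub_distrib]

theorem constantCoeff_lie {F : σ → MvPowerSeries σ R} (hF : ∀ l, constantCoeff (F l) = 0)
    (W : MvPowerSeries σ R) : constantCoeff (lie F W) = 0 := by
  simp [lie, hF]

/-- Monomials are eigenvectors of a diagonal linear field. -/
theorem coeff_lie_diagonal (Λ : σ → R) (W : MvPowerSeries σ R) (α : σ →₀ ℕ) :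
    coeff α (lie (fun l => C (Λ l) * X l) W) = (∑ l, (α l : R) * Λ l) * coeff α W := by
  rw [lie, map_sum, Finset.sum_mul]
  refine Finset.sum_congr rfl fun l _ => ?_
  rw [mul_assoc, coeff_C_mul, coeff_X_mul_pderiv]
  ring

/-- Substitution carries a vector field to its pull-back along a change of variables. -/
theorem lie_csub {τ : Type*} [Fintype τ] {a : σ → MvPowerSeries τ R}
    (ha : ∀ s, constantCoeff (a s) = 0) {F : σ → MvPowerSeries σ R} {G : τ → MvPowerSeries τ R}
    (h : ∀ l, ∑ m, G m * pderiv R m (a l) = csub a ha (F l)) (W : MvPowerSeries σ R) :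
    lie G (csub a ha W) = csub a ha (lie F W) := by
  simp only [lie, pderiv_csub ha, Finset.mul_sum, map_sum, map_mul]
  rw [Finset.sum_comm]
  refine Finset.sum_congr rfl fun l _ => ?_
  rw [← h l, Finset.sum_mul]
  exact Finset.sum_congr rfl fun m _ => by ring

end Lie

/-! ### Perturbations of a stable diagonal field: a priori estimate and solvability. -/

section Diagonal

variable {σ : Type*} [Fintype σ]

/-- All the Λ_l lie in the same half plane, so no cancellation occurs in α·Λ: the divisors grow with
the degree instead of becoming small. -/
theorem mul_degree_le_enorm {Λ : σ → ℂ} {μ : ℝ≥0} (hΛ : ∀ l, (Λ l).re ≤ -μ) (α : σ →₀ ℕ) :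
    (μ : ℝ≥0∞) * α.degree ≤ ‖∑ l, (α l : ℂ) * Λ l‖ₑ := by
  have h1 : (μ : ℝ) * α.degree ≤ ‖∑ l, (α l : ℂ) * Λ l‖ := by
    refine le_trans ?_ (Complex.abs_re_le_norm _)
    refine le_trans ?_ (neg_le_abs _)
    rw [Complex.re_sum, Finsupp.degree_eq_sum, Nat.cast_sum, Finset.mul_sum, ← Finset.sum_neg_distrib]
    refine Finset.sum_le_sum fun l _ => ?_
    have : ((α l : ℂ) * Λ l).re = α l * (Λ l).re := by simp
    rw [this]
    nlinarith [hΛ l, (Nat.cast_nonneg (α l) : (0 : ℝ) ≤ α l)]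
  have h2 := ENNReal.ofReal_le_ofReal h1
  rwa [ENNReal.ofReal_mul (by positivity), ENNReal.ofReal_coe_nnreal, ENNReal.ofReal_natCast,
    ofReal_norm] at h2

/-- The perturbation loses one derivative, measured by the same degree-weighted norm that the
diagonal part gains. Its size relative to r is what decides whether it can be absorbed. -/
theorem wnorm_lie_le {w v : (σ →₀ ℕ) → ℝ≥0∞} {r : ℝ≥0}
    (hwv : ∀ β l, w (β + Finsupp.single l 1) = r * v β)
    (hmul : ∀ α β, α ≠ 0 → w (α + β) ≤ w α * v β) {G : σ → MvPowerSeries σ ℂ}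
    (hG : ∀ l, constantCoeff (G l) = 0) {c : ℝ≥0∞} (hc : ∀ l, wnorm w (G l) ≤ c * r)
    (W : MvPowerSeries σ ℂ) :
    wnorm w (lie G W) ≤ c * wnorm (fun α => (α.degree : ℝ≥0∞) * w α) W := by
  rw [← sum_wnorm_pderiv hwv, Finset.mul_sum]
  refine (wnorm_sum_le _ _ _).trans (Finset.sum_le_sum fun l _ => ?_)
  refine (wnorm_mul_le (u := w) (v := v) fun α β hα => hmul α β ?_).trans ?_
  · rintro rfl
    exact hα (hG l)
  · rw [← mul_assoc]
    gcongr
    exact hc l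

theorem wnorm_lie_diagonal_ge {Λ : σ → ℂ} {μ : ℝ≥0} (hΛ : ∀ l, (Λ l).re ≤ -μ)
    (w : (σ →₀ ℕ) → ℝ≥0∞) (W : MvPowerSeries σ ℂ) :
    μ * wnorm (fun α => (α.degree : ℝ≥0∞) * w α) W ≤
      wnorm w (lie (fun l => C (Λ l) * X l) W) := by
  rw [wnorm, wnorm, ← ENNReal.tsum_mul_left]
  refine ENNReal.tsum_le_tsum fun α => ?_
  rw [coeff_lie_diagonal, enorm_mul]
  calc (μ : ℝ≥0∞) * (α.degree * w α * ‖coeff α W‖ₑ)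
      = (μ * α.degree) * (w α * ‖coeff α W‖ₑ) := by ring
    _ ≤ ‖∑ l, (α l : ℂ) * Λ l‖ₑ * (w α * ‖coeff α W‖ₑ) := by
      gcongr
      exact mul_degree_le_enorm hΛ α
    _ = _ := by ring

/-- The weight `r ^ |α|`, cut off above degree `d`. -/
def cutoff (r : ℝ≥0) (d : ℕ) (α : σ →₀ ℕ) : ℝ≥0∞ := if α.degree ≤ d then radial r α else 0

/-- A priori estimate for a perturbation of a stable diagonal vector field. -/
theorem wnorm_le_of_lie_diagonal {Λ : σ → ℂ} {μ : ℝ≥0} (hΛ : ∀ l, (Λ l).re ≤ -μ)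
    {G : σ → MvPowerSeries σ ℂ} (hG : ∀ l, constantCoeff (G l) = 0) {r : ℝ≥0}
    (hr : ∀ l, pnorm r (G l) ≤ (μ / 2 : ℝ≥0) * r) (W : MvPowerSeries σ ℂ) :
    (μ / 2 : ℝ≥0) * wnorm (fun α => (α.degree : ℝ≥0∞) * radial r α) W ≤
      pnorm r (lie ((fun l => C (Λ l) * X l) + G) W) := by
  set q := lie ((fun l => C (Λ l) * X l) + G) W with hq
  -- Absorbing the perturbation on the left is legitimate only if the norm of `W` is finite, which
  -- is not known. The estimate is therefore proved for weights that vanish above degree `d`, where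
  -- the norm is a finite sum, and `d` is arbitrary.
  have hcut : ∀ d, (μ / 2 : ℝ≥0) * wnorm (fun α => (α.degree : ℝ≥0∞) * cutoff r d α) W ≤
      pnorm r q := by
    intro d
    have hle : ∀ α : σ →₀ ℕ, cutoff r d α ≤ radial r α := fun α => by
      rw [cutoff]; split_ifs <;> simp
    set S := wnorm (fun α => (α.degree : ℝ≥0∞) * cutoff r d α) W with hS
    have hfin : S ≠ ⊤ := by
      have hset : {α : σ →₀ ℕ | α.degree ≤ d}.Finite := Finsupp.finite_of_degree_le d
      rw [hS, wnorm, tsum_eq_sum (s := hset.toFinset)]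
      · refine ENNReal.sum_ne_top.2 fun α _ => ENNReal.mul_ne_top (ENNReal.mul_ne_top ?_ ?_) ?_
        · exact ENNReal.natCast_ne_top _
        · exact ne_top_of_le_ne_top (by simp [radial]) (hle α)
        · exact enorm_ne_top
      · intro α hα
        have : ¬ α.degree ≤ d := by simpa using hα
        simp [cutoff, this]
    have h1 := wnorm_lie_diagonal_ge hΛ (cutoff r d) W
    have h2 : wnorm (cutoff r d) (lie G W) ≤ (μ / 2 : ℝ≥0) * S := by
      -- Derivatives of `W` are cut off one degree earlier than `W`. The product inequality for the
      -- cut-off weights holds for α ≠ 0, which suffices as `G` has no constant term.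
      refine wnorm_lie_le (v := fun β => if β.degree + 1 ≤ d then radial r β else 0) ?_ ?_ hG
        (fun l => (wnorm_mono hle _).trans (hr l)) W
      · intro β l
        simp only [cutoff, map_add, Finsupp.degree_single, radial_add]
        split_ifs
        · simp [radial, mul_comm]
        · simp
      · intro α β hα
        have hα' : α.degree ≠ 0 := fun h0 => hα ((Finsupp.degree_eq_zero_iff α).1 h0)
        simp only [cutoff, map_add]
        by_cases h : α.degree + β.degree ≤ d
        · rw [if_pos h, if_pos (by omega), if_pos (by omega), radial_add]
        · rw [if_neg h]
          exact zero_le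
    have h3 : lie (fun l => C (Λ l) * X l) W = q - lie G W := by
      rw [hq, lie_add_left]; ring
    rw [h3] at h1
    have h4 : (μ : ℝ≥0∞) * S ≤ pnorm r q + (μ / 2 : ℝ≥0) * S :=
      (h1.trans (wnorm_sub_le _ _ _)).trans (add_le_add (wnorm_mono hle _) h2)
    have h5 : (μ : ℝ≥0∞) * S = (μ / 2 : ℝ≥0) * S + (μ / 2 : ℝ≥0) * S := by
      rw [← add_mul, ← ENNReal.coe_add, add_halves]
    rw [h5] at h4
    exact (ENNReal.add_le_add_iff_right (ENNReal.mul_ne_top ENNReal.coe_ne_top hfin)).1 h4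
  rw [wnorm, ← ENNReal.tsum_mul_left, ENNReal.tsum_eq_iSup_sum]
  refine iSup_le fun s => ?_
  refine le_trans ?_ (hcut (s.sup Finsupp.degree))
  rw [wnorm, ← ENNReal.tsum_mul_left]
  refine le_trans (le_of_eq ?_) (ENNReal.sum_le_tsum s)
  refine Finset.sum_congr rfl fun α hα => ?_
  rw [cutoff, if_pos (Finset.le_sup (f := Finsupp.degree) hα)]

theorem tendsto_coeff_lie {ι : Type*} {f : Filter ι} (G : σ → MvPowerSeries σ ℂ)
    {p : ι → MvPowerSeries σ ℂ} {q : MvPowerSeries σ ℂ}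
    (h : ∀ α, Filter.Tendsto (fun i => coeff α (p i)) f (nhds (coeff α q))) (α : σ →₀ ℕ) :
    Filter.Tendsto (fun i => coeff α (lie G (p i))) f (nhds (coeff α (lie G q))) := by
  classical
  simp only [lie, map_sum, coeff_mul, coeff_pderiv]
  exact tendsto_finsetSum _ fun l _ => tendsto_finsetSum _ fun x _ =>
    ((h _).mul_const _).const_mul _

/-- Solvability of the linear equation for a perturbation of a stable diagonal vector field. -/
theorem exists_lie_diagonal_eq {Λ : σ → ℂ} {μ : ℝ≥0} (hμ : 0 < μ) (hΛ : ∀ l, (Λ l).re ≤ -μ)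
    {G : σ → MvPowerSeries σ ℂ} (hG : ∀ l, constantCoeff (G l) = 0) {r : ℝ≥0} (hr0 : 0 < r)
    (hr : ∀ l, pnorm r (G l) ≤ (μ / 2 : ℝ≥0) * r) {q : MvPowerSeries σ ℂ}
    (hq0 : constantCoeff q = 0) (hq : pnorm r q < ⊤) :
    ∃ W, constantCoeff W = 0 ∧ lie ((fun l => C (Λ l) * X l) + G) W = q := by
  have hne : ∀ α : σ →₀ ℕ, α ≠ 0 → (∑ l, (α l : ℂ) * Λ l) ≠ 0 := fun α hα h0 => by
    have hα' : α.degree ≠ 0 := fun h0 => hα ((Finsupp.degree_eq_zero_iff α).1 h0)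
    have := mul_degree_le_enorm hΛ α
    rw [h0, enorm_zero, nonpos_iff_eq_zero, mul_eq_zero] at this
    simp [hμ.ne', hα'] at this
  -- The inverse of the diagonal part. At α = 0 the divisor is 0, and the convention `0⁻¹ = 0` makes
  -- `dinv` drop the constant term.
  let dinv : MvPowerSeries σ ℂ → MvPowerSeries σ ℂ :=
    fun p α => (∑ l, (α l : ℂ) * Λ l)⁻¹ * coeff α p
  have hdinv : ∀ p α, coeff α (dinv p) = (∑ l, (α l : ℂ) * Λ l)⁻¹ * coeff α p := fun _ _ => rfl
  have hdiag : ∀ p, constantCoeff p = 0 → lie (fun l => C (Λ l) * X l) (dinv p) = p := by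
    intro p hp
    ext α
    rw [coeff_lie_diagonal, hdinv]
    by_cases hα : α = 0
    · subst hα
      simp [hp]
    · rw [mul_inv_cancel_left₀ (hne α hα)]
  have hdsub : ∀ p p', dinv p - dinv p' = dinv (p - p') := fun p p' => by
    ext α
    simp [hdinv, mul_sub]
  -- A fixed point of `step` solves the equation. By `hd` and `hlie` the step contracts the
  -- degree-weighted norm by the factor 1/2.
  let step : MvPowerSeries σ ℂ → MvPowerSeries σ ℂ := fun W => dinv (q - lie G W)
  let W : ℕ → MvPowerSeries σ ℂ := fun i => step^[i] 0
  have hW : ∀ i, W (i + 1) = dinv (q - lie G (W i)) := fun i => Function.iterate_succ_apply' _ _ _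
  set w : (σ →₀ ℕ) → ℝ≥0∞ := fun α => (α.degree : ℝ≥0∞) * radial r α with hw
  have hlie : ∀ p, pnorm r (lie G p) ≤ (μ / 2 : ℝ≥0) * wnorm w p := fun p =>
    wnorm_lie_le (v := radial r) (fun β l => by simp [radial, pow_succ, mul_comm])
      (fun α β _ => (radial_add r α β).le) hG hr p
  have hd : ∀ p, constantCoeff p = 0 → μ * wnorm w (dinv p) ≤ pnorm r p := fun p hp => by
    have := wnorm_lie_diagonal_ge hΛ (radial r) (dinv p)
    rwa [hdiag p hp] at this
  have hhalf : ((μ / 2 : ℝ≥0) : ℝ≥0∞) = μ * 2⁻¹ := by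
    rw [div_eq_mul_inv, ENNReal.coe_mul, ENNReal.coe_inv two_ne_zero]
    rfl
  have hstep : ∀ i, wnorm w (W (i + 1) - W i) ≤ 2⁻¹ ^ i * ((μ : ℝ≥0∞)⁻¹ * pnorm r q) := by
    intro i
    have hμ' : (μ : ℝ≥0∞) ≠ 0 := by exact_mod_cast hμ.ne'
    induction i with
    | zero =>
      have h1 : W 1 - W 0 = dinv q := by
        rw [hW]
        simp [W, lie]
      rw [h1, pow_zero, one_mul, ← ENNReal.mul_le_iff_le_inv hμ' ENNReal.coe_ne_top]
      exact hd q hq0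
    | succ i ih =>
      have h0 : W (i + 1 + 1) - W (i + 1) = dinv (-(lie G (W (i + 1) - W i))) := by
        conv_lhs => rw [hW (i + 1)]
        conv_lhs => enter [2]; rw [hW i]
        rw [hdsub, lie_sub]
        congr 1
        ring
      rw [h0]
      have h1 := hd (-(lie G (W (i + 1) - W i))) (by simp [constantCoeff_lie hG])
      rw [pnorm, wnorm_neg] at h1
      have h2 := h1.trans (hlie _)
      rw [hhalf, mul_assoc, ENNReal.mul_le_mul_iff_right hμ' ENNReal.coe_ne_top] at h2
      refine h2.trans ?_
      rw [pow_succ', mul_assoc]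
      gcongr
  -- Convergence of each coefficient is enough, because a coefficient of `lie G W` involves only
  -- finitely many coefficients of `W`. The coefficient at 0 is constantly 0.
  have hlim : ∀ α, ∃ z, Filter.Tendsto (fun i => coeff α (W i)) Filter.atTop (nhds z) := by
    intro α
    by_cases hα : α = 0
    · subst hα
      refine ⟨0, tendsto_const_nhds.congr fun i => ?_⟩
      cases i with
      | zero => simp [W]
      | succ i => rw [hW, hdinv]; simp
    have hα' : α.degree ≠ 0 := fun h0 => hα ((Finsupp.degree_eq_zero_iff α).1 h0)
    have hwα : w α ≠ 0 := by simp [hw, radial, hr0.ne', hα']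
    have hwα' : w α ≠ ⊤ := by simp [hw, radial, ENNReal.mul_eq_top]
    have hμi : (μ : ℝ≥0∞)⁻¹ ≠ ⊤ := by simpa using hμ.ne'
    refine cauchySeq_tendsto_of_complete (cauchySeq_of_edist_le_geometric 2⁻¹
      ((w α)⁻¹ * ((μ : ℝ≥0∞)⁻¹ * pnorm r q)) ?_ ?_ fun i => ?_)
    · exact ENNReal.inv_lt_one.2 ENNReal.one_lt_two
    · exact ENNReal.mul_ne_top (ENNReal.inv_ne_top.2 hwα) (ENNReal.mul_ne_top hμi hq.ne)
    · rw [edist_comm, edist_eq_enorm_sub, ← map_sub]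
      calc ‖coeff α (W (i + 1) - W i)‖ₑ = (w α)⁻¹ * (w α * ‖coeff α (W (i + 1) - W i)‖ₑ) := by
            rw [← mul_assoc, ENNReal.inv_mul_cancel hwα hwα', one_mul]
        _ ≤ (w α)⁻¹ * (2⁻¹ ^ i * ((μ : ℝ≥0∞)⁻¹ * pnorm r q)) :=
            mul_le_mul_right ((le_wnorm w _ α).trans (hstep i)) _
        _ = _ := by ring
  choose z hz using hlim
  let Z : MvPowerSeries σ ℂ := z
  have hZ : ∀ α, Filter.Tendsto (fun i => coeff α (W i)) Filter.atTop (nhds (coeff α Z)) := hz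
  have hfix : Z = dinv (q - lie G Z) := by
    ext α
    have h1 := (Filter.tendsto_add_atTop_iff_nat 1).2 (hZ α)
    have h2 : Filter.Tendsto (fun i => coeff α (W (i + 1))) Filter.atTop
        (nhds (coeff α (dinv (q - lie G Z)))) := by
      simp only [hW, hdinv, map_sub]
      exact ((tendsto_coeff_lie G hZ α).const_sub _).const_mul _
    exact tendsto_nhds_unique h1 h2
  refine ⟨Z, ?_, ?_⟩
  · rw [hfix, ← coeff_zero_eq_constantCoeff_apply, hdinv]
    simp
  · rw [lie_add_left]
    have : lie (fun l => C (Λ l) * X l) Z = q - lie G Z := by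
      conv_lhs => rw [hfix]
      exact hdiag _ (by simp [hq0, constantCoeff_lie hG])
    rw [this]
    ring

end Diagonal

end
end Carleman

open scoped ENNReal NNReal
namespace Carleman
noncomputable section
open MvPowerSeries

/-! ### Triangular form with small off-diagonal entries. -/

section NearDiagonal

open Module

/-- Every endomorphism of a complex vector space is triangular with arbitrarily small off-diagonal
entries in a suitable basis; its diagonal consists of eigenvalues. -/
theorem exists_basis_near_diagonal {ε : ℝ} (hε : 0 < ε) : ∀ (d : ℕ) {V : Type*} [AddCommGroup V]
    [Module ℂ V] [FiniteDimensional ℂ V], finrank ℂ V = d → ∀ f : V →ₗ[ℂ] V,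
    ∃ b : Basis (Fin d) ℂ V, (∀ i j, i ≠ j → ‖b.repr (f (b j)) i‖ ≤ ε) ∧
      ∀ i, End.HasEigenvalue f (b.repr (f (b i)) i) := by
  intro d
  induction d with
  | zero =>
    intro V _ _ _ hd f
    refine ⟨(finBasisOfFinrankEq ℂ V hd), fun i => i.elim0, fun i => i.elim0⟩
  | succ d ih =>
    intro V _ _ _ hd f
    have hnt : Nontrivial V := by
      apply Module.nontrivial_of_finrank_pos (R := ℂ)
      omega
    -- The kernel of an eigenvector `φ` of the dual map is an invariant hyperplane, to which the
    -- induction hypothesis applies; one basis vector outside it has to be added.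
    obtain ⟨μ, hμ⟩ := End.exists_eigenvalue f.dualMap
    obtain ⟨φ, hφ⟩ := hμ.exists_hasEigenvector
    have hφ0 : φ ≠ 0 := hφ.2
    have hφf : ∀ v, φ (f v) = μ * φ v := fun v => by
      have := LinearMap.congr_fun hφ.apply_eq_smul v
      simpa using this
    have hinv : ∀ v ∈ LinearMap.ker φ, f v ∈ LinearMap.ker φ := fun v hv => by
      rw [LinearMap.mem_ker] at hv ⊢
      rw [hφf, hv, mul_zero]
    have hrank : finrank ℂ (LinearMap.ker φ) = d := by
      have h1 := Module.Dual.finrank_ker_add_one_of_ne_zero hφ0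
      omega
    obtain ⟨b', hb1, hb2⟩ := ih hrank (f.restrict hinv)
    obtain ⟨w, hw⟩ : ∃ w, φ w = 1 := by
      obtain ⟨v, hv⟩ : ∃ v, φ v ≠ 0 := by
        by_contra! h
        exact hφ0 (LinearMap.ext h)
      exact ⟨(φ v)⁻¹ • v, by simp [hv]⟩
    have hn : f w - μ • w ∈ LinearMap.ker φ := by
      rw [LinearMap.mem_ker]
      simp [hφf, hw]
    set c : Fin d → ℂ := fun i => b'.repr ⟨f w - μ • w, hn⟩ i with hc
    -- The new basis vector is `s • w`. Its image is μ times itself plus a vector of the kernel with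
    -- coordinates `s * c i`, so a small `s` makes the whole column small.
    obtain ⟨s, hs0, hs⟩ : ∃ s : ℝ, 0 < s ∧ ∀ i, s * ‖c i‖ ≤ ε := by
      refine ⟨ε / (1 + ∑ i, ‖c i‖), by positivity, fun i => ?_⟩
      rw [div_mul_eq_mul_div, div_le_iff₀ (by positivity)]
      have : ‖c i‖ ≤ ∑ i, ‖c i‖ :=
        Finset.single_le_sum (f := fun i => ‖c i‖) (fun _ _ => norm_nonneg _) (Finset.mem_univ i)
      nlinarith
    have hs0' : (s : ℂ) ≠ 0 := by exact_mod_cast hs0.ne'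
    let b : Basis (Fin (d + 1)) ℂ V := Basis.mkFinCons ((s : ℂ) • w) b'
      (fun c x hx h => by
        have := congrArg φ h
        rw [map_add, LinearMap.mem_ker.1 hx] at this
        simpa [hw, hs0'] using this)
      (fun z => ⟨-(φ z) / s, by
        rw [LinearMap.mem_ker]
        simp [hw, hs0']⟩)
    have hb0 : b 0 = (s : ℂ) • w := by simp [b]
    have hbs : ∀ i : Fin d, b i.succ = (b' i : V) := fun i => by simp [b]
    have hsum : ∀ (x : V) (t : ℂ) (v : LinearMap.ker φ), x = t • b 0 + v →
        b.repr x 0 = t ∧ ∀ i : Fin d, b.repr x i.succ = b'.repr v i := by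
      intro x t v hx
      have h1 : x = ∑ i, (Fin.cons t (fun i => b'.repr v i) : Fin (d + 1) → ℂ) i • b i := by
        rw [Fin.sum_univ_succ, hx]
        simp only [Fin.cons_zero, Fin.cons_succ, hbs]
        congr 1
        have := congrArg (Submodule.subtype (LinearMap.ker φ)) (b'.sum_repr v)
        rw [map_sum] at this
        simpa using this.symm
      rw [h1]
      simp only [b.repr_sum_self]
      exact ⟨rfl, fun i => rfl⟩
    have hf0 := hsum (f (b 0)) μ ((s : ℂ) • ⟨f w - μ • w, hn⟩) (by
      rw [hb0, map_smul]
      simp only [SetLike.mk_smul_mk, smul_sub]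
      rw [smul_comm μ]
      abel)
    have hfs : ∀ j : Fin d, _ := fun j =>
      hsum (f (b j.succ)) 0 (f.restrict hinv (b' j)) (by simp [hbs])
    refine ⟨b, fun i j hij => ?_, fun i => ?_⟩
    · induction j using Fin.cases with
      | zero =>
        induction i using Fin.cases with
        | zero => exact absurd rfl hij
        | succ i =>
          rw [hf0.2 i, map_smul, Finsupp.smul_apply, norm_smul, Complex.norm_real,
            Real.norm_of_nonneg hs0.le]
          exact hs i
      | succ j =>
        induction i using Fin.cases with
        | zero =>
          rw [(hfs j).1]
          simpa using hε.le
        | succ i =>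
          rw [(hfs j).2 i]
          exact hb1 i j (fun h => hij (by rw [h]))
    · induction i using Fin.cases with
      | zero =>
        rw [hf0.1, End.hasEigenvalue_iff_mem_spectrum, spectrum.mem_iff]
        intro hu
        -- `φ` annihilates the range of `μ - f`, whereas `φ w = 1`.
        obtain ⟨v, hv⟩ := ((Module.End.isUnit_iff _).1 hu).2 w
        have := congrArg φ hv
        simp [hφf, hw] at this
      | succ i =>
        rw [(hfs i).2 i]
        obtain ⟨v, hv⟩ := (hb2 i).exists_hasEigenvector
        refine End.hasEigenvalue_of_hasEigenvector (x := (v : V)) ?_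
        rw [End.hasEigenvector_iff, End.mem_eigenspace_iff]
        refine ⟨?_, fun h => hv.2 (Subtype.ext h)⟩
        have := congrArg (Submodule.subtype (LinearMap.ker φ)) hv.apply_eq_smul
        simpa using this

theorem exists_matrix_near_diagonal {σ : Type*} [Fintype σ] [DecidableEq σ] (A : Matrix σ σ ℂ)
    {ε : ℝ} (hε : 0 < ε) : ∃ T T' : Matrix σ σ ℂ, T * T' = 1 ∧ T' * T = 1 ∧
      (∀ i j, i ≠ j → ‖(T' * A * T) i j‖ ≤ ε) ∧ ∀ i, (T' * A * T) i i ∈ spectrum ℂ A := by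
  obtain ⟨b₀, h1, h2⟩ := exists_basis_near_diagonal hε (Fintype.card σ) (V := σ → ℂ)
    (Module.finrank_fintype_fun_eq_card ℂ) (Matrix.toLin' A)
  set b := b₀.reindex (Fintype.equivFin σ).symm with hb
  have hA : LinearMap.toMatrix (Pi.basisFun ℂ σ) (Pi.basisFun ℂ σ) (Matrix.toLin' A) = A := by
    rw [LinearMap.toMatrix_eq_toMatrix', LinearMap.toMatrix'_toLin']
  have key := basis_toMatrix_mul_linearMap_toMatrix_mul_basis_toMatrix b (Pi.basisFun ℂ σ) b
    (Pi.basisFun ℂ σ) (Matrix.toLin' A)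
  rw [hA] at key
  have hent : ∀ i j, (b.toMatrix (Pi.basisFun ℂ σ) * A * (Pi.basisFun ℂ σ).toMatrix b) i j =
      b₀.repr (Matrix.toLin' A (b₀ (Fintype.equivFin σ j))) (Fintype.equivFin σ i) := by
    intro i j
    rw [key, LinearMap.toMatrix_apply]
    simp [hb]
  refine ⟨(Pi.basisFun ℂ σ).toMatrix b, b.toMatrix (Pi.basisFun ℂ σ),
    Basis.toMatrix_mul_toMatrix_flip _ _, Basis.toMatrix_mul_toMatrix_flip _ _, ?_, ?_⟩
  · intro i j hij
    rw [hent]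
    exact h1 _ _ (by simpa using hij)
  · intro i
    rw [hent, ← Matrix.spectrum_toLin', ← End.hasEigenvalue_iff_mem_spectrum]
    exact h2 _

end NearDiagonal

/-! ### Linear changes of variables. -/

section Linear

variable {σ τ R : Type*} [Fintype σ] [CommRing R]

/-- The components of the linear map with matrix `A`, as power series. -/
def lin (A : Matrix τ σ R) (l : τ) : MvPowerSeries σ R := ∑ m, C (A l m) * X m

theorem constantCoeff_lin (A : Matrix τ σ R) (l : τ) : constantCoeff (lin A l) = 0 := by
  simp [lin]

theorem pderiv_lin (A : Matrix τ σ R) (l : τ) (m : σ) : pderiv R m (lin A l) = C (A l m) := by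
  classical
  have h : ∀ k, pderiv R m (C (A l k) * X k) = if k = m then C (A l m) else 0 := fun k => by
    rw [Derivation.leibniz, pderiv_C, smul_zero, add_zero, smul_eq_mul]
    split_ifs with h
    · subst h; simp
    · rw [pderiv_X_of_ne h, mul_zero]
  rw [lin, map_sum]
  simp [h]

theorem coeff_lin [DecidableEq σ] (A : Matrix τ σ R) (l : τ) (α : σ →₀ ℕ) :
    coeff α (lin A l) = ∑ m, if α = Finsupp.single m 1 then A l m else 0 := by
  rw [lin, map_sum]
  exact Finset.sum_congr rfl fun m _ => by rw [coeff_C_mul, coeff_X, mul_ite, mul_one, mul_zero]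

theorem sum_C_mul_lin {υ : Type*} [Fintype τ] (A : Matrix υ τ R) (B : Matrix τ σ R) (l : υ) :
    ∑ m, C (A l m) * lin B m = lin (A * B) l := by
  simp only [lin, Finset.mul_sum, Matrix.mul_apply, map_sum, Finset.sum_mul, map_mul]
  rw [Finset.sum_comm]
  exact Finset.sum_congr rfl fun k _ => Finset.sum_congr rfl fun m _ => by ring

/-- The linear change of variables with matrix `T`. -/
def lsub [Finite τ] (T : Matrix τ σ R) : MvPowerSeries τ R →ₐ[R] MvPowerSeries σ R :=
  csub (lin T) (constantCoeff_lin T)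

theorem lsub_lin {υ : Type*} [Fintype τ] (A : Matrix υ τ R) (T : Matrix τ σ R) (l : υ) :
    lsub T (lin A l) = lin (A * T) l := by
  rw [← sum_C_mul_lin, lin, map_sum]
  exact Finset.sum_congr rfl fun m _ => by rw [map_mul, lsub, csub_C, csub_X]

theorem lin_one [DecidableEq σ] (l : σ) : lin (1 : Matrix σ σ R) l = X l := by
  rw [lin, Finset.sum_eq_single l]
  · simp
  · intro b _ hb
    rw [Matrix.one_apply_ne (Ne.symm hb)]
    simp
  · simp

theorem lsub_lsub_cancel [DecidableEq σ] {T T' : Matrix σ σ R} (h : T * T' = 1)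
    (p : MvPowerSeries σ R) : lsub T' (lsub T p) = p := by
  have hs := hasSubst_of_constantCoeff_zero (constantCoeff_lin T)
  have hs' := hasSubst_of_constantCoeff_zero (constantCoeff_lin T')
  have h1 : (fun s => subst (lin T') (lin T s)) = (X : σ → MvPowerSeries σ R) := by
    funext s
    have := lsub_lin T T' s
    rw [lsub, csub_eq_subst] at this
    rw [this, h, lin_one]
  rw [lsub, lsub, csub_eq_subst, csub_eq_subst, subst_comp_subst_apply hs hs', h1, subst_self]
  rfl

/-- The pull-back of a vector field along an invertible linear change of variables. -/
theorem lie_lsub [DecidableEq σ] {T T' : Matrix σ σ R} (h : T * T' = 1)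
    (F : σ → MvPowerSeries σ R) (W : MvPowerSeries σ R) :
    lie (fun m => ∑ l, C (T' m l) * lsub T (F l)) (lsub T W) = lsub T (lie F W) := by
  refine lie_csub _ (fun l => ?_) W
  have h1 : ∀ l', ∑ m, C (T l m) * (C (T' m l') * lsub T (F l')) =
      C ((1 : Matrix σ σ R) l l') * lsub T (F l') := fun l' => by
    rw [← h, Matrix.mul_apply, map_sum, Finset.sum_mul]
    exact Finset.sum_congr rfl fun m _ => by rw [map_mul]; ring
  simp only [pderiv_lin, Finset.sum_mul]
  rw [Finset.sum_comm]
  calc _ = ∑ l', C ((1 : Matrix σ σ R) l l') * lsub T (F l') :=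
        Finset.sum_congr rfl fun l' _ => by
          rw [← h1 l']
          exact Finset.sum_congr rfl fun m _ => by ring
    _ = lsub T (F l) := by
        rw [Finset.sum_eq_single l]
        · simp
        · intro b _ hb
          rw [Matrix.one_apply_ne (Ne.symm hb)]
          simp
        · simp
    _ = _ := rfl

theorem lsub_pderiv [DecidableEq σ] {T T' : Matrix σ σ R} (h : T * T' = 1)
    (W : MvPowerSeries σ R) (l : σ) :
    lsub T (pderiv R l W) = ∑ m, C (T' m l) * pderiv R m (lsub T W) := by
  have h1 : ∀ l', ∑ m, C (T' m l) * (lsub T (pderiv R l' W) * C (T l' m)) =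
      C ((1 : Matrix σ σ R) l' l) * lsub T (pderiv R l' W) := fun l' => by
    rw [← h, Matrix.mul_apply, map_sum, Finset.sum_mul]
    exact Finset.sum_congr rfl fun m _ => by rw [map_mul]; ring
  have h2 : ∀ m, pderiv R m (lsub T W) = ∑ l', lsub T (pderiv R l' W) * C (T l' m) := fun m => by
    rw [lsub, pderiv_csub]
    simp only [pderiv_lin]
  simp only [h2, Finset.mul_sum]
  rw [Finset.sum_comm]
  simp only [h1]
  rw [Finset.sum_eq_single l]
  · simp
  · intro b _ hb
    rw [Matrix.one_apply_ne hb]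
    simp
  · simp

theorem pnorm_lin_le {𝕜 : Type*} [RCLike 𝕜] (A : Matrix τ σ 𝕜) (r : ℝ≥0) (l : τ) :
    pnorm r (lin A l) ≤ (∑ m, ‖A l m‖ₑ) * r := by
  rw [lin, Finset.sum_mul]
  refine (wnorm_sum_le _ _ _).trans (Finset.sum_le_sum fun m _ => ?_)
  rw [wnorm_C_mul]
  exact mul_le_mul_right (pnorm_X r m).le _

theorem pnorm_lsub_le {𝕜 : Type*} [RCLike 𝕜] [Finite τ] {T : Matrix τ σ 𝕜} {c : ℝ≥0}
    (hc : ∀ l, ∑ m, ‖T l m‖ₑ ≤ c) (r : ℝ≥0) (p : MvPowerSeries τ 𝕜) :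
    pnorm r (lsub T p) ≤ pnorm (c * r) p := by
  refine pnorm_csub_le _ (fun s => (pnorm_lin_le T r s).trans ?_) p
  rw [ENNReal.coe_mul]
  gcongr
  exact hc s

end Linear

end
end Carleman

open scoped ENNReal NNReal
namespace Carleman
noncomputable section
open MvPowerSeries

/-! ### Norms adapted to a Hurwitz matrix. -/

section Adapted

variable {σ : Type*} [Fintype σ] [DecidableEq σ]

/-- All complex eigenvalues of `A` have negative real part. -/
def Hurwitz (A : Matrix σ σ ℝ) : Prop :=
  ∀ μ ∈ spectrum ℂ (A.map (algebraMap ℝ ℂ)), μ.re < 0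

/-- A family of norms on real power series for which the derivative along every vector field with
linear part close to `A` is boundedly invertible, with a gain of one derivative. -/
structure AdaptedNorm (A : Matrix σ σ ℝ) where
  nu : ℝ≥0 → MvPowerSeries σ ℝ → ℝ≥0∞
  add_le : ∀ r p q, nu r (p + q) ≤ nu r p + nu r q
  neg : ∀ r p, nu r (-p) = nu r p
  mul_le : ∀ r p q, nu r (p * q) ≤ nu r p * nu r q
  C_mul : ∀ r c p, nu r (C c * p) = ‖c‖ₑ * nu r p
  ratio : ℝ≥0
  one_le_ratio : 1 ≤ ratio
  pnorm_le : ∀ r p, pnorm r p ≤ nu (ratio * r) p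
  le_pnorm : ∀ r p, nu r p ≤ pnorm (ratio * r) p
  eps : ℝ≥0
  eps_pos : 0 < eps
  bound : ℝ≥0
  -- `eps` and `bound` depend neither on the radius nor on the field. This uniformity is what allows
  -- one polydisc for all policies with linear part near `A`.
  pderiv_le : ∀ (r : ℝ≥0) (F : σ → MvPowerSeries σ ℝ), (∀ l, constantCoeff (F l) = 0) →
    (∀ l, nu r (F l - lin A l) ≤ eps * r) → ∀ W, constantCoeff W = 0 →
    ∀ l, r * nu r (pderiv ℝ l W) ≤ bound * nu r (lie F W)
  self_le : ∀ (r : ℝ≥0) (F : σ → MvPowerSeries σ ℝ), (∀ l, constantCoeff (F l) = 0) →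
    (∀ l, nu r (F l - lin A l) ≤ eps * r) → ∀ W, constantCoeff W = 0 →
    nu r W ≤ bound * nu r (lie F W)
  exists_lie_eq : ∀ (r : ℝ≥0) (F : σ → MvPowerSeries σ ℝ), 0 < r →
    (∀ l, constantCoeff (F l) = 0) → (∀ l, nu r (F l - lin A l) ≤ eps * r) →
    ∀ q, constantCoeff q = 0 → nu r q < ⊤ → ∃ W, constantCoeff W = 0 ∧ lie F W = q

omit [DecidableEq σ] in
theorem map_lie {R S : Type*} [CommRing R] [CommRing S] (φ : R →+* S)
    (F : σ → MvPowerSeries σ R) (W : MvPowerSeries σ R) :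
    map φ (lie F W) = lie (fun l => map φ (F l)) (map φ W) := by
  rw [lie, lie, map_sum]
  refine Finset.sum_congr rfl fun l _ => ?_
  rw [map_mul]
  congr 1
  ext α
  simp [coeff_pderiv]

omit [DecidableEq σ] in
theorem map_lin {τ R S : Type*} [CommRing R] [CommRing S] (φ : R →+* S) (A : Matrix τ σ R)
    (l : τ) : map φ (lin A l) = lin (A.map φ) l := by
  simp [lin]

/-- The coefficientwise real part of a complex power series. -/
def rePart (p : MvPowerSeries σ ℂ) : MvPowerSeries σ ℝ := fun α => (coeff α p).re

-- A real field commutes with taking real parts, so a complex solution of a real equation can be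
-- replaced by its real part.
omit [DecidableEq σ] in
theorem lie_rePart (F : σ → MvPowerSeries σ ℝ) (W : MvPowerSeries σ ℂ) :
    lie F (rePart W) = rePart (lie (fun l => map (algebraMap ℝ ℂ) (F l)) W) := by
  classical
  have hre : ∀ (p : MvPowerSeries σ ℂ) α, coeff α (rePart p) = (coeff α p).re := fun _ _ => rfl
  ext α
  simp only [hre, lie, map_sum, coeff_mul, coeff_pderiv, Complex.re_sum, coeff_map]
  refine Finset.sum_congr rfl fun l _ => Finset.sum_congr rfl fun x _ => ?_
  have : ((x.2 l : ℂ) + 1) = (((x.2 l : ℝ) + 1 : ℝ) : ℂ) := by push_cast; ring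
  rw [this, Complex.coe_algebraMap, Complex.re_ofReal_mul, Complex.re_mul_ofReal]

theorem Hurwitz.exists_re_le {A : Matrix σ σ ℝ} (hA : Hurwitz A) : ∃ μ : ℝ≥0, 0 < μ ∧
    ∀ z ∈ spectrum ℂ (A.map (algebraMap ℝ ℂ)), z.re ≤ -μ := by
  have hfin : (spectrum ℂ (A.map (algebraMap ℝ ℂ))).Finite := by
    rw [← Matrix.spectrum_toLin']
    exact Module.End.finite_spectrum _
  have : ∀ s : Finset ℂ, (∀ z ∈ s, z.re < 0) → ∃ μ : ℝ≥0, 0 < μ ∧ ∀ z ∈ s, z.re ≤ -μ := by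
    intro s
    induction s using Finset.induction_on with
    | empty => exact fun _ => ⟨1, one_pos, by simp⟩
    | insert a s _ ih =>
      intro h
      obtain ⟨μ, hμ, h1⟩ := ih fun z hz => h z (Finset.mem_insert_of_mem hz)
      have ha := h a (Finset.mem_insert_self _ _)
      refine ⟨min μ (-a.re).toNNReal, lt_min hμ (by simpa using ha), fun z hz => ?_⟩
      have e : ((min μ (-a.re).toNNReal : ℝ≥0) : ℝ) = min (μ : ℝ) (-a.re) := by
        rw [NNReal.coe_min, Real.coe_toNNReal _ (by linarith)]
      rw [e]
      rcases Finset.mem_insert.1 hz with rfl | hz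
      · linarith [min_le_right (μ : ℝ) (-z.re)]
      · linarith [min_le_left (μ : ℝ) (-a.re), h1 z hz]
  obtain ⟨μ, hμ, h⟩ := this hfin.toFinset fun z hz => hA z (by simpa using hz)
  exact ⟨μ, hμ, fun z hz => h z (by simpa using hz)⟩

theorem exists_adaptedNorm {A : Matrix σ σ ℝ} (hA : Hurwitz A) : Nonempty (AdaptedNorm A) := by
  obtain ⟨μ, hμ, hre⟩ := hA.exists_re_le
  set Ac : Matrix σ σ ℂ := A.map (algebraMap ℝ ℂ) with hAc
  set N : ℝ≥0 := Fintype.card σ + 1 with hN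
  have hN0 : 0 < N := by positivity
  -- The admissible perturbation of the diagonal field is μ/2. Half of it is spent on the
  -- off-diagonal entries: `N` exceeds the number of columns, so each row sums to at most μ/4. The
  -- other half is left for the deviation of the field from its linear part, whence `eps = μ / 4 /
  -- S`.
  obtain ⟨T, T', hTT', hT'T, hoff, hdiag⟩ :=
    exists_matrix_near_diagonal Ac (ε := μ / 4 / N) (by positivity)
  set Λ : σ → ℂ := fun l => (T' * Ac * T) l l with hΛ
  have hΛre : ∀ l, (Λ l).re ≤ -μ := fun l => hre _ (hdiag l)
  set E : Matrix σ σ ℂ := T' * Ac * T - Matrix.diagonal Λ with hE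
  have hEent : ∀ l m, ‖E l m‖ₑ ≤ ((μ / 4 / N : ℝ≥0) : ℝ≥0∞) := fun l m => by
    by_cases h : l = m
    · subst h
      simp [hE, hΛ]
    · have h1 := hoff l m h
      have h2 : E l m = (T' * Ac * T) l m := by
        rw [hE, Matrix.sub_apply, Matrix.diagonal_apply_ne _ h, sub_zero]
      rw [h2, enorm_le_coe, ← NNReal.coe_le_coe]
      simpa using h1
  have hErow : ∀ l, ∑ m, ‖E l m‖ₑ ≤ ((μ / 4 : ℝ≥0) : ℝ≥0∞) := fun l => by
    refine (Finset.sum_le_sum fun m _ => hEent l m).trans ?_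
    rw [Finset.sum_const, Finset.card_univ, nsmul_eq_mul]
    have : (Fintype.card σ : ℝ≥0) * (μ / 4 / N) ≤ μ / 4 := by
      rw [mul_div_assoc', div_le_iff₀ hN0, mul_comm]
      gcongr
      simp [hN]
    exact_mod_cast this
  -- Total masses of the transition matrices.
  set S : ℝ≥0 := 1 + ∑ l, ∑ m, ‖T l m‖₊ + ∑ l, ∑ m, ‖T' l m‖₊ with hS
  have hS1 : 1 ≤ S := by rw [hS, add_assoc]; exact le_self_add
  have hrow : ∀ l, ∑ m, ‖T l m‖ₑ ≤ (S : ℝ≥0∞) := fun l => by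
    have : ∑ m, ‖T l m‖₊ ≤ S :=
      (Finset.single_le_sum (f := fun l => ∑ m, ‖T l m‖₊) (fun _ _ => zero_le)
        (Finset.mem_univ l)).trans (by rw [hS]; exact (le_add_self).trans le_self_add)
    simpa [enorm_eq_nnnorm] using! (ENNReal.coe_le_coe.2 this)
  have hrow' : ∀ l, ∑ m, ‖T' l m‖ₑ ≤ (S : ℝ≥0∞) := fun l => by
    have : ∑ m, ‖T' l m‖₊ ≤ S :=
      (Finset.single_le_sum (f := fun l => ∑ m, ‖T' l m‖₊) (fun _ _ => zero_le)
        (Finset.mem_univ l)).trans le_add_self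
    simpa [enorm_eq_nnnorm] using! (ENNReal.coe_le_coe.2 this)
  have hcol' : ∀ m, ∑ l, ‖T' l m‖ₑ ≤ (S : ℝ≥0∞) := fun m => by
    have : ∑ l, ‖T' l m‖₊ ≤ S := by
      refine (Finset.sum_le_sum fun l _ => ?_).trans (b := ∑ l, ∑ m, ‖T' l m‖₊) le_add_self
      exact Finset.single_le_sum (f := fun m => ‖T' l m‖₊) (fun _ _ => zero_le) (Finset.mem_univ m)
    simpa [enorm_eq_nnnorm] using! (ENNReal.coe_le_coe.2 this)
  have hS0 : 0 < S := lt_of_lt_of_le one_pos hS1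
  set φ : ℝ →+* ℂ := algebraMap ℝ ℂ with hφ
  have hφn : ∀ c, ‖φ c‖ = ‖c‖ := fun c => by simp [hφ]
  -- Complexification followed by the change of coordinates. The adapted norm is the polydisc norm
  -- of `θ p`, and `ratio` bounds the loss of radius in either direction.
  let θ : MvPowerSeries σ ℝ → MvPowerSeries σ ℂ := fun p => lsub T (map φ p)
  -- The vector field in the new coordinates is a small perturbation of a diagonal one.
  let G : (σ → MvPowerSeries σ ℝ) → σ → MvPowerSeries σ ℂ := fun F m =>
    lin E m + ∑ l, C (T' m l) * θ (F l - lin A l)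
  have hG : ∀ F, (fun m => ∑ l, C (T' m l) * lsub T (map φ (F l))) =
      (fun l => C (Λ l) * X l) + G F := by
    intro F
    funext m
    have h1 : ∀ l, lsub T (map φ (F l)) = lin (Ac * T) l + θ (F l - lin A l) := fun l => by
      simp only [θ, map_sub, map_lin]
      rw [← hAc, lsub_lin]
      ring
    have h2 : lin (T' * Ac * T) m = C (Λ m) * X m + lin E m := by
      have h3 : T' * Ac * T = Matrix.diagonal Λ + E := by rw [hE]; abel
      have h4 : C (Λ m) * X m = lin (Matrix.diagonal Λ) m := by
        rw [lin, Finset.sum_eq_single m]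
        · simp
        · intro b _ hb
          simp [Matrix.diagonal_apply_ne _ (Ne.symm hb)]
        · simp
      rw [h4, h3]
      simp [lin, add_mul, Finset.sum_add_distrib]
    simp only [h1, mul_add, Finset.sum_add_distrib, sum_C_mul_lin, ← Matrix.mul_assoc, h2,
      Pi.add_apply, G]
    ring
  have hG0 : ∀ F : σ → MvPowerSeries σ ℝ, (∀ l, constantCoeff (F l) = 0) →
      ∀ m, constantCoeff (G F m) = 0 := by
    intro F hF m
    have h1 : ∀ l, constantCoeff (θ (F l - lin A l)) = 0 := fun l =>
      constantCoeff_csub _ (by simp [hF, constantCoeff_lin])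
    simp [G, constantCoeff_lin, h1]
  have hGn : ∀ (r : ℝ≥0) (F : σ → MvPowerSeries σ ℝ),
      (∀ l, pnorm r (θ (F l - lin A l)) ≤ (μ / 4 / S : ℝ≥0) * r) →
      ∀ m, pnorm r (G F m) ≤ (μ / 2 : ℝ≥0) * r := by
    intro r F hF m
    have h1 : pnorm r (∑ l, C (T' m l) * θ (F l - lin A l)) ≤ (μ / 4 : ℝ≥0) * r := by
      refine (wnorm_sum_le _ _ _).trans ?_
      calc ∑ l, wnorm (radial r) (C (T' m l) * θ (F l - lin A l))
          ≤ ∑ l, ‖T' m l‖ₑ * ((μ / 4 / S : ℝ≥0) * r) := Finset.sum_le_sum fun l _ => by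
            rw [wnorm_C_mul]
            gcongr
            exact hF l
        _ ≤ S * ((μ / 4 / S : ℝ≥0) * r) := by
            rw [← Finset.sum_mul]
            gcongr
            exact hrow' m
        _ = (μ / 4 : ℝ≥0) * r := by
            rw [← mul_assoc, ← ENNReal.coe_mul, mul_div_cancel₀ _ hS0.ne']
    refine (wnorm_add_le _ _ _).trans ((add_le_add ((pnorm_lin_le E r m).trans
      (mul_le_mul_left (hErow m) _)) h1).trans (le_of_eq ?_))
    rw [← add_mul, ← ENNReal.coe_add]
    congr 2
    rw [← NNReal.coe_inj]
    push_cast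
    ring
  have hlie : ∀ (F : σ → MvPowerSeries σ ℝ) W,
      lie ((fun l => C (Λ l) * X l) + G F) (θ W) = θ (lie F W) := fun F W => by
    rw [← hG, lie_lsub hTT', ← map_lie]
  have hkey : ∀ (r : ℝ≥0) (F : σ → MvPowerSeries σ ℝ), (∀ l, constantCoeff (F l) = 0) →
      (∀ l, pnorm r (θ (F l - lin A l)) ≤ (μ / 4 / S : ℝ≥0) * r) → ∀ W,
      wnorm (fun α => (α.degree : ℝ≥0∞) * radial r α) (θ W) ≤
        (2 / μ : ℝ≥0) * pnorm r (θ (lie F W)) := by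
    intro r F hF0 hF W
    have h1 := wnorm_le_of_lie_diagonal hΛre (hG0 F hF0) (hGn r F hF) (θ W)
    rw [hlie] at h1
    have h2 : ((2 / μ : ℝ≥0) : ℝ≥0∞) * ((μ / 2 : ℝ≥0) : ℝ≥0∞) = 1 := by
      rw [← ENNReal.coe_mul, div_mul_div_comm, mul_comm, div_self (by positivity), ENNReal.coe_one]
    calc _ = (2 / μ : ℝ≥0) * ((μ / 2 : ℝ≥0) *
          wnorm (fun α => (α.degree : ℝ≥0∞) * radial r α) (θ W)) := by
            rw [← mul_assoc, h2, one_mul]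
      _ ≤ _ := by gcongr
  refine ⟨{
    nu := fun r p => pnorm r (θ p)
    add_le := fun r p q => by simp only [θ, map_add]; exact wnorm_add_le _ _ _
    neg := fun r p => by simp only [θ, map_neg]; exact wnorm_neg _ _
    mul_le := fun r p q => by simp only [θ, map_mul]; exact pnorm_mul_le _ _ _
    C_mul := fun r c p => ?_
    ratio := S
    one_le_ratio := hS1
    pnorm_le := fun r p => ?_
    le_pnorm := fun r p => ?_
    eps := μ / 4 / S
    eps_pos := by positivity
    bound := S * (2 / μ)
    pderiv_le := fun r F hF0 hF W hW l => ?_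
    self_le := fun r F hF0 hF W hW => ?_
    exists_lie_eq := fun r F hr hF0 hF q hq0 hq => ?_ }⟩
  · simp only [θ, map_mul, map_C]
    rw [lsub, csub_C, pnorm, wnorm_C_mul]
    congr 1
    rw [← ofReal_norm, hφn, ofReal_norm]
  · have h1 : map φ p = lsub T' (θ p) := (lsub_lsub_cancel hTT' _).symm
    calc pnorm r p = pnorm r (map φ p) := (wnorm_map φ hφn _ _).symm
      _ = pnorm r (lsub T' (θ p)) := by rw [← h1]
      _ ≤ pnorm (S * r) (θ p) := pnorm_lsub_le hrow' r _
  · exact (pnorm_lsub_le hrow r _).trans (wnorm_map φ hφn _ _).le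
  · have h1 : θ (pderiv ℝ l W) = ∑ m, C (T' m l) * pderiv ℂ m (θ W) := by
      have : map φ (pderiv ℝ l W) = pderiv ℂ l (map φ W) := by
        ext α
        simp [coeff_pderiv]
      simp only [θ]
      rw [this, lsub_pderiv hTT']
    have h2 := sum_wnorm_pderiv (w := radial r) (v := radial r) (r := r)
      (fun β l => by simp [radial, pow_succ, mul_comm]) (θ W)
    have h3 : ∀ m, r * pnorm r (pderiv ℂ m (θ W)) ≤ (2 / μ : ℝ≥0) * pnorm r (θ (lie F W)) :=
      fun m => by
        refine le_trans ?_ (h2.le.trans (hkey r F hF0 hF W))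
        exact Finset.single_le_sum (f := fun m => r * pnorm r (pderiv ℂ m (θ W)))
          (fun _ _ => zero_le) (Finset.mem_univ m)
    show r * pnorm r (θ (pderiv ℝ l W)) ≤ _
    rw [h1]
    calc r * pnorm r (∑ m, C (T' m l) * pderiv ℂ m (θ W))
        ≤ r * ∑ m, ‖T' m l‖ₑ * pnorm r (pderiv ℂ m (θ W)) := by
          gcongr
          refine (wnorm_sum_le _ _ _).trans (le_of_eq ?_)
          exact Finset.sum_congr rfl fun m _ => wnorm_C_mul _ _ _
      _ = ∑ m, ‖T' m l‖ₑ * (r * pnorm r (pderiv ℂ m (θ W))) := by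
          rw [Finset.mul_sum]
          exact Finset.sum_congr rfl fun m _ => by ring
      _ ≤ ∑ m, ‖T' m l‖ₑ * ((2 / μ : ℝ≥0) * pnorm r (θ (lie F W))) :=
          Finset.sum_le_sum fun m _ => mul_le_mul_right (h3 m) _
      _ ≤ S * ((2 / μ : ℝ≥0) * pnorm r (θ (lie F W))) := by
          rw [← Finset.sum_mul]
          gcongr
          exact hcol' l
      _ = _ := by rw [ENNReal.coe_mul, mul_assoc]
  · have h1 : pnorm r (θ W) ≤ wnorm (fun α => (α.degree : ℝ≥0∞) * radial r α) (θ W) := by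
      have hW0 : constantCoeff (θ W) = 0 := constantCoeff_csub _ (by simp [hW])
      refine wnorm_le_of_coeff_le fun α => ?_
      by_cases hα : α = 0
      · subst hα
        simp [hW0]
      · have hα' : α.degree ≠ 0 := fun h0 => hα ((Finsupp.degree_eq_zero_iff α).1 h0)
        gcongr
        refine le_mul_of_one_le_left' ?_
        exact_mod_cast Nat.one_le_iff_ne_zero.2 hα'
    refine h1.trans ((hkey r F hF0 hF W).trans ?_)
    gcongr
    exact le_mul_of_one_le_left' hS1
  -- The equation is solved in the complex coordinates, carried back by `T'`, and made real by
  -- `rePart`.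
  · obtain ⟨Z, hZ0, hZ⟩ := exists_lie_diagonal_eq hμ hΛre (hG0 F hF0) hr (hGn r F hF)
      (q := θ q) (constantCoeff_csub _ (by simp [hq0])) hq
    set W := lsub T' Z with hW
    have h1 : lsub T W = Z := lsub_lsub_cancel hT'T Z
    have h2 : lie (fun l => map φ (F l)) W = map φ q := by
      have h3 := lie_lsub hTT' (fun l => map φ (F l)) W
      rw [h1, hG, hZ] at h3
      have h4 := congrArg (lsub T') h3
      simp only [θ] at h4
      rw [lsub_lsub_cancel hTT', lsub_lsub_cancel hTT'] at h4
      exact h4.symm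
    refine ⟨rePart W, ?_, ?_⟩
    · have : constantCoeff W = 0 := constantCoeff_csub _ hZ0
      show (coeff 0 W).re = 0
      rw [coeff_zero_eq_constantCoeff_apply, this, Complex.zero_re]
    · rw [lie_rePart, ← hφ, h2]
      ext α
      show (coeff α (map φ q)).re = _
      simp [hφ]

end Adapted

end
end Carleman

open scoped ENNReal NNReal
namespace Carleman
noncomputable section
open MvPowerSeries
open Finsupp (sumElim)

/-! ### Series in two groups of variables and the doubled vector field. -/

section Doubling

variable {σ τ R : Type*} [CommRing R]

theorem exists_sumElim (e : σ ⊕ σ →₀ ℕ) : ∃ α β : σ →₀ ℕ, e = sumElim α β :=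
  ⟨(Finsupp.sumFinsuppEquivProdFinsupp e).1, (Finsupp.sumFinsuppEquivProdFinsupp e).2, by
    ext (x | x) <;> rfl⟩

theorem sumElim_inj {α β α' β' : σ →₀ ℕ} :
    (sumElim α β : σ ⊕ σ →₀ ℕ) = sumElim α' β' ↔ α = α' ∧ β = β' := by
  refine ⟨fun h => ⟨?_, ?_⟩, fun h => by rw [h.1, h.2]⟩
  · ext x
    exact DFunLike.congr_fun h (Sum.inl x)
  · ext x
    exact DFunLike.congr_fun h (Sum.inr x)

theorem degree_sumElim [Fintype σ] (α β : σ →₀ ℕ) :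
    (sumElim α β : σ ⊕ σ →₀ ℕ).degree = α.degree + β.degree := by
  simp [Finsupp.degree_eq_sum]

variable [Finite σ]

theorem coeff_csub_X_comp (f : σ → τ) (p : MvPowerSeries σ R) (e : τ →₀ ℕ) [DecidableEq τ] :
    coeff e (csub (fun s => X (f s)) (fun _ => constantCoeff_X _) p) =
      ∑ᶠ d : σ →₀ ℕ, if d.mapDomain f = e then coeff d p else 0 := by
  rw [csub_eq_subst, coeff_subst (hasSubst_of_constantCoeff_zero fun _ => constantCoeff_X _)]
  refine finsum_congr fun d => ?_
  have h : (d.prod fun s k => (X (f s) : MvPowerSeries τ R) ^ k) =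
      monomial (d.mapDomain f) 1 := by
    have h1 := congrArg (MvPolynomial.toMvPowerSeries (σ := τ) (R := R))
      (MvPolynomial.rename_monomial f d (1 : R))
    rw [MvPolynomial.coe_monomial] at h1
    rw [← h1, MvPolynomial.monomial_eq]
    simp only [map_one, one_mul, Finsupp.prod, map_prod, map_pow, MvPolynomial.rename_X]
    rw [← MvPolynomial.coeToMvPowerSeries.ringHom_apply, map_prod]
    simp
  rw [h, coeff_monomial, smul_eq_mul]
  split_ifs with h1 h2 h2
  · simp
  · exact absurd h1.symm h2
  · exact absurd h2.symm h1
  · simp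

/-- The series `p(x)` as a series in two sets of variables `(x, y)`. -/
def inlHom : MvPowerSeries σ R →ₐ[R] MvPowerSeries (σ ⊕ σ) R :=
  csub (fun s => X (Sum.inl s)) (fun _ => constantCoeff_X _)

/-- The series `p(y)` as a series in two sets of variables `(x, y)`. -/
def inrHom : MvPowerSeries σ R →ₐ[R] MvPowerSeries (σ ⊕ σ) R :=
  csub (fun s => X (Sum.inr s)) (fun _ => constantCoeff_X _)

/-- Restriction of a series in two sets of variables to the diagonal. -/
def diagHom : MvPowerSeries (σ ⊕ σ) R →ₐ[R] MvPowerSeries σ R :=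
  csub (fun s => X (Sum.elim id id s)) (fun _ => constantCoeff_X _)

theorem coeff_inlHom [DecidableEq σ] (p : MvPowerSeries σ R) (α β : σ →₀ ℕ) :
    coeff (sumElim α β) (inlHom p) = if β = 0 then coeff α p else 0 := by
  have h : ∀ d : σ →₀ ℕ, d.mapDomain Sum.inl = (sumElim d 0 : σ ⊕ σ →₀ ℕ) := fun d => by
    rw [Finsupp.sumElim_eq_add]; simp
  rw [inlHom, coeff_csub_X_comp, finsum_eq_single _ α]
  · simp [h, sumElim_inj, eq_comm]
  · intro d hd
    rw [if_neg]
    rw [h, sumElim_inj]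
    exact fun h => hd h.1

theorem coeff_inrHom [DecidableEq σ] (p : MvPowerSeries σ R) (α β : σ →₀ ℕ) :
    coeff (sumElim α β) (inrHom p) = if α = 0 then coeff β p else 0 := by
  have h : ∀ d : σ →₀ ℕ, d.mapDomain Sum.inr = (sumElim 0 d : σ ⊕ σ →₀ ℕ) := fun d => by
    rw [Finsupp.sumElim_eq_add]; simp
  rw [inrHom, coeff_csub_X_comp, finsum_eq_single _ β]
  · simp [h, sumElim_inj, eq_comm]
  · intro d hd
    rw [if_neg]
    rw [h, sumElim_inj]
    exact fun h => hd h.2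

theorem coeff_diagHom [DecidableEq σ] (W : MvPowerSeries (σ ⊕ σ) R) (γ : σ →₀ ℕ) :
    coeff γ (diagHom W) =
      ∑ x ∈ Finset.HasAntidiagonal.antidiagonal γ, coeff (sumElim x.1 x.2) W := by
  have h : ∀ α β : σ →₀ ℕ, (sumElim α β).mapDomain (Sum.elim id id) = α + β := fun α β => by
    rw [Finsupp.sumElim_eq_add, Finsupp.mapDomain_add, ← Finsupp.mapDomain_comp,
      ← Finsupp.mapDomain_comp]
    simp
  rw [diagHom, coeff_csub_X_comp, finsum_eq_sum_of_support_subset (s :=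
    (Finset.HasAntidiagonal.antidiagonal γ).image fun x => sumElim x.1 x.2)]
  · rw [Finset.sum_image]
    · refine Finset.sum_congr rfl fun x hx => ?_
      rw [if_pos]
      rw [h]
      exact Finset.HasAntidiagonal.mem_antidiagonal.1 hx
    · intro x _ y _ hxy
      have := sumElim_inj.1 hxy
      exact Prod.ext this.1 this.2
  · intro e he
    obtain ⟨α, β, rfl⟩ := exists_sumElim e
    rw [Function.mem_support] at he
    have h1 : α + β = γ := by
      by_contra h0
      exact he (if_neg (by rwa [h]))
    simp only [Finset.coe_image, Set.mem_image, Finset.mem_coe,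
      Finset.HasAntidiagonal.mem_antidiagonal]
    exact ⟨(α, β), h1, rfl⟩

/-- The coefficient of `y ^ β` in a series in two sets of variables `(x, y)`. -/
def sliceRight (β : σ →₀ ℕ) (W : MvPowerSeries (σ ⊕ σ) R) : MvPowerSeries σ R :=
  fun α => coeff (sumElim α β) W

/-- The coefficient of `x ^ α` in a series in two sets of variables `(x, y)`. -/
def sliceLeft (α : σ →₀ ℕ) (W : MvPowerSeries (σ ⊕ σ) R) : MvPowerSeries σ R :=
  fun β => coeff (sumElim α β) W

omit [Finite σ] in
theorem coeff_sliceRight (α β : σ →₀ ℕ) (W : MvPowerSeries (σ ⊕ σ) R) :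
    coeff α (sliceRight β W) = coeff (sumElim α β) W := rfl

omit [Finite σ] in
theorem coeff_sliceLeft (α β : σ →₀ ℕ) (W : MvPowerSeries (σ ⊕ σ) R) :
    coeff β (sliceLeft α W) = coeff (sumElim α β) W := rfl

omit [Finite σ] in
theorem sumElim_mem_antidiagonal [DecidableEq σ] {α β : σ →₀ ℕ}
    {x : (σ ⊕ σ →₀ ℕ) × (σ ⊕ σ →₀ ℕ)}
    (hx : x ∈ Finset.HasAntidiagonal.antidiagonal (sumElim α β)) :
    ∃ a a' b b' : σ →₀ ℕ, x = (sumElim a b, sumElim a' b') ∧ a + a' = α ∧ b + b' = β := by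
  obtain ⟨a, b, h1⟩ := exists_sumElim x.1
  obtain ⟨a', b', h2⟩ := exists_sumElim x.2
  rw [Finset.HasAntidiagonal.mem_antidiagonal, h1, h2, ← Finsupp.sumElim_add, sumElim_inj] at hx
  exact ⟨a, a', b, b', Prod.ext h1 h2, hx.1, hx.2⟩

/-- Multiplication by p(x) acts on each coefficient of y^β separately. -/
theorem coeff_inlHom_mul [DecidableEq σ] (p : MvPowerSeries σ R) (W : MvPowerSeries (σ ⊕ σ) R)
    (α β : σ →₀ ℕ) :
    coeff (sumElim α β) (inlHom p * W) = coeff α (p * sliceRight β W) := by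
  rw [coeff_mul, coeff_mul]
  symm
  refine Finset.sum_of_injOn (fun x => (sumElim x.1 0, sumElim x.2 β)) ?_ ?_ ?_ ?_
  · intro x _ y _ hxy
    simp only [Prod.mk.injEq, sumElim_inj] at hxy
    exact Prod.ext hxy.1.1 hxy.2.1
  · intro x hx
    have := Finset.HasAntidiagonal.mem_antidiagonal.1 hx
    simp only [Finset.mem_coe, Finset.HasAntidiagonal.mem_antidiagonal]
    rw [← Finsupp.sumElim_add, this, zero_add]
  · intro x hx hx'
    obtain ⟨a, a', b, b', rfl, ha, hb⟩ := sumElim_mem_antidiagonal hx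
    simp only [coeff_inlHom]
    rw [if_neg, zero_mul]
    rintro rfl
    rw [zero_add] at hb
    exact hx' ⟨(a, a'), Finset.HasAntidiagonal.mem_antidiagonal.2 ha, by rw [hb]⟩
  · intro x _
    simp [coeff_inlHom, coeff_sliceRight]

theorem coeff_inrHom_mul [DecidableEq σ] (p : MvPowerSeries σ R) (W : MvPowerSeries (σ ⊕ σ) R)
    (α β : σ →₀ ℕ) :
    coeff (sumElim α β) (inrHom p * W) = coeff β (p * sliceLeft α W) := by
  rw [coeff_mul, coeff_mul]
  symm
  refine Finset.sum_of_injOn (fun x => (sumElim 0 x.1, sumElim α x.2)) ?_ ?_ ?_ ?_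
  · intro x _ y _ hxy
    simp only [Prod.mk.injEq, sumElim_inj] at hxy
    exact Prod.ext hxy.1.2 hxy.2.2
  · intro x hx
    have := Finset.HasAntidiagonal.mem_antidiagonal.1 hx
    simp only [Finset.mem_coe, Finset.HasAntidiagonal.mem_antidiagonal]
    rw [← Finsupp.sumElim_add, this, zero_add]
  · intro x hx hx'
    obtain ⟨a, a', b, b', rfl, ha, hb⟩ := sumElim_mem_antidiagonal hx
    simp only [coeff_inrHom]
    rw [if_neg, zero_mul]
    rintro rfl
    rw [zero_add] at ha
    exact hx' ⟨(b, b'), Finset.HasAntidiagonal.mem_antidiagonal.2 hb, by rw [ha]⟩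
  · intro x _
    simp [coeff_inrHom, coeff_sliceLeft]

theorem coeff_inlHom_mul_inrHom (p q : MvPowerSeries σ R) (α β : σ →₀ ℕ) :
    coeff (sumElim α β) (inlHom p * inrHom q) = coeff α p * coeff β q := by
  classical
  rw [coeff_inlHom_mul]
  have : sliceRight β (inrHom q) = C (coeff β q) := by
    ext a
    rw [coeff_sliceRight, coeff_inrHom, coeff_C]
  rw [this, coeff_mul_C]

omit [Finite σ] in
theorem sliceRight_pderiv_inl (l : σ) (β : σ →₀ ℕ) (W : MvPowerSeries (σ ⊕ σ) R) :
    sliceRight β (pderiv R (Sum.inl l) W) = pderiv R l (sliceRight β W) := by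
  ext α
  rw [coeff_sliceRight, coeff_pderiv, coeff_pderiv, coeff_sliceRight,
    ← Finsupp.sumElim_single_zero, ← Finsupp.sumElim_add, add_zero]
  rfl

omit [Finite σ] in
theorem sliceLeft_pderiv_inr (l : σ) (α : σ →₀ ℕ) (W : MvPowerSeries (σ ⊕ σ) R) :
    sliceLeft α (pderiv R (Sum.inr l) W) = pderiv R l (sliceLeft α W) := by
  ext β
  rw [coeff_sliceLeft, coeff_pderiv, coeff_pderiv, coeff_sliceLeft,
    ← Finsupp.sumElim_zero_single, ← Finsupp.sumElim_add, add_zero]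
  rfl

/-- The vector field `(F(x), F(y))`. -/
def double (F : σ → MvPowerSeries σ R) : σ ⊕ σ → MvPowerSeries (σ ⊕ σ) R :=
  Sum.elim (fun l => inlHom (F l)) (fun l => inrHom (F l))

end Doubling

section DoubledLie

variable {σ R : Type*} [Fintype σ] [CommRing R]

/-- The two halves of the doubled field act on the left and on the right index of the coefficient
array. These are the two terms of a Lyapunov equation 𝒜ᵀP + P𝒜. -/
theorem coeff_lie_double (F : σ → MvPowerSeries σ R) (W : MvPowerSeries (σ ⊕ σ) R)
    (α β : σ →₀ ℕ) : coeff (sumElim α β) (lie (double F) W) =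
      coeff α (lie F (sliceRight β W)) + coeff β (lie F (sliceLeft α W)) := by
  classical
  rw [lie, Fintype.sum_sum_type, map_add, map_sum, map_sum, lie, lie, map_sum, map_sum]
  congr 1
  · refine Finset.sum_congr rfl fun l _ => ?_
    rw [double, Sum.elim_inl, coeff_inlHom_mul, sliceRight_pderiv_inl]
  · refine Finset.sum_congr rfl fun l _ => ?_
    rw [double, Sum.elim_inr, coeff_inrHom_mul, sliceLeft_pderiv_inr]

theorem constantCoeff_inlHom {p : MvPowerSeries σ R} (hp : constantCoeff p = 0) :
    constantCoeff (inlHom p) = 0 := constantCoeff_csub _ hp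

theorem constantCoeff_inrHom {p : MvPowerSeries σ R} (hp : constantCoeff p = 0) :
    constantCoeff (inrHom p) = 0 := constantCoeff_csub _ hp

theorem constantCoeff_double {F : σ → MvPowerSeries σ R} (hF : ∀ l, constantCoeff (F l) = 0)
    (l : σ ⊕ σ) : constantCoeff (double F l) = 0 := by
  cases l with
  | inl l => exact constantCoeff_inlHom (hF l)
  | inr l => exact constantCoeff_inrHom (hF l)

theorem diagHom_inlHom (p : MvPowerSeries σ R) : diagHom (inlHom p) = p := by
  rw [diagHom, inlHom, csub_eq_subst, csub_eq_subst, subst_comp_subst_apply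
    (hasSubst_of_constantCoeff_zero fun _ => constantCoeff_X _)
    (hasSubst_of_constantCoeff_zero fun _ => constantCoeff_X _)]
  simp only [subst_X (hasSubst_of_constantCoeff_zero
    (a := fun s : σ ⊕ σ => (X (Sum.elim id id s) : MvPowerSeries σ R))
    fun _ => constantCoeff_X _), Sum.elim_inl, id]
  exact congrFun subst_self p

theorem diagHom_inrHom (p : MvPowerSeries σ R) : diagHom (inrHom p) = p := by
  rw [diagHom, inrHom, csub_eq_subst, csub_eq_subst, subst_comp_subst_apply
    (hasSubst_of_constantCoeff_zero fun _ => constantCoeff_X _)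
    (hasSubst_of_constantCoeff_zero fun _ => constantCoeff_X _)]
  simp only [subst_X (hasSubst_of_constantCoeff_zero
    (a := fun s : σ ⊕ σ => (X (Sum.elim id id s) : MvPowerSeries σ R))
    fun _ => constantCoeff_X _), Sum.elim_inr, id]
  exact congrFun subst_self p

theorem pderiv_diagHom (W : MvPowerSeries (σ ⊕ σ) R) (l : σ) :
    pderiv R l (diagHom W) =
      diagHom (pderiv R (Sum.inl l) W) + diagHom (pderiv R (Sum.inr l) W) := by
  rw [diagHom, pderiv_csub, Fintype.sum_sum_type]
  congr 1
  · rw [Finset.sum_eq_single l]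
    · simp
    · intro b _ hb
      rw [Sum.elim_inl, id, pderiv_X_of_ne hb, mul_zero]
    · simp
  · rw [Finset.sum_eq_single l]
    · simp
    · intro b _ hb
      rw [Sum.elim_inr, id, pderiv_X_of_ne hb, mul_zero]
    · simp

/-- The diagonal y = x is invariant under (F(x), F(y)), which restricts to F on it. This carries the
equation of W over to the value function. -/
theorem lie_diagHom (F : σ → MvPowerSeries σ R) (W : MvPowerSeries (σ ⊕ σ) R) :
    lie F (diagHom W) = diagHom (lie (double F) W) := by
  rw [lie, lie, Fintype.sum_sum_type, map_add, map_sum, map_sum, ← Finset.sum_add_distrib]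
  refine Finset.sum_congr rfl fun l _ => ?_
  rw [pderiv_diagHom, mul_add, map_mul, map_mul, double, Sum.elim_inl, Sum.elim_inr,
    diagHom_inlHom, diagHom_inrHom]

theorem pnorm_inlHom_le {𝕜 : Type*} [RCLike 𝕜] (r : ℝ≥0) (p : MvPowerSeries σ 𝕜) :
    pnorm r (inlHom p) ≤ pnorm r p :=
  pnorm_csub_le _ (fun _ => (pnorm_X r _).le) p

theorem pnorm_inrHom_le {𝕜 : Type*} [RCLike 𝕜] (r : ℝ≥0) (p : MvPowerSeries σ 𝕜) :
    pnorm r (inrHom p) ≤ pnorm r p :=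
  pnorm_csub_le _ (fun _ => (pnorm_X r _).le) p

theorem pnorm_diagHom_le {𝕜 : Type*} [RCLike 𝕜] (r : ℝ≥0) (p : MvPowerSeries (σ ⊕ σ) 𝕜) :
    pnorm r (diagHom p) ≤ pnorm r p :=
  pnorm_csub_le _ (fun _ => (pnorm_X r _).le) p

end DoubledLie

end
end Carleman

open scoped ENNReal NNReal
namespace Carleman
noncomputable section
open MvPowerSeries
open Finsupp (sumElim)

/-! ### Rows of infinite matrices as power series. -/

section Rows

variable {n : ℕ}

theorem coeff_rowSeries (r : Idx n → ℝ) (α : Idx n) : coeff α.1 (rowSeries r) = r α := by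
  show (if h : α.1 ≠ 0 then r ⟨α.1, h⟩ else 0) = r α
  rw [dif_pos α.2]

theorem constantCoeff_rowSeries (r : Idx n → ℝ) : constantCoeff (rowSeries r) = 0 := by
  show (if h : (0 : Fin n →₀ ℕ) ≠ 0 then r ⟨0, h⟩ else 0) = 0
  simp

/-- Two series without constant term agree if their coefficients of positive degree do. -/
theorem eq_of_coeff_idx {p q : MvPowerSeries (Fin n) ℝ} (hp : constantCoeff p = 0)
    (hq : constantCoeff q = 0) (h : ∀ α : Idx n, coeff α.1 p = coeff α.1 q) : p = q := by
  ext α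
  by_cases hα : α = 0
  · subst hα
    rw [coeff_zero_eq_constantCoeff_apply, hp, coeff_zero_eq_constantCoeff_apply, hq]
  · exact h ⟨α, hα⟩

theorem rowSeries_injective : Function.Injective (rowSeries (n := n)) := fun r s h => by
  funext α
  rw [← coeff_rowSeries r, h, coeff_rowSeries]

/-- The coefficients of positive degree of a power series. -/
def rowOf (p : MvPowerSeries (Fin n) ℝ) (α : Idx n) : ℝ := coeff α.1 p

theorem rowSeries_rowOf {p : MvPowerSeries (Fin n) ℝ} (hp : constantCoeff p = 0) :
    rowSeries (rowOf p) = p :=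
  eq_of_coeff_idx (constantCoeff_rowSeries _) hp fun α => coeff_rowSeries _ α

theorem rowSeries_sub (r s : Idx n → ℝ) : rowSeries (r - s) = rowSeries r - rowSeries s :=
  eq_of_coeff_idx (constantCoeff_rowSeries _)
    (by rw [map_sub, constantCoeff_rowSeries, constantCoeff_rowSeries, sub_zero])
    fun α => by simp [coeff_rowSeries]

theorem finsum_idx_eq_sum {f : Idx n → ℝ} {s : Finset (Fin n →₀ ℕ)}
    {g : (Fin n →₀ ℕ) → ℝ} (hg : g 0 = 0) (hfg : ∀ α : Idx n, f α = g α.1)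
    (hs : ∀ α, g α ≠ 0 → α ∈ s) : ∑ᶠ α, f α = ∑ α ∈ s, g α := by
  have h1 : ∑ᶠ α, f α = ∑ᶠ α : {α : Fin n →₀ ℕ // α ≠ 0}, g α := finsum_congr hfg
  rw [h1, finsum_subtype_eq_finsum_cond (f := g) (fun α => α ≠ 0)]
  have h2 : ∑ᶠ (α : Fin n →₀ ℕ) (_ : α ≠ 0), g α = ∑ᶠ α, g α := finsum_congr fun α => by
    by_cases hα : α = 0
    · subst hα
      simp [hg]
    · simp [hα]
  rw [h2]
  exact finsum_eq_sum_of_support_subset _ fun α hα => hs α hα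

/-- All multi-indices of degree at most `d`. -/
def degreeLE (n d : ℕ) : Finset (Fin n →₀ ℕ) :=
  (Finsupp.finite_of_degree_le (σ := Fin n) d).toFinset

theorem mem_degreeLE {d : ℕ} {α : Fin n →₀ ℕ} : α ∈ degreeLE n d ↔ α.degree ≤ d := by
  simp [degreeLE]

/-- The coefficients of a formal sum `∑_α α_l x^(α - e_l) h_α`. -/
theorem sum_coeff_monomial_mul (h : (Fin n →₀ ℕ) → MvPowerSeries (Fin n) ℝ) (l : Fin n)
    (v : Fin n →₀ ℕ) {d : ℕ} (hd : v.degree + 1 ≤ d) :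
    ∑ α ∈ degreeLE n d, coeff v (monomial (α - Finsupp.single l 1) (α l : ℝ) * h α) =
      ∑ x ∈ Finset.HasAntidiagonal.antidiagonal v,
        ((x.1 l : ℝ) + 1) * coeff x.2 (h (x.1 + Finsupp.single l 1)) := by
  classical
  symm
  refine Finset.sum_of_injOn (fun x => x.1 + Finsupp.single l 1) ?_ ?_ ?_ ?_
  · intro x hx y hy hxy
    have hx := Finset.HasAntidiagonal.mem_antidiagonal.1 hx
    have hy := Finset.HasAntidiagonal.mem_antidiagonal.1 hy
    have h1 : x.1 = y.1 := add_right_cancel hxy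
    have h2 : x.2 = y.2 := by
      rw [← hy, h1] at hx
      exact add_left_cancel hx
    exact Prod.ext h1 h2
  · intro x hx
    have hx := congrArg Finsupp.degree (Finset.HasAntidiagonal.mem_antidiagonal.1 hx)
    rw [map_add] at hx
    rw [Finset.mem_coe, mem_degreeLE, map_add, Finsupp.degree_single]
    omega
  · intro α _ hα
    rw [coeff_monomial_mul]
    split_ifs with h1
    · by_cases h0 : α l = 0
      · simp [h0]
      · refine absurd ⟨(α - Finsupp.single l 1, v - (α - Finsupp.single l 1)), ?_, ?_⟩ hα
        · rw [Finset.mem_coe, Finset.HasAntidiagonal.mem_antidiagonal]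
          exact add_tsub_cancel_of_le h1
        · exact tsub_add_cancel_of_le (by simpa [Nat.one_le_iff_ne_zero] using h0)
    · rfl
  · intro x hx
    have hx := Finset.HasAntidiagonal.mem_antidiagonal.1 hx
    rw [add_tsub_cancel_right, coeff_monomial_mul, if_pos (by rw [← hx]; exact le_self_add), ← hx,
      add_tsub_cancel_left]
    simp

/-- The block triangular form of the lifted matrix: a field without constant term does not lower the
degree of a monomial. -/
theorem coeff_monoRate_eq_zero {v : Fin n → MvPowerSeries (Fin n) ℝ}
    (hv : ∀ l, constantCoeff (v l) = 0) {α β : Fin n →₀ ℕ} (h : β.degree < α.degree) :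
    coeff β (monoRate v α) = 0 := by
  rw [monoRate, map_sum]
  refine Finset.sum_eq_zero fun l _ => ?_
  rw [coeff_monomial_mul]
  split_ifs with h1
  · by_cases h0 : α l = 0
    · simp [h0]
    · have h2 : α - Finsupp.single l 1 + Finsupp.single l 1 = α :=
        tsub_add_cancel_of_le (by simpa [Nat.one_le_iff_ne_zero] using h0)
      have h3 := congrArg Finsupp.degree h2
      have h4 := congrArg Finsupp.degree (add_tsub_cancel_of_le h1)
      rw [map_add, Finsupp.degree_single] at h3
      rw [map_add] at h4
      have h5 : β - (α - Finsupp.single l 1) = 0 := by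
        rw [← Finsupp.degree_eq_zero_iff]
        omega
      rw [h5, coeff_zero_eq_constantCoeff_apply, hv, mul_zero]
  · rfl

theorem monoRate_zero (v : Fin n → MvPowerSeries (Fin n) ℝ) : monoRate v 0 = 0 := by
  simp [monoRate]

/-- Linearity of the derivative in `p`, monomial by monomial. Exponents of degree |β| + 1 are
included because `v` may have a constant term, as the columns of g do. -/
theorem coeff_lie_eq_sum (v : Fin n → MvPowerSeries (Fin n) ℝ) (p : MvPowerSeries (Fin n) ℝ)
    (β : Fin n →₀ ℕ) {d : ℕ} (hd : β.degree + 1 ≤ d) :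
    coeff β (lie v p) = ∑ α ∈ degreeLE n d, coeff β (monoRate v α) * coeff α p := by
  classical
  have h1 : ∀ l x, x ∈ Finset.HasAntidiagonal.antidiagonal β →
      coeff x.2 (pderiv ℝ l p) = ∑ α ∈ degreeLE n d,
        coeff x.2 (monomial (α - Finsupp.single l 1) (α l : ℝ) * C (coeff α p)) := by
    intro l x hx
    have hx := congrArg Finsupp.degree (Finset.HasAntidiagonal.mem_antidiagonal.1 hx)
    rw [map_add] at hx
    rw [sum_coeff_monomial_mul (fun α => C (coeff α p)) l x.2 (by omega),
      Finset.sum_eq_single (x.2, 0)]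
    · simp [coeff_pderiv, mul_comm]
    · intro y hy hne
      have hy := Finset.HasAntidiagonal.mem_antidiagonal.1 hy
      have : y.2 ≠ 0 := by
        intro h0
        apply hne
        rw [h0, add_zero] at hy
        exact Prod.ext hy h0
      rw [coeff_C, if_neg this, mul_zero]
    · simp
  simp only [lie, map_sum, coeff_mul, monoRate]
  calc _ = ∑ l, ∑ x ∈ Finset.HasAntidiagonal.antidiagonal β, ∑ α ∈ degreeLE n d,
        coeff x.1 (v l) *
          coeff x.2 (monomial (α - Finsupp.single l 1) (α l : ℝ) * C (coeff α p)) := by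
        refine Finset.sum_congr rfl fun l _ => Finset.sum_congr rfl fun x hx => ?_
        rw [h1 l x hx, Finset.mul_sum]
    _ = ∑ α ∈ degreeLE n d, ∑ l, coeff β (v l *
          (monomial (α - Finsupp.single l 1) (α l : ℝ) * C (coeff α p))) := by
        rw [Finset.sum_comm (s := degreeLE n d)]
        refine Finset.sum_congr rfl fun l _ => ?_
        simp only [coeff_mul (n := β)]
        rw [Finset.sum_comm]
    _ = _ := by
        refine Finset.sum_congr rfl fun α _ => ?_
        rw [Finset.sum_mul]
        refine Finset.sum_congr rfl fun l _ => ?_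
        rw [← coeff_mul, ← coeff_mul_C]
        congr 1
        ring

/-- Differentiating the function rᵀψ along `v` is applying the transpose of the lifted matrix of `v`
to the row `r`. -/
theorem finsum_monoRate_mul {v : Fin n → MvPowerSeries (Fin n) ℝ}
    (hv : ∀ l, constantCoeff (v l) = 0) (r : Idx n → ℝ) (β : Fin n →₀ ℕ) :
    ∑ᶠ γ : Idx n, coeff β (monoRate v γ.1) * r γ = coeff β (lie v (rowSeries r)) := by
  rw [coeff_lie_eq_sum v _ β le_rfl]
  refine finsum_idx_eq_sum ?_ (fun α => by rw [coeff_rowSeries]) fun α hα => ?_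
  · simp [monoRate_zero]
  · rw [mem_degreeLE]
    by_contra h
    exact hα (by rw [coeff_monoRate_eq_zero hv (by omega), zero_mul])

end Rows

end
end Carleman

open scoped ENNReal NNReal
namespace Carleman
noncomputable section
open MvPowerSeries
open Finsupp (sumElim)

/-! ### Infinite matrices as series in two groups of variables. -/

section BiSeries

variable {n : ℕ}

/-- The series `ψ(x)ᵀ P ψ(y)` in two sets of variables. -/
def biSeries (P : Matrix (Idx n) (Idx n) ℝ) : MvPowerSeries (Fin n ⊕ Fin n) ℝ := fun e =>
  coeff (Finsupp.sumFinsuppEquivProdFinsupp e).1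
    (rowSeries fun α => coeff (Finsupp.sumFinsuppEquivProdFinsupp e).2 (rowSeries (P α)))

theorem coeff_biSeries_eq (P : Matrix (Idx n) (Idx n) ℝ) (α β : Fin n →₀ ℕ) :
    coeff (sumElim α β) (biSeries P) =
      coeff α (rowSeries fun a => coeff β (rowSeries (P a))) := by
  have h : Finsupp.sumFinsuppEquivProdFinsupp (sumElim α β : Fin n ⊕ Fin n →₀ ℕ) = (α, β) :=
    Prod.ext (by ext; rfl) (by ext; rfl)
  show coeff (Finsupp.sumFinsuppEquivProdFinsupp (sumElim α β)).1 (rowSeries fun a =>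
    coeff (Finsupp.sumFinsuppEquivProdFinsupp (sumElim α β)).2 (rowSeries (P a))) = _
  rw [h]

theorem coeff_biSeries (P : Matrix (Idx n) (Idx n) ℝ) (α β : Idx n) :
    coeff (sumElim α.1 β.1) (biSeries P) = P α β := by
  rw [coeff_biSeries_eq, coeff_rowSeries, coeff_rowSeries]

theorem coeff_biSeries_zero_left (P : Matrix (Idx n) (Idx n) ℝ) (β : Fin n →₀ ℕ) :
    coeff (sumElim 0 β) (biSeries P) = 0 := by
  rw [coeff_biSeries_eq, coeff_zero_eq_constantCoeff_apply]
  exact constantCoeff_rowSeries _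

theorem coeff_biSeries_zero_right (P : Matrix (Idx n) (Idx n) ℝ) (α : Fin n →₀ ℕ) :
    coeff (sumElim α 0) (biSeries P) = 0 := by
  by_cases hα : α = 0
  · subst hα
    exact coeff_biSeries_zero_left P 0
  · rw [coeff_biSeries_eq, coeff_rowSeries (α := ⟨α, hα⟩), coeff_zero_eq_constantCoeff_apply]
    exact constantCoeff_rowSeries _

theorem constantCoeff_biSeries (P : Matrix (Idx n) (Idx n) ℝ) :
    constantCoeff (biSeries P) = 0 := by
  rw [← coeff_zero_eq_constantCoeff_apply, ← Finsupp.sumElim_zero_zero]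
  exact coeff_biSeries_zero_left P 0

theorem biSeries_injective : Function.Injective (biSeries (n := n)) := fun P P' h => by
  ext α β
  rw [← coeff_biSeries P, h, coeff_biSeries]

/-- Two series in two sets of variables agree if their coefficients do. -/
theorem ext_sumElim {R : Type*} [CommRing R] {σ : Type*} {W W' : MvPowerSeries (σ ⊕ σ) R}
    (h : ∀ α β : σ →₀ ℕ, coeff (sumElim α β) W = coeff (sumElim α β) W') : W = W' := by
  ext e
  obtain ⟨α, β, rfl⟩ := exists_sumElim e
  exact h α β

theorem biSeries_sub (P P' : Matrix (Idx n) (Idx n) ℝ) :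
    biSeries (P - P') = biSeries P - biSeries P' := by
  refine ext_sumElim fun α β => ?_
  rw [map_sub]
  by_cases hα : α = 0
  · subst hα
    simp [coeff_biSeries_zero_left]
  by_cases hβ : β = 0
  · subst hβ
    simp [coeff_biSeries_zero_right]
  · rw [coeff_biSeries _ ⟨α, hα⟩ ⟨β, hβ⟩, coeff_biSeries _ ⟨α, hα⟩ ⟨β, hβ⟩,
      coeff_biSeries _ ⟨α, hα⟩ ⟨β, hβ⟩, Matrix.sub_apply]

theorem sliceRight_biSeries (P : Matrix (Idx n) (Idx n) ℝ) (β : Idx n) :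
    sliceRight β.1 (biSeries P) = rowSeries fun α => P α β :=
  eq_of_coeff_idx (by
      rw [← coeff_zero_eq_constantCoeff_apply, coeff_sliceRight, coeff_biSeries_zero_left])
    (constantCoeff_rowSeries _) fun α => by
      rw [coeff_sliceRight, coeff_biSeries, coeff_rowSeries]

theorem sliceLeft_biSeries (P : Matrix (Idx n) (Idx n) ℝ) (α : Idx n) :
    sliceLeft α.1 (biSeries P) = rowSeries (P α) :=
  eq_of_coeff_idx (by
      rw [← coeff_zero_eq_constantCoeff_apply, coeff_sliceLeft, coeff_biSeries_zero_right])
    (constantCoeff_rowSeries _) fun β => by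
      rw [coeff_sliceLeft, coeff_biSeries, coeff_rowSeries]

/-- Collecting the entries with α + β = γ is setting y = x. -/
theorem rowSeries_vectorize (P : Matrix (Idx n) (Idx n) ℝ) :
    rowSeries (vectorize P) = diagHom (biSeries P) := by
  refine eq_of_coeff_idx (constantCoeff_rowSeries _)
    (constantCoeff_csub _ (constantCoeff_biSeries P)) fun γ => ?_
  rw [coeff_rowSeries, coeff_diagHom, vectorize]
  refine Finset.sum_congr rfl fun x _ => ?_
  split_ifs with h
  · exact (coeff_biSeries P ⟨x.1, h.1⟩ ⟨x.2, h.2⟩).symm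
  · rw [not_and_or, not_not, not_not] at h
    rcases h with h | h
    · rw [h, coeff_biSeries_zero_left]
    · rw [h, coeff_biSeries_zero_right]

end BiSeries

section Norms

variable {n k : ℕ}

theorem pnorm_biSeries (r : ℝ≥0) (P : Matrix (Idx n) (Idx n) ℝ) : pnorm r (biSeries P) =
    ∑' p : Idx n × Idx n, ((‖P p.1 p.2‖₊ * r ^ (p.1.1.degree + p.2.1.degree) : ℝ≥0) : ℝ≥0∞) := by
  have hinj : Function.Injective fun p : Idx n × Idx n =>
      (sumElim p.1.1 p.2.1 : Fin n ⊕ Fin n →₀ ℕ) := fun p q h => by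
    have := sumElim_inj.1 h
    exact Prod.ext (Subtype.ext this.1) (Subtype.ext this.2)
  rw [pnorm, wnorm, ← hinj.tsum_eq]
  · refine tsum_congr fun p => ?_
    rw [coeff_biSeries, radial, degree_sumElim, enorm_eq_nnnorm, mul_comm]
    push_cast
    rfl
  · intro e he
    obtain ⟨α, β, rfl⟩ := exists_sumElim e
    have hα : α ≠ 0 := by
      rintro rfl
      simp [coeff_biSeries_zero_left] at he
    have hβ : β ≠ 0 := by
      rintro rfl
      simp [coeff_biSeries_zero_right] at he
    exact ⟨(⟨α, hα⟩, ⟨β, hβ⟩), rfl⟩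

theorem matSummable_iff (r : ℝ≥0) (P : Matrix (Idx n) (Idx n) ℝ) :
    MatSummable r P ↔ pnorm r (biSeries P) < ⊤ := by
  rw [pnorm_biSeries, lt_top_iff_ne_top, ENNReal.tsum_coe_ne_top_iff_summable_coe, MatSummable]
  simp

theorem matNorm_eq (r : ℝ≥0) (P : Matrix (Idx n) (Idx n) ℝ) :
    matNorm r P = (pnorm r (biSeries P)).toReal := by
  rw [pnorm_biSeries, ENNReal.tsum_toReal_eq (fun _ => ENNReal.coe_ne_top), matNorm]
  simp

theorem pnorm_rowSeries (r : ℝ≥0) (v : Idx n → ℝ) : pnorm r (rowSeries v) =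
    ∑' γ : Idx n, ((‖v γ‖₊ * r ^ γ.1.degree : ℝ≥0) : ℝ≥0∞) := by
  rw [pnorm, wnorm, ← (Subtype.val_injective (p := fun α : Fin n →₀ ℕ => α ≠ 0)).tsum_eq]
  · refine tsum_congr fun γ => ?_
    rw [coeff_rowSeries, radial, enorm_eq_nnnorm, mul_comm]
    push_cast
    rfl
  · intro α hα
    have h : α ≠ 0 := by
      rintro rfl
      rw [Function.mem_support, coeff_zero_eq_constantCoeff_apply, constantCoeff_rowSeries] at hα
      simp at hα
    exact ⟨⟨α, h⟩, rfl⟩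

theorem vecSummable_iff (r : ℝ≥0) (v : Idx n → ℝ) :
    VecSummable r v ↔ pnorm r (rowSeries v) < ⊤ := by
  rw [pnorm_rowSeries, lt_top_iff_ne_top, ENNReal.tsum_coe_ne_top_iff_summable_coe, VecSummable]
  simp

theorem vecNorm_eq (r : ℝ≥0) (v : Idx n → ℝ) :
    vecNorm r v = (pnorm r (rowSeries v)).toReal := by
  rw [pnorm_rowSeries, ENNReal.tsum_toReal_eq (fun _ => ENNReal.coe_ne_top), vecNorm]
  simp

theorem gainConverges_iff (K : Matrix (Fin k) (Idx n) ℝ) :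
    GainConverges K ↔ ∃ r : ℝ≥0, 0 < r ∧ ∀ j, pnorm r (rowSeries (K j)) < ⊤ := by
  constructor
  · rintro ⟨r, hr, h⟩
    lift r to ℝ≥0 using hr.le
    exact ⟨r, hr, fun j => (vecSummable_iff r (K j)).1 (h j)⟩
  · rintro ⟨r, hr, h⟩
    exact ⟨r, hr, fun j => (vecSummable_iff r (K j)).2 (h j)⟩

end Norms

/-! ### The cost equation and the gain as identities of power series. -/

namespace System

variable {n k : ℕ} (S : System n k)

/-- The series of the closed-loop vector field under the feedback `u = -κ(x)`. -/
def field (κ : Fin k → MvPowerSeries (Fin n) ℝ) (l : Fin n) : MvPowerSeries (Fin n) ℝ :=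
  S.fSeries l - ∑ j, S.gSeries l j * κ j

/-- The series of the components of `K ψ`. -/
def gainSeries (K : Matrix (Fin k) (Idx n) ℝ) (j : Fin k) : MvPowerSeries (Fin n) ℝ :=
  rowSeries (K j)

theorem constantCoeff_fSeries (l : Fin n) : constantCoeff (S.fSeries l) = 0 := by
  have h := S.hasSum_f.self_of_nhds l
  rw [S.f_zero] at h
  have h2 := hasSum_single (f := fun α => coeff α (S.fSeries l) * mono (0 : Fin n → ℝ) α) 0
    (fun α hα => by
      obtain ⟨i, hi⟩ := Finsupp.ne_iff.1 hα
      have : mono (0 : Fin n → ℝ) α = 0 :=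
        Finset.prod_eq_zero (Finset.mem_univ i) (by simpa using hi)
      rw [this, mul_zero])
  have h3 := h.unique h2
  simpa [mono] using h3.symm

theorem constantCoeff_field {κ : Fin k → MvPowerSeries (Fin n) ℝ}
    (hκ : ∀ j, constantCoeff (κ j) = 0) (l : Fin n) : constantCoeff (S.field κ l) = 0 := by
  simp [field, S.constantCoeff_fSeries, hκ]

theorem constantCoeff_gainSeries (K : Matrix (Fin k) (Idx n) ℝ) (j : Fin k) :
    constantCoeff (gainSeries K j) = 0 := constantCoeff_rowSeries _

theorem inputSeries_eq (α : Idx n) (j : Fin k) :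
    S.inputSeries α j = monoRate (fun l => S.gSeries l j) α.1 := by
  ext β
  by_cases hβ : β = 0
  · subst hβ
    rw [inputSeries, map_add, coeff_zero_eq_constantCoeff_apply (rowSeries _),
      constantCoeff_rowSeries]
    simp [inputConst]
  · rw [inputSeries, map_add, coeff_rowSeries (α := ⟨β, hβ⟩), coeff_C, if_neg hβ]
    simp [inputMatrix]

/-- The rate of change of a monomial is linear in the field over the ring of power series, so drift
and feedback combine to the closed-loop field. -/
theorem closedLoop_eq (K : Matrix (Fin k) (Idx n) ℝ) (α β : Idx n) :
    S.closedLoop K α β = coeff β.1 (monoRate (S.field (gainSeries K)) α.1) := by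
  have h : monoRate (S.field (gainSeries K)) α.1 = monoRate S.fSeries α.1 -
      ∑ j, monoRate (fun l => S.gSeries l j) α.1 * gainSeries K j := by
    simp only [monoRate, field, mul_sub, Finset.sum_sub_distrib, Finset.sum_mul, Finset.mul_sum]
    congr 1
    rw [Finset.sum_comm]
    exact Finset.sum_congr rfl fun _ _ => Finset.sum_congr rfl fun _ _ => by ring
  rw [h, map_sub, map_sum, closedLoop]
  simp only [inputSeries_eq]
  rfl

/-- The series `xᵀ Q₁ y + κ(x)ᵀ R κ(y)`. -/
def costSeries (Q₁ : Matrix (Fin n) (Fin n) ℝ) (R : Matrix (Fin k) (Fin k) ℝ)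
    (κ : Fin k → MvPowerSeries (Fin n) ℝ) : MvPowerSeries (Fin n ⊕ Fin n) ℝ :=
  ∑ l, ∑ m, C (Q₁ l m) * (inlHom (X l) * inrHom (X m)) +
    ∑ i, ∑ j, C (R i j) * (inlHom (κ i) * inrHom (κ j))

theorem coeff_costSeries (Q₁ : Matrix (Fin n) (Fin n) ℝ) (R : Matrix (Fin k) (Fin k) ℝ)
    (K : Matrix (Fin k) (Idx n) ℝ) (α β : Idx n) :
    coeff (sumElim α.1 β.1) (costSeries Q₁ R (gainSeries K)) =
      liftWeight Q₁ α β + (K.transpose * R * K) α β := by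
  simp only [costSeries, map_add, map_sum, coeff_C_mul, coeff_inlHom_mul_inrHom, gainSeries,
    coeff_rowSeries]
  congr 1
  · simp only [liftWeight, coeff_X]
    refine Finset.sum_congr rfl fun i _ => Finset.sum_congr rfl fun j _ => ?_
    split_ifs <;> simp_all
  · simp only [Matrix.mul_apply, Matrix.transpose_apply, Finset.sum_mul]
    rw [Finset.sum_comm]
    exact Finset.sum_congr rfl fun i _ => Finset.sum_congr rfl fun j _ => by ring

theorem coeff_costSeries_of_eq_zero (Q₁ : Matrix (Fin n) (Fin n) ℝ)
    (R : Matrix (Fin k) (Fin k) ℝ) {κ : Fin k → MvPowerSeries (Fin n) ℝ}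
    (hκ : ∀ j, constantCoeff (κ j) = 0) {α β : Fin n →₀ ℕ} (h : α = 0 ∨ β = 0) :
    coeff (sumElim α β) (costSeries Q₁ R κ) = 0 := by
  simp only [costSeries, map_add, map_sum, coeff_C_mul, coeff_inlHom_mul_inrHom]
  rcases h with rfl | rfl <;> simp [hκ]

/-- The equation of a cost matrix, as an identity of power series. -/
theorem costEquation_iff (Q₁ : Matrix (Fin n) (Fin n) ℝ) (R : Matrix (Fin k) (Fin k) ℝ)
    (K : Matrix (Fin k) (Idx n) ℝ) (P : Matrix (Idx n) (Idx n) ℝ) :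
    (∀ α β : Idx n, (∑ᶠ γ, S.closedLoop K γ α * P γ β) + (∑ᶠ γ, P α γ * S.closedLoop K γ β) =
      -(liftWeight Q₁ α β + (K.transpose * R * K) α β)) ↔
    lie (double (S.field (gainSeries K))) (biSeries P) = -costSeries Q₁ R (gainSeries K) := by
  have h0 := S.constantCoeff_field (κ := gainSeries K) (constantCoeff_gainSeries K)
  have h1 : ∀ α β : Idx n, ∑ᶠ γ, S.closedLoop K γ α * P γ β =
      coeff α.1 (lie (S.field (gainSeries K)) (sliceRight β.1 (biSeries P))) := fun α β => by
    simp only [closedLoop_eq]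
    rw [sliceRight_biSeries, finsum_monoRate_mul h0 (fun γ => P γ β) α.1]
  have h2 : ∀ α β : Idx n, ∑ᶠ γ, P α γ * S.closedLoop K γ β =
      coeff β.1 (lie (S.field (gainSeries K)) (sliceLeft α.1 (biSeries P))) := fun α β => by
    simp only [closedLoop_eq]
    rw [sliceLeft_biSeries, ← finsum_monoRate_mul h0 (P α) β.1]
    exact finsum_congr fun γ => mul_comm _ _
  constructor
  · intro h
    refine ext_sumElim fun α β => ?_
    rw [coeff_lie_double, map_neg]
    -- The matrix equation says nothing about zero multi-indices, but there both sides of the series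
    -- identity vanish.
    by_cases hα : α = 0
    · subst hα
      rw [coeff_costSeries_of_eq_zero Q₁ R (constantCoeff_gainSeries K) (Or.inl rfl),
        coeff_zero_eq_constantCoeff_apply, constantCoeff_lie h0]
      have : sliceLeft 0 (biSeries P) = 0 := by
        ext b
        rw [coeff_sliceLeft, coeff_biSeries_zero_left, map_zero]
      simp [this, lie]
    by_cases hβ : β = 0
    · subst hβ
      rw [coeff_costSeries_of_eq_zero Q₁ R (constantCoeff_gainSeries K) (Or.inr rfl),
        coeff_zero_eq_constantCoeff_apply, constantCoeff_lie h0]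
      have : sliceRight 0 (biSeries P) = 0 := by
        ext b
        rw [coeff_sliceRight, coeff_biSeries_zero_right, map_zero]
      simp [this, lie]
    have := h ⟨α, hα⟩ ⟨β, hβ⟩
    rw [h1, h2] at this
    rw [this, coeff_costSeries Q₁ R K ⟨α, hα⟩ ⟨β, hβ⟩]
  · intro h α β
    rw [h1, h2, ← coeff_lie_double, h, map_neg, coeff_costSeries]

/-- A solution of the linear equation yields a solution in matrix form. -/
theorem costEquation_of_lie_eq {Q₁ : Matrix (Fin n) (Fin n) ℝ} {R : Matrix (Fin k) (Fin k) ℝ}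
    {K : Matrix (Fin k) (Idx n) ℝ} {W : MvPowerSeries (Fin n ⊕ Fin n) ℝ}
    (h : lie (double (S.field (gainSeries K))) W = -costSeries Q₁ R (gainSeries K)) :
    lie (double (S.field (gainSeries K)))
      (biSeries (Matrix.of fun α β => coeff (sumElim α.1 β.1) W)) = -costSeries Q₁ R (gainSeries K) := by
  refine (S.costEquation_iff Q₁ R K _).1 fun α β => ?_
  simp only [Matrix.of_apply]
  have h0 := S.constantCoeff_field (κ := gainSeries K) (constantCoeff_gainSeries K)
  -- Derivatives do not see constant terms, so the coefficients of `W` with a zero index, which the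
  -- matrix forgets, do not enter the remaining equations.
  have hlie : ∀ p q : MvPowerSeries (Fin n) ℝ, (∀ γ : Idx n, coeff γ.1 p = coeff γ.1 q) →
      lie (S.field (gainSeries K)) p = lie (S.field (gainSeries K)) q := by
    intro p q hpq
    simp only [lie]
    refine Finset.sum_congr rfl fun l _ => ?_
    congr 1
    ext γ
    rw [coeff_pderiv, coeff_pderiv, hpq ⟨γ + Finsupp.single l 1, by simp⟩]
  have e1 : ∑ᶠ γ, S.closedLoop K γ α * coeff (sumElim γ.1 β.1) W =
      coeff α.1 (lie (S.field (gainSeries K)) (sliceRight β.1 W)) := by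
    simp only [closedLoop_eq]
    rw [finsum_monoRate_mul h0 (fun γ => coeff (sumElim γ.1 β.1) W) α.1]
    rw [hlie (rowSeries _) (sliceRight β.1 W) fun γ => by rw [coeff_rowSeries, coeff_sliceRight]]
  have e2 : ∑ᶠ γ : Idx n, coeff (sumElim α.1 γ.1) W * S.closedLoop K γ β =
      coeff β.1 (lie (S.field (gainSeries K)) (sliceLeft α.1 W)) := by
    simp only [closedLoop_eq]
    rw [← hlie (rowSeries fun γ : Idx n => coeff (sumElim α.1 γ.1) W) (sliceLeft α.1 W)
      fun γ => by rw [coeff_rowSeries, coeff_sliceLeft],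
      ← finsum_monoRate_mul h0 (fun γ => coeff (sumElim α.1 γ.1) W) β.1]
    exact finsum_congr fun γ => mul_comm _ _
  rw [e1, e2, ← coeff_lie_double, h, map_neg, coeff_costSeries]

/-- The gain of `P`, as an identity of power series. -/
theorem gainSeries_gain (R : Matrix (Fin k) (Fin k) ℝ) (P : Matrix (Idx n) (Idx n) ℝ)
    (i : Fin k) : gainSeries (S.gain R P) i = ∑ j, C (R⁻¹ i j) *
      ∑ l, S.gSeries l j * diagHom (pderiv ℝ (Sum.inl l) (biSeries P)) := by
  classical
  -- The sum over α of D(x^α) times the series of (Pψ)_α is the gradient of W(x,y) in x, taken at y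
  -- = x.
  have hD : ∀ l v, ∀ d, v.degree + 1 ≤ d →
      coeff v (diagHom (pderiv ℝ (Sum.inl l) (biSeries P))) = ∑ α ∈ degreeLE n d,
        coeff v (monomial (α - Finsupp.single l 1) (α l : ℝ) * sliceLeft α (biSeries P)) := by
    intro l v d hd
    rw [sum_coeff_monomial_mul _ l v hd, coeff_diagHom]
    refine Finset.sum_congr rfl fun x _ => ?_
    rw [coeff_pderiv, coeff_sliceLeft, ← Finsupp.sumElim_single_zero, ← Finsupp.sumElim_add,
      add_zero, mul_comm]
    rfl
  have hkey : ∀ (j : Fin k) (γ : Idx n),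
      ∑ᶠ α : Idx n, coeff γ.1 (S.inputSeries α j * rowSeries (P α)) =
        coeff γ.1 (∑ l, S.gSeries l j * diagHom (pderiv ℝ (Sum.inl l) (biSeries P))) := by
    intro j γ
    rw [finsum_idx_eq_sum (s := degreeLE n (γ.1.degree + 1)) (g := fun α =>
      coeff γ.1 (monoRate (fun l => S.gSeries l j) α * sliceLeft α (biSeries P)))]
    · simp only [map_sum, coeff_mul γ.1 (S.gSeries _ j)]
      calc _ = ∑ α ∈ degreeLE n (γ.1.degree + 1), ∑ l, coeff γ.1 (S.gSeries l j *
            (monomial (α - Finsupp.single l 1) (α l : ℝ) * sliceLeft α (biSeries P))) := by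
            refine Finset.sum_congr rfl fun α _ => ?_
            rw [monoRate, Finset.sum_mul, map_sum]
            refine Finset.sum_congr rfl fun l _ => ?_
            congr 1
            ring
        _ = _ := by
            rw [Finset.sum_comm]
            refine Finset.sum_congr rfl fun l _ => ?_
            simp only [coeff_mul γ.1 (S.gSeries _ j)]
            rw [Finset.sum_comm]
            refine Finset.sum_congr rfl fun x hx => ?_
            have hx := congrArg Finsupp.degree (Finset.HasAntidiagonal.mem_antidiagonal.1 hx)
            rw [map_add] at hx
            rw [hD l x.2 (γ.1.degree + 1) (by omega), Finset.mul_sum]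
    · simp [monoRate_zero]
    · intro α
      rw [inputSeries_eq, sliceLeft_biSeries]
    -- D(x^α) consists of monomials of degree |α| - 1, so only α with |α| ≤ |γ| + 1 can contribute
    -- to the coefficient of γ.
    · intro α hα
      rw [mem_degreeLE]
      by_contra hlt
      apply hα
      rw [monoRate, Finset.sum_mul, map_sum]
      refine Finset.sum_eq_zero fun l _ => ?_
      rw [mul_assoc, coeff_monomial_mul]
      split_ifs with h1
      · exfalso
        have h2 := congrArg Finsupp.degree (add_tsub_cancel_of_le h1)
        have h3 := Finsupp.degree_mono (le_tsub_add (a := Finsupp.single l 1) (b := α))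
        rw [map_add] at h2
        rw [map_add, Finsupp.degree_single] at h3
        omega
      · rfl
  refine eq_of_coeff_idx (constantCoeff_rowSeries _) ?_ fun γ => ?_
  · have : ∀ l, constantCoeff (diagHom (pderiv ℝ (Sum.inl l) (biSeries P))) = 0 := fun l => by
      refine constantCoeff_csub _ ?_
      rw [← coeff_zero_eq_constantCoeff_apply, coeff_pderiv, zero_add,
        ← Finsupp.sumElim_single_zero, coeff_biSeries_zero_right, zero_mul]
    simp [this]
  · rw [gainSeries, coeff_rowSeries, gain, Matrix.mul_apply, map_sum]
    refine Finset.sum_congr rfl fun j _ => ?_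
    rw [coeff_C_mul, Matrix.of_apply, hkey]

end System

end
end Carleman

open scoped ENNReal NNReal
namespace Carleman
noncomputable section
open Matrix Filter Topology

/-! ### Quadratic Lyapunov functions and Hurwitz matrices. -/

section Lyapunov

variable {σ τ : Type*} [Fintype σ] [Fintype τ]

theorem dotProduct_mulVec_comm_of_isSymm {X : Matrix σ σ ℝ} (hX : X.IsSymm) (x y : σ → ℝ) :
    x ⬝ᵥ X *ᵥ y = y ⬝ᵥ X *ᵥ x := by
  rw [dotProduct_mulVec, ← mulVec_transpose, hX.eq, dotProduct_comm]

theorem continuous_dotProduct_mulVec (X : Matrix σ τ ℝ) :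
    Continuous fun p : (σ → ℝ) × (τ → ℝ) => p.1 ⬝ᵥ X *ᵥ p.2 := by
  simp only [dotProduct, mulVec]
  fun_prop

/-- An isotropic vector of a positive semidefinite form lies in its radical. -/
theorem dotProduct_mulVec_eq_zero {X : Matrix σ σ ℝ} (hX : X.IsSymm)
    (h : ∀ x, 0 ≤ x ⬝ᵥ X *ᵥ x) {v : σ → ℝ} (hv : v ⬝ᵥ X *ᵥ v = 0) (z : σ → ℝ) :
    v ⬝ᵥ X *ᵥ z = 0 := by
  have key : ∀ t : ℝ, 0 ≤ 2 * t * (v ⬝ᵥ X *ᵥ z) + t ^ 2 * (z ⬝ᵥ X *ᵥ z) := fun t => by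
    have h1 := h (v + t • z)
    simp only [mulVec_add, mulVec_smul, dotProduct_add, add_dotProduct, dotProduct_smul,
      smul_dotProduct, smul_eq_mul, hv, dotProduct_mulVec_comm_of_isSymm hX z v] at h1
    linarith
  set a := v ⬝ᵥ X *ᵥ z
  set b := z ⬝ᵥ X *ᵥ z
  have hb : 0 ≤ b := h z
  by_contra ha
  -- This value of t makes 2ta + t²b negative unless a = 0; the denominator b + 1 also covers the
  -- case b = 0.
  have h1 := key (-a / (b + 1))
  have h2 : 2 * (-a / (b + 1)) * a + (-a / (b + 1)) ^ 2 * b =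
      -(a ^ 2 * (b + 2)) / (b + 1) ^ 2 := by
    field_simp
    ring
  rw [h2] at h1
  have h3 : 0 < a ^ 2 * (b + 2) / (b + 1) ^ 2 := by positivity
  rw [neg_div] at h1
  linarith

theorem posDef_dotProduct_nonneg {R : Matrix τ τ ℝ} (hR : R.PosDef) (x : τ → ℝ) :
    0 ≤ x ⬝ᵥ R *ᵥ x := hR.posSemidef.dotProduct_mulVec_nonneg x

theorem posDef_dotProduct_pos {R : Matrix τ τ ℝ} (hR : R.PosDef) {x : τ → ℝ} (hx : x ≠ 0) :
    0 < x ⬝ᵥ R *ᵥ x := hR.dotProduct_mulVec_pos hx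

variable [DecidableEq σ]

/-- A Hurwitz matrix has a quadratic Lyapunov function. -/
theorem Hurwitz.exists_lyapunov {A : Matrix σ σ ℝ} (hA : Hurwitz A) : ∃ X : Matrix σ σ ℝ,
    X.IsSymm ∧ (∀ x, x ≠ 0 → 0 < x ⬝ᵥ X *ᵥ x) ∧ ∀ x, x ≠ 0 → x ⬝ᵥ X *ᵥ (A *ᵥ x) < 0 := by
  obtain ⟨μ, hμ, hre⟩ := hA.exists_re_le
  have hμ' : (0 : ℝ) < μ := hμ
  set Ac : Matrix σ σ ℂ := A.map (algebraMap ℝ ℂ) with hAc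
  set N : ℝ := Fintype.card σ + 1 with hN
  have hN0 : 0 < N := by positivity
  -- The Lyapunov function is the squared Euclidean norm of T'x in nearly diagonal coordinates. The
  -- diagonal contributes at most -μ|y|², and with the tolerance μ/2/N the off-diagonal entries
  -- contribute at most (μ/2)|y|².
  obtain ⟨T, T', hTT', hT'T, hoff, hdiag⟩ :=
    exists_matrix_near_diagonal Ac (ε := μ / 2 / N) (by positivity)
  set D := T' * Ac * T with hD
  set Y : (σ → ℝ) → σ → ℂ := fun x => T' *ᵥ fun i => (x i : ℂ) with hY
  have hform : ∀ x z, x ⬝ᵥ (Matrix.of fun l m => ∑ s, (star (T' s l) * T' s m).re) *ᵥ z =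
      ∑ s, (star (Y x s) * Y z s).re := by
    intro x z
    simp only [hY, mulVec, dotProduct, Matrix.of_apply, star_sum, Finset.sum_mul, Finset.mul_sum,
      Complex.re_sum]
    rw [Finset.sum_comm' (t' := Finset.univ) (s' := fun _ => Finset.univ) (by simp)]
    conv_rhs => rw [Finset.sum_comm]
    refine Finset.sum_congr rfl fun m _ => ?_
    rw [Finset.sum_comm]
    refine Finset.sum_congr rfl fun s _ => Finset.sum_congr rfl fun l _ => ?_
    simp
    ring
  have hYA : ∀ x, Y (A *ᵥ x) = D *ᵥ Y x := by
    intro x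
    have h1 : (fun i => ((A *ᵥ x) i : ℂ)) = Ac *ᵥ fun i => (x i : ℂ) := by
      ext i
      simp [mulVec, dotProduct, hAc]
    rw [hY]
    simp only [h1, hD, mulVec_mulVec]
    rw [Matrix.mul_assoc, Matrix.mul_assoc, hTT', Matrix.mul_one]
  have hYpos : ∀ x, x ≠ 0 → 0 < ∑ s, ‖Y x s‖ ^ 2 := by
    intro x hx
    refine lt_of_le_of_ne (by positivity) fun h0 => hx ?_
    have h1 : Y x = 0 := by
      ext s
      have := (Finset.sum_eq_zero_iff_of_nonneg fun s _ => by positivity).1 h0.symm s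
        (Finset.mem_univ s)
      simpa using this
    have h2 : (fun i => (x i : ℂ)) = T *ᵥ Y x := by
      rw [hY]
      simp only [mulVec_mulVec, hTT', one_mulVec]
    ext i
    have := congrFun h2 i
    rw [h1] at this
    simpa using this
  refine ⟨Matrix.of fun l m => ∑ s, (star (T' s l) * T' s m).re, ?_, fun x hx => ?_,
    fun x hx => ?_⟩
  · ext l m
    simp only [transpose_apply, Matrix.of_apply]
    refine Finset.sum_congr rfl fun s _ => ?_
    simp
    ring
  · rw [hform]
    convert hYpos x hx using 2 with s
    have : star (Y x s) * Y x s = ((‖Y x s‖ ^ 2 : ℝ) : ℂ) := by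
      rw [Complex.star_def, Complex.conj_mul']
      push_cast
      rfl
    rw [this, Complex.ofReal_re]
  · rw [hform, hYA]
    set y := Y x with hy
    have hpos := hYpos x hx
    have h1 : ∀ s, (star (y s) * (D *ᵥ y) s).re ≤
        -μ * ‖y s‖ ^ 2 + μ / 2 / N * ∑ t, ‖y s‖ * ‖y t‖ := by
      intro s
      have e1 : (D *ᵥ y) s = D s s * y s + ∑ t ∈ Finset.univ.erase s, D s t * y t := by
        rw [mulVec, dotProduct, ← Finset.add_sum_erase _ _ (Finset.mem_univ s)]
      have e2 : (star (y s) * (D s s * y s)).re = (D s s).re * ‖y s‖ ^ 2 := by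
        have : star (y s) * (D s s * y s) = D s s * ((‖y s‖ ^ 2 : ℝ) : ℂ) := by
          push_cast
          rw [← Complex.conj_mul', Complex.star_def]
          ring
        rw [this, Complex.re_mul_ofReal]
      have e3 : (star (y s) * ∑ t ∈ Finset.univ.erase s, D s t * y t).re ≤
          μ / 2 / N * ∑ t, ‖y s‖ * ‖y t‖ := by
        refine (Complex.re_le_norm _).trans ?_
        rw [norm_mul, norm_star, Finset.mul_sum]
        calc ‖y s‖ * ‖∑ t ∈ Finset.univ.erase s, D s t * y t‖
            ≤ ‖y s‖ * ∑ t ∈ Finset.univ.erase s, μ / 2 / N * ‖y t‖ := by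
              gcongr
              refine (norm_sum_le _ _).trans (Finset.sum_le_sum fun t ht => ?_)
              rw [norm_mul]
              gcongr
              exact hoff s t (Finset.ne_of_mem_erase ht).symm
          _ ≤ ‖y s‖ * ∑ t, μ / 2 / N * ‖y t‖ := by
              gcongr
              exact Finset.subset_univ _
          _ = _ := by
              rw [Finset.mul_sum]
              exact Finset.sum_congr rfl fun t _ => by ring
      rw [e1, mul_add, Complex.add_re, e2]
      have := mul_le_mul_of_nonneg_right (hre _ (hdiag s)) (sq_nonneg ‖y s‖)
      linarith
    refine (Finset.sum_le_sum fun s _ => h1 s).trans_lt ?_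
    rw [Finset.sum_add_distrib, ← Finset.mul_sum, ← Finset.mul_sum]
    have h2 : ∑ s, ∑ t, ‖y s‖ * ‖y t‖ ≤ Fintype.card σ * ∑ s, ‖y s‖ ^ 2 := by
      rw [← Finset.sum_mul_sum, ← sq]
      simpa using sq_sum_le_card_mul_sum_sq (s := Finset.univ) (f := fun s => ‖y s‖)
    have h3 : (μ : ℝ) / 2 / N * ∑ s, ∑ t, ‖y s‖ * ‖y t‖ ≤ μ / 2 * ∑ s, ‖y s‖ ^ 2 := by
      calc _ ≤ (μ : ℝ) / 2 / N * (Fintype.card σ * ∑ s, ‖y s‖ ^ 2) := by gcongr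
        _ ≤ (μ : ℝ) / 2 / N * (N * ∑ s, ‖y s‖ ^ 2) := by
            gcongr
            linarith
        _ = _ := by field_simp
    nlinarith

/-- Solutions of the Lyapunov inequality of a Hurwitz matrix are positive semidefinite. -/
theorem Hurwitz.dotProduct_mulVec_nonneg {A X : Matrix σ σ ℝ} (hA : Hurwitz A) (hX : X.IsSymm)
    (h : ∀ x, x ⬝ᵥ X *ᵥ (A *ᵥ x) ≤ 0) (x : σ → ℝ) : 0 ≤ x ⬝ᵥ X *ᵥ x := by
  obtain ⟨X₀, hs, hp, hd⟩ := hA.exists_lyapunov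
  by_contra! hx
  have hx0 : x ≠ 0 := by
    rintro rfl
    simp at hx
  have hne : (Metric.sphere (0 : σ → ℝ) 1).Nonempty :=
    ⟨‖x‖⁻¹ • x, by simp [norm_smul, inv_mul_cancel₀ (norm_ne_zero_iff.2 hx0)]⟩
  have hsph : ∀ y ∈ Metric.sphere (0 : σ → ℝ) 1, y ≠ 0 := fun y hy h0 => by
    simp [h0] at hy
  have hc : ∀ Z : Matrix σ σ ℝ, Continuous fun y : σ → ℝ => y ⬝ᵥ Z *ᵥ y := fun Z =>
    (continuous_dotProduct_mulVec Z).comp (continuous_id.prodMk continuous_id)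
  -- At the minimizer `v` of the quotient, with minimum c, the form X - cX₀ is positive semidefinite
  -- and vanishes at `v`, so `v` lies in its radical. Hence v·XAv = c v·X₀Av, which is positive if c
  -- < 0, against the hypothesis. This replaces the integral formula for the solution of a Lyapunov
  -- equation.
  obtain ⟨v, hv, hmin⟩ := (isCompact_sphere (0 : σ → ℝ) 1).exists_isMinOn hne
    (f := fun y => (y ⬝ᵥ X *ᵥ y) / (y ⬝ᵥ X₀ *ᵥ y))
    ((hc X).continuousOn.div (hc X₀).continuousOn fun y hy => (hp y (hsph y hy)).ne')
  have hv0 := hsph v hv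
  set c := (v ⬝ᵥ X *ᵥ v) / (v ⬝ᵥ X₀ *ᵥ v) with hcdef
  have hle : ∀ y, c * (y ⬝ᵥ X₀ *ᵥ y) ≤ y ⬝ᵥ X *ᵥ y := by
    intro y
    by_cases hy : y = 0
    · simp [hy]
    have h1 : ‖y‖⁻¹ • y ∈ Metric.sphere (0 : σ → ℝ) 1 := by
      simp [norm_smul, inv_mul_cancel₀ (norm_ne_zero_iff.2 hy)]
    have h2 : c ≤ _ := hmin h1
    simp only [mulVec_smul, dotProduct_smul, smul_dotProduct, smul_eq_mul] at h2
    have hn : ‖y‖⁻¹ ≠ 0 := inv_ne_zero (norm_ne_zero_iff.2 hy)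
    rw [mul_div_mul_left _ _ hn, mul_div_mul_left _ _ hn] at h2
    rwa [le_div_iff₀ (hp y hy)] at h2
  have hc0 : c < 0 := by
    by_contra! h0
    have := hle x
    nlinarith [hp x hx0]
  have hform : ∀ y z, y ⬝ᵥ (X - c • X₀) *ᵥ z = y ⬝ᵥ X *ᵥ z - c * (y ⬝ᵥ X₀ *ᵥ z) := by
    intro y z
    rw [sub_mulVec, dotProduct_sub, smul_mulVec, dotProduct_smul, smul_eq_mul]
  have hY : (X - c • X₀).IsSymm := by
    rw [Matrix.IsSymm, transpose_sub, transpose_smul, hX.eq, hs.eq]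
  have h0 := dotProduct_mulVec_eq_zero hY (fun y => by rw [hform]; linarith [hle y]) (v := v)
    (by rw [hform, hcdef, div_mul_cancel₀ _ (hp v hv0).ne', sub_self]) (A *ᵥ v)
  rw [hform] at h0
  nlinarith [h v, hd v hv0]

/-- Solutions of the strict Lyapunov inequality of a Hurwitz matrix are positive definite. -/
theorem Hurwitz.dotProduct_mulVec_pos {A X : Matrix σ σ ℝ} (hA : Hurwitz A) (hX : X.IsSymm)
    (h : ∀ x, x ≠ 0 → x ⬝ᵥ X *ᵥ (A *ᵥ x) < 0) {x : σ → ℝ} (hx : x ≠ 0) : 0 < x ⬝ᵥ X *ᵥ x := by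
  have hp : ∀ y, 0 ≤ y ⬝ᵥ X *ᵥ y := hA.dotProduct_mulVec_nonneg hX fun y => by
    by_cases hy : y = 0
    · simp [hy]
    · exact (h y hy).le
  refine lt_of_le_of_ne (hp x) fun h0 => ?_
  linarith [dotProduct_mulVec_eq_zero hX hp h0.symm (A *ᵥ x), h x hx]

/-- A matrix with a quadratic Lyapunov function is Hurwitz. -/
theorem hurwitz_of_lyapunov {A X : Matrix σ σ ℝ} (hX : X.IsSymm) (hp : ∀ x, 0 ≤ x ⬝ᵥ X *ᵥ x)
    (hd : ∀ x, x ≠ 0 → x ⬝ᵥ X *ᵥ (A *ᵥ x) < 0) : Hurwitz A := by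
  intro μ hμ
  rw [← Matrix.spectrum_toLin', ← Module.End.hasEigenvalue_iff_mem_spectrum] at hμ
  obtain ⟨v, hv⟩ := hμ.exists_hasEigenvector
  have hAv : A.map (algebraMap ℝ ℂ) *ᵥ v = μ • v := by
    simpa using hv.apply_eq_smul
  -- For the real and imaginary parts of an eigenvector the cross terms cancel by symmetry of X, and
  -- the two derivatives add up to Re μ times a nonnegative number.
  set a : σ → ℝ := fun i => (v i).re with ha
  set b : σ → ℝ := fun i => (v i).im with hb
  have hA1 : A *ᵥ a = μ.re • a - μ.im • b := by
    ext i
    have := congrArg Complex.re (congrFun hAv i)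
    simpa [mulVec, dotProduct, ha, hb] using this
  have hA2 : A *ᵥ b = μ.im • a + μ.re • b := by
    ext i
    have := congrArg Complex.im (congrFun hAv i)
    simp [mulVec, dotProduct] at this
    simp [mulVec, dotProduct, ha, hb]
    linarith
  have hab : a ≠ 0 ∨ b ≠ 0 := by
    by_contra! h
    refine hv.2 ?_
    ext i
    exact Complex.ext (congrFun h.1 i) (congrFun h.2 i)
  have hle : ∀ x, x ⬝ᵥ X *ᵥ (A *ᵥ x) ≤ 0 := fun x => by
    by_cases hx : x = 0
    · simp [hx]
    · exact (hd x hx).le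
  have hsum : a ⬝ᵥ X *ᵥ (A *ᵥ a) + b ⬝ᵥ X *ᵥ (A *ᵥ b) =
      μ.re * (a ⬝ᵥ X *ᵥ a + b ⬝ᵥ X *ᵥ b) := by
    rw [hA1, hA2]
    simp only [mulVec_add, mulVec_sub, mulVec_smul, dotProduct_add, dotProduct_sub,
      dotProduct_smul, smul_eq_mul, dotProduct_mulVec_comm_of_isSymm hX b a]
    ring
  have hneg : a ⬝ᵥ X *ᵥ (A *ᵥ a) + b ⬝ᵥ X *ᵥ (A *ᵥ b) < 0 := by
    rcases hab with h | h
    · linarith [hd a h, hle b]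
    · linarith [hd b h, hle a]
  rw [hsum] at hneg
  by_contra! h
  nlinarith [hp a, hp b]

end Lyapunov

/-! ### Kleinman's iteration for the linearized problem. -/

section Kleinman

variable {σ τ : Type*} [Fintype σ] [Fintype τ] [DecidableEq τ]
  {A : Matrix σ σ ℝ} {B : Matrix σ τ ℝ} {Q : Matrix σ σ ℝ} {R : Matrix τ τ ℝ}

/-- Comparison of the decay of a cost form under its own gain and under the improved gain. -/
theorem lyapunov_improve (hR : R.PosDef) {X : Matrix σ σ ℝ} (hX : X.IsSymm)
    {K K' : Matrix τ σ ℝ} (hK' : K' = R⁻¹ * Bᵀ * X)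
    (h : ∀ x, 2 * (x ⬝ᵥ X *ᵥ ((A - B * K) *ᵥ x)) =
      -(x ⬝ᵥ Q *ᵥ x + (K *ᵥ x) ⬝ᵥ R *ᵥ (K *ᵥ x))) (x : σ → ℝ) :
    2 * (x ⬝ᵥ X *ᵥ ((A - B * K') *ᵥ x)) =
      -(x ⬝ᵥ Q *ᵥ x + (K' *ᵥ x) ⬝ᵥ R *ᵥ (K' *ᵥ x)) -
        ((K - K') *ᵥ x) ⬝ᵥ R *ᵥ ((K - K') *ᵥ x) := by
  have hRs : R.IsSymm := by
    have := hR.isHermitian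
    rwa [Matrix.IsHermitian, conjTranspose_eq_transpose_of_trivial] at this
  have hRK : R * K' = Bᵀ * X := by
    rw [hK', ← Matrix.mul_assoc, ← Matrix.mul_assoc,
      Matrix.mul_nonsing_inv _ ((Matrix.isUnit_iff_isUnit_det R).1 hR.isUnit), Matrix.one_mul]
  -- The relation RK' = BᵀX turns all terms with `B` into R-products with K'x; what remains is
  -- completing the square.
  have h1 : ∀ L : Matrix τ σ ℝ, x ⬝ᵥ X *ᵥ ((B * L) *ᵥ x) = (K' *ᵥ x) ⬝ᵥ R *ᵥ (L *ᵥ x) := by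
    intro L
    have e : R *ᵥ (K' *ᵥ x) = Bᵀ *ᵥ (X *ᵥ x) := by
      rw [mulVec_mulVec, hRK, ← mulVec_mulVec]
    rw [dotProduct_mulVec_comm_of_isSymm hRs, e, dotProduct_mulVec _ Bᵀ, vecMul_transpose,
      dotProduct_mulVec_comm_of_isSymm hX, ← mulVec_mulVec]
  have h2 := h x
  rw [sub_mulVec, mulVec_sub, dotProduct_sub, h1] at h2 ⊢
  simp only [sub_mulVec, mulVec_sub, dotProduct_sub, sub_dotProduct,
    dotProduct_mulVec_comm_of_isSymm hRs (K *ᵥ x) (K' *ᵥ x)]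
  linarith

variable [DecidableEq σ]

/-- The improved gain is stabilizing. -/
theorem hurwitz_improve (hQ : Q.PosDef) (hR : R.PosDef) {X : Matrix σ σ ℝ} (hX : X.IsSymm)
    {K K' : Matrix τ σ ℝ} (hK' : K' = R⁻¹ * Bᵀ * X) (hK : Hurwitz (A - B * K))
    (h : ∀ x, 2 * (x ⬝ᵥ X *ᵥ ((A - B * K) *ᵥ x)) =
      -(x ⬝ᵥ Q *ᵥ x + (K *ᵥ x) ⬝ᵥ R *ᵥ (K *ᵥ x))) : Hurwitz (A - B * K') := by
  -- The cost form of the old gain is a Lyapunov function for the new one: it is nonnegative by the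
  -- old closed loop and decays strictly because of `Q`.
  refine hurwitz_of_lyapunov hX (hK.dotProduct_mulVec_nonneg hX fun x => ?_) fun x hx => ?_
  · linarith [h x, posDef_dotProduct_nonneg hQ x, posDef_dotProduct_nonneg hR (K *ᵥ x)]
  · linarith [lyapunov_improve hR hX hK' h x, posDef_dotProduct_pos hQ hx,
      posDef_dotProduct_nonneg hR (K' *ᵥ x), posDef_dotProduct_nonneg hR ((K - K') *ᵥ x)]

/-- A decreasing sequence of positive semidefinite matrices converges. -/
theorem exists_tendsto_of_antitone {X : ℕ → Matrix σ σ ℝ} (hX : ∀ i, (X i).IsSymm)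
    (hpos : ∀ i x, 0 ≤ x ⬝ᵥ X i *ᵥ x) (hanti : ∀ x, Antitone fun i => x ⬝ᵥ X i *ᵥ x) :
    ∃ Y, Tendsto X atTop (𝓝 Y) := by
  have hlim : ∀ x, ∃ c, Tendsto (fun i => x ⬝ᵥ X i *ᵥ x) atTop (𝓝 c) := fun x =>
    ⟨_, tendsto_atTop_ciInf (hanti x) ⟨0, by rintro _ ⟨i, rfl⟩; exact hpos i x⟩⟩
  choose q hq using hlim
  -- Polarization: the entries of a symmetric matrix are combinations of values of its quadratic
  -- form, which converge monotonically.
  have hent : ∀ l m, Tendsto (fun i => X i l m) atTop (𝓝 ((q (Pi.single l 1 + Pi.single m 1) -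
      q (Pi.single l 1) - q (Pi.single m 1)) / 2)) := fun l m => by
    refine (((hq _).sub (hq _)).sub (hq _)).div_const 2 |>.congr fun i => ?_
    simp only [mulVec_add, dotProduct_add, add_dotProduct,
      dotProduct_mulVec_comm_of_isSymm (hX i) (Pi.single m 1) (Pi.single l 1)]
    simp
    ring
  exact ⟨Matrix.of _, tendsto_pi_nhds.2 fun l => tendsto_pi_nhds.2 fun m => hent l m⟩

omit [DecidableEq τ] [DecidableEq σ] in
theorem tendsto_closedLoop_form {X : ℕ → Matrix σ σ ℝ} {Y : Matrix σ σ ℝ}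
    {K : ℕ → Matrix τ σ ℝ} {L : Matrix τ σ ℝ} (hX : Tendsto X atTop (𝓝 Y))
    (hK : Tendsto K atTop (𝓝 L)) (x y : σ → ℝ) :
    Tendsto (fun i => x ⬝ᵥ X i *ᵥ ((A - B * K i) *ᵥ y)) atTop
      (𝓝 (x ⬝ᵥ Y *ᵥ ((A - B * L) *ᵥ y))) := by
  simp only [dotProduct, mulVec, Matrix.sub_apply, Matrix.mul_apply]
  refine tendsto_finsetSum _ fun l _ => tendsto_const_nhds.mul <|
    tendsto_finsetSum _ fun m _ => (tendsto_pi_nhds.1 (tendsto_pi_nhds.1 hX l) m).mul <|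
    tendsto_finsetSum _ fun p _ => Tendsto.mul (tendsto_const_nhds.sub ?_) tendsto_const_nhds
  exact tendsto_finsetSum _ fun j _ =>
    tendsto_const_nhds.mul (tendsto_pi_nhds.1 (tendsto_pi_nhds.1 hK j) p)

/-- Kleinman's theorem: policy iteration for the linear quadratic problem converges. -/
theorem exists_tendsto_kleinman (hQ : Q.PosDef) (hR : R.PosDef) {X : ℕ → Matrix σ σ ℝ}
    (hX : ∀ i, (X i).IsSymm) {K : ℕ → Matrix τ σ ℝ} (hK : ∀ i, K (i + 1) = R⁻¹ * Bᵀ * X i)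
    (hH : ∀ i, Hurwitz (A - B * K i))
    (h : ∀ i x, 2 * (x ⬝ᵥ X i *ᵥ ((A - B * K i) *ᵥ x)) =
      -(x ⬝ᵥ Q *ᵥ x + (K i *ᵥ x) ⬝ᵥ R *ᵥ (K i *ᵥ x))) :
    ∃ L, Tendsto K atTop (𝓝 L) ∧ Hurwitz (A - B * L) := by
  have hpos : ∀ i x, 0 ≤ x ⬝ᵥ X i *ᵥ x := fun i => (hH i).dotProduct_mulVec_nonneg (hX i)
    fun x => by
      linarith [h i x, posDef_dotProduct_nonneg hQ x, posDef_dotProduct_nonneg hR (K i *ᵥ x)]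
  -- X_i - X_{i+1} satisfies the Lyapunov inequality of the closed loop of K_{i+1}, with the square
  -- of K_i - K_{i+1} as defect; hence it is positive semidefinite.
  have hanti : ∀ x, Antitone fun i => x ⬝ᵥ X i *ᵥ x := fun x => antitone_nat_of_succ_le fun i => by
    have hs : (X i - X (i + 1)).IsSymm := by
      rw [Matrix.IsSymm, transpose_sub, (hX i).eq, (hX (i + 1)).eq]
    have := (hH (i + 1)).dotProduct_mulVec_nonneg hs (fun y => by
      rw [sub_mulVec, dotProduct_sub]
      linarith [lyapunov_improve hR (hX i) (hK i) (h i) y, h (i + 1) y,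
        posDef_dotProduct_nonneg hR ((K i - K (i + 1)) *ᵥ y)]) x
    rw [sub_mulVec, dotProduct_sub] at this
    linarith
  obtain ⟨Y, hXY⟩ := exists_tendsto_of_antitone hX hpos hanti
  have hKY : Tendsto K atTop (𝓝 (R⁻¹ * Bᵀ * Y)) := by
    rw [← tendsto_add_atTop_iff_nat 1]
    simp only [hK]
    exact ((continuous_const.matrix_mul continuous_id).tendsto Y).comp hXY
  have hYs : Y.IsSymm := by
    refine tendsto_nhds_unique (f := X) (l := atTop) ?_ hXY
    have : Tendsto (fun i => (X i)ᵀ) atTop (𝓝 Yᵀ) :=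
      (continuous_id.matrix_transpose.tendsto Y).comp hXY
    simpa only [fun i => (hX i).eq] using this
  have hform : ∀ x y, Tendsto (fun i => x ⬝ᵥ X i *ᵥ ((A - B * K i) *ᵥ y)) atTop
      (𝓝 (x ⬝ᵥ Y *ᵥ ((A - B * (R⁻¹ * Bᵀ * Y)) *ᵥ y))) := tendsto_closedLoop_form hXY hKY
  have hquad : ∀ x, Tendsto (fun i => x ⬝ᵥ X i *ᵥ x) atTop (𝓝 (x ⬝ᵥ Y *ᵥ x)) := fun x =>
    ((continuous_const.dotProduct (continuous_id.matrix_mulVec continuous_const)).tendsto Y).comp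
      hXY
  have hYp : ∀ x, 0 ≤ x ⬝ᵥ Y *ᵥ x := fun x => ge_of_tendsto' (hquad x) fun i => hpos i x
  -- A limit of Hurwitz matrices need not be Hurwitz, but the decay by at least the form of `Q` is
  -- uniform in i and survives.
  have hYd : ∀ x, x ≠ 0 → x ⬝ᵥ Y *ᵥ ((A - B * (R⁻¹ * Bᵀ * Y)) *ᵥ x) < 0 := fun x hx => by
    have h1 : x ⬝ᵥ Y *ᵥ ((A - B * (R⁻¹ * Bᵀ * Y)) *ᵥ x) ≤ -(x ⬝ᵥ Q *ᵥ x) / 2 :=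
      le_of_tendsto' (hform x x) fun i => by
        linarith [h i x, posDef_dotProduct_nonneg hR (K i *ᵥ x)]
    linarith [posDef_dotProduct_pos hQ hx]
  exact ⟨_, hKY, hurwitz_of_lyapunov hYs hYp hYd⟩

end Kleinman

end
end Carleman

open scoped ENNReal NNReal
namespace Carleman
noncomputable section
open MvPowerSeries Filter Topology
open Finsupp (sumElim)

/-! ### Convergent power series, linear parts and small polydiscs. -/

section Converges

variable {σ 𝕜 : Type*} [NormedField 𝕜]

/-- The power series `p` converges absolutely on some polydisc. -/
def Converges (p : MvPowerSeries σ 𝕜) : Prop := ∃ r : ℝ≥0, 0 < r ∧ pnorm r p < ⊤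

theorem Converges.eventually {p : MvPowerSeries σ 𝕜} (hp : Converges p) :
    ∀ᶠ r in 𝓝[>] (0 : ℝ≥0), pnorm r p < ⊤ := by
  obtain ⟨r, hr, h⟩ := hp
  filter_upwards [Ioc_mem_nhdsGT hr] with s hs
  exact (pnorm_mono hs.2 p).trans_lt h

theorem converges_of_eventually {p : MvPowerSeries σ 𝕜}
    (h : ∀ᶠ r in 𝓝[>] (0 : ℝ≥0), pnorm r p < ⊤) : Converges p := by
  obtain ⟨r, hr, h0⟩ := (h.and self_mem_nhdsWithin).exists
  exact ⟨r, h0, hr⟩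

theorem Converges.mul {p q : MvPowerSeries σ 𝕜} (hp : Converges p) (hq : Converges q) :
    Converges (p * q) := converges_of_eventually <| by
  filter_upwards [hp.eventually, hq.eventually] with r h1 h2
  exact (pnorm_mul_le r p q).trans_lt (ENNReal.mul_lt_top h1 h2)

theorem Converges.add {p q : MvPowerSeries σ 𝕜} (hp : Converges p) (hq : Converges q) :
    Converges (p + q) := converges_of_eventually <| by
  filter_upwards [hp.eventually, hq.eventually] with r h1 h2
  exact (wnorm_add_le _ p q).trans_lt (ENNReal.add_lt_top.2 ⟨h1, h2⟩)

theorem Converges.sub {p q : MvPowerSeries σ 𝕜} (hp : Converges p) (hq : Converges q) :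
    Converges (p - q) := converges_of_eventually <| by
  filter_upwards [hp.eventually, hq.eventually] with r h1 h2
  exact (wnorm_sub_le _ p q).trans_lt (ENNReal.add_lt_top.2 ⟨h1, h2⟩)

theorem Converges.sum {ι : Type*} {s : Finset ι} {p : ι → MvPowerSeries σ 𝕜}
    (hp : ∀ i ∈ s, Converges (p i)) : Converges (∑ i ∈ s, p i) := converges_of_eventually <| by
  filter_upwards [(eventually_all_finset s).2 fun i hi => (hp i hi).eventually] with r h
  exact (wnorm_sum_le _ s p).trans_lt (ENNReal.sum_lt_top.2 h)

theorem converges_C (c : 𝕜) : Converges (C c : MvPowerSeries σ 𝕜) :=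
  ⟨1, one_pos, by rw [pnorm_C]; exact enorm_lt_top⟩

theorem converges_X (s : σ) : Converges (X s : MvPowerSeries σ 𝕜) :=
  ⟨1, one_pos, by rw [pnorm_X]; exact ENNReal.coe_lt_top⟩

theorem converges_lin [Fintype σ] {τ : Type*} (A : Matrix τ σ 𝕜) (l : τ) : Converges (lin A l) :=
  Converges.sum fun m _ => (converges_C _).mul (converges_X m)

theorem Converges.pderiv {𝕜 : Type*} [RCLike 𝕜] {p : MvPowerSeries σ 𝕜} (hp : Converges p)
    (l : σ) : Converges (pderiv 𝕜 l p) := by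
  obtain ⟨s, hs, h⟩ := hp
  exact ⟨s / 2, by positivity, pnorm_pderiv_lt_top (half_lt_self hs) l h⟩

/-- A series that vanishes to order `d` is `O(r ^ d)` in the norm of radius `r`. -/
theorem Converges.exists_pnorm_le {p : MvPowerSeries σ 𝕜} (hp : Converges p) {d : ℕ}
    (hd : ∀ α : σ →₀ ℕ, α.degree < d → coeff α p = 0) (a : ℝ≥0) :
    ∃ c : ℝ≥0, ∀ᶠ r in 𝓝[>] (0 : ℝ≥0), pnorm (a * r) p ≤ c * r ^ d := by
  obtain ⟨s, hs, h⟩ := hp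
  have ha : 0 < a + 1 := by positivity
  refine ⟨((a + 1) / s) ^ d * (pnorm s p).toNNReal, ?_⟩
  filter_upwards [Ioc_mem_nhdsGT (div_pos hs ha)] with r hr
  have h1 : (a + 1) * r / s ≤ 1 := by
    rw [div_le_one hs, mul_comm, ← le_div_iff₀ ha]
    exact hr.2
  calc pnorm (a * r) p ≤ pnorm ((a + 1) * r / s * s) p := by
        refine pnorm_mono ?_ p
        rw [div_mul_cancel₀ _ hs.ne']
        gcongr
        exact le_self_add
    _ ≤ (((a + 1) * r / s : ℝ≥0) : ℝ≥0∞) ^ d * pnorm s p := pnorm_le_of_order hd h1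
    _ = _ := by
        conv_lhs => rw [← ENNReal.coe_toNNReal h.ne]
        norm_cast
        rw [mul_div_right_comm, mul_pow]
        ring

theorem Converges.exists_pnorm_le_const {p : MvPowerSeries σ 𝕜} (hp : Converges p) (a : ℝ≥0) :
    ∃ c : ℝ≥0, ∀ᶠ r in 𝓝[>] (0 : ℝ≥0), pnorm (a * r) p ≤ c := by
  simpa using hp.exists_pnorm_le (d := 0) (by simp) a

/-- Terms of order two are o(r) on the polydisc of radius r. The factor `a` leaves room for passing
between the adapted and the plain norm. -/
theorem Converges.eventually_pnorm_le {p : MvPowerSeries σ 𝕜} (hp : Converges p)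
    (hd : ∀ α : σ →₀ ℕ, α.degree < 2 → coeff α p = 0) (a : ℝ≥0) {c : ℝ≥0} (hc : 0 < c) :
    ∀ᶠ r in 𝓝[>] (0 : ℝ≥0), pnorm (a * r) p ≤ c * r := by
  obtain ⟨M, hM⟩ := hp.exists_pnorm_le hd a
  filter_upwards [hM, Ioc_mem_nhdsGT (div_pos hc (show 0 < M + 1 by positivity))] with r h1 h2
  refine h1.trans ?_
  have : M * r ≤ c := by
    have h3 := (le_div_iff₀ (show 0 < M + 1 by positivity)).1 h2.2
    calc M * r ≤ r * (M + 1) := by rw [mul_comm]; gcongr; exact le_self_add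
      _ ≤ c := h3
  rw [sq, ← mul_assoc]
  gcongr
  exact_mod_cast this

end Converges

section LinPart

variable {σ τ R : Type*} [CommRing R]

/-- The linear part of a family of power series. -/
def linPart (F : τ → MvPowerSeries σ R) : Matrix τ σ R :=
  Matrix.of fun l m => coeff (Finsupp.single m 1) (F l)

theorem linPart_apply (F : τ → MvPowerSeries σ R) (l : τ) (m : σ) :
    linPart F l m = coeff (Finsupp.single m 1) (F l) := rfl

theorem exists_single_of_degree_eq_one {α : σ →₀ ℕ} (h : α.degree = 1) :
    ∃ m, α = Finsupp.single m 1 := by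
  have h0 : α ≠ 0 := by
    rintro rfl
    simp at h
  obtain ⟨m, hm⟩ := Finsupp.ne_iff.1 h0
  have h1 : Finsupp.single m 1 ≤ α := by
    rw [Finsupp.single_le_iff]
    exact Nat.one_le_iff_ne_zero.2 hm
  have h2 := add_tsub_cancel_of_le h1
  have h3 := congrArg Finsupp.degree h2
  rw [map_add, h, Finsupp.degree_single] at h3
  have h4 : (α - Finsupp.single m 1).degree = 0 := by omega
  rw [Finsupp.degree_eq_zero_iff] at h4
  exact ⟨m, by rw [← h2, h4, add_zero]⟩

theorem coeff_eq_zero_of_degree_lt_two [Fintype σ] {F : τ → MvPowerSeries σ R}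
    (h0 : ∀ l, constantCoeff (F l) = 0) (l : τ) (α : σ →₀ ℕ) (hα : α.degree < 2) :
    coeff α (F l - lin (linPart F) l) = 0 := by
  classical
  rw [map_sub, coeff_lin]
  have h : α.degree = 0 ∨ α.degree = 1 := by omega
  rcases h with h | h
  · rw [Finsupp.degree_eq_zero_iff] at h
    subst h
    rw [coeff_zero_eq_constantCoeff_apply, h0, Finset.sum_eq_zero, sub_zero]
    intro m _
    rw [if_neg]
    intro h
    simpa using h.symm
  · obtain ⟨m, rfl⟩ := exists_single_of_degree_eq_one h
    rw [Finset.sum_eq_single m]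
    · simp [linPart_apply]
    · intro b _ hb
      rw [if_neg]
      intro h
      exact hb (Finsupp.single_left_injective one_ne_zero h).symm
    · simp

theorem coeff_single_mul (p q : MvPowerSeries σ R) (m : σ) :
    coeff (Finsupp.single m 1) (p * q) = constantCoeff p * coeff (Finsupp.single m 1) q +
      coeff (Finsupp.single m 1) p * constantCoeff q := by
  classical
  rw [coeff_mul, Finsupp.antidiagonal_single]
  simp [Finset.Nat.antidiagonal_succ]

theorem lin_sub [Fintype σ] (A B : Matrix τ σ R) (l : τ) : lin (A - B) l = lin A l - lin B l := by
  simp [lin, sub_mul, Finset.sum_sub_distrib]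

theorem coeff_single_lie [Fintype σ] {F : σ → MvPowerSeries σ R}
    (h0 : ∀ l, constantCoeff (F l) = 0) (W : MvPowerSeries σ R) (m : σ) :
    coeff (Finsupp.single m 1) (lie F W) =
      ∑ s, linPart F s m * coeff (Finsupp.single s 1) W := by
  rw [lie, map_sum]
  refine Finset.sum_congr rfl fun s _ => ?_
  rw [coeff_single_mul, h0, zero_mul, zero_add, ← coeff_zero_eq_constantCoeff_apply (pderiv R s W),
    coeff_pderiv]
  simp [linPart_apply]

end LinPart

section DoubledLinear

variable {σ : Type*} [Fintype σ]

theorem linPart_double [DecidableEq σ] {R : Type*} [CommRing R] (F : σ → MvPowerSeries σ R) :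
    linPart (double F) = Matrix.fromBlocks (linPart F) 0 0 (linPart F) := by
  ext (l | l) (m | m) <;> rw [linPart_apply] <;>
    simp [double, ← Finsupp.sumElim_single_zero, ← Finsupp.sumElim_zero_single, coeff_inlHom,
      coeff_inrHom, linPart_apply]

theorem double_lin [DecidableEq σ] {R : Type*} [CommRing R] (A : Matrix σ σ R) (l : σ ⊕ σ) :
    double (lin A) l = lin (Matrix.fromBlocks A 0 0 A) l := by
  cases l <;> simp [double, lin, inlHom, inrHom, csub_C, csub_X]

/-- The sum of two copies of a Lyapunov function is a Lyapunov function of the doubled matrix. -/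
theorem hurwitz_fromBlocks [DecidableEq σ] {A : Matrix σ σ ℝ} (hA : Hurwitz A) :
    Hurwitz (Matrix.fromBlocks A 0 0 A) := by
  obtain ⟨X, h1, h2, h3⟩ := hA.exists_lyapunov
  have hf : ∀ Z : Matrix σ σ ℝ, ∀ x y : σ ⊕ σ → ℝ,
      x ⬝ᵥ Matrix.mulVec (Matrix.fromBlocks Z 0 0 Z) y =
        (x ∘ Sum.inl) ⬝ᵥ Z.mulVec (y ∘ Sum.inl) + (x ∘ Sum.inr) ⬝ᵥ Z.mulVec (y ∘ Sum.inr) := by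
    intro Z x y
    rw [Matrix.fromBlocks_mulVec]
    simp [dotProduct]
  have hne : ∀ x : σ ⊕ σ → ℝ, x ≠ 0 → x ∘ Sum.inl ≠ 0 ∨ x ∘ Sum.inr ≠ 0 := by
    intro x hx
    by_contra! h
    refine hx (funext fun i => ?_)
    cases i with
    | inl i => exact congrFun h.1 i
    | inr i => exact congrFun h.2 i
  have h2' : ∀ x, 0 ≤ x ⬝ᵥ X.mulVec x := fun x => by
    by_cases hx : x = 0
    · simp [hx]
    · exact (h2 x hx).le
  have h3' : ∀ x, x ⬝ᵥ X.mulVec (A.mulVec x) ≤ 0 := fun x => by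
    by_cases hx : x = 0
    · simp [hx]
    · exact (h3 x hx).le
  refine hurwitz_of_lyapunov (X := Matrix.fromBlocks X 0 0 X) ?_ (fun x => ?_) fun x hx => ?_
  · rw [Matrix.IsSymm, Matrix.fromBlocks_transpose, h1.eq, Matrix.transpose_zero]
  · rw [hf]
    exact add_nonneg (h2' _) (h2' _)
  · have e : Matrix.mulVec (Matrix.fromBlocks A 0 0 A) x =
        Sum.elim (A.mulVec (x ∘ Sum.inl)) (A.mulVec (x ∘ Sum.inr)) := by
      rw [Matrix.fromBlocks_mulVec]
      simp
    rw [hf, e, Sum.elim_comp_inl, Sum.elim_comp_inr]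
    rcases hne x hx with h | h
    · linarith [h3 _ h, h3' (x ∘ Sum.inr)]
    · linarith [h3 _ h, h3' (x ∘ Sum.inl)]

theorem Converges.inlHom {p : MvPowerSeries σ ℝ} (hp : Converges p) :
    Converges (Carleman.inlHom p) := by
  obtain ⟨r, hr, h⟩ := hp
  exact ⟨r, hr, (pnorm_inlHom_le r p).trans_lt h⟩

theorem Converges.inrHom {p : MvPowerSeries σ ℝ} (hp : Converges p) :
    Converges (Carleman.inrHom p) := by
  obtain ⟨r, hr, h⟩ := hp
  exact ⟨r, hr, (pnorm_inrHom_le r p).trans_lt h⟩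

theorem Converges.diagHom {p : MvPowerSeries (σ ⊕ σ) ℝ} (hp : Converges p) :
    Converges (Carleman.diagHom p) := by
  obtain ⟨r, hr, h⟩ := hp
  exact ⟨r, hr, (pnorm_diagHom_le r p).trans_lt h⟩

theorem Converges.double {F : σ → MvPowerSeries σ ℝ} (hF : ∀ l, Converges (F l)) (l : σ ⊕ σ) :
    Converges (Carleman.double F l) := by
  cases l with
  | inl l => exact (hF l).inlHom
  | inr l => exact (hF l).inrHom

end DoubledLinear

/-! ### The linear equation for convergent fields with Hurwitz linear part. -/

section AdaptedNormLemmas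

variable {σ : Type*} [Fintype σ] {A : Matrix σ σ ℝ} (N : AdaptedNorm A)

namespace AdaptedNorm

theorem nu_zero (r : ℝ≥0) : N.nu r 0 = 0 := by
  simpa using N.C_mul r 0 0

theorem sum_le {ι : Type*} (r : ℝ≥0) (s : Finset ι) (p : ι → MvPowerSeries σ ℝ) :
    N.nu r (∑ i ∈ s, p i) ≤ ∑ i ∈ s, N.nu r (p i) := by
  classical
  induction s using Finset.induction_on with
  | empty => simp [N.nu_zero]
  | insert a s ha ih =>
    rw [Finset.sum_insert ha, Finset.sum_insert ha]
    exact (N.add_le r _ _).trans (by gcongr)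

theorem lt_top_of_pnorm {r : ℝ≥0} {p : MvPowerSeries σ ℝ} (h : pnorm (N.ratio * r) p < ⊤) :
    N.nu r p < ⊤ := (N.le_pnorm r p).trans_lt h

theorem ratio_pos : 0 < N.ratio := one_pos.trans_le N.one_le_ratio

theorem pnorm_div_le (r : ℝ≥0) (p : MvPowerSeries σ ℝ) : pnorm (r / N.ratio) p ≤ N.nu r p := by
  have := N.pnorm_le (r / N.ratio) p
  rwa [mul_div_cancel₀ _ N.ratio_pos.ne'] at this

/-- On small polydiscs a vector field is close to its linear part. -/
theorem eventually_sub_lin_le {F : σ → MvPowerSeries σ ℝ} (h0 : ∀ l, constantCoeff (F l) = 0)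
    (hF : ∀ l, Converges (F l)) {c : ℝ≥0} (hc : 0 < c) :
    ∀ᶠ r in 𝓝[>] (0 : ℝ≥0), ∀ l, N.nu r (F l - lin (linPart F) l) ≤ c * r := by
  refine eventually_all.2 fun l => ?_
  filter_upwards [((hF l).sub (converges_lin _ l)).eventually_pnorm_le
    (coeff_eq_zero_of_degree_lt_two h0 l) N.ratio hc] with r hr
  exact (N.le_pnorm r _).trans hr

/-- Solutions of `lie F W = 0` vanish. -/
theorem eq_zero_of_lie_eq_zero (N : AdaptedNorm A) {F : σ → MvPowerSeries σ ℝ} (h0 : ∀ l, constantCoeff (F l) = 0)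
    (hF : ∀ l, Converges (F l)) (hA : linPart F = A) {W : MvPowerSeries σ ℝ}
    (hW : constantCoeff W = 0) (h : lie F W = 0) : W = 0 := by
  subst hA
  obtain ⟨r, hr, hpos⟩ :=
    ((N.eventually_sub_lin_le h0 hF N.eps_pos).and self_mem_nhdsWithin).exists
  have h1 := N.self_le r F h0 hr W hW
  rw [h, N.nu_zero, mul_zero] at h1
  refine eq_zero_of_pnorm_eq_zero (r := r / N.ratio) (div_pos hpos N.ratio_pos) ?_
  exact le_antisymm ((N.pnorm_div_le r W).trans h1) zero_le

/-- Solutions of `lie F W = q` converge if `q` does. -/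
theorem converges_of_lie_eq (N : AdaptedNorm A) {F : σ → MvPowerSeries σ ℝ} (h0 : ∀ l, constantCoeff (F l) = 0)
    (hF : ∀ l, Converges (F l)) (hA : linPart F = A) {W q : MvPowerSeries σ ℝ}
    (hW : constantCoeff W = 0) (hq : Converges q) (h : lie F W = q) : Converges W := by
  subst hA
  obtain ⟨M, hM⟩ := hq.exists_pnorm_le_const N.ratio
  obtain ⟨r, hr, hM, hpos⟩ :=
    ((N.eventually_sub_lin_le h0 hF N.eps_pos).and (hM.and self_mem_nhdsWithin)).exists
  refine ⟨r / N.ratio, div_pos hpos N.ratio_pos, (N.pnorm_div_le r W).trans_lt ?_⟩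
  refine (N.self_le r F h0 hr W hW).trans_lt (ENNReal.mul_lt_top ENNReal.coe_lt_top ?_)
  rw [h]
  exact N.lt_top_of_pnorm (hM.trans_lt ENNReal.coe_lt_top)

theorem exists_of_converges (N : AdaptedNorm A) {F : σ → MvPowerSeries σ ℝ} (h0 : ∀ l, constantCoeff (F l) = 0)
    (hF : ∀ l, Converges (F l)) (hA : linPart F = A) {q : MvPowerSeries σ ℝ}
    (hq0 : constantCoeff q = 0) (hq : Converges q) : ∃ W, constantCoeff W = 0 ∧ lie F W = q := by
  subst hA
  obtain ⟨M, hM⟩ := hq.exists_pnorm_le_const N.ratio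
  obtain ⟨r, hr, hM, hpos⟩ :=
    ((N.eventually_sub_lin_le h0 hF N.eps_pos).and (hM.and self_mem_nhdsWithin)).exists
  exact N.exists_lie_eq r F hpos h0 hr q hq0
    (N.lt_top_of_pnorm (hM.trans_lt ENNReal.coe_lt_top))

end AdaptedNorm

end AdaptedNormLemmas

end
end Carleman

open scoped ENNReal NNReal
namespace Carleman
noncomputable section
open MvPowerSeries Filter Topology
open Finsupp (sumElim)

/-! ### Cost matrices and improved policies. -/

section Symmetric

variable {n : ℕ}

theorem coeff_biSeries_symm {P : Matrix (Idx n) (Idx n) ℝ} (hP : P.IsSymm) (α β : Fin n →₀ ℕ) :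
    coeff (sumElim α β) (biSeries P) = coeff (sumElim β α) (biSeries P) := by
  by_cases hα : α = 0
  · subst hα
    rw [coeff_biSeries_zero_left, coeff_biSeries_zero_right]
  by_cases hβ : β = 0
  · subst hβ
    rw [coeff_biSeries_zero_left, coeff_biSeries_zero_right]
  · rw [coeff_biSeries _ ⟨α, hα⟩ ⟨β, hβ⟩, coeff_biSeries _ ⟨β, hβ⟩ ⟨α, hα⟩]
    exact hP.apply _ _

/-- W(x,y) = W(y,x), so the two partial gradients agree at y = x. Each is therefore half of the
gradient of the value function. -/
theorem diagHom_pderiv_inl {P : Matrix (Idx n) (Idx n) ℝ} (hP : P.IsSymm) (l : Fin n) :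
    diagHom (pderiv ℝ (Sum.inl l) (biSeries P)) = diagHom (pderiv ℝ (Sum.inr l) (biSeries P)) := by
  ext γ
  rw [coeff_diagHom, coeff_diagHom]
  have hswap : ∀ x ∈ Finset.HasAntidiagonal.antidiagonal γ,
      Prod.swap x ∈ Finset.HasAntidiagonal.antidiagonal γ := fun x hx => by
    rw [Finset.HasAntidiagonal.mem_antidiagonal] at hx ⊢
    rw [← hx, add_comm]
    rfl
  refine Finset.sum_nbij' Prod.swap Prod.swap hswap hswap (fun _ _ => rfl) (fun _ _ => rfl)
    fun x _ => ?_
  rw [coeff_pderiv, coeff_pderiv, ← Finsupp.sumElim_single_zero, ← Finsupp.sumElim_zero_single,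
    ← Finsupp.sumElim_add, ← Finsupp.sumElim_add, add_zero, add_zero, coeff_biSeries_symm hP]
  rfl

theorem pderiv_vectorize {P : Matrix (Idx n) (Idx n) ℝ} (hP : P.IsSymm) (l : Fin n) :
    pderiv ℝ l (rowSeries (vectorize P)) =
      C 2 * diagHom (pderiv ℝ (Sum.inl l) (biSeries P)) := by
  rw [rowSeries_vectorize, pderiv_diagHom, ← diagHom_pderiv_inl hP, map_ofNat, two_mul]

end Symmetric

namespace System

variable {n k : ℕ} (S : System n k)

/-- The linear part of the drift. -/
abbrev driftLin : Matrix (Fin n) (Fin n) ℝ := linPart S.fSeries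

/-- The input matrix at the equilibrium. -/
def inputLin : Matrix (Fin n) (Fin k) ℝ := Matrix.of fun l j => constantCoeff (S.gSeries l j)

theorem linPart_field {κ : Fin k → MvPowerSeries (Fin n) ℝ} (hκ : ∀ j, constantCoeff (κ j) = 0) :
    linPart (S.field κ) = S.driftLin - S.inputLin * linPart κ := by
  ext l m
  rw [linPart_apply, field, map_sub, map_sum, Matrix.sub_apply, Matrix.mul_apply]
  congr 1
  refine Finset.sum_congr rfl fun j _ => ?_
  rw [coeff_single_mul, hκ, mul_zero, add_zero]
  rfl

theorem closedLoopLinear_eq (K : Matrix (Fin k) (Idx n) ℝ) :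
    S.closedLoopLinear K = linPart (S.field (gainSeries K)) := by
  ext l m
  rw [closedLoopLinear, closedLoop_eq, linPart_apply, monoRate, Finset.sum_eq_single l]
  · simp
  · intro b _ hb
    rw [Finsupp.single_eq_of_ne hb]
    simp
  · simp

theorem stabilizing_iff (K : Matrix (Fin k) (Idx n) ℝ) :
    S.Stabilizing K ↔ Hurwitz (linPart (S.field (gainSeries K))) := by
  rw [Stabilizing, closedLoopLinear_eq]
  rfl

/-- At the point with all coordinates equal to r the monomials are r^|α|, and summability of real
families is absolute. -/
theorem converges_of_hasSum {p : MvPowerSeries (Fin n) ℝ} {v : (Fin n → ℝ) → ℝ}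
    (h : ∀ᶠ x in 𝓝 (0 : Fin n → ℝ), HasSum (fun α => coeff α p * mono x α) (v x)) :
    Converges p := by
  obtain ⟨ε, hε, h⟩ := Metric.eventually_nhds_iff.1 h
  set r : ℝ≥0 := ⟨ε / 2, by positivity⟩ with hr
  have hr0 : 0 < r := by rw [← NNReal.coe_pos]; exact half_pos hε
  refine ⟨r, hr0, ?_⟩
  have h1 := (h (y := fun _ => (r : ℝ)) (by
    rw [dist_zero_right]
    refine (pi_norm_const_le (r : ℝ)).trans_lt ?_
    rw [NNReal.norm_eq]
    exact half_lt_self hε)).summable.norm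
  have h2 : ∀ α : Fin n →₀ ℕ, mono (fun _ => (r : ℝ)) α = (r : ℝ) ^ α.degree := fun α => by
    rw [mono, Finset.prod_pow_eq_pow_sum, Finsupp.degree_eq_sum]
  have h3 : pnorm r p = ∑' α : Fin n →₀ ℕ, ((‖coeff α p‖₊ * r ^ α.degree : ℝ≥0) : ℝ≥0∞) := by
    refine tsum_congr fun α => ?_
    rw [radial, enorm_eq_nnnorm, mul_comm]
    push_cast
    rfl
  rw [h3, lt_top_iff_ne_top, ENNReal.tsum_coe_ne_top_iff_summable_coe]
  refine h1.congr fun α => ?_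
  rw [h2]
  simp

theorem converges_fSeries (l : Fin n) : Converges (S.fSeries l) :=
  converges_of_hasSum (v := fun x => S.f x l) (S.hasSum_f.mono fun _ h => h l)

theorem converges_gSeries (l : Fin n) (j : Fin k) : Converges (S.gSeries l j) :=
  converges_of_hasSum (v := fun x => S.g x l j) (S.hasSum_g.mono fun _ h => h l j)

theorem converges_field {κ : Fin k → MvPowerSeries (Fin n) ℝ} (hκ : ∀ j, Converges (κ j))
    (l : Fin n) : Converges (S.field κ l) :=
  (S.converges_fSeries l).sub (Converges.sum fun j _ => (S.converges_gSeries l j).mul (hκ j))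

theorem gainConverges_iff_converges (K : Matrix (Fin k) (Idx n) ℝ) :
    GainConverges K ↔ ∀ j, Converges (gainSeries K j) := by
  rw [gainConverges_iff]
  constructor
  · rintro ⟨r, hr, h⟩ j
    exact ⟨r, hr, h j⟩
  · intro h
    obtain ⟨r, h1, hr⟩ := ((eventually_all.2 fun j => (h j).eventually).and
      self_mem_nhdsWithin).exists
    exact ⟨r, hr, h1⟩

theorem converges_costSeries (Q₁ : Matrix (Fin n) (Fin n) ℝ) (R : Matrix (Fin k) (Fin k) ℝ)
    {κ : Fin k → MvPowerSeries (Fin n) ℝ} (hκ : ∀ j, Converges (κ j)) :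
    Converges (costSeries Q₁ R κ) :=
  (Converges.sum fun l _ => Converges.sum fun m _ =>
    (converges_C _).mul ((converges_X l).inlHom.mul (converges_X m).inrHom)).add
  (Converges.sum fun i _ => Converges.sum fun j _ =>
    (converges_C _).mul ((hκ i).inlHom.mul (hκ j).inrHom))

theorem constantCoeff_costSeries (Q₁ : Matrix (Fin n) (Fin n) ℝ) (R : Matrix (Fin k) (Fin k) ℝ)
    {κ : Fin k → MvPowerSeries (Fin n) ℝ} (hκ : ∀ j, constantCoeff (κ j) = 0) :
    constantCoeff (costSeries Q₁ R κ) = 0 := by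
  rw [← coeff_zero_eq_constantCoeff_apply, ← Finsupp.sumElim_zero_zero]
  exact coeff_costSeries_of_eq_zero Q₁ R hκ (Or.inl rfl)

variable {S} {Q₁ : Matrix (Fin n) (Fin n) ℝ} {R : Matrix (Fin k) (Fin k) ℝ}
  {K : Matrix (Fin k) (Idx n) ℝ}

theorem IsCostMatrix.lie_eq {P : Matrix (Idx n) (Idx n) ℝ} (h : S.IsCostMatrix Q₁ R K P) :
    lie (double (S.field (gainSeries K))) (biSeries P) = -costSeries Q₁ R (gainSeries K) :=
  (S.costEquation_iff Q₁ R K P).1 h.2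

theorem exists_adaptedNorm_double (hS : S.Stabilizing K) :
    Nonempty (AdaptedNorm (linPart (double (S.field (gainSeries K))))) := by
  rw [linPart_double]
  exact exists_adaptedNorm (hurwitz_fromBlocks ((S.stabilizing_iff K).1 hS))

theorem constantCoeff_double_field (K : Matrix (Fin k) (Idx n) ℝ) (l : Fin n ⊕ Fin n) :
    constantCoeff (double (S.field (gainSeries K)) l) = 0 :=
  constantCoeff_double (S.constantCoeff_field (constantCoeff_gainSeries K)) l

theorem converges_double_field (hK : GainConverges K) (l : Fin n ⊕ Fin n) :
    Converges (double (S.field (gainSeries K)) l) :=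
  Converges.double (S.converges_field ((gainConverges_iff_converges K).1 hK)) l

theorem eq_of_costEquation (hK : GainConverges K) (hS : S.Stabilizing K)
    {P P' : Matrix (Idx n) (Idx n) ℝ}
    (h : lie (double (S.field (gainSeries K))) (biSeries P) = -costSeries Q₁ R (gainSeries K))
    (h' : lie (double (S.field (gainSeries K))) (biSeries P') = -costSeries Q₁ R (gainSeries K)) :
    P = P' := by
  obtain ⟨N⟩ := exists_adaptedNorm_double hS
  refine biSeries_injective (sub_eq_zero.1 (N.eq_zero_of_lie_eq_zero
    (constantCoeff_double_field K) (converges_double_field hK) rfl ?_ ?_))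
  · simp [constantCoeff_biSeries]
  · rw [lie_sub, h, h', sub_self]

theorem IsCostMatrix.unique (hK : GainConverges K) (hS : S.Stabilizing K)
    {P P' : Matrix (Idx n) (Idx n) ℝ} (h : S.IsCostMatrix Q₁ R K P)
    (h' : S.IsCostMatrix Q₁ R K P') : P = P' :=
  eq_of_costEquation hK hS h.lie_eq h'.lie_eq

theorem IsCostMatrix.converges (hK : GainConverges K) (hS : S.Stabilizing K)
    {P : Matrix (Idx n) (Idx n) ℝ} (h : S.IsCostMatrix Q₁ R K P) : Converges (biSeries P) := by
  obtain ⟨N⟩ := exists_adaptedNorm_double hS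
  refine N.converges_of_lie_eq (constantCoeff_double_field K) (converges_double_field hK) rfl
    (constantCoeff_biSeries P) ?_ h.lie_eq
  rw [← zero_sub, ← map_zero C]
  exact (converges_C 0).sub (converges_costSeries Q₁ R ((gainConverges_iff_converges K).1 hK))

theorem exists_isCostMatrix (hQ : Q₁.IsSymm) (hR : R.IsSymm) (hK : GainConverges K)
    (hS : S.Stabilizing K) : ∃ P, S.IsCostMatrix Q₁ R K P := by
  obtain ⟨N⟩ := exists_adaptedNorm_double hS
  obtain ⟨W, -, hW⟩ := N.exists_of_converges (constantCoeff_double_field K)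
    (converges_double_field hK) rfl (q := -costSeries Q₁ R (gainSeries K))
    (by rw [map_neg, constantCoeff_costSeries _ _ (constantCoeff_gainSeries K), neg_zero]) (by
      rw [← zero_sub, ← map_zero C]
      exact (converges_C 0).sub
        (converges_costSeries Q₁ R ((gainConverges_iff_converges K).1 hK)))
  have hP := S.costEquation_of_lie_eq hW
  set P : Matrix (Idx n) (Idx n) ℝ := Matrix.of fun α β => coeff (sumElim α.1 β.1) W
  have hP' := (S.costEquation_iff Q₁ R K P).2 hP
  refine ⟨P, ?_, hP'⟩
  -- The transpose of a solution solves the same equation because `Q₁` and `R` are symmetric, so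
  -- symmetry follows from uniqueness.
  refine (eq_of_costEquation hK hS hP ((S.costEquation_iff Q₁ R K P.transpose).1 fun α β => ?_)).symm
  have h1 : liftWeight Q₁ α β = liftWeight Q₁ β α := by
    rw [liftWeight, liftWeight, Finset.sum_comm]
    refine Finset.sum_congr rfl fun i _ => Finset.sum_congr rfl fun j _ => ?_
    rw [hQ.apply]
    simp only [and_comm]
  have h2 : (K.transpose * R * K) α β = (K.transpose * R * K) β α := by
    have : (K.transpose * R * K).IsSymm := by
      rw [Matrix.IsSymm, Matrix.transpose_mul, Matrix.transpose_mul, hR.eq,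
        Matrix.transpose_transpose, Matrix.mul_assoc]
    exact this.apply β α
  rw [h1, h2, ← hP' β α, add_comm]
  simp only [Matrix.transpose_apply, mul_comm]

/-- The degree-one diagonal block of an infinite matrix. -/
def linBlock (P : Matrix (Idx n) (Idx n) ℝ) : Matrix (Fin n) (Fin n) ℝ :=
  Matrix.of fun l m => coeff (sumElim (Finsupp.single l 1) (Finsupp.single m 1)) (biSeries P)

theorem linBlock_isSymm {P : Matrix (Idx n) (Idx n) ℝ} (hP : P.IsSymm) : (linBlock P).IsSymm := by
  ext l m
  exact coeff_biSeries_symm hP _ _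

/-- By triangularity the coefficients at (e_l, e_m) of the cost equation involve only the degree-one
block: they form the finite Lyapunov equation of the linearized closed loop. -/
theorem IsCostMatrix.linBlock_eq {P : Matrix (Idx n) (Idx n) ℝ} (h : S.IsCostMatrix Q₁ R K P)
    (x : Fin n → ℝ) : 2 * (x ⬝ᵥ (linBlock P).mulVec ((S.driftLin -
        S.inputLin * linPart (gainSeries K)).mulVec x)) =
      -(x ⬝ᵥ Q₁.mulVec x + ((linPart (gainSeries K)).mulVec x) ⬝ᵥ
        R.mulVec ((linPart (gainSeries K)).mulVec x)) := by
  have h0 := S.constantCoeff_field (constantCoeff_gainSeries K)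
  rw [← S.linPart_field (constantCoeff_gainSeries K)]
  set A := linPart (S.field (gainSeries K)) with hA
  set L := linPart (gainSeries K) with hL
  set Y := linBlock P with hY
  have e : A.transpose * Y + Y * A = -(Q₁ + L.transpose * R * L) := by
    ext l m
    have h1 := congrArg (coeff (sumElim (Finsupp.single l 1) (Finsupp.single m 1))) h.lie_eq
    rw [coeff_lie_double, coeff_single_lie h0, coeff_single_lie h0, map_neg,
      coeff_costSeries Q₁ R K ⟨Finsupp.single l 1, by simp⟩ ⟨Finsupp.single m 1, by simp⟩] at h1
    have h2 : liftWeight Q₁ ⟨Finsupp.single l 1, by simp⟩ ⟨Finsupp.single m 1, by simp⟩ =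
        Q₁ l m := by
      simp [liftWeight, Finsupp.single_left_inj, ite_and]
    rw [h2] at h1
    rw [Matrix.add_apply, Matrix.mul_apply, Matrix.mul_apply, Matrix.neg_apply, Matrix.add_apply]
    have h3 : ∑ s, A.transpose l s * Y s m = ∑ s, linPart (S.field (gainSeries K)) s l *
        coeff (Finsupp.single s 1) (sliceRight (Finsupp.single m 1) (biSeries P)) := rfl
    have h4 : ∑ s, Y l s * A s m = ∑ s, linPart (S.field (gainSeries K)) s m *
        coeff (Finsupp.single s 1) (sliceLeft (Finsupp.single l 1) (biSeries P)) :=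
      Finset.sum_congr rfl fun s _ => mul_comm _ _
    have h5 : ∀ j (m : Fin n), L j m = K j ⟨Finsupp.single m 1, by simp⟩ := fun j m =>
      coeff_rowSeries (K j) ⟨Finsupp.single m 1, by simp⟩
    have h6 : (L.transpose * R * L) l m =
        (K.transpose * R * K) ⟨Finsupp.single l 1, by simp⟩ ⟨Finsupp.single m 1, by simp⟩ := by
      simp only [Matrix.mul_apply, Matrix.transpose_apply, h5]
    rw [h3, h4, h1, h6]
  have hs : x ⬝ᵥ (A.transpose * Y).mulVec x = x ⬝ᵥ (Y * A).mulVec x := by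
    rw [← Matrix.mulVec_mulVec, ← Matrix.mulVec_mulVec, Matrix.dotProduct_mulVec,
      Matrix.vecMul_transpose, dotProduct_mulVec_comm_of_isSymm (linBlock_isSymm h.1)]
  have e2 := congrArg (fun M => x ⬝ᵥ M.mulVec x) e
  simp only [Matrix.add_mulVec, dotProduct_add, Matrix.neg_mulVec, dotProduct_neg, hs] at e2
  rw [Matrix.mulVec_mulVec, two_mul, e2, ← Matrix.mulVec_mulVec, ← Matrix.mulVec_mulVec,
    Matrix.dotProduct_mulVec x L.transpose, Matrix.vecMul_transpose]

/-- The improvement step acts on degree-one blocks as Kleinman's step, so the linear parts of the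
iteration form a finite-dimensional policy iteration. -/
theorem linPart_gain (P : Matrix (Idx n) (Idx n) ℝ) :
    linPart (gainSeries (S.gain R P)) = R⁻¹ * S.inputLin.transpose * linBlock P := by
  have h1 : ∀ l, constantCoeff (diagHom (pderiv ℝ (Sum.inl l) (biSeries P))) = 0 := fun l => by
    refine constantCoeff_csub _ ?_
    rw [← coeff_zero_eq_constantCoeff_apply, coeff_pderiv, zero_add,
      ← Finsupp.sumElim_single_zero, coeff_biSeries_zero_right, zero_mul]
  have h2 : ∀ l m, coeff (Finsupp.single m 1) (diagHom (pderiv ℝ (Sum.inl l) (biSeries P))) =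
      linBlock P l m := fun l m => by
    rw [coeff_diagHom, Finsupp.antidiagonal_single]
    simp only [Finset.Nat.antidiagonal_succ]
    simp [coeff_pderiv, ← Finsupp.sumElim_single_zero, ← Finsupp.sumElim_add,
      coeff_biSeries_zero_right, linBlock]
  ext i m
  rw [linPart_apply, gainSeries_gain, map_sum, Matrix.mul_assoc, Matrix.mul_apply]
  refine Finset.sum_congr rfl fun j _ => ?_
  rw [coeff_C_mul, map_sum, Matrix.mul_apply]
  congr 1
  refine Finset.sum_congr rfl fun l _ => ?_
  rw [coeff_single_mul, h1, mul_zero, add_zero, h2]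
  rfl

theorem isSymm_of_posDef {σ : Type*} {M : Matrix σ σ ℝ} (hM : M.PosDef) : M.IsSymm := by
  have := hM.isHermitian
  rwa [Matrix.IsHermitian, Matrix.conjTranspose_eq_transpose_of_trivial] at this

theorem stabilizing_gain (hQ : Q₁.PosDef) (hR : R.PosDef) (hS : S.Stabilizing K)
    {P : Matrix (Idx n) (Idx n) ℝ} (h : S.IsCostMatrix Q₁ R K P) :
    S.Stabilizing (S.gain R P) := by
  rw [stabilizing_iff, linPart_field _ (constantCoeff_gainSeries _)] at hS ⊢
  exact hurwitz_improve hQ hR (linBlock_isSymm h.1) (linPart_gain P) hS h.linBlock_eq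

theorem gainConverges_gain {P : Matrix (Idx n) (Idx n) ℝ} (hP : Converges (biSeries P)) :
    GainConverges (S.gain R P) := by
  rw [gainConverges_iff_converges]
  intro i
  rw [gainSeries_gain]
  exact Converges.sum fun j _ => (converges_C _).mul (Converges.sum fun l _ =>
    (S.converges_gSeries l j).mul (hP.pderiv _).diagHom)

/-- The improved policy `½ R⁻¹ gᵀ ∇V`. -/
def policy (S : System n k) (R : Matrix (Fin k) (Fin k) ℝ) (V : MvPowerSeries (Fin n) ℝ)
    (i : Fin k) : MvPowerSeries (Fin n) ℝ :=
  ∑ j, C (R⁻¹ i j / 2) * ∑ l, S.gSeries l j * pderiv ℝ l V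

/-- The gain of a symmetric matrix depends on its value function only. This is why data that
determine p̄ suffice for the next step. -/
theorem gainSeries_gain_eq_policy {P : Matrix (Idx n) (Idx n) ℝ} (hP : P.IsSymm) :
    gainSeries (S.gain R P) = S.policy R (rowSeries (vectorize P)) := by
  ext1 i
  rw [gainSeries_gain, policy]
  refine Finset.sum_congr rfl fun j _ => ?_
  rw [Finset.mul_sum, Finset.mul_sum]
  refine Finset.sum_congr rfl fun l _ => ?_
  rw [pderiv_vectorize hP]
  have : (C (R⁻¹ i j) : MvPowerSeries (Fin n) ℝ) = C (R⁻¹ i j / 2) * C 2 := by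
    rw [← map_mul, div_mul_cancel₀ _ two_ne_zero]
  rw [this]
  ring

theorem policy_sub (V V' : MvPowerSeries (Fin n) ℝ) (i : Fin k) :
    S.policy R (V - V') i = S.policy R V i - S.policy R V' i := by
  simp only [policy, map_sub, mul_sub, Finset.sum_sub_distrib]

/-- The quadratic form `κᵀ R κ`. -/
def quad (R : Matrix (Fin k) (Fin k) ℝ) (κ : Fin k → MvPowerSeries (Fin n) ℝ) :
    MvPowerSeries (Fin n) ℝ := ∑ i, ∑ j, C (R i j) * (κ i * κ j)

/-- The running cost of the policy `κ`. -/
def stageSeries (Q₁ : Matrix (Fin n) (Fin n) ℝ) (R : Matrix (Fin k) (Fin k) ℝ)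
    (κ : Fin k → MvPowerSeries (Fin n) ℝ) : MvPowerSeries (Fin n) ℝ :=
  ∑ l, ∑ m, C (Q₁ l m) * (X l * X m) + quad R κ

theorem diagHom_C {τ : Type*} [Fintype τ] (c : ℝ) :
    diagHom (C c : MvPowerSeries (τ ⊕ τ) ℝ) = C c := csub_C _ c

theorem diagHom_costSeries (κ : Fin k → MvPowerSeries (Fin n) ℝ) :
    diagHom (costSeries Q₁ R κ) = stageSeries Q₁ R κ := by
  simp only [costSeries, stageSeries, quad, map_add, map_sum, map_mul, diagHom_inlHom,
    diagHom_inrHom, diagHom_C]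

theorem IsCostMatrix.lie_vectorize {P : Matrix (Idx n) (Idx n) ℝ}
    (h : S.IsCostMatrix Q₁ R K P) :
    lie (S.field (gainSeries K)) (rowSeries (vectorize P)) =
      -stageSeries Q₁ R (gainSeries K) := by
  rw [rowSeries_vectorize, lie_diagHom, h.lie_eq, map_neg, diagHom_costSeries]

theorem lie_field (κ : Fin k → MvPowerSeries (Fin n) ℝ) (V : MvPowerSeries (Fin n) ℝ) :
    lie (S.field κ) V = lie S.fSeries V - ∑ j, κ j * ∑ l, S.gSeries l j * pderiv ℝ l V := by
  simp only [lie, field, sub_mul, Finset.sum_sub_distrib, Finset.sum_mul, Finset.mul_sum]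
  congr 1
  rw [Finset.sum_comm]
  exact Finset.sum_congr rfl fun j _ => Finset.sum_congr rfl fun l _ => by ring

theorem sum_mul_policy (hR : R.PosDef) (V : MvPowerSeries (Fin n) ℝ) (j : Fin k) :
    ∑ l, S.gSeries l j * pderiv ℝ l V = C 2 * ∑ i, C (R j i) * S.policy R V i := by
  have h1 : R * R⁻¹ = 1 :=
    Matrix.mul_nonsing_inv _ ((Matrix.isUnit_iff_isUnit_det R).1 hR.isUnit)
  set G : Fin k → MvPowerSeries (Fin n) ℝ := fun j => ∑ l, S.gSeries l j * pderiv ℝ l V with hG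
  have h2 : ∑ i, C (R j i) * S.policy R V i = ∑ j', C ((R * R⁻¹) j j' / 2) * G j' := by
    simp only [policy, Matrix.mul_apply, Finset.mul_sum, Finset.sum_div, map_sum, Finset.sum_mul]
    rw [Finset.sum_comm]
    refine Finset.sum_congr rfl fun j' _ => ?_
    simp only [hG, Finset.mul_sum]
    refine Finset.sum_congr rfl fun i _ => ?_
    refine Finset.sum_congr rfl fun l _ => ?_
    rw [mul_div_assoc, map_mul]
    ring
  rw [h2, h1, Finset.sum_eq_single j]
  · rw [Matrix.one_apply_eq, ← mul_assoc, ← map_mul, mul_one_div_cancel two_ne_zero, map_one,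
      one_mul]
  · intro b _ hb
    rw [Matrix.one_apply_ne hb.symm]
    simp
  · simp

/-- The decay of a value function along another policy. -/
theorem lie_field_policy (hR : R.PosDef) (κ : Fin k → MvPowerSeries (Fin n) ℝ)
    {V : MvPowerSeries (Fin n) ℝ} (h : lie (S.field κ) V = -stageSeries Q₁ R κ) :
    lie (S.field (S.policy R V)) V = -stageSeries Q₁ R (S.policy R V) -
      quad R (fun j => κ j - S.policy R V j) := by
  rw [lie_field] at h ⊢
  simp only [sum_mul_policy hR] at h ⊢
  set μ := S.policy R V
  rw [sub_eq_iff_eq_add.1 h]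
  -- With gᵀ∇V = 2Rμ, μ the improved policy, the derivative along the drift is -stage(κ) + 2κᵀRμ,
  -- and passing to μ subtracts 2μᵀRμ. The symmetry `hc` lets these terms combine to the square of κ
  -- - μ.
  have hs : ∀ a b : Fin k → MvPowerSeries (Fin n) ℝ,
      ∑ j, a j * (C 2 * ∑ i, C (R j i) * b i) =
        2 * ∑ i, ∑ j, C (R i j) * (a i * b j) := by
    intro a b
    simp only [Finset.mul_sum]
    refine Finset.sum_congr rfl fun i _ => Finset.sum_congr rfl fun j _ => ?_
    rw [map_ofNat]
    ring
  have hc : ∑ i, ∑ j, C (R i j) * (μ i * κ j) = ∑ i, ∑ j, C (R i j) * (κ i * μ j) := by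
    rw [Finset.sum_comm]
    refine Finset.sum_congr rfl fun i _ => Finset.sum_congr rfl fun j _ => ?_
    rw [(isSymm_of_posDef hR).apply]
    ring
  rw [hs, hs]
  simp only [stageSeries, quad, sub_mul, mul_sub, Finset.sum_sub_distrib]
  rw [hc]
  ring

end System

end
end Carleman

open scoped ENNReal NNReal
namespace Carleman
noncomputable section
open MvPowerSeries Filter Topology
open Finsupp (sumElim)

/-! ### Quadratic contraction of the policy iteration on a fixed polydisc. -/

theorem nnnorm_le_sum_sum {ι κ : Type*} [Fintype ι] [Fintype κ] (f : ι → κ → ℝ≥0) (i : ι) :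
    ∑ j, f i j ≤ ∑ i, ∑ j, f i j :=
  Finset.single_le_sum (f := fun i => ∑ j, f i j) (fun _ _ => zero_le) (Finset.mem_univ i)

namespace System

variable {n k : ℕ} {S : System n k} {Q₁ : Matrix (Fin n) (Fin n) ℝ} {R : Matrix (Fin k) (Fin k) ℝ}
  {A : Matrix (Fin n) (Fin n) ℝ}

/-- One step of the policy iteration contracts quadratically. -/
theorem nu_policy_sub_le (N : AdaptedNorm A) (hR : R.PosDef) {κ : Fin k → MvPowerSeries (Fin n) ℝ}
    {V V' : MvPowerSeries (Fin n) ℝ} (hV : constantCoeff V = 0) (hV' : constantCoeff V' = 0)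
    (h : lie (S.field κ) V = -stageSeries Q₁ R κ)
    (h' : lie (S.field (S.policy R V)) V' = -stageSeries Q₁ R (S.policy R V))
    (h0 : ∀ l, constantCoeff (S.field (S.policy R V) l) = 0) {s : ℝ≥0}
    (hF : ∀ l, N.nu s (S.field (S.policy R V) l - lin A l) ≤ N.eps * s) {c e : ℝ≥0}
    (hg : ∀ l j, N.nu s (S.gSeries l j) ≤ c) (he : ∀ j, N.nu s (κ j - S.policy R V j) ≤ e)
    (i : Fin k) : s * N.nu s (S.policy R V i - S.policy R V' i) ≤
      (((∑ i, ∑ j, ‖R⁻¹ i j / 2‖₊) * n * c * N.bound * (∑ i, ∑ j, ‖R i j‖₊) * e ^ 2 : ℝ≥0) :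
        ℝ≥0∞) := by
  -- Both value functions are differentiated along the same new field, so the difference solves a
  -- linear equation whose right-hand side is quadratic in the change of policy.
  have hlie : lie (S.field (S.policy R V)) (V - V') =
      -quad R (fun j => κ j - S.policy R V j) := by
    rw [lie_sub, h', lie_field_policy hR κ h]
    ring
  have hquad : N.nu s (quad R (fun j => κ j - S.policy R V j)) ≤
      (((∑ i, ∑ j, ‖R i j‖₊) * e ^ 2 : ℝ≥0) : ℝ≥0∞) := by
    push_cast
    rw [quad, Finset.sum_mul]
    refine (N.sum_le _ _ _).trans (Finset.sum_le_sum fun i _ => ?_)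
    rw [Finset.sum_mul]
    refine (N.sum_le _ _ _).trans (Finset.sum_le_sum fun j _ => ?_)
    rw [N.C_mul, sq, enorm_eq_nnnorm]
    exact mul_le_mul_right ((N.mul_le _ _ _).trans (mul_le_mul' (he i) (he j))) _
  -- The policy contains the gradient of the value function; the gained derivative pays for it at
  -- the price of the factor s.
  have hder : ∀ l, s * N.nu s (pderiv ℝ l (V - V')) ≤
      ((N.bound * ((∑ i, ∑ j, ‖R i j‖₊) * e ^ 2) : ℝ≥0) : ℝ≥0∞) := fun l => by
    refine (N.pderiv_le s _ h0 hF (V - V') (by rw [map_sub, hV, hV', sub_zero]) l).trans ?_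
    rw [hlie, N.neg, ENNReal.coe_mul]
    exact mul_le_mul_right hquad _
  set b : ℝ≥0 := N.bound * ((∑ i, ∑ j, ‖R i j‖₊) * e ^ 2) with hb
  have hsum : ∀ j, s * N.nu s (∑ l, S.gSeries l j * pderiv ℝ l (V - V')) ≤
      ((n * (c * b) : ℝ≥0) : ℝ≥0∞) := fun j => by
    calc s * N.nu s (∑ l, S.gSeries l j * pderiv ℝ l (V - V'))
        ≤ s * ∑ l, N.nu s (S.gSeries l j) * N.nu s (pderiv ℝ l (V - V')) :=
          mul_le_mul_right ((N.sum_le _ _ _).trans (Finset.sum_le_sum fun l _ => N.mul_le _ _ _)) _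
      _ = ∑ l, N.nu s (S.gSeries l j) * (s * N.nu s (pderiv ℝ l (V - V'))) := by
          rw [Finset.mul_sum]
          exact Finset.sum_congr rfl fun l _ => by ring
      _ ≤ ∑ _l : Fin n, (c * b : ℝ≥0∞) :=
          Finset.sum_le_sum fun l _ => mul_le_mul' (hg l j) (hder l)
      _ = _ := by simp
  rw [← policy_sub, policy]
  calc s * N.nu s (∑ j, C (R⁻¹ i j / 2) * ∑ l, S.gSeries l j * pderiv ℝ l (V - V'))
      ≤ s * ∑ j, ‖R⁻¹ i j / 2‖ₑ * N.nu s (∑ l, S.gSeries l j * pderiv ℝ l (V - V')) := by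
        refine mul_le_mul_right ((N.sum_le _ _ _).trans (Finset.sum_le_sum fun j _ => ?_)) _
        rw [N.C_mul]
    _ = ∑ j, ‖R⁻¹ i j / 2‖ₑ * (s * N.nu s (∑ l, S.gSeries l j * pderiv ℝ l (V - V'))) := by
        rw [Finset.mul_sum]
        exact Finset.sum_congr rfl fun l _ => by ring
    _ ≤ ∑ j, ‖R⁻¹ i j / 2‖ₑ * ((n * (c * b) : ℝ≥0) : ℝ≥0∞) :=
        Finset.sum_le_sum fun j _ => mul_le_mul_right (hsum j) _
    _ = (((∑ j, ‖R⁻¹ i j / 2‖₊) * (n * (c * b)) : ℝ≥0) : ℝ≥0∞) := by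
        rw [← Finset.sum_mul, ENNReal.coe_mul (∑ j, ‖R⁻¹ i j / 2‖₊), ENNReal.ofNNReal_finsetSum]
        rfl
    _ ≤ _ := by
        refine ENNReal.coe_le_coe.2 ?_
        calc (∑ j, ‖R⁻¹ i j / 2‖₊) * (n * (c * b))
            ≤ (∑ i, ∑ j, ‖R⁻¹ i j / 2‖₊) * (n * (c * b)) :=
              mul_le_mul_left (nnnorm_le_sum_sum (fun i j => ‖R⁻¹ i j / 2‖₊) i) _
          _ = _ := by rw [hb]; ring

theorem tendsto_sum_nnnorm_sub {τ σ : Type*} [Fintype σ] [Finite τ] {M : ℕ → Matrix τ σ ℝ}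
    {L : Matrix τ σ ℝ} (h : Tendsto M atTop (𝓝 L)) {c : ℝ≥0} (hc : 0 < c) :
    ∀ᶠ i in atTop, ∀ l, ∑ m, ‖(M i - L) l m‖₊ ≤ c := by
  refine eventually_all.2 fun l => ?_
  have h1 : Tendsto (fun i => ∑ m, ‖(M i - L) l m‖₊) atTop (𝓝 (∑ _m : σ, 0)) := by
    refine tendsto_finsetSum _ fun m _ => ?_
    have := ((tendsto_pi_nhds.1 (tendsto_pi_nhds.1 h l) m).sub_const (L l m)).nnnorm
    simpa using this
  rw [Finset.sum_const_zero] at h1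
  exact h1.eventually_le_const hc

theorem nu_lin_le (N : AdaptedNorm A) {τ : Type*} (M : Matrix τ (Fin n) ℝ) (s : ℝ≥0) (l : τ)
    {c : ℝ≥0} (h : ∑ m, ‖M l m‖₊ ≤ c / N.ratio) : N.nu s (lin M l) ≤ ((c * s : ℝ≥0) : ℝ≥0∞) := by
  refine (N.le_pnorm _ _).trans ((pnorm_lin_le M _ l).trans ?_)
  have : (∑ m, ‖M l m‖₊) * (N.ratio * s) ≤ c * s := by
    calc (∑ m, ‖M l m‖₊) * (N.ratio * s) ≤ c / N.ratio * (N.ratio * s) := by gcongr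
      _ = c * s := by rw [← mul_assoc, div_mul_cancel₀ _ N.ratio_pos.ne']
  have h2 := ENNReal.coe_le_coe.2 this
  rw [ENNReal.coe_mul, ENNReal.ofNNReal_finsetSum] at h2
  exact h2

theorem field_sub (κ κ' : Fin k → MvPowerSeries (Fin n) ℝ) (l : Fin n) :
    S.field κ l - S.field κ' l = ∑ j, S.gSeries l j * (κ' j - κ j) := by
  simp only [field, mul_sub, Finset.sum_sub_distrib]
  ring

/-- The tail of the policy iteration converges geometrically on a fixed polydisc. -/
theorem exists_tail (hR : R.PosDef) {κ : ℕ → Fin k → MvPowerSeries (Fin n) ℝ}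
    {V : ℕ → MvPowerSeries (Fin n) ℝ} (hκ0 : ∀ i j, constantCoeff (κ i j) = 0)
    (hV0 : ∀ i, constantCoeff (V i) = 0) (hconv : ∀ i j, Converges (κ i j))
    (hlie : ∀ i, lie (S.field (κ i)) (V i) = -stageSeries Q₁ R (κ i))
    (himp : ∀ i, κ (i + 1) = S.policy R (V i)) {L : Matrix (Fin k) (Fin n) ℝ}
    (hL : Tendsto (fun i => linPart (κ i)) atTop (𝓝 L)) (hA : A = S.driftLin - S.inputLin * L)
    (hH : Hurwitz A) {ε : ℝ≥0} (hε : 0 < ε) :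
    ∃ (i₀ : ℕ) (r : ℝ≥0), 0 < r ∧ (∀ l j, pnorm r (S.gSeries l j) < ⊤) ∧
      (∀ j, pnorm r (κ i₀ j) < ⊤) ∧
      (∀ m l, pnorm r (S.field (κ (i₀ + m)) l - lin A l) ≤ ε * r) ∧
      ∀ m j, pnorm r (κ (i₀ + m) j - κ (i₀ + m + 1) j) ≤ (((1 / 2) ^ m * r : ℝ≥0) : ℝ≥0∞) := by
  obtain ⟨N⟩ := exists_adaptedNorm hH
  have hρ := N.ratio_pos
  choose c₀ hc₀ using fun l j => (S.converges_gSeries l j).exists_pnorm_le_const N.ratio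
  set c : ℝ≥0 := ∑ l, ∑ j, c₀ l j with hc
  have hcg : ∀ l j, c₀ l j ≤ c := fun l j =>
    (Finset.single_le_sum (f := c₀ l) (fun _ _ => zero_le) (Finset.mem_univ j)).trans
      (nnnorm_le_sum_sum c₀ l)
  -- The constant of the quadratic estimate of `nu_policy_sub_le`.
  set D : ℝ≥0 := (∑ i, ∑ j, ‖R⁻¹ i j / 2‖₊) * n * c * N.bound * (∑ i, ∑ j, ‖R i j‖₊) with hD
  set ε₁ : ℝ≥0 := min N.eps (ε / N.ratio) with hε₁
  have hε₁0 : 0 < ε₁ := lt_min N.eps_pos (div_pos hε hρ)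
  -- Three requirements on the initial step, relative to the radius: D·η ≤ 1/2 turns quadratic
  -- contraction into halving; a total drift 2η of the policies moves the field by at most ε₁/2; and
  -- η·ratio ≤ 1 gives the stated bound after returning to the plain norm.
  set η : ℝ≥0 := min (1 / (2 * (D + 1))) (min (ε₁ / (4 * (k * c + 1))) (1 / N.ratio)) with hη
  have hη0 : 0 < η := by positivity
  have hη1 : D * η ≤ 1 / 2 := by
    calc D * η ≤ (D + 1) * (1 / (2 * (D + 1))) := by
          gcongr
          · exact le_self_add
          · exact min_le_left _ _
      _ = 1 / 2 := by field_simp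
  have hη2 : k * c * (2 * η) ≤ ε₁ / 2 := by
    calc k * c * (2 * η) ≤ (k * c + 1) * (2 * (ε₁ / (4 * (k * c + 1)))) := by
          gcongr
          · exact le_self_add
          · exact (min_le_right _ _).trans (min_le_left _ _)
      _ = ε₁ / 2 := by field_simp; norm_num
  have hη3 : η * N.ratio ≤ 1 := by
    rw [← le_div_iff₀ hρ]
    exact (min_le_right _ _).trans (min_le_right _ _)
  -- Choose the starting index by the linear parts and then the radius.
  have hAlim : Tendsto (fun i => linPart (S.field (κ i))) atTop (𝓝 A) := by
    simp only [fun i => S.linPart_field (hκ0 i)]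
    rw [hA]
    have : Tendsto (fun i => S.inputLin * linPart (κ i)) atTop (𝓝 (S.inputLin * L)) :=
      ((continuous_const.matrix_mul continuous_id).tendsto L).comp hL
    exact this.const_sub _
  have hδlim : Tendsto (fun i => linPart (κ i) - linPart (κ (i + 1))) atTop (𝓝 (0 : Matrix _ _ ℝ)) := by
    have := hL.sub (hL.comp (tendsto_add_atTop_nat 1))
    rwa [sub_self] at this
  obtain ⟨i₀, hi1, hi2⟩ := ((tendsto_sum_nnnorm_sub hAlim
    (div_pos (show 0 < ε₁ / 4 by positivity) hρ)).and
    (tendsto_sum_nnnorm_sub hδlim (div_pos (show 0 < η / 2 by positivity) hρ))).exists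
  have hs1 := eventually_all.2 fun l => eventually_all.2 fun j => hc₀ l j
  have hs2 := N.eventually_sub_lin_le (S.constantCoeff_field (hκ0 i₀))
    (S.converges_field (hconv i₀)) (show 0 < ε₁ / 4 by positivity)
  have hs3 : ∀ᶠ s in 𝓝[>] (0 : ℝ≥0), ∀ j, pnorm (N.ratio * s) ((κ i₀ j - κ (i₀ + 1) j) -
      lin (linPart fun j => κ i₀ j - κ (i₀ + 1) j) j) ≤ ((η / 2 : ℝ≥0) : ℝ≥0∞) * s :=
    eventually_all.2 fun j => (((hconv i₀ j).sub (hconv (i₀ + 1) j)).sub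
      (converges_lin _ j)).eventually_pnorm_le (coeff_eq_zero_of_degree_lt_two
        (F := fun j => κ i₀ j - κ (i₀ + 1) j) (fun j => by simp [hκ0]) j) _ (by positivity)
  have hs4 := eventually_all.2 fun j => (hconv i₀ j).eventually
  obtain ⟨s, hs1, hs2, hs3, ⟨r₁, hr₁, hr₁s⟩, hs0⟩ :=
    (hs1.and (hs2.and (hs3.and ((show ∀ᶠ s in 𝓝[>] (0 : ℝ≥0), ∃ r₁, (∀ j, pnorm r₁ (κ i₀ j) < ⊤) ∧
      s ≤ r₁ by
        obtain ⟨r₁, h, h0⟩ := (hs4.and self_mem_nhdsWithin).exists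
        filter_upwards [Ioc_mem_nhdsGT (h0 : 0 < r₁)] with s hs
        exact ⟨r₁, h, hs.2⟩).and self_mem_nhdsWithin)))).exists
  have hs0 : 0 < s := hs0
  have hs0' : (s : ℝ≥0∞) ≠ 0 := by simpa using hs0.ne'
  have hg : ∀ l j, N.nu s (S.gSeries l j) ≤ c := fun l j =>
    (N.le_pnorm _ _).trans ((hs1 l j).trans (ENNReal.coe_le_coe.2 (hcg l j)))
  set e : ℕ → ℝ≥0 := fun m => (1 / 2) ^ m * η * s with he
  -- The initial step is at most η·s: its linear part contributes one half by the choice of `i₀`,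
  -- its higher-order part the other half by the choice of `s`.
  have hstart : ∀ j, N.nu s (κ i₀ j - κ (i₀ + 1) j) ≤ e 0 := fun j => by
    have h1 : κ i₀ j - κ (i₀ + 1) j = ((κ i₀ j - κ (i₀ + 1) j) -
        lin (linPart fun j => κ i₀ j - κ (i₀ + 1) j) j) +
        lin (linPart fun j => κ i₀ j - κ (i₀ + 1) j) j := by ring
    have h2 : (linPart fun j => κ i₀ j - κ (i₀ + 1) j) =
        linPart (κ i₀) - linPart (κ (i₀ + 1)) - 0 := by
      ext j m
      simp [linPart_apply]
    rw [h1]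
    refine (N.add_le _ _ _).trans ((add_le_add ((N.le_pnorm _ _).trans (hs3 j))
      (nu_lin_le N _ s j (c := η / 2) ?_)).trans ?_)
    · rw [h2]
      exact hi2 j
    · refine le_of_eq ?_
      norm_cast
      simp only [he, pow_zero, one_mul]
      rw [← add_mul, add_halves]
  have hfield : ∀ m, (∀ j, N.nu s (κ i₀ j - κ (i₀ + m) j) ≤ ((2 * η * s : ℝ≥0) : ℝ≥0∞)) →
      ∀ l, N.nu s (S.field (κ (i₀ + m)) l - lin A l) ≤ ((ε₁ * s : ℝ≥0) : ℝ≥0∞) := by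
    intro m hm l
    have h1 : S.field (κ (i₀ + m)) l - lin A l = ((S.field (κ i₀) l -
        lin (linPart (S.field (κ i₀))) l) + lin (linPart (S.field (κ i₀)) - A) l) +
        ∑ j, S.gSeries l j * (κ i₀ j - κ (i₀ + m) j) := by
      rw [← field_sub, lin_sub]
      ring
    rw [h1]
    calc _ ≤ ((((ε₁ / 4 * s : ℝ≥0) : ℝ≥0∞) + ((ε₁ / 4 * s : ℝ≥0) : ℝ≥0∞))) +
          ∑ _j : Fin k, ((c * (2 * η * s) : ℝ≥0) : ℝ≥0∞) := by
          refine (N.add_le _ _ _).trans (add_le_add ((N.add_le _ _ _).trans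
            (add_le_add (by exact_mod_cast hs2 l) (nu_lin_le N _ s l (hi1 l)))) ?_)
          refine (N.sum_le _ _ _).trans (Finset.sum_le_sum fun j _ => (N.mul_le _ _ _).trans ?_)
          rw [ENNReal.coe_mul]
          exact mul_le_mul' (hg l j) (hm j)
      _ = ((ε₁ / 2 * s + k * c * (2 * η) * s : ℝ≥0) : ℝ≥0∞) := by
          rw [Finset.sum_const, Finset.card_univ, Fintype.card_fin, nsmul_eq_mul]
          norm_cast
          have : ε₁ / 4 + ε₁ / 4 = ε₁ / 2 := by
            rw [← two_mul, show (4 : ℝ≥0) = 2 * 2 by norm_num, ← div_div, mul_div_cancel₀]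
            exact two_ne_zero
          rw [← add_mul, this]
          ring
      _ ≤ _ := by
          refine ENNReal.coe_le_coe.2 ?_
          calc _ ≤ ε₁ / 2 * s + ε₁ / 2 * s := by gcongr
            _ = ε₁ * s := by rw [← add_mul, add_halves]
  -- The summand `2 * e m` reserves the geometric tail still to come. It keeps the total drift below
  -- 2ηs, hence the field close to its linear part, so that the contraction applies again in the
  -- next step.
  have hmain : ∀ m, (∀ j, N.nu s (κ i₀ j - κ (i₀ + m) j) + ((2 * e m : ℝ≥0) : ℝ≥0∞) ≤
      ((2 * η * s : ℝ≥0) : ℝ≥0∞)) ∧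
      ∀ j, N.nu s (κ (i₀ + m) j - κ (i₀ + m + 1) j) ≤ e m := by
    intro m
    induction m with
    | zero =>
      refine ⟨fun j => ?_, hstart⟩
      rw [add_zero, sub_self, N.nu_zero, zero_add]
      refine ENNReal.coe_le_coe.2 (le_of_eq ?_)
      simp only [he]
      ring
    | succ m ih =>
      have he2 : e (m + 1) * 2 = e m := by
        simp only [he, pow_succ]
        calc (1 / 2 : ℝ≥0) ^ m * (1 / 2) * η * s * 2 = (1 / 2) ^ m * η * s * (1 / 2 * 2) := by ring
          _ = _ := by rw [div_mul_cancel₀ _ two_ne_zero, mul_one]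
      have h1 : ∀ j, N.nu s (κ i₀ j - κ (i₀ + (m + 1)) j) + ((2 * e (m + 1) : ℝ≥0) : ℝ≥0∞) ≤
          ((2 * η * s : ℝ≥0) : ℝ≥0∞) := fun j => by
        have h2 : κ i₀ j - κ (i₀ + (m + 1)) j = (κ i₀ j - κ (i₀ + m) j) +
            (κ (i₀ + m) j - κ (i₀ + m + 1) j) := by
          rw [add_assoc]
          ring
        rw [h2, mul_comm, he2]
        refine le_trans ?_ (ih.1 j)
        calc _ ≤ (N.nu s (κ i₀ j - κ (i₀ + m) j) + e m) + e m :=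
              add_le_add ((N.add_le _ _ _).trans (add_le_add le_rfl (ih.2 j))) le_rfl
          _ = _ := by
              rw [two_mul, ENNReal.coe_add, add_assoc]
      refine ⟨h1, fun j => ?_⟩
      have hF := hfield (m + 1) fun j => le_self_add.trans (h1 j)
      have hpol := himp (i₀ + m)
      have h3 := nu_policy_sub_le N hR (κ := κ (i₀ + m)) (hV0 (i₀ + m)) (hV0 (i₀ + m + 1))
        (hlie _) (by rw [← hpol]; exact hlie _)
        (by rw [← hpol]; exact S.constantCoeff_field (hκ0 _)) (s := s) (fun l => by
          rw [← hpol]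
          refine (hF l).trans ?_
          rw [ENNReal.coe_mul]
          exact mul_le_mul_left (ENNReal.coe_le_coe.2 (min_le_left _ _)) _) hg
        (e := e m) (fun j => by rw [← hpol]; exact ih.2 j) j
      rw [← hpol, ← himp] at h3
      -- The estimate carries a factor `s` on the left; since `e m` is at most η·s, one factor `e m`
      -- on the right pays for it and for the halving.
      have h4 : D * e m ^ 2 ≤ s * e (m + 1) := by
        have h5 : D * e m ≤ s * (1 / 2) := by
          calc D * e m = (1 / 2) ^ m * (D * η * s) := by simp only [he]; ring
            _ ≤ 1 * (1 / 2 * s) := by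
                gcongr
                exact pow_le_one₀ zero_le (by norm_num)
            _ = _ := by ring
        calc D * e m ^ 2 = D * e m * e m := by ring
          _ ≤ s * (1 / 2) * e m := by gcongr
          _ = s * (1 / 2) * (e (m + 1) * 2) := by rw [he2]
          _ = s * e (m + 1) * (1 / 2 * 2) := by ring
          _ = _ := by rw [div_mul_cancel₀ _ two_ne_zero, mul_one]
      have h6 := h3.trans (ENNReal.coe_le_coe.2 h4)
      rw [ENNReal.coe_mul] at h6
      exact (ENNReal.mul_le_mul_iff_right hs0' ENNReal.coe_ne_top).1 h6
  have hsr : s = N.ratio * (s / N.ratio) := by rw [mul_div_cancel₀ _ hρ.ne']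
  have hle : s / N.ratio ≤ s := div_le_self zero_le N.one_le_ratio
  refine ⟨i₀, s / N.ratio, div_pos hs0 hρ, fun l j => ?_, fun j => ?_, fun m l => ?_, fun m j => ?_⟩
  · exact ((N.pnorm_div_le s _).trans (hg l j)).trans_lt ENNReal.coe_lt_top
  · exact (pnorm_mono (hle.trans hr₁s) _).trans_lt (hr₁ j)
  · refine (N.pnorm_div_le s _).trans ((hfield m (fun j => le_self_add.trans ((hmain m).1 j)) l).trans ?_)
    rw [← ENNReal.coe_mul]
    refine ENNReal.coe_le_coe.2 ?_
    calc ε₁ * s ≤ ε / N.ratio * s := by gcongr; exact min_le_right _ _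
      _ = ε * (s / N.ratio) := by rw [div_mul_eq_mul_div, mul_div_assoc]
  · refine (N.pnorm_div_le s _).trans (((hmain m).2 j).trans (ENNReal.coe_le_coe.2 ?_))
    simp only [he]
    rw [mul_assoc]
    gcongr
    rw [le_div_iff₀ hρ]
    calc η * s * N.ratio = η * N.ratio * s := by ring
      _ ≤ 1 * s := by gcongr
      _ = s := one_mul s

end System

end
end Carleman

open scoped ENNReal NNReal
namespace Carleman
noncomputable section
open MvPowerSeries Filter Topology
open Finsupp (sumElim)

/-! ### Limits of the policy iteration. -/

section Limits

variable {σ : Type*}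

theorem tendsto_half_pow_mul (c : ℝ≥0) :
    Tendsto (fun m : ℕ => ((2 * (1 / 2) ^ m * c : ℝ≥0) : ℝ≥0∞)) atTop (𝓝 0) := by
  have h : Tendsto (fun m : ℕ => (2 * (1 / 2) ^ m * c : ℝ≥0)) atTop (𝓝 (2 * 0 * c)) :=
    (tendsto_const_nhds.mul (NNReal.tendsto_pow_atTop_nhds_zero_of_lt_one
      (NNReal.coe_lt_coe.1 (by norm_num)))).mul_const c
  rw [mul_zero, zero_mul] at h
  rw [← ENNReal.coe_zero]
  exact ENNReal.tendsto_coe.2 h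

/-- A sequence of power series with geometrically decreasing differences converges. -/
theorem exists_limit_of_geometric {r : ℝ≥0} (hr : 0 < r) {p : ℕ → MvPowerSeries σ ℝ}
    (h : ∀ m, pnorm r (p m - p (m + 1)) ≤ (((1 / 2) ^ m * r : ℝ≥0) : ℝ≥0∞)) :
    ∃ q, (∀ m, pnorm r (p m - q) ≤ ((2 * (1 / 2) ^ m * r : ℝ≥0) : ℝ≥0∞)) ∧
      ∀ α, Tendsto (fun m => coeff α (p m)) atTop (𝓝 (coeff α q)) := by
  have hrad : ∀ α : σ →₀ ℕ, radial r α ≠ 0 ∧ radial r α ≠ ⊤ := fun α => by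
    simp [radial, hr.ne', ENNReal.pow_eq_top_iff]
  have hc : ∀ α, ∃ a, Tendsto (fun m => coeff α (p m)) atTop (𝓝 a) := fun α => by
    refine cauchySeq_tendsto_of_complete (cauchySeq_of_edist_le_geometric (1 / 2)
      (r / radial r α) (by simp) (ENNReal.div_ne_top ENNReal.coe_ne_top (hrad α).1) fun m => ?_)
    rw [edist_eq_enorm_sub, ← map_sub]
    have h1 := (le_wnorm (radial r) _ α).trans (h m)
    rw [mul_comm, ← ENNReal.le_div_iff_mul_le (Or.inl (hrad α).1) (Or.inl (hrad α).2)] at h1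
    refine h1.trans (le_of_eq ?_)
    rw [mul_comm, ENNReal.coe_mul, ENNReal.coe_pow, ENNReal.mul_div_right_comm]
    norm_num
  choose a ha using hc
  refine ⟨a, fun m => ?_, ha⟩
  -- The reserve for the remaining tail is carried along, so that the geometric sum telescopes.
  have hfin : ∀ t, pnorm r (p m - p (m + t)) + ((2 * (1 / 2) ^ (m + t) * r : ℝ≥0) : ℝ≥0∞) ≤
      ((2 * (1 / 2) ^ m * r : ℝ≥0) : ℝ≥0∞) := by
    intro t
    induction t with
    | zero => simp [wnorm_zero]
    | succ t ih =>
      refine le_trans ?_ ih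
      have e1 : p m - p (m + (t + 1)) = (p m - p (m + t)) + (p (m + t) - p (m + t + 1)) := by
        rw [← add_assoc]
        ring
      have e2 : (2 * (1 / 2) ^ (m + (t + 1)) * r : ℝ≥0) = (1 / 2) ^ (m + t) * r := by
        rw [← add_assoc, pow_succ]
        calc (2 * ((1 / 2) ^ (m + t) * (1 / 2)) * r : ℝ≥0)
            = (1 / 2) ^ (m + t) * r * (1 / 2 * 2) := by ring
          _ = _ := by rw [div_mul_cancel₀ _ two_ne_zero, mul_one]
      rw [e1, e2]
      calc _ ≤ (pnorm r (p m - p (m + t)) + (((1 / 2) ^ (m + t) * r : ℝ≥0) : ℝ≥0∞)) +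
            (((1 / 2) ^ (m + t) * r : ℝ≥0) : ℝ≥0∞) :=
            add_le_add ((wnorm_add_le _ _ _).trans (add_le_add le_rfl (h _))) le_rfl
        _ = _ := by
            rw [add_assoc, ← ENNReal.coe_add]
            congr 2
            ring
  refine wnorm_le_of_tendsto (p := fun t => p m - p (m + t)) (fun α => (hrad α).2) (fun α => ?_)
    (Eventually.of_forall fun t => le_self_add.trans (hfin t))
  simp only [map_sub]
  refine tendsto_const_nhds.sub ?_
  have := (ha α).comp (tendsto_add_atTop_nat m)
  refine this.congr fun t => ?_
  rw [Function.comp_apply, add_comm]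

theorem tendsto_coeff_mul {p : ℕ → MvPowerSeries σ ℝ} {q : MvPowerSeries σ ℝ}
    (h : ∀ α, Tendsto (fun i => coeff α (p i)) atTop (𝓝 (coeff α q))) (a : MvPowerSeries σ ℝ)
    (α : σ →₀ ℕ) : Tendsto (fun i => coeff α (a * p i)) atTop (𝓝 (coeff α (a * q))) := by
  classical
  simp only [coeff_mul]
  exact tendsto_finsetSum _ fun x _ => tendsto_const_nhds.mul (h _)

theorem tendsto_coeff_pderiv {p : ℕ → MvPowerSeries σ ℝ} {q : MvPowerSeries σ ℝ}
    (h : ∀ α, Tendsto (fun i => coeff α (p i)) atTop (𝓝 (coeff α q))) (l : σ) (α : σ →₀ ℕ) :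
    Tendsto (fun i => coeff α (pderiv ℝ l (p i))) atTop (𝓝 (coeff α (pderiv ℝ l q))) := by
  simp only [coeff_pderiv]
  exact (h _).mul_const _

theorem tendsto_coeff_of_tendsto_pnorm {r : ℝ≥0} (hr : 0 < r) {p : ℕ → MvPowerSeries σ ℝ}
    {q : MvPowerSeries σ ℝ} (h : Tendsto (fun i => pnorm r (p i - q)) atTop (𝓝 0)) (α : σ →₀ ℕ) :
    Tendsto (fun i => coeff α (p i)) atTop (𝓝 (coeff α q)) :=
  tendsto_coeff_of_tendsto_wnorm (by simp [radial, hr.ne']) (by simp [radial]) h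

end Limits

theorem pnorm_sub_comm {σ : Type*} (r : ℝ≥0) (p q : MvPowerSeries σ ℝ) :
    pnorm r (p - q) = pnorm r (q - p) := by
  rw [pnorm, ← wnorm_neg, neg_sub]

namespace System

variable {n k : ℕ} {S : System n k} {Q₁ : Matrix (Fin n) (Fin n) ℝ} {R : Matrix (Fin k) (Fin k) ℝ}
  {A : Matrix (Fin n) (Fin n) ℝ}

theorem tendsto_coeff_policy {V : ℕ → MvPowerSeries (Fin n) ℝ} {V' : MvPowerSeries (Fin n) ℝ}
    (h : ∀ α, Tendsto (fun i => coeff α (V i)) atTop (𝓝 (coeff α V'))) (i : Fin k)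
    (α : Fin n →₀ ℕ) :
    Tendsto (fun t => coeff α (S.policy R (V t) i)) atTop (𝓝 (coeff α (S.policy R V' i))) := by
  simp only [policy, map_sum]
  refine tendsto_finsetSum _ fun j _ => tendsto_coeff_mul (fun β => ?_) _ _
  simp only [map_sum]
  exact tendsto_finsetSum _ fun l _ => tendsto_coeff_mul (tendsto_coeff_pderiv h l) _ _

theorem nu_double_sub_le (N : AdaptedNorm (Matrix.fromBlocks A 0 0 A)) {s : ℝ≥0}
    {F G : Fin n → MvPowerSeries (Fin n) ℝ} {c : ℝ≥0∞}
    (h : ∀ l, pnorm (N.ratio * s) (F l - G l) ≤ c) (l : Fin n ⊕ Fin n) :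
    N.nu s (double F l - double G l) ≤ c := by
  refine (N.le_pnorm _ _).trans ?_
  cases l with
  | inl l =>
    have : double F (Sum.inl l) - double G (Sum.inl l) = inlHom (F l - G l) := by
      rw [map_sub]
      rfl
    rw [this]
    exact (pnorm_inlHom_le _ _).trans (h l)
  | inr l =>
    have : double F (Sum.inr l) - double G (Sum.inr l) = inrHom (F l - G l) := by
      rw [map_sub]
      rfl
    rw [this]
    exact (pnorm_inrHom_le _ _).trans (h l)

theorem pnorm_costSeries_sub_le {r : ℝ≥0} {κ κ' : Fin k → MvPowerSeries (Fin n) ℝ}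
    {M t : ℝ≥0∞} (hκ : ∀ j, pnorm r (κ j) ≤ M) (hκ' : ∀ j, pnorm r (κ' j) ≤ M)
    (h : ∀ j, pnorm r (κ j - κ' j) ≤ t) :
    pnorm r (costSeries Q₁ R κ - costSeries Q₁ R κ') ≤ (∑ i, ∑ j, ‖R i j‖ₑ) * (2 * M) * t := by
  have h1 : costSeries Q₁ R κ - costSeries Q₁ R κ' = ∑ i, ∑ j, C (R i j) *
      (inlHom (κ i) * inrHom (κ j - κ' j) + inlHom (κ i - κ' i) * inrHom (κ' j)) := by
    simp only [costSeries, map_sub, add_sub_add_left_eq_sub, ← Finset.sum_sub_distrib]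
    exact Finset.sum_congr rfl fun i _ => Finset.sum_congr rfl fun j _ => by ring
  rw [h1, mul_assoc, Finset.sum_mul]
  refine (wnorm_sum_le _ _ _).trans (Finset.sum_le_sum fun i _ => ?_)
  rw [Finset.sum_mul]
  refine (wnorm_sum_le _ _ _).trans (Finset.sum_le_sum fun j _ => ?_)
  rw [wnorm_C_mul]
  refine mul_le_mul_right ((wnorm_add_le _ _ _).trans ?_) _
  calc _ ≤ M * t + t * M := by
        refine add_le_add ((pnorm_mul_le _ _ _).trans (mul_le_mul' ?_ ?_))
          ((pnorm_mul_le _ _ _).trans (mul_le_mul' ?_ ?_))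
        · exact (pnorm_inlHom_le _ _).trans (hκ i)
        · exact (pnorm_inrHom_le _ _).trans (h j)
        · exact (pnorm_inlHom_le _ _).trans (h i)
        · exact (pnorm_inrHom_le _ _).trans (hκ' j)
    _ = 2 * M * t := by ring

theorem pnorm_costSeries_lt_top {r : ℝ≥0} {κ : Fin k → MvPowerSeries (Fin n) ℝ}
    (hκ : ∀ j, pnorm r (κ j) < ⊤) : pnorm r (costSeries Q₁ R κ) < ⊤ := by
  have hX : ∀ l : Fin n, pnorm r (X l : MvPowerSeries (Fin n) ℝ) < ⊤ := fun l => by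
    rw [pnorm_X]
    exact ENNReal.coe_lt_top
  have hm : ∀ (c : ℝ) (p q : MvPowerSeries (Fin n) ℝ), pnorm r p < ⊤ → pnorm r q < ⊤ →
      pnorm r (C c * (inlHom p * inrHom q)) < ⊤ := fun c p q hp hq => by
    rw [pnorm, wnorm_C_mul]
    exact ENNReal.mul_lt_top enorm_lt_top ((pnorm_mul_le _ _ _).trans_lt (ENNReal.mul_lt_top
      ((pnorm_inlHom_le _ _).trans_lt hp) ((pnorm_inrHom_le _ _).trans_lt hq)))
  refine (wnorm_add_le _ _ _).trans_lt (ENNReal.add_lt_top.2 ⟨?_, ?_⟩)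
  · exact (wnorm_sum_le _ _ _).trans_lt (ENNReal.sum_lt_top.2 fun l _ =>
      (wnorm_sum_le _ _ _).trans_lt (ENNReal.sum_lt_top.2 fun m _ => hm _ _ _ (hX l) (hX m)))
  · exact (wnorm_sum_le _ _ _).trans_lt (ENNReal.sum_lt_top.2 fun i _ =>
      (wnorm_sum_le _ _ _).trans_lt (ENNReal.sum_lt_top.2 fun j _ => hm _ _ _ (hκ i) (hκ j)))

variable {K₀ : Matrix (Fin k) (Idx n) ℝ}

theorem LyapunovIteration.stable (hQ : Q₁.PosDef) (hR : R.PosDef) (hK₀ : GainConverges K₀)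
    (hS : S.Stabilizing K₀) {P : ℕ → Matrix (Idx n) (Idx n) ℝ} {K : ℕ → Matrix (Fin k) (Idx n) ℝ}
    (h : S.LyapunovIteration Q₁ R K₀ P K) (i : ℕ) : GainConverges (K i) ∧ S.Stabilizing (K i) := by
  induction i with
  | zero => rw [h.start]; exact ⟨hK₀, hS⟩
  | succ i ih =>
    rw [h.improve]
    exact ⟨gainConverges_gain ((h.evaluate i).converges ih.1 ih.2),
      stabilizing_gain hQ hR ih.2 (h.evaluate i)⟩

theorem existsUnique_lyapunovIteration (hQ : Q₁.PosDef) (hR : R.PosDef) (hK₀ : GainConverges K₀)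
    (hS : S.Stabilizing K₀) : ∃! PK : (ℕ → Matrix (Idx n) (Idx n) ℝ) ×
      (ℕ → Matrix (Fin k) (Idx n) ℝ), S.LyapunovIteration Q₁ R K₀ PK.1 PK.2 := by
  classical
  -- The evaluation step becomes a total function; its value on gains that are not convergent and
  -- stabilizing is never used.
  have hex : ∀ K, ∃ P, GainConverges K → S.Stabilizing K → S.IsCostMatrix Q₁ R K P := fun K => by
    by_cases hK : GainConverges K ∧ S.Stabilizing K
    · obtain ⟨P, hP⟩ := exists_isCostMatrix (isSymm_of_posDef hQ) (isSymm_of_posDef hR) hK.1 hK.2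
      exact ⟨P, fun _ _ => hP⟩
    · exact ⟨0, fun h1 h2 => absurd ⟨h1, h2⟩ hK⟩
  choose cm hcm using hex
  let K : ℕ → Matrix (Fin k) (Idx n) ℝ := fun i => Nat.rec K₀ (fun _ K => S.gain R (cm K)) i
  have hgood : ∀ i, GainConverges (K i) ∧ S.Stabilizing (K i) := fun i => by
    induction i with
    | zero => exact ⟨hK₀, hS⟩
    | succ i ih =>
      have := hcm _ ih.1 ih.2
      exact ⟨gainConverges_gain (this.converges ih.1 ih.2), stabilizing_gain hQ hR ih.2 this⟩
  refine ⟨(fun i => cm (K i), K), ⟨rfl, fun i => hcm _ (hgood i).1 (hgood i).2, fun _ => rfl⟩, ?_⟩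
  rintro ⟨P', K'⟩ h
  have hst := h.stable hQ hR hK₀ hS
  have hKK : ∀ i, K' i = K i := fun i => by
    induction i with
    | zero => exact h.start
    | succ i ih =>
      have h1 : P' i = cm (K i) := (h.evaluate i).unique (hst i).1 (hst i).2 (by
        dsimp only
        rw [ih]
        exact hcm _ (hgood i).1 (hgood i).2)
      have := h.improve i
      dsimp only at this
      rw [this, h1]
  refine Prod.ext (funext fun i => ?_) (funext hKK)
  refine (h.evaluate i).unique (hst i).1 (hst i).2 ?_
  dsimp only
  rw [hKK]
  exact hcm _ (hgood i).1 (hgood i).2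

/-- The limits of the gains and the cost matrices of a policy iteration. -/
theorem LyapunovIteration.exists_limit (hQ : Q₁.PosDef) (hR : R.PosDef) (hK₀ : GainConverges K₀)
    (hS : S.Stabilizing K₀) {P : ℕ → Matrix (Idx n) (Idx n) ℝ} {K : ℕ → Matrix (Fin k) (Idx n) ℝ}
    (h : S.LyapunovIteration Q₁ R K₀ P K) :
    ∃ Kstar Pstar, GainConverges Kstar ∧ S.Stabilizing Kstar ∧ S.IsCostMatrix Q₁ R Kstar Pstar ∧
      Kstar = S.gain R Pstar ∧ ∃ r : ℝ≥0, 0 < r ∧ pnorm r (biSeries Pstar) < ⊤ ∧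
        (∀ i, pnorm r (biSeries (P i)) < ⊤) ∧
        Tendsto (fun i => pnorm r (biSeries (P i) - biSeries Pstar)) atTop (𝓝 0) := by
  have hst := h.stable hQ hR hK₀ hS
  -- The degree-one blocks of the iteration perform Kleinman's iteration for the linearized problem.
  obtain ⟨L, hL, hH⟩ := exists_tendsto_kleinman (A := S.driftLin) (B := S.inputLin) hQ hR
    (fun i => linBlock_isSymm (h.evaluate i).1) (K := fun i => linPart (gainSeries (K i)))
    (fun i => by rw [h.improve, linPart_gain])
    (fun i => by
      have := (S.stabilizing_iff _).1 (hst i).2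
      rwa [linPart_field _ (constantCoeff_gainSeries _)] at this)
    fun i => (h.evaluate i).linBlock_eq
  obtain ⟨A, hA⟩ : ∃ A, A = S.driftLin - S.inputLin * L := ⟨_, rfl⟩
  rw [← hA] at hH
  -- This norm lives on series in (x, y) and differs from the one inside `exists_tail`. There the
  -- tolerance eps/ratio is requested in the plain norm of radius r = ratio·s, so that this norm of
  -- radius s sees the tolerance eps.
  obtain ⟨N⟩ := exists_adaptedNorm (hurwitz_fromBlocks hH)
  obtain ⟨i₀, r, hr, hg, hκ₀, hF, hδ⟩ := exists_tail (Q₁ := Q₁) hR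
    (κ := fun i => gainSeries (K i)) (V := fun i => rowSeries (vectorize (P i)))
    (fun i => constantCoeff_gainSeries _) (fun i => constantCoeff_rowSeries _)
    (fun i => (gainConverges_iff_converges _).1 (hst i).1)
    (fun i => (h.evaluate i).lie_vectorize)
    (fun i => by rw [h.improve, gainSeries_gain_eq_policy (h.evaluate i).1]) hL hA hH
    (div_pos N.eps_pos N.ratio_pos)
  set s : ℝ≥0 := r / N.ratio with hs
  have hrs : r = N.ratio * s := by rw [hs, mul_div_cancel₀ _ N.ratio_pos.ne']
  have hs0 : 0 < s := div_pos hr N.ratio_pos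
  choose κ hκ hκc using fun j => exists_limit_of_geometric hr
    (p := fun m => gainSeries (K (i₀ + m)) j) fun m => hδ m j
  set t : ℕ → ℝ≥0∞ := fun m => ((2 * (1 / 2) ^ m * r : ℝ≥0) : ℝ≥0∞) with ht
  have ht0 : Tendsto t atTop (𝓝 0) := tendsto_half_pow_mul r
  -- The limit gain.
  have hκ0 : ∀ j, constantCoeff (κ j) = 0 := fun j => by
    have := hκc j 0
    simp only [coeff_zero_eq_constantCoeff_apply, constantCoeff_gainSeries] at this
    exact (tendsto_nhds_unique tendsto_const_nhds this).symm
  obtain ⟨Kstar, hKstar⟩ : ∃ Kstar, gainSeries Kstar = κ :=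
    ⟨Matrix.of fun j => rowOf (κ j), funext fun j => rowSeries_rowOf (hκ0 j)⟩
  have hκfin : ∀ j, pnorm r (κ j) < ⊤ := fun j => by
    have h1 : κ j = gainSeries (K i₀) j - (gainSeries (K i₀) j - κ j) := by ring
    rw [h1]
    refine (wnorm_sub_le _ _ _).trans_lt (ENNReal.add_lt_top.2 ⟨hκ₀ j, ?_⟩)
    exact (hκ j 0).trans_lt ENNReal.coe_lt_top
  have hKc : GainConverges Kstar := by
    rw [gainConverges_iff_converges, hKstar]
    exact fun j => ⟨r, hr, hκfin j⟩
  have hlinκ : linPart κ = L := by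
    ext j m
    have h1 := tendsto_pi_nhds.1 (tendsto_pi_nhds.1 (hL.comp (tendsto_add_atTop_nat i₀)) j) m
    refine tendsto_nhds_unique (hκc j (Finsupp.single m 1)) (h1.congr fun i => ?_)
    rw [Function.comp_apply, add_comm]
    rfl
  have hKs : S.Stabilizing Kstar := by
    rw [stabilizing_iff, hKstar, linPart_field _ hκ0, hlinκ, ← hA]
    exact hH
  obtain ⟨Pstar, hP⟩ := exists_isCostMatrix (isSymm_of_posDef hQ) (isSymm_of_posDef hR) hKc hKs
  -- The limit vector field.
  have hfd : ∀ m l, pnorm r (S.field κ l - S.field (gainSeries (K (i₀ + m))) l) ≤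
      (∑ l, ∑ j, pnorm r (S.gSeries l j)) * t m := fun m l => by
    rw [field_sub]
    refine (wnorm_sum_le _ _ _).trans ?_
    calc _ ≤ ∑ j, pnorm r (S.gSeries l j) * t m :=
          Finset.sum_le_sum fun j _ => (pnorm_mul_le _ _ _).trans (mul_le_mul_right (hκ j m) _)
      _ ≤ _ := by
          rw [← Finset.sum_mul]
          exact mul_le_mul_left (Finset.single_le_sum (f := fun l => ∑ j, pnorm r (S.gSeries l j))
            (fun _ _ => zero_le) (Finset.mem_univ l)) _
  set G : ℝ≥0∞ := ∑ l, ∑ j, pnorm r (S.gSeries l j) with hG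
  have hGfin : G ≠ ⊤ :=
    (ENNReal.sum_lt_top.2 fun l _ => ENNReal.sum_lt_top.2 fun j _ => hg l j).ne
  -- The closeness of the fields to the linear field of A passes to the limit by Fatou's lemma.
  have hFstar : ∀ l, pnorm r (S.field κ l - lin A l) ≤ ((N.eps / N.ratio : ℝ≥0) : ℝ≥0∞) * r := by
    intro l
    refine wnorm_le_of_tendsto (p := fun m => S.field (gainSeries (K (i₀ + m))) l - lin A l)
      (fun α => by simp [radial]) (tendsto_coeff_of_tendsto_pnorm hr ?_)
      (Eventually.of_forall fun m => hF m l)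
    refine tendsto_of_tendsto_of_tendsto_of_le_of_le tendsto_const_nhds
      (g := fun _ => (0 : ℝ≥0∞)) (h := fun m => G * t m) ?_ (fun _ => zero_le) fun m => ?_
    · simpa using ENNReal.Tendsto.const_mul ht0 (Or.inr hGfin)
    · rw [sub_sub_sub_cancel_right]
      rw [pnorm_sub_comm]
      exact hfd m l
  have heps : ((N.eps / N.ratio : ℝ≥0) : ℝ≥0∞) * r = N.eps * s := by
    rw [← ENNReal.coe_mul, ← ENNReal.coe_mul, hs, div_mul_eq_mul_div, mul_div_assoc]
  have hdbl : ∀ κ' : Fin k → MvPowerSeries (Fin n) ℝ,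
      (∀ l, pnorm r (S.field κ' l - lin A l) ≤ ((N.eps / N.ratio : ℝ≥0) : ℝ≥0∞) * r) →
      ∀ l, N.nu s (double (S.field κ') l - lin (Matrix.fromBlocks A 0 0 A) l) ≤ N.eps * s := by
    intro κ' h1 l
    rw [← double_lin, ← heps]
    exact nu_double_sub_le N (by rw [← hrs]; exact h1) l
  have hnu : ∀ p, pnorm r p < ⊤ → N.nu s p < ⊤ := fun p hp =>
    N.lt_top_of_pnorm (by rwa [← hrs])
  -- The limit cost matrix on the fixed polydisc.
  have hlie := hP.lie_eq
  rw [hKstar] at hlie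
  have hcostfin : N.nu s (lie (double (S.field κ)) (biSeries Pstar)) < ⊤ := by
    rw [hlie, N.neg]
    exact hnu _ (pnorm_costSeries_lt_top hκfin)
  have h0star := constantCoeff_double (S.constantCoeff_field hκ0)
  have hWfin : N.nu s (biSeries Pstar) < ⊤ :=
    (N.self_le s _ h0star (hdbl κ hFstar) _ (constantCoeff_biSeries _)).trans_lt
      (ENNReal.mul_lt_top ENNReal.coe_lt_top hcostfin)
  have hdW : ∀ l, N.nu s (pderiv ℝ l (biSeries Pstar)) < ⊤ := fun l => by
    have h1 := (N.pderiv_le s _ h0star (hdbl κ hFstar) _ (constantCoeff_biSeries Pstar) l).trans_lt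
      (ENNReal.mul_lt_top ENNReal.coe_lt_top hcostfin)
    by_contra h2
    rw [not_lt_top_iff] at h2
    rw [h2, ENNReal.mul_top (by simpa using hs0.ne')] at h1
    exact lt_irrefl _ h1
  have hκm : ∀ m j, pnorm r (gainSeries (K (i₀ + m)) j) ≤ ∑ j, pnorm r (κ j) + 2 * r := by
    intro m j
    have h1 : gainSeries (K (i₀ + m)) j = κ j + (gainSeries (K (i₀ + m)) j - κ j) := by ring
    rw [h1]
    refine (wnorm_add_le _ _ _).trans (add_le_add (Finset.single_le_sum
      (f := fun j => pnorm r (κ j)) (fun _ _ => zero_le) (Finset.mem_univ j)) ((hκ j m).trans ?_))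
    have : (2 * (1 / 2) ^ m * r : ℝ≥0) ≤ 2 * r := by
      have : ((1 / 2 : ℝ≥0)) ^ m ≤ 1 := pow_le_one₀ zero_le (NNReal.coe_le_coe.1 (by norm_num))
      calc (2 * (1 / 2) ^ m * r : ℝ≥0) ≤ 2 * 1 * r := by gcongr
        _ = 2 * r := by rw [mul_one]
    exact_mod_cast this
  set M : ℝ≥0∞ := ∑ j, pnorm r (κ j) + 2 * r with hM
  have hMfin : M ≠ ⊤ := (ENNReal.add_lt_top.2 ⟨ENNReal.sum_lt_top.2 fun j _ => hκfin j,
    ENNReal.mul_lt_top (by simp) ENNReal.coe_lt_top⟩).ne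
  have hκM : ∀ j, pnorm r (κ j) ≤ M := fun j => (Finset.single_le_sum
      (f := fun j => pnorm r (κ j)) (fun _ _ => zero_le) (Finset.mem_univ j)).trans le_self_add
  have hPfin : ∀ m, N.nu s (biSeries (P (i₀ + m))) < ⊤ := fun m => by
    refine (N.self_le s _ (constantCoeff_double_field (K (i₀ + m))) (hdbl _ (hF m)) _
      (constantCoeff_biSeries _)).trans_lt (ENNReal.mul_lt_top ENNReal.coe_lt_top ?_)
    rw [(h.evaluate _).lie_eq, N.neg]
    exact hnu _ (pnorm_costSeries_lt_top fun j => (hκm m j).trans_lt hMfin.lt_top)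
  set CW : ℝ≥0∞ := N.bound * ((∑ i, ∑ j, ‖R i j‖ₑ) * (2 * M) +
    ∑ l, G * N.nu s (pderiv ℝ l (biSeries Pstar))) with hCW
  have hCWfin : CW ≠ ⊤ := by
    refine ENNReal.mul_ne_top ENNReal.coe_ne_top (ENNReal.add_ne_top.2 ⟨?_, ?_⟩)
    · refine ENNReal.mul_ne_top ?_ (ENNReal.mul_ne_top (by simp) hMfin)
      exact (ENNReal.sum_lt_top.2 fun i _ => ENNReal.sum_lt_top.2 fun j _ => enorm_lt_top).ne
    · exact (ENNReal.sum_lt_top.2 fun l _ => ENNReal.mul_lt_top hGfin.lt_top (hdW l)).ne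
  have hdiff : ∀ m, N.nu s (biSeries (P (i₀ + m)) - biSeries Pstar) ≤ CW * t m := fun m => by
    refine (N.self_le s _ (constantCoeff_double_field (K (i₀ + m))) (hdbl _ (hF m)) _
      (by simp [constantCoeff_biSeries])).trans ?_
    -- The difference of the solutions solves the m-th equation, with the change of the cost and the
    -- change of the field applied to the gradient of the limit as right-hand side. Both are bounded
    -- by a constant times `t m`.
    have h1 : lie (double (S.field (gainSeries (K (i₀ + m))))) (biSeries (P (i₀ + m)) -
        biSeries Pstar) = (costSeries Q₁ R κ - costSeries Q₁ R (gainSeries (K (i₀ + m)))) +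
        ∑ l, (double (S.field κ) l - double (S.field (gainSeries (K (i₀ + m)))) l) *
          pderiv ℝ l (biSeries Pstar) := by
      have h2 : ∑ l, (double (S.field κ) l - double (S.field (gainSeries (K (i₀ + m)))) l) *
          pderiv ℝ l (biSeries Pstar) = lie (double (S.field κ)) (biSeries Pstar) -
            lie (double (S.field (gainSeries (K (i₀ + m))))) (biSeries Pstar) := by
        simp only [lie, sub_mul, Finset.sum_sub_distrib]
      rw [h2, hlie, lie_sub, (h.evaluate _).lie_eq]
      ring
    rw [h1, hCW, mul_assoc, add_mul]
    refine mul_le_mul_right ((N.add_le _ _ _).trans (add_le_add ?_ ?_)) _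
    · refine (N.le_pnorm _ _).trans ?_
      rw [← hrs]
      exact pnorm_costSeries_sub_le hκM (hκm m) fun j =>
        (pnorm_sub_comm _ _ _).trans_le (hκ j m)
    · rw [Finset.sum_mul]
      refine (N.sum_le _ _ _).trans (Finset.sum_le_sum fun l _ => (N.mul_le _ _ _).trans ?_)
      rw [mul_right_comm]
      exact mul_le_mul_left (nu_double_sub_le N (by rw [← hrs]; exact hfd m) l) _
  have hWlim : Tendsto (fun m => pnorm (s / N.ratio) (biSeries (P (i₀ + m)) - biSeries Pstar))
      atTop (𝓝 0) := by
    refine tendsto_of_tendsto_of_tendsto_of_le_of_le tendsto_const_nhds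
      (g := fun _ => (0 : ℝ≥0∞)) (h := fun m => CW * t m) ?_ (fun _ => zero_le) fun m => ?_
    · simpa using ENNReal.Tendsto.const_mul ht0 (Or.inr hCWfin)
    · exact (N.pnorm_div_le s _).trans (hdiff m)
  have hs1 : 0 < s / N.ratio := div_pos hs0 N.ratio_pos
  -- The limit gain is the gain of the limit.
  have hgain : Kstar = S.gain R Pstar := by
    have hV : ∀ α, Tendsto (fun m => coeff α (rowSeries (vectorize (P (i₀ + m))))) atTop
        (𝓝 (coeff α (rowSeries (vectorize Pstar)))) := by
      refine tendsto_coeff_of_tendsto_pnorm hs1 ?_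
      refine tendsto_of_tendsto_of_tendsto_of_le_of_le tendsto_const_nhds hWlim
        (fun _ => zero_le) fun m => ?_
      dsimp only
      rw [rowSeries_vectorize, rowSeries_vectorize, ← map_sub]
      exact pnorm_diagHom_le _ _
    have h1 : κ = S.policy R (rowSeries (vectorize Pstar)) := by
      funext j
      ext α
      refine tendsto_nhds_unique ((hκc j α).comp (tendsto_add_atTop_nat 1))
        ((tendsto_coeff_policy hV j α).congr fun m => ?_)
      rw [← gainSeries_gain_eq_policy (h.evaluate _).1, ← h.improve]
      rfl
    rw [← hKstar, ← gainSeries_gain_eq_policy hP.1] at h1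
    exact funext fun j => rowSeries_injective (congrFun h1 j)
  -- The first `i₀` iterates converge on polydiscs of their own; being finitely many, they only
  -- shrink the radius.
  obtain ⟨r', hr', hle, hpos⟩ := ((((eventually_all_finset (Finset.range i₀)).2 fun i _ =>
    ((h.evaluate i).converges (hst i).1 (hst i).2).eventually)).and
      ((show ∀ᶠ r' in 𝓝[>] (0 : ℝ≥0), r' ≤ s / N.ratio by
        filter_upwards [Ioc_mem_nhdsGT hs1] with r' h1 using h1.2).and self_mem_nhdsWithin)).exists
  refine ⟨Kstar, Pstar, hKc, hKs, hP, hgain, r', hpos, ?_, fun i => ?_, ?_⟩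
  · exact (pnorm_mono hle _).trans_lt ((N.pnorm_div_le s _).trans_lt hWfin)
  · by_cases hi : i < i₀
    · exact hr' i (Finset.mem_range.2 hi)
    · obtain ⟨m, rfl⟩ := Nat.exists_eq_add_of_le (not_lt.1 hi)
      exact (pnorm_mono hle _).trans_lt ((N.pnorm_div_le s _).trans_lt (hPfin m))
  · rw [← tendsto_add_atTop_iff_nat i₀]
    refine tendsto_of_tendsto_of_tendsto_of_le_of_le tendsto_const_nhds hWlim
      (fun _ => zero_le) fun m => ?_
    dsimp only
    rw [add_comm m]
    exact pnorm_mono hle _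

end System

end
end Carleman

open scoped ENNReal NNReal
namespace Carleman
noncomputable section
open MvPowerSeries Filter Topology
open Finsupp (sumElim)

/-! ### Power series as functions: evaluation, derivatives and the identity theorem. -/

section Mono

variable {n : ℕ}

theorem mono_zero (x : Fin n → ℝ) : mono x 0 = 1 := by simp [mono]

theorem mono_add (x : Fin n → ℝ) (α β : Fin n →₀ ℕ) :
    mono x (α + β) = mono x α * mono x β := by
  simp [mono, pow_add, Finset.prod_mul_distrib]

theorem mono_single (x : Fin n → ℝ) (l : Fin n) : mono x (Finsupp.single l 1) = x l := by
  rw [mono, Finset.prod_eq_single l]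
  · simp
  · intro b _ hb
    rw [Finsupp.single_eq_of_ne hb, pow_zero]
  · simp

theorem mono_zero_left {α : Fin n →₀ ℕ} (hα : α ≠ 0) : mono (0 : Fin n → ℝ) α = 0 := by
  obtain ⟨i, hi⟩ := Finsupp.ne_iff.1 hα
  exact Finset.prod_eq_zero (Finset.mem_univ i) (by simpa using hi)

theorem norm_mono_le (x : Fin n → ℝ) (α : Fin n →₀ ℕ) : ‖mono x α‖ ≤ ‖x‖ ^ α.degree := by
  rw [mono, norm_prod, Finsupp.degree_eq_sum, ← Finset.prod_pow_eq_pow_sum]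
  refine Finset.prod_le_prod (fun _ _ => norm_nonneg _) fun i _ => ?_
  rw [norm_pow]
  exact pow_le_pow_left₀ (norm_nonneg _) (norm_le_pi_norm x i) _

theorem hasFDerivAt_mono (α : Fin n →₀ ℕ) (x : Fin n → ℝ) : HasFDerivAt (fun y => mono y α)
    (∑ l, ((α l : ℝ) * mono x (α - Finsupp.single l 1)) •
      ContinuousLinearMap.proj (R := ℝ) (φ := fun _ : Fin n => ℝ) l) x := by
  have h := HasFDerivAt.finsetProd (u := Finset.univ) (x := x)
    (g := fun (i : Fin n) (y : Fin n → ℝ) => y i ^ α i)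
    (fun i _ => ((ContinuousLinearMap.proj (R := ℝ) (φ := fun _ : Fin n => ℝ) i).hasFDerivAt
      (x := x)).pow (α i))
  refine h.congr_fderiv (Finset.sum_congr rfl fun l _ => ?_)
  have h1 : mono x (α - Finsupp.single l 1) =
      x l ^ (α l - 1) * ∏ j ∈ Finset.univ.erase l, x j ^ α j := by
    rw [mono, ← Finset.mul_prod_erase _ _ (Finset.mem_univ l)]
    congr 1
    · simp
    · refine Finset.prod_congr rfl fun j hj => ?_
      rw [Finsupp.tsub_apply, Finsupp.single_eq_of_ne (Finset.ne_of_mem_erase hj), tsub_zero]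
  rw [h1, smul_smul]
  congr 1
  simp
  ring

theorem norm_mul_mono_sub_le {x : Fin n → ℝ} {s : ℝ} (hx : ‖x‖ ≤ s) (α : Fin n →₀ ℕ) (l : Fin n) :
    ‖(α l : ℝ) * mono x (α - Finsupp.single l 1)‖ ≤ α.degree * s ^ (α.degree - 1) := by
  have hs : 0 ≤ s := (norm_nonneg x).trans hx
  -- If α_l = 0, the truncated subtraction does not lower the degree, but the factor α_l vanishes.
  rcases Nat.eq_zero_or_pos (α l) with h0 | h0
  · rw [h0]
    simp
    positivity
  · have h1 : Finsupp.single l 1 ≤ α := by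
      rw [Finsupp.single_le_iff]
      exact h0
    have h2 := congrArg Finsupp.degree (add_tsub_cancel_of_le h1)
    rw [map_add, Finsupp.degree_single] at h2
    have h3 : (α - Finsupp.single l 1).degree = α.degree - 1 := by omega
    rw [norm_mul]
    refine mul_le_mul ?_ ((norm_mono_le _ _).trans ?_) (norm_nonneg _) (by positivity)
    · rw [Real.norm_natCast]
      exact_mod_cast Finsupp.le_degree l α
    · rw [h3]
      exact pow_le_pow_left₀ (norm_nonneg _) hx _

/-- Bernoulli's inequality s^d + d s^(d-1)(r - s) ≤ r^d, by induction. It bounds the differentiated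
terms by the terms at the larger radius. -/
theorem mul_pow_pred_le {r s : ℝ} (hs : 0 ≤ s) (hrs : s < r) (d : ℕ) :
    d * s ^ (d - 1) ≤ r ^ d / (r - s) := by
  have hr : 0 < r - s := by linarith
  rw [le_div_iff₀ hr]
  have key : ∀ d : ℕ, s ^ (d + 1) + (d + 1 : ℕ) * s ^ d * (r - s) ≤ r ^ (d + 1) := by
    intro d
    induction d with
    | zero => simp
    | succ d ih =>
      have h1 : r * (s ^ (d + 1) + (d + 1 : ℕ) * s ^ d * (r - s)) ≤ r * r ^ (d + 1) :=
        mul_le_mul_of_nonneg_left ih (by linarith)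
      have h2 : 0 ≤ ((d + 1 : ℕ) : ℝ) * s ^ d * (r - s) * (r - s) := by positivity
      have e1 : r ^ (d + 1 + 1) = r * r ^ (d + 1) := by ring
      have e2 : s ^ (d + 1 + 1) + ((d + 1 + 1 : ℕ) : ℝ) * s ^ (d + 1) * (r - s) =
          r * (s ^ (d + 1) + (d + 1 : ℕ) * s ^ d * (r - s)) -
            ((d + 1 : ℕ) : ℝ) * s ^ d * (r - s) * (r - s) := by
        push_cast
        ring
      rw [e1, e2]
      linarith
  cases d with
  | zero => simp
  | succ d =>
    have := key d
    have h2 : 0 ≤ s ^ (d + 1) := by positivity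
    simp only [Nat.add_sub_cancel]
    linarith

end Mono

section Eval

variable {n : ℕ}

/-- The value of a power series at a point. -/
def eval (p : MvPowerSeries (Fin n) ℝ) (x : Fin n → ℝ) : ℝ := ∑' α, coeff α p * mono x α

theorem summable_coeff_mul_pow {r : ℝ≥0} {p : MvPowerSeries (Fin n) ℝ} (hp : pnorm r p < ⊤) :
    Summable fun α : Fin n →₀ ℕ => ‖coeff α p‖ * (r : ℝ) ^ α.degree := by
  have h3 : pnorm r p = ∑' α : Fin n →₀ ℕ, ((‖coeff α p‖₊ * r ^ α.degree : ℝ≥0) : ℝ≥0∞) := by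
    refine tsum_congr fun α => ?_
    rw [radial, enorm_eq_nnnorm, mul_comm]
    push_cast
    rfl
  rw [h3, lt_top_iff_ne_top, ENNReal.tsum_coe_ne_top_iff_summable_coe] at hp
  simpa using hp

theorem tsum_coeff_mul_pow (r : ℝ≥0) (p : MvPowerSeries (Fin n) ℝ) :
    ∑' α : Fin n →₀ ℕ, ‖coeff α p‖ * (r : ℝ) ^ α.degree = (pnorm r p).toReal := by
  have h3 : pnorm r p = ∑' α : Fin n →₀ ℕ, ((‖coeff α p‖₊ * r ^ α.degree : ℝ≥0) : ℝ≥0∞) := by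
    refine tsum_congr fun α => ?_
    rw [radial, enorm_eq_nnnorm, mul_comm]
    push_cast
    rfl
  rw [h3, ENNReal.tsum_toReal_eq (fun _ => ENNReal.coe_ne_top)]
  simp

/-- The power series `p` converges absolutely at `x`, with value `v`. -/
structure HasEval (p : MvPowerSeries (Fin n) ℝ) (x : Fin n → ℝ) (v : ℝ) : Prop where
  fin : pnorm ‖x‖₊ p < ⊤
  eval_eq : eval p x = v

theorem norm_coeff_mul_mono_le (p : MvPowerSeries (Fin n) ℝ) (x : Fin n → ℝ) (α : Fin n →₀ ℕ) :
    ‖coeff α p * mono x α‖ ≤ ‖coeff α p‖ * (‖x‖₊ : ℝ) ^ α.degree := by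
  rw [norm_mul, coe_nnnorm]
  exact mul_le_mul_of_nonneg_left (norm_mono_le x α) (norm_nonneg _)

theorem summable_norm_eval {p : MvPowerSeries (Fin n) ℝ} {x : Fin n → ℝ}
    (h : pnorm ‖x‖₊ p < ⊤) : Summable fun α => ‖coeff α p * mono x α‖ :=
  (summable_coeff_mul_pow h).of_nonneg_of_le (fun _ => norm_nonneg _) (norm_coeff_mul_mono_le p x)

theorem hasEval_eval {p : MvPowerSeries (Fin n) ℝ} {x : Fin n → ℝ} (h : pnorm ‖x‖₊ p < ⊤) :
    HasEval p x (eval p x) := ⟨h, rfl⟩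

theorem HasEval.hasSum {p : MvPowerSeries (Fin n) ℝ} {x : Fin n → ℝ} {v : ℝ} (h : HasEval p x v) :
    HasSum (fun α => coeff α p * mono x α) v := by
  rw [← h.eval_eq]
  exact (summable_norm_eval h.fin).of_norm.hasSum

theorem HasEval.of_hasSum {p : MvPowerSeries (Fin n) ℝ} {x : Fin n → ℝ} {v : ℝ}
    (h : pnorm ‖x‖₊ p < ⊤) (hs : HasSum (fun α => coeff α p * mono x α) v) : HasEval p x v :=
  ⟨h, hs.tsum_eq⟩

theorem abs_eval_le {p : MvPowerSeries (Fin n) ℝ} {x : Fin n → ℝ} (h : pnorm ‖x‖₊ p < ⊤) :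
    |eval p x| ≤ (pnorm ‖x‖₊ p).toReal := by
  rw [← tsum_coeff_mul_pow, ← Real.norm_eq_abs]
  exact tsum_of_norm_bounded (summable_coeff_mul_pow h).hasSum (norm_coeff_mul_mono_le p x)

namespace HasEval

variable {p q : MvPowerSeries (Fin n) ℝ} {x : Fin n → ℝ} {v w : ℝ}

theorem add (hp : HasEval p x v) (hq : HasEval q x w) : HasEval (p + q) x (v + w) := by
  refine of_hasSum ((wnorm_add_le _ p q).trans_lt (ENNReal.add_lt_top.2 ⟨hp.fin, hq.fin⟩)) ?_
  simpa only [map_add, add_mul] using hp.hasSum.add hq.hasSum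

theorem neg (hp : HasEval p x v) : HasEval (-p) x (-v) := by
  refine of_hasSum ((wnorm_neg _ p).trans_lt hp.fin) ?_
  simpa only [map_neg, neg_mul] using hp.hasSum.neg

theorem sub (hp : HasEval p x v) (hq : HasEval q x w) : HasEval (p - q) x (v - w) := by
  simpa only [sub_eq_add_neg] using hp.add hq.neg

theorem const (c : ℝ) (x : Fin n → ℝ) : HasEval (C c) x c := by
  refine of_hasSum (by rw [pnorm_C]; exact enorm_lt_top) ?_
  have := hasSum_single (f := fun α => coeff α (C c : MvPowerSeries (Fin n) ℝ) * mono x α) 0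
    fun α hα => by rw [coeff_C, if_neg hα, zero_mul]
  simpa [mono_zero] using this

theorem var (l : Fin n) (x : Fin n → ℝ) : HasEval (X l) x (x l) := by
  refine of_hasSum (by rw [pnorm_X]; exact ENNReal.coe_lt_top) ?_
  have := hasSum_single (f := fun α => coeff α (X l : MvPowerSeries (Fin n) ℝ) * mono x α)
    (Finsupp.single l 1) fun α hα => by rw [coeff_X, if_neg hα, zero_mul]
  simpa [mono_single] using this

theorem sum {ι : Type*} {s : Finset ι} {p : ι → MvPowerSeries (Fin n) ℝ} {v : ι → ℝ}
    (h : ∀ i ∈ s, HasEval (p i) x (v i)) : HasEval (∑ i ∈ s, p i) x (∑ i ∈ s, v i) := by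
  classical
  induction s using Finset.induction_on with
  | empty => simpa using const (0 : ℝ) x
  | insert a s ha ih =>
    rw [Finset.sum_insert ha, Finset.sum_insert ha]
    exact (h a (Finset.mem_insert_self _ _)).add
      (ih fun i hi => h i (Finset.mem_insert_of_mem hi))

end HasEval

theorem hasSum_of_eq {ι E : Type*} [AddCommMonoid E] [TopologicalSpace E] {f g : ι → E} {a : E}
    (h : HasSum f a) (e : ∀ i, g i = f i) : HasSum g a := by
  rwa [funext e]

theorem hasSum_antidiagonal {f : (Fin n →₀ ℕ) × (Fin n →₀ ℕ) → ℝ} {v : ℝ} (h : HasSum f v) :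
    HasSum (fun γ => ∑ x ∈ Finset.HasAntidiagonal.antidiagonal γ, f x) v := by
  have h1 := (Finset.HasAntidiagonal.sigmaAntidiagonalEquivProd (A := Fin n →₀ ℕ)).hasSum_iff.2 h
  refine h1.sigma fun γ => ?_
  have h2 := hasSum_fintype fun c : Finset.HasAntidiagonal.antidiagonal γ => f c
  rwa [Finset.sum_coe_sort (Finset.HasAntidiagonal.antidiagonal γ) f] at h2

theorem HasEval.mul {p q : MvPowerSeries (Fin n) ℝ} {x : Fin n → ℝ} {v w : ℝ}
    (hp : HasEval p x v) (hq : HasEval q x w) : HasEval (p * q) x (v * w) := by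
  refine of_hasSum ((pnorm_mul_le _ p q).trans_lt (ENNReal.mul_lt_top hp.fin hq.fin)) ?_
  have hmul : ∀ f g : (Fin n →₀ ℕ) → ℝ, HasSum f v → HasSum g w → (Summable fun α => ‖f α‖) →
      (Summable fun α => ‖g α‖) →
      HasSum (fun y : (Fin n →₀ ℕ) × (Fin n →₀ ℕ) => f y.1 * g y.2) (v * w) :=
    fun f g hf hg hf' hg' => hf.mul hg (summable_mul_of_summable_norm hf' hg')
  have h0 := hmul _ _ hp.hasSum hq.hasSum (summable_norm_eval hp.fin) (summable_norm_eval hq.fin)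
  have h1 := hasSum_antidiagonal h0
  refine hasSum_of_eq h1 fun γ => ?_
  rw [coeff_mul, Finset.sum_mul]
  refine Finset.sum_congr rfl fun y hy => ?_
  rw [← Finset.HasAntidiagonal.mem_antidiagonal.1 hy, mono_add]
  ring

theorem eval_zero_right (p : MvPowerSeries (Fin n) ℝ) : eval p 0 = constantCoeff p := by
  rw [eval, tsum_eq_single 0 fun α hα => by rw [mono_zero_left hα, mul_zero], mono_zero, mul_one,
    coeff_zero_eq_constantCoeff_apply]

theorem pnorm_lt_top_of_norm_le {p : MvPowerSeries (Fin n) ℝ} {r : ℝ≥0} (hp : pnorm r p < ⊤)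
    {x : Fin n → ℝ} (hx : ‖x‖ ≤ r) : pnorm ‖x‖₊ p < ⊤ :=
  (pnorm_mono (NNReal.coe_le_coe.1 (by simpa using hx)) p).trans_lt hp

theorem Converges.eventually_pnorm {p : MvPowerSeries (Fin n) ℝ} (hp : Converges p) :
    ∀ᶠ x in 𝓝 (0 : Fin n → ℝ), pnorm ‖x‖₊ p < ⊤ := by
  obtain ⟨r, hr, h⟩ := hp
  filter_upwards [Metric.closedBall_mem_nhds (0 : Fin n → ℝ) (NNReal.coe_pos.2 hr)] with x hx
  exact pnorm_lt_top_of_norm_le h (mem_closedBall_zero_iff.1 hx)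

theorem hasSum_pderiv {p : MvPowerSeries (Fin n) ℝ} {x : Fin n → ℝ} {l : Fin n}
    (h : pnorm ‖x‖₊ (pderiv ℝ l p) < ⊤) :
    HasSum (fun α => coeff α p * ((α l : ℝ) * mono x (α - Finsupp.single l 1)))
      (eval (pderiv ℝ l p) x) := by
  have hinj : Function.Injective fun β : Fin n →₀ ℕ => β + Finsupp.single l 1 :=
    fun a b hab => add_right_cancel hab
  rw [← hinj.hasSum_iff]
  · refine hasSum_of_eq (hasEval_eval h).hasSum fun β => ?_
    rw [Function.comp_apply, coeff_pderiv, add_tsub_cancel_right]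
    simp
    ring
  · intro α hα
    have : α l = 0 := by
      by_contra h0
      exact hα ⟨α - Finsupp.single l 1, tsub_add_cancel_of_le (by
        rw [Finsupp.single_le_iff]
        exact Nat.one_le_iff_ne_zero.2 h0)⟩
    simp [this]

theorem hasFDerivAt_eval {p : MvPowerSeries (Fin n) ℝ} {r : ℝ≥0} (hp : pnorm r p < ⊤)
    {x : Fin n → ℝ} (hx : ‖x‖ < r) : HasFDerivAt (eval p)
      (∑ l, eval (pderiv ℝ l p) x •
        ContinuousLinearMap.proj (R := ℝ) (φ := fun _ : Fin n => ℝ) l) x := by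
  -- Termwise differentiation needs one summable majorant on a ball around 0 that contains x; the
  -- gap between s and r provides it.
  obtain ⟨s, hxs, hsr⟩ := exists_between hx
  have hs0 : 0 ≤ s := (norm_nonneg x).trans hxs.le
  have hprojle : ∀ l, ‖ContinuousLinearMap.proj (R := ℝ) (φ := fun _ : Fin n => ℝ) l‖ ≤ 1 :=
    fun l => ContinuousLinearMap.opNorm_le_bound _ zero_le_one fun y => by
      rw [one_mul]
      exact norm_le_pi_norm y l
  have h := hasFDerivAt_tsum_of_isPreconnected
    (f := fun (α : Fin n →₀ ℕ) y => coeff α p * mono y α)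
    (f' := fun α y => coeff α p • ∑ l, ((α l : ℝ) * mono y (α - Finsupp.single l 1)) •
      ContinuousLinearMap.proj (R := ℝ) (φ := fun _ : Fin n => ℝ) l)
    (u := fun α => n * (‖coeff α p‖ * (r : ℝ) ^ α.degree / (r - s)))
    (s := Metric.ball 0 s) (x₀ := x) (x := x)
    (((summable_coeff_mul_pow hp).div_const _).mul_left _) Metric.isOpen_ball
    (convex_ball 0 s).isPreconnected (fun α y _ => (hasFDerivAt_mono α y).const_smul (coeff α p))
    (fun α y hy => ?_) (by simpa using hxs)
    (summable_norm_eval (pnorm_lt_top_of_norm_le hp hx.le)).of_norm (by simpa using hxs)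
  · refine h.congr_fderiv ?_
    refine HasSum.tsum_eq ?_
    have h1 : HasSum (fun α : Fin n →₀ ℕ => ∑ l, (coeff α p * ((α l : ℝ) *
        mono x (α - Finsupp.single l 1))) •
          ContinuousLinearMap.proj (R := ℝ) (φ := fun _ : Fin n => ℝ) l)
        (∑ l, eval (pderiv ℝ l p) x •
          ContinuousLinearMap.proj (R := ℝ) (φ := fun _ : Fin n => ℝ) l) :=
      hasSum_sum fun l _ => (hasSum_pderiv (pnorm_pderiv_lt_top (s := r)
        (NNReal.coe_lt_coe.1 (by simpa using hx)) l hp)).smul_const _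
    refine hasSum_of_eq h1 fun α => ?_
    rw [Finset.smul_sum]
    exact Finset.sum_congr rfl fun l _ => by rw [smul_smul]
  · have hy' : ‖y‖ ≤ s := (mem_ball_zero_iff.1 hy).le
    rw [norm_smul]
    calc ‖coeff α p‖ * ‖∑ l, ((α l : ℝ) * mono y (α - Finsupp.single l 1)) •
          ContinuousLinearMap.proj (R := ℝ) (φ := fun _ : Fin n => ℝ) l‖
        ≤ ‖coeff α p‖ * ∑ _l : Fin n, (r : ℝ) ^ α.degree / (r - s) := by
          refine mul_le_mul_of_nonneg_left ((norm_sum_le _ _).trans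
            (Finset.sum_le_sum fun l _ => ?_)) (norm_nonneg _)
          rw [norm_smul]
          refine (mul_le_of_le_one_right (norm_nonneg _) (hprojle l)).trans ?_
          exact (norm_mul_mono_sub_le hy' α l).trans (mul_pow_pred_le hs0 hsr _)
      _ = _ := by
          simp
          ring

theorem eval_pderiv_eq_zero {p : MvPowerSeries (Fin n) ℝ} (hp : Converges p)
    (h : ∀ᶠ x in 𝓝 (0 : Fin n → ℝ), eval p x = 0) (l : Fin n) :
    ∀ᶠ x in 𝓝 (0 : Fin n → ℝ), eval (pderiv ℝ l p) x = 0 := by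
  obtain ⟨r, hr, hp⟩ := hp
  filter_upwards [h.eventually_nhds, Metric.ball_mem_nhds (0 : Fin n → ℝ) (NNReal.coe_pos.2 hr)]
    with x hx hxr
  have h1 := hasFDerivAt_eval hp (mem_ball_zero_iff.1 hxr)
  have h2 : HasFDerivAt (eval p) (0 : (Fin n → ℝ) →L[ℝ] ℝ) x :=
    (hasFDerivAt_const (0 : ℝ) x).congr_of_eventuallyEq hx
  have h3 := congrArg (fun φ : (Fin n → ℝ) →L[ℝ] ℝ => φ (Pi.single l 1)) (h1.unique h2)
  simpa [Pi.single_apply] using h3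

/-- The identity theorem for power series. -/
theorem eq_zero_of_eval_eq_zero {p : MvPowerSeries (Fin n) ℝ} (hp : Converges p)
    (h : ∀ᶠ x in 𝓝 (0 : Fin n → ℝ), eval p x = 0) : p = 0 := by
  -- Induction on the degree for all `p` at once: up to a positive factor, a coefficient of degree d
  -- + 1 is a coefficient of degree d of a partial derivative, which again vanishes near 0.
  have key : ∀ d : ℕ, ∀ p : MvPowerSeries (Fin n) ℝ, Converges p →
      (∀ᶠ x in 𝓝 (0 : Fin n → ℝ), eval p x = 0) → ∀ α : Fin n →₀ ℕ, α.degree = d →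
        coeff α p = 0 := by
    intro d
    induction d with
    | zero =>
      intro p _ h α hα
      rw [Finsupp.degree_eq_zero_iff] at hα
      rw [hα, coeff_zero_eq_constantCoeff_apply, ← eval_zero_right]
      exact h.self_of_nhds
    | succ d ih =>
      intro p hp h α hα
      have h0 : α ≠ 0 := by
        rintro rfl
        simp at hα
      obtain ⟨l, hl⟩ := Finsupp.ne_iff.1 h0
      have hle : Finsupp.single l 1 ≤ α := by
        rw [Finsupp.single_le_iff]
        exact Nat.one_le_iff_ne_zero.2 hl
      have hα' := tsub_add_cancel_of_le hle
      have hdeg := congrArg Finsupp.degree hα'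
      rw [map_add, Finsupp.degree_single, hα] at hdeg
      have h1 := ih _ (hp.pderiv l) (eval_pderiv_eq_zero hp h l) (α - Finsupp.single l 1)
        (by omega)
      rw [coeff_pderiv, hα'] at h1
      refine (mul_eq_zero.1 h1).resolve_right ?_
      positivity
  ext α
  exact key _ p hp h α rfl

theorem eq_of_eval_eq {p q : MvPowerSeries (Fin n) ℝ} (hp : Converges p) (hq : Converges q)
    (h : ∀ᶠ x in 𝓝 (0 : Fin n → ℝ), eval p x = eval q x) : p = q := by
  refine sub_eq_zero.1 (eq_zero_of_eval_eq_zero (hp.sub hq) ?_)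
  filter_upwards [h, hp.eventually_pnorm, hq.eventually_pnorm] with x h1 h2 h3
  rw [((hasEval_eval h2).sub (hasEval_eval h3)).eval_eq, h1, sub_self]

theorem Converges.exists_abs_eval_le {p : MvPowerSeries (Fin n) ℝ} (hp : Converges p) {d : ℕ}
    (hd0 : d ≠ 0) (hd : ∀ α : Fin n →₀ ℕ, α.degree < d → coeff α p = 0) :
    ∃ c : ℝ, 0 ≤ c ∧ ∀ᶠ x in 𝓝 (0 : Fin n → ℝ), |eval p x| ≤ c * ‖x‖ ^ d := by
  obtain ⟨c, hc⟩ := hp.exists_pnorm_le hd 1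
  obtain ⟨δ, hδ, hc⟩ := (mem_nhdsGT_iff_exists_Ioo_subset (a := (0 : ℝ≥0))).1 hc
  refine ⟨c, c.2, ?_⟩
  filter_upwards [Metric.ball_mem_nhds (0 : Fin n → ℝ) (NNReal.coe_pos.2 hδ)] with x hx
  rcases eq_or_ne x 0 with rfl | hx0
  · rw [eval_zero_right, ← coeff_zero_eq_constantCoeff_apply, hd 0 (by simpa using hd0.bot_lt)]
    simp [hd0]
  · have h1 : pnorm (1 * ‖x‖₊) p ≤ c * (‖x‖₊ : ℝ≥0∞) ^ d := hc
      ⟨nnnorm_pos.2 hx0, NNReal.coe_lt_coe.1 (by simpa using hx)⟩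
    rw [one_mul] at h1
    have h2 : (c : ℝ≥0∞) * (‖x‖₊ : ℝ≥0∞) ^ d = ((c * ‖x‖₊ ^ d : ℝ≥0) : ℝ≥0∞) := by push_cast; rfl
    rw [h2] at h1
    refine (abs_eval_le (h1.trans_lt ENNReal.coe_lt_top)).trans ?_
    refine (ENNReal.toReal_mono ENNReal.coe_ne_top h1).trans (le_of_eq ?_)
    simp

theorem hasSum_rowSeries {v : Idx n → ℝ} {x : Fin n → ℝ} (h : pnorm ‖x‖₊ (rowSeries v) < ⊤) :
    HasSum (fun γ : Idx n => v γ * lift x γ) (eval (rowSeries v) x) := by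
  have h1 := (hasEval_eval h).hasSum
  rw [← (Subtype.val_injective (p := fun α : Fin n →₀ ℕ => α ≠ 0)).hasSum_iff] at h1
  · refine hasSum_of_eq h1 fun γ => ?_
    rw [Function.comp_apply, coeff_rowSeries]
    rfl
  · intro α hα
    have : α = 0 := by
      by_contra h0
      exact hα ⟨⟨α, h0⟩, rfl⟩
    rw [this, coeff_zero_eq_constantCoeff_apply, constantCoeff_rowSeries, zero_mul]

/-- The double series is absolutely summable, so it may be regrouped along the antidiagonals, which
are the coefficients of p̄. -/
theorem hasEval_quadForm {P : Matrix (Idx n) (Idx n) ℝ} {x : Fin n → ℝ}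
    (h : pnorm ‖x‖₊ (biSeries P) < ⊤) :
    HasEval (rowSeries (vectorize P)) x (quadForm P x) := by
  have hs : Summable fun p : Idx n × Idx n => lift x p.1 * P p.1 p.2 * lift x p.2 := by
    refine ((matSummable_iff _ P).2 h).of_norm_bounded fun p => ?_
    rw [norm_mul, norm_mul, pow_add, coe_nnnorm, Real.norm_eq_abs (P p.1 p.2)]
    have h1 : ‖lift x p.1‖ ≤ ‖x‖ ^ p.1.1.degree := norm_mono_le x p.1.1
    have h2 : ‖lift x p.2‖ ≤ ‖x‖ ^ p.2.1.degree := norm_mono_le x p.2.1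
    calc ‖lift x p.1‖ * |P p.1 p.2| * ‖lift x p.2‖
        ≤ ‖x‖ ^ p.1.1.degree * |P p.1 p.2| * ‖x‖ ^ p.2.1.degree := by gcongr
      _ = _ := by ring
  have hinj : Function.Injective fun p : Idx n × Idx n => (p.1.1, p.2.1) := fun p q hpq =>
    Prod.ext (Subtype.ext (congrArg Prod.fst hpq)) (Subtype.ext (congrArg Prod.snd hpq))
  have h1 : HasSum (fun y : (Fin n →₀ ℕ) × (Fin n →₀ ℕ) =>
      coeff (sumElim y.1 y.2) (biSeries P) * (mono x y.1 * mono x y.2)) (quadForm P x) := by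
    rw [← hinj.hasSum_iff]
    · refine hasSum_of_eq hs.hasSum fun p => ?_
      rw [Function.comp_apply, coeff_biSeries, lift, lift]
      ring
    · intro y hy
      by_cases h1 : y.1 = 0
      · rw [h1, coeff_biSeries_zero_left, zero_mul]
      by_cases h2 : y.2 = 0
      · rw [h2, coeff_biSeries_zero_right, zero_mul]
      exact absurd ⟨(⟨y.1, h1⟩, ⟨y.2, h2⟩), rfl⟩ hy
  rw [rowSeries_vectorize]
  refine HasEval.of_hasSum ((pnorm_diagHom_le _ _).trans_lt h) ?_
  refine hasSum_of_eq (hasSum_antidiagonal h1) fun γ => ?_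
  rw [coeff_diagHom, Finset.sum_mul]
  refine Finset.sum_congr rfl fun y hy => ?_
  rw [← Finset.HasAntidiagonal.mem_antidiagonal.1 hy, mono_add]

end Eval

end
end Carleman

open scoped ENNReal NNReal
namespace Carleman
noncomputable section
open MvPowerSeries Filter Topology
open Finsupp (sumElim)

/-! ### Local estimates near the equilibrium and the Hamilton–Jacobi–Bellman identity. -/

section Local

variable {n : ℕ}

theorem eventually_forall_norm_le {E : Type*} [SeminormedAddCommGroup E] {p : E → Prop}
    (h : ∀ᶠ x in 𝓝 (0 : E), p x) : ∀ᶠ ρ in 𝓝[>] (0 : ℝ), ∀ x, ‖x‖ ≤ ρ → p x := by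
  obtain ⟨ε, hε, h⟩ := Metric.eventually_nhds_iff.1 h
  filter_upwards [Ioo_mem_nhdsGT hε] with ρ hρ x hx
  exact h (by rw [dist_zero_right]; exact hx.trans_lt hρ.2)

/-- The gradient of a power series, as a linear form. -/
def gradient (p : MvPowerSeries (Fin n) ℝ) (x : Fin n → ℝ) : (Fin n → ℝ) →L[ℝ] ℝ :=
  ∑ l, eval (pderiv ℝ l p) x • ContinuousLinearMap.proj (R := ℝ) (φ := fun _ : Fin n => ℝ) l

theorem gradient_apply (p : MvPowerSeries (Fin n) ℝ) (x y : Fin n → ℝ) :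
    gradient p x y = ∑ l, eval (pderiv ℝ l p) x * y l := by
  simp [gradient]

theorem Converges.eventually_hasFDerivAt {p : MvPowerSeries (Fin n) ℝ} (hp : Converges p) :
    ∀ᶠ x in 𝓝 (0 : Fin n → ℝ), HasFDerivAt (eval p) (gradient p x) x := by
  obtain ⟨r, hr, h⟩ := hp
  filter_upwards [Metric.ball_mem_nhds (0 : Fin n → ℝ) (NNReal.coe_pos.2 hr)] with x hx
  exact hasFDerivAt_eval h (mem_ball_zero_iff.1 hx)

theorem Converges.eventually_continuousOn {p : MvPowerSeries (Fin n) ℝ} (hp : Converges p) :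
    ∀ᶠ ρ in 𝓝[>] (0 : ℝ), ContinuousOn (eval p) (Metric.closedBall 0 ρ) := by
  filter_upwards [eventually_forall_norm_le hp.eventually_hasFDerivAt] with ρ h x hx
  exact (h x (mem_closedBall_zero_iff.1 hx)).continuousAt.continuousWithinAt

theorem Converges.eventually_continuousOn_gradient {p : MvPowerSeries (Fin n) ℝ}
    (hp : Converges p) :
    ∀ᶠ ρ in 𝓝[>] (0 : ℝ), ContinuousOn (gradient p) (Metric.closedBall 0 ρ) := by
  filter_upwards [eventually_all.2 fun l => (hp.pderiv l).eventually_continuousOn] with ρ h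
  exact continuousOn_finsetSum _ fun l _ => (h l).smul continuousOn_const

theorem Converges.eventually_lipschitzOnWith {p : MvPowerSeries (Fin n) ℝ} (hp : Converges p) :
    ∀ᶠ ρ in 𝓝[>] (0 : ℝ), ∃ c, LipschitzOnWith c (eval p) (Metric.closedBall 0 ρ) := by
  filter_upwards [eventually_forall_norm_le hp.eventually_hasFDerivAt,
    hp.eventually_continuousOn_gradient] with ρ h1 h2
  obtain ⟨c, hc⟩ := (isCompact_closedBall (0 : Fin n → ℝ) ρ).exists_bound_of_continuousOn h2
  refine ⟨c.toNNReal, (convex_closedBall 0 ρ).lipschitzOnWith_of_nnnorm_hasFDerivWithin_le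
    (fun x hx => (h1 x (mem_closedBall_zero_iff.1 hx)).hasFDerivWithinAt) fun x hx => ?_⟩
  rw [← NNReal.coe_le_coe, coe_nnnorm]
  exact (hc x hx).trans (Real.le_coe_toNNReal c)

theorem hasEval_lie {F : Fin n → MvPowerSeries (Fin n) ℝ} {V : MvPowerSeries (Fin n) ℝ}
    {x v : Fin n → ℝ} (hF : ∀ l, HasEval (F l) x (v l))
    (hV : ∀ l, pnorm ‖x‖₊ (pderiv ℝ l V) < ⊤) : HasEval (lie F V) x (gradient V x v) := by
  rw [gradient_apply]
  exact HasEval.sum fun l _ => by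
    rw [mul_comm (eval _ _)]
    exact (hF l).mul (hasEval_eval (hV l))

/-- Bounds for positive definite quadratic forms. -/
theorem exists_pos_mul_le {X : Matrix (Fin n) (Fin n) ℝ}
    (hX : ∀ x, x ≠ 0 → 0 < x ⬝ᵥ X.mulVec x) : ∃ q > 0, ∀ x, q * ‖x‖ ^ 2 ≤ x ⬝ᵥ X.mulVec x := by
  have hc : Continuous fun x : Fin n → ℝ => x ⬝ᵥ X.mulVec x :=
    (continuous_dotProduct_mulVec X).comp (continuous_id.prodMk continuous_id)
  by_cases hne : (Metric.sphere (0 : Fin n → ℝ) 1).Nonempty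
  · obtain ⟨v, hv, hmin⟩ := (isCompact_sphere (0 : Fin n → ℝ) 1).exists_isMinOn hne hc.continuousOn
    have hv0 : v ≠ 0 := by
      rintro rfl
      simp at hv
    refine ⟨_, hX v hv0, fun x => ?_⟩
    by_cases hx : x = 0
    · simp [hx]
    have h1 : ‖x‖⁻¹ • x ∈ Metric.sphere (0 : Fin n → ℝ) 1 := by
      simp [norm_smul, inv_mul_cancel₀ (norm_ne_zero_iff.2 hx)]
    have h2 : v ⬝ᵥ X.mulVec v ≤ _ := hmin h1
    simp only [Matrix.mulVec_smul, dotProduct_smul, smul_dotProduct, smul_eq_mul] at h2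
    have hn : 0 < ‖x‖ := norm_pos_iff.2 hx
    calc v ⬝ᵥ X.mulVec v * ‖x‖ ^ 2 ≤ ‖x‖⁻¹ * (‖x‖⁻¹ * x ⬝ᵥ X.mulVec x) * ‖x‖ ^ 2 := by gcongr
      _ = _ := by field_simp
  -- An empty sphere means that the only vector is 0, and any constant will do.
  · refine ⟨1, one_pos, fun x => ?_⟩
    by_cases hx : x = 0
    · simp [hx]
    · exact absurd ⟨‖x‖⁻¹ • x, by
        simp [norm_smul, inv_mul_cancel₀ (norm_ne_zero_iff.2 hx)]⟩ hne

theorem exists_le_mul (X : Matrix (Fin n) (Fin n) ℝ) :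
    ∃ q ≥ 0, ∀ x, |x ⬝ᵥ X.mulVec x| ≤ q * ‖x‖ ^ 2 := by
  refine ⟨∑ l, ∑ m, |X l m|, by positivity, fun x => ?_⟩
  simp only [dotProduct, Matrix.mulVec, Finset.mul_sum, Finset.sum_mul]
  refine (Finset.abs_sum_le_sum_abs _ _).trans (Finset.sum_le_sum fun l _ =>
    (Finset.abs_sum_le_sum_abs _ _).trans (Finset.sum_le_sum fun m _ => ?_))
  rw [abs_mul, abs_mul]
  have h1 : |x l| ≤ ‖x‖ := norm_le_pi_norm x l
  have h2 : |x m| ≤ ‖x‖ := norm_le_pi_norm x m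
  calc |x l| * (|X l m| * |x m|) ≤ ‖x‖ * (|X l m| * ‖x‖) := by gcongr
    _ = _ := by ring

end Local

namespace System

variable {n k : ℕ} {S : System n k} {Q₁ : Matrix (Fin n) (Fin n) ℝ} {R : Matrix (Fin k) (Fin k) ℝ}
  {K : Matrix (Fin k) (Idx n) ℝ}

theorem eventually_hasEval_gain (hK : GainConverges K) : ∀ᶠ x in 𝓝 (0 : Fin n → ℝ), ∀ j,
    HasEval (gainSeries K j) x (-feedback K x j) ∧ Summable fun α => K j α * lift x α := by
  rw [gainConverges_iff_converges] at hK
  refine eventually_all.2 fun j => ?_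
  filter_upwards [(hK j).eventually_pnorm] with x hx
  have h := hasSum_rowSeries hx
  refine ⟨⟨hx, ?_⟩, h.summable⟩
  rw [feedback, neg_neg]
  exact h.tsum_eq.symm

variable (S) in
theorem eventually_hasEval_f : ∀ᶠ x in 𝓝 (0 : Fin n → ℝ), ∀ l,
    HasEval (S.fSeries l) x (S.f x l) := by
  filter_upwards [S.hasSum_f, eventually_all.2 fun l => (S.converges_fSeries l).eventually_pnorm]
    with x h1 h2 l
  exact HasEval.of_hasSum (h2 l) (h1 l)

variable (S) in
theorem eventually_hasEval_g : ∀ᶠ x in 𝓝 (0 : Fin n → ℝ), ∀ l j,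
    HasEval (S.gSeries l j) x (S.g x l j) := by
  filter_upwards [S.hasSum_g, eventually_all.2 fun l => eventually_all.2 fun j =>
    (S.converges_gSeries l j).eventually_pnorm] with x h1 h2 l j
  exact HasEval.of_hasSum (h2 l j) (h1 l j)

/-- The closed-loop vector field of the feedback `u = -K ψ`. -/
def closedField (S : System n k) (K : Matrix (Fin k) (Idx n) ℝ) (x : Fin n → ℝ) : Fin n → ℝ :=
  S.f x + (S.g x).mulVec (feedback K x)

theorem eventually_hasEval_field (hK : GainConverges K) : ∀ᶠ x in 𝓝 (0 : Fin n → ℝ), ∀ l,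
    HasEval (S.field (gainSeries K) l) x (S.closedField K x l) := by
  filter_upwards [S.eventually_hasEval_f, S.eventually_hasEval_g, eventually_hasEval_gain hK]
    with x h1 h2 h3 l
  have e : S.closedField K x l = S.f x l - ∑ j, S.g x l j * -feedback K x j := by
    simp [closedField, Matrix.mulVec, dotProduct]
  rw [e]
  exact (h1 l).sub (HasEval.sum fun j _ => (h2 l j).mul (h3 j).1)

theorem hasEval_quad {κ : Fin k → MvPowerSeries (Fin n) ℝ} {x : Fin n → ℝ} {u : Fin k → ℝ}
    (h : ∀ j, HasEval (κ j) x (u j)) : HasEval (quad R κ) x (u ⬝ᵥ R.mulVec u) := by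
  have e : u ⬝ᵥ R.mulVec u = ∑ i, ∑ j, R i j * (u i * u j) := by
    simp only [dotProduct, Matrix.mulVec, Finset.mul_sum]
    exact Finset.sum_congr rfl fun i _ => Finset.sum_congr rfl fun j _ => by ring
  rw [e]
  exact HasEval.sum fun i _ => HasEval.sum fun j _ =>
    (HasEval.const _ x).mul ((h i).mul (h j))

theorem hasEval_stage {κ : Fin k → MvPowerSeries (Fin n) ℝ} {x : Fin n → ℝ} {u : Fin k → ℝ}
    (h : ∀ j, HasEval (κ j) x (u j)) :
    HasEval (stageSeries Q₁ R κ) x (x ⬝ᵥ Q₁.mulVec x + u ⬝ᵥ R.mulVec u) :=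
  (hasEval_quad (R := Q₁) fun l => HasEval.var l x).add (hasEval_quad h)

theorem eventually_hasEval_stage (hK : GainConverges K) : ∀ᶠ x in 𝓝 (0 : Fin n → ℝ),
    HasEval (stageSeries Q₁ R (gainSeries K)) x (runningCost Q₁ R x (feedback K x)) := by
  filter_upwards [eventually_hasEval_gain hK] with x h
  have := hasEval_stage (Q₁ := Q₁) (R := R) (u := -feedback K x) fun j => (h j).1
  simpa [runningCost, Matrix.mulVec_neg] using this

theorem eventually_continuousOn_feedback (hK : GainConverges K) :
    ∀ᶠ ρ in 𝓝[>] (0 : ℝ), ContinuousOn (feedback K) (Metric.closedBall 0 ρ) := by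
  filter_upwards [eventually_forall_norm_le (eventually_hasEval_gain hK), eventually_all.2 fun j =>
    ((gainConverges_iff_converges K).1 hK j).eventually_continuousOn] with ρ h1 h2
  refine continuousOn_pi.2 fun j => (h2 j).neg.congr fun x hx => ?_
  rw [Pi.neg_apply, (h1 x (mem_closedBall_zero_iff.1 hx) j).1.eval_eq, neg_neg]

theorem eventually_lipschitzOnWith_closedField (hK : GainConverges K) :
    ∀ᶠ ρ in 𝓝[>] (0 : ℝ), ∃ c, LipschitzOnWith c (S.closedField K) (Metric.closedBall 0 ρ) := by
  filter_upwards [eventually_forall_norm_le (eventually_hasEval_field (S := S) hK),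
    eventually_all.2 fun l => (S.converges_field ((gainConverges_iff_converges K).1 hK) l
      ).eventually_lipschitzOnWith] with ρ h1 h2
  choose c hc using h2
  refine ⟨∑ l, c l, LipschitzOnWith.of_dist_le_mul fun x hx y hy => ?_⟩
  refine (dist_pi_le_iff (by positivity)).2 fun l => ?_
  rw [← (h1 x (mem_closedBall_zero_iff.1 hx) l).eval_eq,
    ← (h1 y (mem_closedBall_zero_iff.1 hy) l).eval_eq]
  refine ((hc l).dist_le_mul x hx y hy).trans ?_
  gcongr
  exact Finset.single_le_sum (f := c) (fun _ _ => zero_le) (Finset.mem_univ l)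

/-- The decay of the value function along the closed loop. -/
theorem eventually_gradient_closedField (hK : GainConverges K) {V : MvPowerSeries (Fin n) ℝ}
    (hV : Converges V)
    (h : lie (S.field (gainSeries K)) V = -stageSeries Q₁ R (gainSeries K)) :
    ∀ᶠ x in 𝓝 (0 : Fin n → ℝ),
      gradient V x (S.closedField K x) = -runningCost Q₁ R x (feedback K x) := by
  filter_upwards [eventually_hasEval_field (S := S) hK, eventually_hasEval_stage hK,
    eventually_all.2 fun l => (hV.pderiv l).eventually_pnorm] with x h1 h2 h3
  rw [← (hasEval_lie h1 h3).eval_eq, h, h2.neg.eval_eq]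

/-- The Hamilton–Jacobi–Bellman identity. -/
theorem eventually_gradient_eq (hR : R.PosDef) (hK : GainConverges K)
    {V : MvPowerSeries (Fin n) ℝ} (hV : Converges V)
    (h : lie (S.field (gainSeries K)) V = -stageSeries Q₁ R (gainSeries K))
    (hpol : gainSeries K = S.policy R V) :
    ∀ᶠ x in 𝓝 (0 : Fin n → ℝ), ∀ u : Fin k → ℝ,
      gradient V x (S.f x + (S.g x).mulVec u) = -runningCost Q₁ R x u +
        (u - feedback K x) ⬝ᵥ R.mulVec (u - feedback K x) := by
  filter_upwards [eventually_gradient_closedField hK hV h, S.eventually_hasEval_g,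
    eventually_hasEval_gain hK, eventually_all.2 fun l => (hV.pderiv l).eventually_pnorm]
    with x h1 h2 h3 h4 u
  set w := feedback K x with hw
  -- The policy relation reads gᵀ∇V = -2Rw, where w = -κ is the feedback. The derivative of V is
  -- affine in u with this slope, and its value at u = w is known, so changing w to u completes the
  -- square.
  have hG : ∀ j, ∑ l, S.g x l j * eval (pderiv ℝ l V) x = -2 * R.mulVec w j := fun j => by
    have e1 : HasEval (∑ l, S.gSeries l j * pderiv ℝ l V) x
        (∑ l, S.g x l j * eval (pderiv ℝ l V) x) :=
      HasEval.sum fun l _ => (h2 l j).mul (hasEval_eval (h4 l))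
    have e2 : HasEval (C 2 * ∑ i, C (R j i) * S.policy R V i) x
        (2 * ∑ i, R j i * -w i) := by
      rw [← hpol]
      exact (HasEval.const _ x).mul (HasEval.sum fun i _ => (HasEval.const _ x).mul (h3 i).1)
    rw [← e1.eval_eq, sum_mul_policy hR, e2.eval_eq]
    simp [Matrix.mulVec, dotProduct]
  have hgu : ∀ y, gradient V x ((S.g x).mulVec y) = -2 * (y ⬝ᵥ R.mulVec w) := fun y => by
    rw [gradient_apply]
    simp only [Matrix.mulVec, dotProduct, Finset.mul_sum]
    rw [Finset.sum_comm]
    refine Finset.sum_congr rfl fun j _ => ?_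
    have := hG j
    simp only [Matrix.mulVec, dotProduct, Finset.mul_sum] at this
    have e : ∑ l, eval (pderiv ℝ l V) x * (S.g x l j * y j) =
        (∑ l, S.g x l j * eval (pderiv ℝ l V) x) * y j := by
      rw [Finset.sum_mul]
      exact Finset.sum_congr rfl fun l _ => by ring
    rw [e, this, Finset.sum_mul]
    exact Finset.sum_congr rfl fun l _ => by ring
  have h5 : gradient V x (S.f x) = -runningCost Q₁ R x w + 2 * (w ⬝ᵥ R.mulVec w) := by
    rw [closedField, map_add, hgu] at h1
    linarith
  rw [map_add, h5, hgu]
  simp only [runningCost, Matrix.mulVec_sub, dotProduct_sub, sub_dotProduct,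
    dotProduct_mulVec_comm_of_isSymm (isSymm_of_posDef hR) w u]
  ring

theorem coeff_biSeries_sub_linBlock (P : Matrix (Idx n) (Idx n) ℝ) (e : Fin n ⊕ Fin n →₀ ℕ)
    (he : e.degree < 3) : coeff e (biSeries P -
      ∑ l, ∑ m, C (linBlock P l m) * (inlHom (X l) * inrHom (X m))) = 0 := by
  obtain ⟨α, β, rfl⟩ := exists_sumElim e
  rw [degree_sumElim] at he
  simp only [map_sub, map_sum, coeff_C_mul, coeff_inlHom_mul_inrHom, coeff_X]
  by_cases hα : α = 0
  · subst hα
    simp [coeff_biSeries_zero_left, eq_comm]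
  by_cases hβ : β = 0
  · subst hβ
    simp [coeff_biSeries_zero_right, eq_comm]
  have h1 : α.degree ≠ 0 := fun h => hα ((Finsupp.degree_eq_zero_iff α).1 h)
  have h2 : β.degree ≠ 0 := fun h => hβ ((Finsupp.degree_eq_zero_iff β).1 h)
  obtain ⟨l, rfl⟩ := exists_single_of_degree_eq_one (show α.degree = 1 by omega)
  obtain ⟨m, rfl⟩ := exists_single_of_degree_eq_one (show β.degree = 1 by omega)
  simp [Finsupp.single_left_inj, linBlock]

/-- The value function is quadratic to leading order. -/
theorem exists_abs_eval_sub_le {P : Matrix (Idx n) (Idx n) ℝ} (hP : Converges (biSeries P)) :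
    ∃ c, 0 ≤ c ∧ ∀ᶠ x in 𝓝 (0 : Fin n → ℝ),
      |eval (rowSeries (vectorize P)) x - x ⬝ᵥ (linBlock P).mulVec x| ≤ c * ‖x‖ ^ 3 := by
  set D := biSeries P - ∑ l, ∑ m, C (linBlock P l m) * (inlHom (X l) * inrHom (X m)) with hD
  have hDc : Converges D := hP.sub (Converges.sum fun l _ => Converges.sum fun m _ =>
    (converges_C _).mul ((converges_X l).inlHom.mul (converges_X m).inrHom))
  obtain ⟨c, hc0, hc⟩ := hDc.diagHom.exists_abs_eval_le (d := 3) (by norm_num) fun α hα =>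
    coeff_csub_eq_zero_of_order _ (coeff_biSeries_sub_linBlock P) hα
  refine ⟨c, hc0, ?_⟩
  filter_upwards [hc, hP.diagHom.eventually_pnorm] with x h1 h2
  have e : diagHom D = diagHom (biSeries P) - quad (linBlock P) X := by
    simp only [hD, quad, map_sub, map_sum, map_mul, diagHom_C, diagHom_inlHom, diagHom_inrHom]
  rw [e, ((hasEval_eval h2).sub (hasEval_quad fun l => HasEval.var l x)).eval_eq] at h1
  rwa [rowSeries_vectorize]

/-- The value function is comparable with the square of the norm. -/
theorem exists_value_bounds {P : Matrix (Idx n) (Idx n) ℝ} (hP : Converges (biSeries P))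
    (hpos : ∀ x, x ≠ 0 → 0 < x ⬝ᵥ (linBlock P).mulVec x) :
    ∃ a > 0, ∃ b > 0, ∀ᶠ x in 𝓝 (0 : Fin n → ℝ),
      a * ‖x‖ ^ 2 ≤ eval (rowSeries (vectorize P)) x ∧
      eval (rowSeries (vectorize P)) x ≤ b * ‖x‖ ^ 2 := by
  obtain ⟨q, hq, hq'⟩ := exists_pos_mul_le hpos
  obtain ⟨b, hb, hb'⟩ := exists_le_mul (linBlock P)
  obtain ⟨c, hc, hc'⟩ := exists_abs_eval_sub_le hP
  -- On the ball of radius q/2/(c+1) the cubic remainder is at most (q/2)‖x‖², half of the quadratic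
  -- lower bound. The upper constant is enlarged to be positive.
  refine ⟨q / 2, by positivity, b + 1 + q, by positivity, ?_⟩
  filter_upwards [hc', Metric.ball_mem_nhds (0 : Fin n → ℝ) (show 0 < q / 2 / (c + 1) by positivity)]
    with x h1 h2
  have h3 : ‖x‖ * (c + 1) ≤ q / 2 :=
    ((lt_div_iff₀ (by positivity)).1 (mem_ball_zero_iff.1 h2)).le
  have h4 : c * ‖x‖ ^ 3 ≤ q / 2 * ‖x‖ ^ 2 := by
    calc c * ‖x‖ ^ 3 = (c * ‖x‖) * ‖x‖ ^ 2 := by ring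
      _ ≤ q / 2 * ‖x‖ ^ 2 := by
          gcongr
          nlinarith [norm_nonneg x]
  have h5 := abs_le.1 h1
  have h6 := hq' x
  have h7 := (le_abs_self _).trans (hb' x)
  constructor <;> nlinarith [sq_nonneg ‖x‖]

/-- The degree-one block solves a strict Lyapunov inequality of the Hurwitz linearization. -/
theorem IsCostMatrix.linBlock_pos (hQ : Q₁.PosDef) (hR : R.PosDef) (hS : S.Stabilizing K)
    {P : Matrix (Idx n) (Idx n) ℝ} (h : S.IsCostMatrix Q₁ R K P) {x : Fin n → ℝ} (hx : x ≠ 0) :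
    0 < x ⬝ᵥ (linBlock P).mulVec x := by
  rw [stabilizing_iff, linPart_field _ (constantCoeff_gainSeries _)] at hS
  refine hS.dotProduct_mulVec_pos (linBlock_isSymm h.1) (fun y hy => ?_) hx
  linarith [h.linBlock_eq y, posDef_dotProduct_pos hQ hy,
    posDef_dotProduct_nonneg hR ((linPart (gainSeries K)).mulVec y)]

end System

end
end Carleman

open scoped ENNReal NNReal
namespace Carleman
noncomputable section
open MvPowerSeries Filter Topology
open Finsupp (sumElim)

/-! ### Solutions of differential equations and the chain rule along absolutely continuous curves.
-/

section Flow

open MeasureTheory Set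

/-- A bounded Lipschitz vector field has a solution for all positive times. -/
theorem exists_forall_hasDerivWithinAt {E : Type*} [NormedAddCommGroup E] [NormedSpace ℝ E]
    [CompleteSpace E] {v : E → E} {c L : ℝ≥0} (hv : LipschitzWith c v) (hL : ∀ x, ‖v x‖ ≤ L)
    (x₀ : E) : ∃ x : ℝ → E, x 0 = x₀ ∧ ∀ t ≥ 0, HasDerivWithinAt x (v (x t)) (Ici 0) t := by
  -- The bound `L` allows Picard's theorem on [0, N + 1] for every N. By uniqueness the pieces
  -- agree, and the solution at time t is read off from the piece ⌊t⌋.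
  have hex : ∀ N : ℕ, ∃ α : ℝ → E, α 0 = x₀ ∧
      ∀ t ∈ Icc (0 : ℝ) (N + 1), HasDerivWithinAt α (v (α t)) (Icc 0 (N + 1)) t := fun N => by
    have h0 : (0 : ℝ) ∈ Icc (0 : ℝ) (N + 1) := ⟨le_rfl, by positivity⟩
    have := IsPicardLindelof.exists_eq_forall_mem_Icc_hasDerivWithinAt₀ (f := fun _ => v)
      (t₀ := ⟨0, h0⟩) (x₀ := x₀) (a := L * (N + 1)) (L := L) (K := c)
      ⟨fun t _ => hv.lipschitzOnWith, fun x _ => continuousOn_const, fun t _ x _ => hL x, by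
        rw [max_eq_left] <;> simp
        positivity⟩
    exact this
  choose α hα0 hα using hex
  have hcont : ∀ N, ContinuousOn (α N) (Icc 0 (N + 1)) := fun N t ht =>
    (hα N t ht).continuousWithinAt
  have huniq : ∀ M N : ℕ, M ≤ N → EqOn (α M) (α N) (Icc 0 (M + 1)) := fun M N h => by
    have hMN : (M : ℝ) + 1 ≤ N + 1 := by exact_mod_cast Nat.succ_le_succ h
    have hd : ∀ N : ℕ, M ≤ N → ∀ t ∈ Ico (0 : ℝ) (M + 1),
        HasDerivWithinAt (α N) (v (α N t)) (Ici t) t := fun N h t ht => by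
      have hMN : (M : ℝ) + 1 ≤ N + 1 := by exact_mod_cast Nat.succ_le_succ h
      refine (hα N t ⟨ht.1, ht.2.le.trans hMN⟩).mono_of_mem_nhdsWithin ?_
      exact mem_of_superset (Icc_mem_nhdsGE (ht.2.trans_le hMN)) (Icc_subset_Icc_left ht.1)
    exact ODE_solution_unique (v := fun _ => v) (K := c) (fun _ => hv) (hcont M) (hd M le_rfl)
      ((hcont N).mono (Icc_subset_Icc_right hMN)) (hd N h) ((hα0 M).trans (hα0 N).symm)
  have hx : ∀ N : ℕ, EqOn (fun t => α ⌊t⌋₊ t) (α N) (Icc 0 (N + 1)) := fun N t ht => by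
    rcases le_total ⌊t⌋₊ N with h | h
    · exact huniq _ _ h ⟨ht.1, (Nat.lt_floor_add_one t).le⟩
    · exact (huniq _ _ h ht).symm
  refine ⟨fun t => α ⌊t⌋₊ t, by simp [hα0], fun t ht => ?_⟩
  have ht' : t < (⌊t⌋₊ : ℝ) + 1 := Nat.lt_floor_add_one t
  have hmem : Icc (0 : ℝ) (⌊t⌋₊ + 1) ∈ 𝓝[Ici 0] t := by
    rw [← Ici_inter_Iic]
    exact inter_mem_nhdsWithin _ (Iic_mem_nhds ht')
  exact ((hα ⌊t⌋₊ t ⟨ht, ht'.le⟩).mono_of_mem_nhdsWithin hmem).congr_of_eventuallyEq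
    (mem_of_superset hmem (hx _)) rfl

variable {n : ℕ}

/-- The projection onto the ball of radius `ρ` in the maximum norm. -/
def clamp (ρ : ℝ) (x : Fin n → ℝ) : Fin n → ℝ := fun l => max (-ρ) (min ρ (x l))

theorem norm_clamp_le {ρ : ℝ} (hρ : 0 ≤ ρ) (x : Fin n → ℝ) : ‖clamp ρ x‖ ≤ ρ :=
  (pi_norm_le_iff_of_nonneg hρ).2 fun _ => abs_le.2
    ⟨le_max_left _ _, max_le (by linarith) (min_le_left _ _)⟩

theorem clamp_eq {ρ : ℝ} {x : Fin n → ℝ} (hx : ‖x‖ ≤ ρ) : clamp ρ x = x := by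
  ext l
  have := abs_le.1 ((norm_le_pi_norm x l).trans hx)
  simp [clamp, this.1, this.2]

theorem lipschitzWith_clamp (ρ : ℝ) : LipschitzWith 1 (clamp ρ : (Fin n → ℝ) → Fin n → ℝ) :=
  LipschitzWith.of_dist_le_mul fun x y => by
    refine (dist_pi_le_iff (by positivity)).2 fun l => ?_
    refine ((((LipschitzWith.id (α := ℝ)).const_min ρ).const_max (-ρ)).dist_le_mul _ _).trans ?_
    gcongr
    exact dist_le_pi_dist x y l

/-- A vector field that is Lipschitz on a ball has solutions until they leave the ball. -/
theorem exists_solution_clamp {v : (Fin n → ℝ) → Fin n → ℝ} {c : ℝ≥0} {ρ : ℝ} (hρ : 0 ≤ ρ)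
    (hv : LipschitzOnWith c v (Metric.closedBall 0 ρ)) (x₀ : Fin n → ℝ) :
    ∃ x : ℝ → Fin n → ℝ, x 0 = x₀ ∧
      ∀ t ≥ 0, HasDerivWithinAt x (v (clamp ρ (x t))) (Ici 0) t := by
  have hm : ∀ x, clamp ρ x ∈ Metric.closedBall (0 : Fin n → ℝ) ρ := fun x =>
    mem_closedBall_zero_iff.2 (norm_clamp_le hρ x)
  obtain ⟨L, hL⟩ := (isCompact_closedBall (0 : Fin n → ℝ) ρ).exists_bound_of_continuousOn
    hv.continuousOn
  refine exists_forall_hasDerivWithinAt (v := fun x => v (clamp ρ x)) (c := c * 1) (L := L.toNNReal)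
    ?_ (fun x => (hL _ (hm x)).trans (Real.le_coe_toNNReal L)) x₀
  rw [← lipschitzOnWith_univ]
  exact hv.comp (lipschitzWith_clamp ρ).lipschitzOnWith fun x _ => hm x

/-- A continuous function that cannot reach the level `ρ` for the first time stays below it. -/
theorem forall_lt_of_forall_le_imp_lt {φ : ℝ → ℝ} {ρ T : ℝ} (hφ : ContinuousOn φ (Icc 0 T))
    (h0 : φ 0 < ρ) (h : ∀ t ∈ Icc 0 T, (∀ s ∈ Icc 0 t, φ s ≤ ρ) → φ t < ρ) :
    ∀ t ∈ Icc 0 T, φ t < ρ := by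
  by_contra! hne
  obtain ⟨t, ht, htρ⟩ := hne
  have hcl : IsClosed {s ∈ Icc 0 T | ρ ≤ φ s} :=
    hφ.preimage_isClosed_of_isClosed isClosed_Icc isClosed_Ici
  -- At the first time `m` at which the level is reached, the intermediate value theorem gives
  -- equality, so the bound ≤ ρ holds up to `m` and the hypothesis yields a contradiction.
  obtain ⟨m, ⟨hmT, hmρ⟩, hmin⟩ := (isCompact_Icc.of_isClosed_subset hcl
    (sep_subset _ _)).exists_isLeast ⟨t, ht, htρ⟩
  refine absurd hmρ (not_le.2 (h m hmT fun s hs => ?_))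
  by_contra! hs'
  have hsm : m = s := le_antisymm (hmin ⟨⟨hs.1, hs.2.trans hmT.2⟩, hs'.le⟩) hs.2
  subst hsm
  have h0m : 0 < m := lt_of_le_of_ne hmT.1 fun e => by
    rw [← e] at hmρ
    linarith
  obtain ⟨r, hr, hr'⟩ := intermediate_value_Icc hmT.1 (hφ.mono (Icc_subset_Icc_right hmT.2))
    ⟨h0.le, hmρ⟩
  have := hmin ⟨⟨hr.1, hr.2.trans hmT.2⟩, hr'.ge⟩
  have hrm : r = m := le_antisymm hr.2 this
  rw [hrm] at hr'
  linarith

/-- The chain rule along an absolutely continuous curve. -/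
theorem integral_hasFDerivAt_of_eq_integral {h x : ℝ → Fin n → ℝ} {x₀ : Fin n → ℝ} {T : ℝ}
    (hT : 0 ≤ T) (hh : IntervalIntegrable h volume 0 T)
    (hx : ∀ t ∈ Icc 0 T, x t = x₀ + ∫ s in (0 : ℝ)..t, h s)
    {φ : (Fin n → ℝ) → ℝ} {D : (Fin n → ℝ) → (Fin n → ℝ) →L[ℝ] ℝ} {s : Set (Fin n → ℝ)} {c : ℝ≥0}
    (hφ : LipschitzOnWith c φ s) (hs : ∀ t ∈ Icc 0 T, x t ∈ s)
    (hD : ∀ t ∈ Icc 0 T, HasFDerivAt φ (D (x t)) (x t)) :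
    IntervalIntegrable (fun t => D (x t) (h t)) volume 0 T ∧
      ∫ t in (0 : ℝ)..T, D (x t) (h t) = φ (x T) - φ (x 0) := by
  -- `x` is prescribed on [0, T] only; the indefinite integral `y` extends it, so that two-sided
  -- derivatives make sense.
  set y : ℝ → Fin n → ℝ := fun t => x₀ + ∫ s in (0 : ℝ)..t, h s with hy
  have hxy : ∀ t ∈ Icc 0 T, x t = y t := hx
  have hI : uIcc 0 T = Icc 0 T := uIcc_of_le hT
  have hhl : ∀ l, IntervalIntegrable (fun t => h t l) volume 0 T := fun l =>
    ⟨hh.1.eval l, hh.2.eval l⟩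
  have hyl : ∀ l, ∀ t ∈ Icc 0 T, y t l = x₀ l + ∫ s in (0 : ℝ)..t, h s l := fun l t ht => by
    have hi : IntervalIntegrable h volume 0 t := hh.mono_set (by
      rw [hI, uIcc_of_le ht.1]
      exact Icc_subset_Icc_right ht.2)
    have := (ContinuousLinearMap.proj (R := ℝ) (φ := fun _ : Fin n => ℝ) l
      ).intervalIntegral_comp_comm hi
    simp only [ContinuousLinearMap.proj_apply] at this
    simp [hy, this]
  -- Controls are merely integrable, so the classical chain rule does not apply. A Lipschitz
  -- function of an absolutely continuous curve is absolutely continuous, and the chain rule almost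
  -- everywhere then suffices.
  have hac : AbsolutelyContinuousOnInterval (fun t => φ (y t)) 0 T := by
    have hsum := tendsto_finsetSum Finset.univ fun l (_ : l ∈ Finset.univ) =>
      (hhl l).absolutelyContinuousOnInterval_intervalIntegral (left_mem_uIcc)
    have hsum' := hsum.const_mul (c : ℝ)
    rw [Finset.sum_const_zero, mul_zero] at hsum'
    refine squeeze_zero' (Eventually.of_forall fun E => by positivity) ?_ hsum'
    filter_upwards [mem_inf_of_right (mem_principal_self _)] with E hE
    rw [Finset.sum_comm, Finset.mul_sum]
    refine Finset.sum_le_sum fun i hi => ?_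
    have h1 := (hE.1 i hi).1
    have h2 := (hE.1 i hi).2
    rw [hI] at h1 h2
    refine (hφ.dist_le_mul _ (hxy _ h1 ▸ hs _ h1) _ (hxy _ h2 ▸ hs _ h2)).trans ?_
    gcongr
    refine (dist_pi_le_iff (by positivity)).2 fun l => ?_
    rw [hyl l _ h1, hyl l _ h2, dist_add_left]
    exact Finset.single_le_sum (f := fun l => dist (∫ s in (0 : ℝ)..(E.2 i).1, h s l)
      (∫ s in (0 : ℝ)..(E.2 i).2, h s l)) (fun _ _ => dist_nonneg) (Finset.mem_univ l)
  have hder : ∀ᵐ t, t ∈ uIcc 0 T → deriv (fun t => φ (y t)) t = D (x t) (h t) := by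
    filter_upwards [hh.ae_hasDerivAt_integral] with t ht htm
    have h1 : HasDerivAt y (h t) t := (ht htm 0 left_mem_uIcc).const_add x₀
    rw [hI] at htm
    have h2 := hD t htm
    rw [hxy t htm] at h2 ⊢
    exact (h2.comp_hasDerivAt t h1).deriv
  have hder' : deriv (fun t => φ (y t)) =ᵐ[volume.restrict (uIoc 0 T)]
      fun t => D (x t) (h t) := by
    rw [EventuallyEq, ae_restrict_iff' measurableSet_uIoc]
    filter_upwards [hder] with t ht htm
    exact ht (uIoc_subset_uIcc htm)
  refine ⟨hac.intervalIntegrable_deriv.congr_ae hder', ?_⟩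
  rw [← intervalIntegral.integral_congr_ae_restrict hder', hac.integral_deriv_eq_sub,
    hxy T ⟨hT, le_rfl⟩, hxy 0 ⟨le_rfl, hT⟩]

end Flow

end
end Carleman

open scoped ENNReal NNReal
namespace Carleman
noncomputable section
open MvPowerSeries Filter Topology
open Finsupp (sumElim)

/-! ### Verification: the value function bounds the cost of every competitor from below. -/

namespace System

open MeasureTheory Set

variable {n k : ℕ} {S : System n k} {Q₁ : Matrix (Fin n) (Fin n) ℝ} {R : Matrix (Fin k) (Fin k) ℝ}
  {x₀ : Fin n → ℝ} {x : ℝ → Fin n → ℝ} {u : ℝ → Fin k → ℝ}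

theorem runningCost_nonneg (hQ : Q₁.PosDef) (hR : R.PosDef) (x : Fin n → ℝ) (u : Fin k → ℝ) :
    0 ≤ runningCost Q₁ R x u :=
  add_nonneg (posDef_dotProduct_nonneg hQ x) (posDef_dotProduct_nonneg hR u)

theorem continuous_runningCost :
    Continuous fun p : (Fin n → ℝ) × (Fin k → ℝ) => runningCost Q₁ R p.1 p.2 :=
  ((continuous_dotProduct_mulVec Q₁).comp (continuous_fst.prodMk continuous_fst)).add
    ((continuous_dotProduct_mulVec R).comp (continuous_snd.prodMk continuous_snd))

theorem Admissible.apply_zero (h : S.Admissible x₀ x u) : x 0 = x₀ := by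
  simpa using h.eq_integral 0 le_rfl

theorem Admissible.continuousOn_Icc (h : S.Admissible x₀ x u) (T : ℝ) :
    ContinuousOn x (Icc 0 T) :=
  h.continuousOn.mono Icc_subset_Ici_self

theorem Admissible.intervalIntegrable_rate (h : S.Admissible x₀ x u) {T : ℝ} (hT : 0 ≤ T) :
    IntervalIntegrable (fun s => S.f (x s) + (S.g (x s)).mulVec (u s)) volume 0 T := by
  have hx : ContinuousOn x (uIcc 0 T) := by
    rw [uIcc_of_le hT]
    exact h.continuousOn_Icc T
  have hu := h.integrable T hT
  refine ((S.continuous_f.comp_continuousOn hx).intervalIntegrable).add ?_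
  rw [intervalIntegrable_iff]
  refine Integrable.of_eval fun l => ?_
  simp only [Matrix.mulVec, dotProduct]
  refine integrable_finsetSum _ fun j _ => ?_
  rw [← IntegrableOn, ← intervalIntegrable_iff]
  refine IntervalIntegrable.continuousOn_mul ⟨hu.1.eval j, hu.2.eval j⟩ ?_
  exact ((continuous_apply_apply l j).comp S.continuous_g).comp_continuousOn hx

theorem Admissible.intervalIntegrable_runningCost (hQ : Q₁.PosDef) (hR : R.PosDef)
    (h : S.Admissible x₀ x u) (hc : cost Q₁ R x u ≠ ⊤) {T : ℝ} (hT : 0 ≤ T) :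
    IntervalIntegrable (fun t => runningCost Q₁ R (x t) (u t)) volume 0 T ∧
      ∫ t in (0 : ℝ)..T, runningCost Q₁ R (x t) (u t) ≤ (cost Q₁ R x u).toReal := by
  have hle : ∫⁻ t in Ioc 0 T, ENNReal.ofReal (runningCost Q₁ R (x t) (u t)) ≤ cost Q₁ R x u :=
    lintegral_mono_set Ioc_subset_Ioi_self
  have hm : AEStronglyMeasurable (fun t => runningCost Q₁ R (x t) (u t))
      (volume.restrict (Ioc 0 T)) := by
    refine continuous_runningCost.comp_aestronglyMeasurable (AEStronglyMeasurable.prodMk ?_ ?_)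
    · exact ((h.continuousOn_Icc T).mono Ioc_subset_Icc_self).aestronglyMeasurable measurableSet_Ioc
    · exact (h.integrable T hT).1.aestronglyMeasurable
  have hnn : 0 ≤ᵐ[volume.restrict (Ioc 0 T)] fun t => runningCost Q₁ R (x t) (u t) :=
    Eventually.of_forall fun t => runningCost_nonneg hQ hR _ _
  have hi : IntegrableOn (fun t => runningCost Q₁ R (x t) (u t)) (Ioc 0 T) :=
    ⟨hm, (hasFiniteIntegral_iff_ofReal hnn).2 (hle.trans_lt hc.lt_top)⟩
  refine ⟨(intervalIntegrable_iff_integrableOn_Ioc_of_le hT).2 hi, ?_⟩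
  rw [intervalIntegral.integral_of_le hT, integral_eq_lintegral_of_nonneg_ae hnn hm]
  exact ENNReal.toReal_mono hc hle

/-- A solution of the Hamilton–Jacobi–Bellman equation on a ball around the equilibrium: a positive
definite function `W` with derivative `D`, and the minimizing feedback `κ`. -/
structure LocalValue (S : System n k) (Q₁ : Matrix (Fin n) (Fin n) ℝ) (R : Matrix (Fin k) (Fin k) ℝ)
    (W : (Fin n → ℝ) → ℝ) (D : (Fin n → ℝ) → (Fin n → ℝ) →L[ℝ] ℝ) (κ : (Fin n → ℝ) → Fin k → ℝ)
    (a b q c ρ : ℝ) : Prop where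
  a_pos : 0 < a
  b_pos : 0 < b
  q_pos : 0 < q
  c_nonneg : 0 ≤ c
  radius_pos : 0 < ρ
  le_value : ∀ x, ‖x‖ ≤ ρ → a * ‖x‖ ^ 2 ≤ W x
  value_le : ∀ x, ‖x‖ ≤ ρ → W x ≤ b * ‖x‖ ^ 2
  hasFDerivAt : ∀ x, ‖x‖ ≤ ρ → HasFDerivAt W (D x) x
  lipschitz : ∃ L, LipschitzOnWith L W (Metric.closedBall 0 ρ)
  bellman : ∀ x, ‖x‖ ≤ ρ → ∀ u, D x (S.f x + (S.g x).mulVec u) = -runningCost Q₁ R x u +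
    (u - κ x) ⬝ᵥ R.mulVec (u - κ x)
  le_weight : ∀ x, q * ‖x‖ ^ 2 ≤ x ⬝ᵥ Q₁.mulVec x
  feedback_le : ∀ x, ‖x‖ ≤ ρ → κ x ⬝ᵥ R.mulVec (κ x) ≤ c * (x ⬝ᵥ Q₁.mulVec x)
  continuousOn : ContinuousOn κ (Metric.closedBall 0 ρ)
  lipschitz_field : ∃ L, LipschitzOnWith L (fun x => S.f x + (S.g x).mulVec (κ x))
    (Metric.closedBall 0 ρ)

/-- A trajectory of bounded cost comes arbitrarily close to the equilibrium. -/
theorem exists_norm_sq_le {q M T ε : ℝ} (hq : 0 < q) (hε : 0 < ε)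
    (hqQ : ∀ x : Fin n → ℝ, q * ‖x‖ ^ 2 ≤ x ⬝ᵥ Q₁.mulVec x) (hQ : Q₁.PosDef) (hR : R.PosDef)
    (hT : 0 ≤ T)
    (hi : ∀ t ≥ 0, IntervalIntegrable (fun t => runningCost Q₁ R (x t) (u t)) volume 0 t)
    (hM : ∀ t ≥ 0, ∫ t in (0 : ℝ)..t, runningCost Q₁ R (x t) (u t) ≤ M) :
    ∃ t ≥ T, ‖x t‖ ^ 2 ≤ ε := by
  by_contra! hne
  have hM0 : 0 ≤ M := by simpa using hM 0 le_rfl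
  -- If ‖x‖² stayed above ε after T, a time span of this length would already cost M + 1.
  have hτ : 0 ≤ (M + 1) / (q * ε) := by positivity
  set τ := (M + 1) / (q * ε) with hτe
  have h1 := hi (T + τ) (by positivity)
  have h2 : IntervalIntegrable (fun t => runningCost Q₁ R (x t) (u t)) volume T (T + τ) :=
    (hi T hT).symm.trans h1
  have h3 : ∫ _ in T..(T + τ), q * ε ≤ ∫ t in T..(T + τ), runningCost Q₁ R (x t) (u t) := by
    refine intervalIntegral.integral_mono_on (by linarith) (by simp) h2 fun t ht => ?_
    have h4 := hqQ (x t)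
    have h5 := hne t ht.1
    have h6 := posDef_dotProduct_nonneg hR (u t)
    rw [runningCost]
    nlinarith
  have h4 := hM (T + τ) (by positivity)
  rw [← intervalIntegral.integral_add_adjacent_intervals (hi T hT) h2] at h4
  have h5 : 0 ≤ ∫ t in (0 : ℝ)..T, runningCost Q₁ R (x t) (u t) :=
    intervalIntegral.integral_nonneg hT fun t _ => runningCost_nonneg hQ hR _ _
  rw [intervalIntegral.integral_const, smul_eq_mul, add_sub_cancel_left, hτe,
    div_mul_cancel₀ _ (by positivity)] at h3
  linarith

namespace LocalValue

variable {W : (Fin n → ℝ) → ℝ} {D : (Fin n → ℝ) → (Fin n → ℝ) →L[ℝ] ℝ}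
  {κ : (Fin n → ℝ) → Fin k → ℝ} {a b q c ρ : ℝ}

theorem value_nonneg (h : S.LocalValue Q₁ R W D κ a b q c ρ) {x : Fin n → ℝ} (hx : ‖x‖ ≤ ρ) :
    0 ≤ W x :=
  (mul_nonneg h.a_pos.le (sq_nonneg _)).trans (h.le_value x hx)

/-- The change of the value function along an admissible trajectory that stays in the ball. -/
theorem integral_eq (hQ : Q₁.PosDef) (hR : R.PosDef) (h : S.LocalValue Q₁ R W D κ a b q c ρ)
    (hx : S.Admissible x₀ x u) (hc : cost Q₁ R x u ≠ ⊤) {T : ℝ} (hT : 0 ≤ T)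
    (hball : ∀ t ∈ Icc 0 T, ‖x t‖ ≤ ρ) :
    IntervalIntegrable (fun t => (u t - κ (x t)) ⬝ᵥ R.mulVec (u t - κ (x t))) volume 0 T ∧
      W x₀ + ∫ t in (0 : ℝ)..T, (u t - κ (x t)) ⬝ᵥ R.mulVec (u t - κ (x t)) =
        W (x T) + ∫ t in (0 : ℝ)..T, runningCost Q₁ R (x t) (u t) := by
  obtain ⟨L, hL⟩ := h.lipschitz
  obtain ⟨hi1, he⟩ := integral_hasFDerivAt_of_eq_integral hT (hx.intervalIntegrable_rate hT)
    (fun t ht => hx.eq_integral t ht.1) hL (fun t ht => mem_closedBall_zero_iff.2 (hball t ht))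
    fun t ht => h.hasFDerivAt _ (hball t ht)
  obtain ⟨hi2, -⟩ := hx.intervalIntegrable_runningCost hQ hR hc hT
  have hcongr : EqOn (fun t => D (x t) (S.f (x t) + (S.g (x t)).mulVec (u t)) +
      runningCost Q₁ R (x t) (u t))
      (fun t => (u t - κ (x t)) ⬝ᵥ R.mulVec (u t - κ (x t))) (uIcc 0 T) := fun t ht => by
    rw [uIcc_of_le hT] at ht
    simp only [h.bellman _ (hball t ht)]
    ring
  refine ⟨(hi1.add hi2).congr (hcongr.mono uIoc_subset_uIcc), ?_⟩
  rw [← intervalIntegral.integral_congr hcongr, intervalIntegral.integral_add hi1 hi2, he,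
    hx.apply_zero]
  ring

/-- Trajectories of small cost stay in the ball. -/
theorem forall_norm_lt (hQ : Q₁.PosDef) (hR : R.PosDef)
    (h : S.LocalValue Q₁ R W D κ a b q c ρ) (hx : S.Admissible x₀ x u) (hx₀ : ‖x₀‖ < ρ)
    (hx₀' : (3 + 2 * c) * (b * ‖x₀‖ ^ 2) < a * ρ ^ 2)
    (hc : cost Q₁ R x u ≤ ENNReal.ofReal (W x₀)) : ∀ t ≥ 0, ‖x t‖ < ρ := by
  have hc' : cost Q₁ R x u ≠ ⊤ := (hc.trans_lt ENNReal.ofReal_lt_top).ne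
  have hcr : (cost Q₁ R x u).toReal ≤ W x₀ :=
    ENNReal.toReal_le_of_le_ofReal (h.value_nonneg hx₀.le) hc
  have hc0 := h.c_nonneg
  intro T hT
  refine forall_lt_of_forall_le_imp_lt (hx.continuousOn_Icc T).norm (by rwa [hx.apply_zero])
    (fun t ht hball => ?_) T ⟨hT, le_rfl⟩
  obtain ⟨hi, he⟩ := h.integral_eq hQ hR hx hc' ht.1 hball
  obtain ⟨hi', hle⟩ := hx.intervalIntegrable_runningCost hQ hR hc' ht.1
  -- The square of u - κ is at most twice the sum of the squares, and `feedback_le` bounds the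
  -- square of κ by c times the state cost. Since the cost is at most W(x₀), the value along the
  -- trajectory stays below (3 + 2c)W(x₀), hence the trajectory stays in the ball.
  have h1 : ∫ s in (0 : ℝ)..t, (u s - κ (x s)) ⬝ᵥ R.mulVec (u s - κ (x s)) ≤
      ∫ s in (0 : ℝ)..t, (2 + 2 * c) * runningCost Q₁ R (x s) (u s) := by
    refine intervalIntegral.integral_mono_on ht.1 hi (hi'.const_mul _) fun s hs => ?_
    have h2 := posDef_dotProduct_nonneg hR (u s + κ (x s))
    have h3 := h.feedback_le (x s) (hball s hs)
    have h4 := posDef_dotProduct_nonneg hR (u s)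
    have h5 := posDef_dotProduct_nonneg hQ (x s)
    simp only [runningCost, Matrix.mulVec_sub, dotProduct_sub, sub_dotProduct, Matrix.mulVec_add,
      dotProduct_add, add_dotProduct] at h2 ⊢
    nlinarith
  rw [intervalIntegral.integral_const_mul] at h1
  have h0 : 0 ≤ ∫ s in (0 : ℝ)..t, runningCost Q₁ R (x s) (u s) :=
    intervalIntegral.integral_nonneg ht.1 fun s _ => runningCost_nonneg hQ hR _ _
  have h6 : W (x t) ≤ (3 + 2 * c) * W x₀ := by nlinarith
  have h7 := h.le_value (x t) (hball t ⟨ht.1, le_rfl⟩)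
  have h8 := h.value_le x₀ hx₀.le
  have h9 : a * ‖x t‖ ^ 2 < a * ρ ^ 2 := by nlinarith
  exact lt_of_pow_lt_pow_left₀ 2 h.radius_pos.le (lt_of_mul_lt_mul_left h9 h.a_pos.le)

/-- The value function bounds the cost from below, and the deviation from the feedback `κ` is
paid for. -/
theorem add_integral_le (hQ : Q₁.PosDef) (hR : R.PosDef)
    (h : S.LocalValue Q₁ R W D κ a b q c ρ) (hx : S.Admissible x₀ x u) (hx₀ : ‖x₀‖ < ρ)
    (hx₀' : (3 + 2 * c) * (b * ‖x₀‖ ^ 2) < a * ρ ^ 2)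
    (hc : cost Q₁ R x u ≤ ENNReal.ofReal (W x₀)) {T : ℝ} (hT : 0 ≤ T) :
    IntervalIntegrable (fun t => (u t - κ (x t)) ⬝ᵥ R.mulVec (u t - κ (x t))) volume 0 T ∧
      W x₀ + ∫ t in (0 : ℝ)..T, (u t - κ (x t)) ⬝ᵥ R.mulVec (u t - κ (x t)) ≤
        (cost Q₁ R x u).toReal := by
  have hc' : cost Q₁ R x u ≠ ⊤ := (hc.trans_lt ENNReal.ofReal_lt_top).ne
  have hball := h.forall_norm_lt hQ hR hx hx₀ hx₀' hc
  have hall := fun (t : ℝ) (ht : 0 ≤ t) => h.integral_eq hQ hR hx hc' ht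
    fun s hs => (hball s hs.1).le
  have hrc := fun (t : ℝ) (ht : 0 ≤ t) => hx.intervalIntegrable_runningCost hQ hR hc' ht
  refine ⟨(hall T hT).1, le_of_forall_pos_le_add fun ε hε => ?_⟩
  -- A competitor need not tend to 0, but finite cost provides late times at which the value is at
  -- most ε.
  obtain ⟨t, ht, hle⟩ := exists_norm_sq_le h.q_pos (div_pos hε h.b_pos) h.le_weight hQ hR hT
    (fun t ht => (hrc t ht).1) fun t ht => (hrc t ht).2
  have ht0 := hT.trans ht
  have h1 : W (x t) ≤ ε := (h.value_le _ (hball t ht0).le).trans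
    (by rwa [le_div_iff₀' h.b_pos] at hle)
  have h2 := intervalIntegral.integral_add_adjacent_intervals (hall T hT).1
    ((hall T hT).1.symm.trans (hall t ht0).1)
  have h3 : 0 ≤ ∫ s in T..t, (u s - κ (x s)) ⬝ᵥ R.mulVec (u s - κ (x s)) :=
    intervalIntegral.integral_nonneg ht fun s _ => posDef_dotProduct_nonneg hR _
  have h4 := (hall t ht0).2
  have h5 := (hrc t ht0).2
  linarith

/-- A cheaper competitor would be confined to the ball, where the completed square shows that it
costs at least the value. -/
theorem ofReal_le_cost (hQ : Q₁.PosDef) (hR : R.PosDef)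
    (h : S.LocalValue Q₁ R W D κ a b q c ρ) (hx : S.Admissible x₀ x u) (hx₀ : ‖x₀‖ < ρ)
    (hx₀' : (3 + 2 * c) * (b * ‖x₀‖ ^ 2) < a * ρ ^ 2) :
    ENNReal.ofReal (W x₀) ≤ cost Q₁ R x u := by
  by_contra! hlt
  have := (h.add_integral_le hQ hR hx hx₀ hx₀' hlt.le le_rfl).2
  rw [intervalIntegral.integral_same, add_zero] at this
  exact absurd (ENNReal.ofReal_le_of_le_toReal this) (not_le.2 hlt)

/-- If the cost attains the value function, then the control starts like the feedback `κ`. -/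
theorem apply_zero_eq (hQ : Q₁.PosDef) (hR : R.PosDef)
    (h : S.LocalValue Q₁ R W D κ a b q c ρ) (hx : S.Admissible x₀ x u) (hx₀ : ‖x₀‖ < ρ)
    (hx₀' : (3 + 2 * c) * (b * ‖x₀‖ ^ 2) < a * ρ ^ 2)
    (hc : cost Q₁ R x u ≤ ENNReal.ofReal (W x₀)) (hu : ContinuousWithinAt u (Ici 0) 0) :
    u 0 = κ x₀ := by
  by_contra hne
  have hκ : ContinuousWithinAt (fun t => κ (x t)) (Ici 0) 0 := by
    refine ContinuousAt.comp_continuousWithinAt ?_ (hx.continuousOn 0 self_mem_Ici)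
    rw [hx.apply_zero]
    exact h.continuousOn.continuousAt
      (mem_of_superset (Metric.isOpen_ball.mem_nhds (mem_ball_zero_iff.2 hx₀))
        Metric.ball_subset_closedBall)
  have hδ : ContinuousWithinAt (fun t => (u t - κ (x t)) ⬝ᵥ R.mulVec (u t - κ (x t))) (Ici 0) 0 :=
    (continuous_dotProduct_mulVec R).continuousAt.comp_continuousWithinAt
      ((hu.sub hκ).prodMk (hu.sub hκ))
  have h0 : 0 < (u 0 - κ (x 0)) ⬝ᵥ R.mulVec (u 0 - κ (x 0)) :=
    posDef_dotProduct_pos hR (by rwa [hx.apply_zero, sub_ne_zero])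
  obtain ⟨m, hm0, hm⟩ := exists_between h0
  -- A deviation from κ at time 0 persists by continuity for some time T and costs at least mT more
  -- than the value.
  obtain ⟨T, hT, hsub⟩ := mem_nhdsGE_iff_exists_Icc_subset.1 (hδ.eventually (lt_mem_nhds hm))
  have hT' : 0 < T := hT
  obtain ⟨hi, hle⟩ := h.add_integral_le hQ hR hx hx₀ hx₀' hc hT'.le
  have h1 : ∫ _ in (0 : ℝ)..T, m ≤
      ∫ t in (0 : ℝ)..T, (u t - κ (x t)) ⬝ᵥ R.mulVec (u t - κ (x t)) :=
    intervalIntegral.integral_mono_on hT'.le (by simp) hi fun t ht => (hsub ht).le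
  rw [intervalIntegral.integral_const, smul_eq_mul, sub_zero] at h1
  have h2 : (cost Q₁ R x u).toReal ≤ W x₀ :=
    ENNReal.toReal_le_of_le_ofReal (h.value_nonneg hx₀.le) hc
  nlinarith [mul_pos hT' hm0]

end LocalValue

end System

end
end Carleman

open scoped ENNReal NNReal
namespace Carleman
noncomputable section
open MvPowerSeries Filter Topology
open Finsupp (sumElim)

/-! ### The closed loop attains the value function. -/

namespace System

open MeasureTheory Set

variable {n k : ℕ} {S : System n k} {Q₁ : Matrix (Fin n) (Fin n) ℝ} {R : Matrix (Fin k) (Fin k) ℝ}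
  {x₀ : Fin n → ℝ}

namespace LocalValue

variable {W : (Fin n → ℝ) → ℝ} {D : (Fin n → ℝ) → (Fin n → ℝ) →L[ℝ] ℝ}
  {κ : (Fin n → ℝ) → Fin k → ℝ} {a b q c ρ : ℝ}

/-- The feedback `κ` steers small initial states to the equilibrium at the cost `W`. -/
theorem exists_closedLoop (hQ : Q₁.PosDef) (hR : R.PosDef)
    (h : S.LocalValue Q₁ R W D κ a b q c ρ) (hx₀ : ‖x₀‖ < ρ) (hx₀' : b * ‖x₀‖ ^ 2 < a * ρ ^ 2) :
    ∃ x : ℝ → Fin n → ℝ, S.Admissible x₀ x (fun t => κ (x t)) ∧ (∀ t ≥ 0, ‖x t‖ < ρ) ∧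
      Tendsto x atTop (𝓝 0) ∧ cost Q₁ R x (fun t => κ (x t)) = ENNReal.ofReal (W x₀) := by
  obtain ⟨L, hL⟩ := h.lipschitz_field
  -- The clamped field is globally Lipschitz and has a global solution. The clamp is never active,
  -- because the value decreases along the solution and confines it to the ball.
  obtain ⟨x, hx0, hx⟩ := exists_solution_clamp h.radius_pos.le hL x₀
  have hcont : ContinuousOn x (Ici 0) := fun t ht => (hx t ht).continuousWithinAt
  have hW : ∀ t ≥ 0, ‖x t‖ ≤ ρ → HasDerivWithinAt (fun t => W (x t))
      (-runningCost Q₁ R (x t) (κ (x t))) (Ici 0) t := fun t ht hb => by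
    have h1 := hx t ht
    rw [clamp_eq hb] at h1
    have h2 := (h.hasFDerivAt _ hb).comp_hasDerivWithinAt t h1
    rw [h.bellman _ hb, sub_self, zero_dotProduct, add_zero] at h2
    exact h2
  have hanti : ∀ t ≥ 0, (∀ s ∈ Icc 0 t, ‖x s‖ ≤ ρ) → AntitoneOn (fun t => W (x t)) (Icc 0 t) :=
    fun t ht hb => by
      have hd : ∀ s ∈ Ioo 0 t, HasDerivAt (fun t => W (x t))
          (-runningCost Q₁ R (x s) (κ (x s))) s := fun s hs =>
        (hW s hs.1.le (hb s (Ioo_subset_Icc_self hs))).hasDerivAt (Ici_mem_nhds hs.1)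
      refine antitoneOn_of_deriv_nonpos (convex_Icc 0 t)
        (fun s hs => ((hW s hs.1 (hb s hs)).mono Icc_subset_Ici_self).continuousWithinAt) ?_ ?_
      all_goals
        rw [interior_Icc]
        intro s hs
      · exact (hd s hs).differentiableAt.differentiableWithinAt
      · rw [(hd s hs).deriv]
        exact neg_nonpos.2 (runningCost_nonneg hQ hR _ _)
  have hball : ∀ t ≥ 0, ‖x t‖ < ρ := fun T hT => by
    refine forall_lt_of_forall_le_imp_lt (hcont.mono Icc_subset_Ici_self).norm (by rwa [hx0])
      (fun t ht hb => ?_) T ⟨hT, le_rfl⟩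
    have h1 := hanti t ht.1 hb ⟨le_rfl, ht.1⟩ ⟨ht.1, le_rfl⟩ ht.1
    simp only [hx0] at h1
    have h2 := h.le_value (x t) (hb t ⟨ht.1, le_rfl⟩)
    have h3 := h.value_le x₀ hx₀.le
    exact lt_of_pow_lt_pow_left₀ 2 h.radius_pos.le
      (lt_of_mul_lt_mul_left (by linarith : a * ‖x t‖ ^ 2 < a * ρ ^ 2) h.a_pos.le)
  have hmem : MapsTo x (Ici 0) (Metric.closedBall 0 ρ) := fun t ht =>
    mem_closedBall_zero_iff.2 (hball t ht).le
  have hκ : ContinuousOn (fun t => κ (x t)) (Ici 0) := h.continuousOn.comp hcont hmem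
  have hF : ContinuousOn (fun t => S.f (x t) + (S.g (x t)).mulVec (κ (x t))) (Ici 0) :=
    hL.continuousOn.comp hcont hmem
  have hrc : ContinuousOn (fun t => runningCost Q₁ R (x t) (κ (x t))) (Ici 0) :=
    continuous_runningCost.comp_continuousOn (hcont.prodMk hκ)
  have hsub : ∀ t ≥ 0, uIcc 0 t ⊆ Ici (0 : ℝ) := fun t ht => by
    rw [uIcc_of_le ht]
    exact Icc_subset_Ici_self
  have hadm : S.Admissible x₀ x fun t => κ (x t) := by
    refine ⟨hcont, fun t ht => (hκ.mono (hsub t ht)).intervalIntegrable, fun t ht => ?_⟩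
    rw [intervalIntegral.integral_eq_sub_of_hasDerivAt_of_le ht
      (hcont.mono Icc_subset_Ici_self) (fun s hs => ?_)
      (hF.mono (hsub t ht)).intervalIntegrable, hx0, add_sub_cancel]
    have := hx s hs.1.le
    rw [clamp_eq (hball s hs.1.le).le] at this
    exact this.hasDerivAt (Ici_mem_nhds hs.1)
  have hint : ∀ t ≥ 0, ∫ s in (0 : ℝ)..t, runningCost Q₁ R (x s) (κ (x s)) ≤ W x₀ :=
    fun t ht => by
      have := intervalIntegral.integral_eq_sub_of_hasDerivAt_of_le ht
        (f := fun t => -W (x t)) (f' := fun s => runningCost Q₁ R (x s) (κ (x s)))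
        (fun s hs => ((hW s hs.1 (hball s hs.1).le).mono Icc_subset_Ici_self).continuousWithinAt.neg)
        (fun s hs => by
          simpa using ((hW s hs.1.le (hball s hs.1.le).le).hasDerivAt (Ici_mem_nhds hs.1)).fun_neg)
        (hrc.mono (hsub t ht)).intervalIntegrable
      rw [this, hx0]
      linarith [h.value_nonneg (hball t ht).le]
  have htend : Tendsto x atTop (𝓝 0) := by
    refine Metric.tendsto_atTop.2 fun ε hε => ?_
    -- One late time with a small state is enough: the value decreases, so the state stays small
    -- afterwards.
    obtain ⟨T, hT, hle⟩ := exists_norm_sq_le (x := x) (u := fun t => κ (x t))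
      (ε := a * (ε / 2) ^ 2 / b) (T := 0) h.q_pos
      (div_pos (mul_pos h.a_pos (by positivity)) h.b_pos) h.le_weight hQ hR le_rfl
      (fun t ht => (hrc.mono (hsub t ht)).intervalIntegrable) hint
    refine ⟨T, fun t ht => ?_⟩
    have h1 := hanti t (le_trans hT ht) (fun s hs => (hball s hs.1).le) ⟨hT, ht⟩
      ⟨le_trans hT ht, le_rfl⟩ ht
    have h2 := h.le_value (x t) (hball t (le_trans hT ht)).le
    have h3 := h.value_le (x T) (hball T hT).le
    rw [le_div_iff₀' h.b_pos] at hle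
    have h4 : ‖x t‖ ≤ ε / 2 := (pow_le_pow_iff_left₀ (norm_nonneg _) (by positivity) two_ne_zero).1
      (le_of_mul_le_mul_left (by simp only at h1; linarith : a * ‖x t‖ ^ 2 ≤ a * (ε / 2) ^ 2) h.a_pos)
    rw [dist_zero_right]
    linarith
  refine ⟨x, hadm, hball, htend, ?_⟩
  have h00 : ‖(0 : Fin n → ℝ)‖ ≤ ρ := by simpa using h.radius_pos.le
  have hW0 : W 0 = 0 := by
    have h1 := h.le_value 0 h00
    have h2 := h.value_le 0 h00
    simp only [norm_zero] at h1 h2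
    linarith
  have hWt : Tendsto (fun t => -W (x t)) atTop (𝓝 0) := by
    have := ((h.hasFDerivAt 0 h00).continuousAt.tendsto.comp htend).neg
    rwa [hW0, neg_zero] at this
  have hc0 : ContinuousWithinAt (fun t => -W (x t)) (Ici 0) 0 :=
    (hW 0 le_rfl (hball 0 le_rfl).le).continuousWithinAt.neg
  have hd : ∀ t ∈ Ioi (0 : ℝ), HasDerivAt (fun t => -W (x t))
      (runningCost Q₁ R (x t) (κ (x t))) t := fun t ht => by
    have ht : 0 < t := ht
    simpa using ((hW t ht.le (hball t ht.le).le).hasDerivAt (Ici_mem_nhds ht)).fun_neg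
  have hnn : ∀ t ∈ Ioi (0 : ℝ), 0 ≤ runningCost Q₁ R (x t) (κ (x t)) := fun t _ =>
    runningCost_nonneg hQ hR _ _
  -- -W along the trajectory is an antiderivative of the running cost and tends to 0, so the
  -- improper integral equals W(x₀).
  rw [cost, ← ofReal_integral_eq_lintegral_ofReal
    (integrableOn_Ioi_deriv_of_nonneg hc0 hd hnn hWt)
    (Eventually.of_forall fun t => runningCost_nonneg hQ hR _ _),
    integral_Ioi_of_hasDerivAt_of_nonneg hc0 hd hnn hWt, hx0]
  simp

end LocalValue

variable {K : Matrix (Fin k) (Idx n) ℝ} {P : Matrix (Idx n) (Idx n) ℝ}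

theorem eventually_lipschitzOnWith_feedback (hK : GainConverges K) :
    ∀ᶠ ρ in 𝓝[>] (0 : ℝ), ∃ c, LipschitzOnWith c (feedback K) (Metric.closedBall 0 ρ) := by
  filter_upwards [eventually_forall_norm_le (eventually_hasEval_gain hK), eventually_all.2 fun j =>
    ((gainConverges_iff_converges K).1 hK j).eventually_lipschitzOnWith] with ρ h1 h2
  choose c hc using h2
  refine ⟨∑ j, c j, LipschitzOnWith.of_dist_le_mul fun x hx y hy => ?_⟩
  refine (dist_pi_le_iff (by positivity)).2 fun j => ?_
  rw [← dist_neg_neg, ← (h1 x (mem_closedBall_zero_iff.1 hx) j).1.eval_eq,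
    ← (h1 y (mem_closedBall_zero_iff.1 hy) j).1.eval_eq]
  refine ((hc j).dist_le_mul x hx y hy).trans ?_
  gcongr
  exact Finset.single_le_sum (f := c) (fun _ _ => zero_le) (Finset.mem_univ j)

theorem feedback_zero (K : Matrix (Fin k) (Idx n) ℝ) : feedback K (0 : Fin n → ℝ) = 0 := by
  have h : ∀ α : Idx n, lift (0 : Fin n → ℝ) α = 0 := fun α => by
    obtain ⟨l, hl⟩ := Finsupp.ne_iff.1 α.2
    exact Finset.prod_eq_zero (Finset.mem_univ l) (zero_pow hl)
  ext j
  simp [feedback, h]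

/-- A gain that is optimal for its own cost matrix solves the Hamilton–Jacobi–Bellman equation. -/
theorem IsCostMatrix.exists_localValue (hQ : Q₁.PosDef) (hR : R.PosDef) (hK : GainConverges K)
    (hS : S.Stabilizing K) (h : S.IsCostMatrix Q₁ R K P) (hPK : K = S.gain R P) :
    ∃ a b q c : ℝ, ∀ᶠ ρ in 𝓝[>] (0 : ℝ), S.LocalValue Q₁ R (eval (rowSeries (vectorize P)))
      (gradient (rowSeries (vectorize P))) (feedback K) a b q c ρ := by
  have hP : Converges (biSeries P) := h.converges hK hS
  have hV : Converges (rowSeries (vectorize P)) := by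
    rw [rowSeries_vectorize]
    exact hP.diagHom
  obtain ⟨a, ha, b, hb, hab⟩ := exists_value_bounds hP fun x hx => h.linBlock_pos hQ hR hS hx
  obtain ⟨q, hq, hqQ⟩ := exists_pos_mul_le fun x (hx : x ≠ 0) => posDef_dotProduct_pos hQ hx
  obtain ⟨e, he, heR⟩ := exists_le_mul R
  obtain ⟨ρ₁, ⟨L, hL⟩, hρ₁⟩ :=
    ((eventually_lipschitzOnWith_feedback hK).and self_mem_nhdsWithin).exists
  -- The feedback is Lipschitz with constant L and vanishes at 0, so its R-form is at most eL²‖x‖²,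
  -- and q‖x‖² is at most the state cost.
  refine ⟨a, b, q, e * L ^ 2 / q, ?_⟩
  filter_upwards [self_mem_nhdsWithin, eventually_forall_norm_le hab,
    eventually_forall_norm_le hV.eventually_hasFDerivAt, hV.eventually_lipschitzOnWith,
    eventually_forall_norm_le (eventually_gradient_eq hR hK hV (h.lie_vectorize)
      (hPK ▸ gainSeries_gain_eq_policy h.1)),
    eventually_continuousOn_feedback hK, eventually_lipschitzOnWith_closedField (S := S) hK,
    Ioo_mem_nhdsGT hρ₁] with ρ h0 h1 h2 h3 h4 h5 h6 h7
  refine ⟨ha, hb, hq, by positivity, h0, fun x hx => (h1 x hx).1, fun x hx => (h1 x hx).2, h2, h3,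
    h4, hqQ, fun x hx => ?_, h5, h6⟩
  have h8 : ‖feedback K x‖ ≤ L * ‖x‖ := by
    have := hL.dist_le_mul x (mem_closedBall_zero_iff.2 (hx.trans h7.2.le)) 0
      (Metric.mem_closedBall_self (le_of_lt hρ₁))
    simpa [feedback_zero] using this
  calc feedback K x ⬝ᵥ R.mulVec (feedback K x) ≤ e * ‖feedback K x‖ ^ 2 :=
        (le_abs_self _).trans (heR _)
    _ ≤ e * (L * ‖x‖) ^ 2 := by gcongr
    _ = e * L ^ 2 / q * (q * ‖x‖ ^ 2) := by field_simp
    _ ≤ _ := by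
      gcongr
      exact hqQ x

end System

end
end Carleman

open scoped ENNReal NNReal
namespace Carleman
noncomputable section
open MvPowerSeries Filter Topology
open Finsupp (sumElim)

/-! ### Optimality and uniqueness of the gain, and the data-driven iteration. -/

namespace System

open MeasureTheory Set

variable {n k : ℕ} {S : System n k} {Q₁ : Matrix (Fin n) (Fin n) ℝ} {R : Matrix (Fin k) (Fin k) ℝ}
  {K : Matrix (Fin k) (Idx n) ℝ} {P : Matrix (Idx n) (Idx n) ℝ}

theorem eventually_hasEval_quadForm (hP : Converges (biSeries P)) :
    ∀ᶠ x in 𝓝 (0 : Fin n → ℝ), HasEval (rowSeries (vectorize P)) x (quadForm P x) := by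
  obtain ⟨r, hr, h⟩ := hP
  filter_upwards [Metric.closedBall_mem_nhds (0 : Fin n → ℝ) (NNReal.coe_pos.2 hr)] with x hx
  have hx' : ‖x‖₊ ≤ r := NNReal.coe_le_coe.1 (by simpa using hx)
  exact hasEval_quadForm ((pnorm_mono hx' _).trans_lt h)

theorem gainSeries_injective : Function.Injective (gainSeries (n := n) (k := k)) := fun K K' h => by
  ext j
  rw [rowSeries_injective (congrFun h j)]

/-- A gain that is the policy of its own cost matrix is the only optimal one, and its cost matrix
gives the minimal cost. -/
theorem IsCostMatrix.isOptimalGain (hQ : Q₁.PosDef) (hR : R.PosDef) (hK : GainConverges K)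
    (hS : S.Stabilizing K) (h : S.IsCostMatrix Q₁ R K P) (hPK : K = S.gain R P) :
    S.IsOptimalGain Q₁ R K ∧ (∀ K', S.IsOptimalGain Q₁ R K' → K' = K) ∧
      ∃ ρ > 0, ∀ x₀ : Fin n → ℝ, ‖x₀‖ < ρ →
        IsLeast {J | ∃ x u, S.Admissible x₀ x u ∧ J = cost Q₁ R x u}
          (ENNReal.ofReal (quadForm P x₀)) := by
  obtain ⟨a, b, q, c, hev⟩ := h.exists_localValue hQ hR hK hS hPK
  obtain ⟨ρ, hval, hgain, hquad⟩ := (hev.and ((eventually_forall_norm_le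
    (eventually_hasEval_gain hK)).and (eventually_forall_norm_le
      (eventually_hasEval_quadForm (h.converges hK hS))))).exists
  -- The initial states from which neither the closed loop nor a competitor of cost at most W(x₀)
  -- can leave the ball.
  have hsmall : ∀ᶠ x₀ in 𝓝 (0 : Fin n → ℝ), ‖x₀‖ < ρ ∧
      (3 + 2 * c) * (b * ‖x₀‖ ^ 2) < a * ρ ^ 2 := by
    refine (ContinuousAt.eventually_lt (by fun_prop) (by fun_prop) ?_).and
      (ContinuousAt.eventually_lt (by fun_prop) (by fun_prop) ?_)
    · simpa using hval.radius_pos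
    · simpa using mul_pos hval.a_pos (pow_pos hval.radius_pos 2)
  have hloop : ∀ x₀ : Fin n → ℝ, ‖x₀‖ < ρ ∧ (3 + 2 * c) * (b * ‖x₀‖ ^ 2) < a * ρ ^ 2 →
      ∃ x : ℝ → Fin n → ℝ, S.Admissible x₀ x (fun t => feedback K (x t)) ∧ (∀ t ≥ 0, ‖x t‖ < ρ) ∧
      Tendsto x atTop (𝓝 0) ∧ cost Q₁ R x (fun t => feedback K (x t)) =
        ENNReal.ofReal (eval (rowSeries (vectorize P)) x₀) := fun x₀ hx₀ =>
    hval.exists_closedLoop hQ hR hx₀.1 (by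
      nlinarith [hx₀.2, mul_nonneg hval.c_nonneg (mul_nonneg hval.b_pos.le (sq_nonneg ‖x₀‖)),
        mul_nonneg hval.b_pos.le (sq_nonneg ‖x₀‖)])
  obtain ⟨ρ₀, hρ₀, hsmall'⟩ := Metric.eventually_nhds_iff.1 hsmall
  simp only [dist_zero_right] at hsmall'
  refine ⟨⟨hK, ρ₀, hρ₀, fun x₀ hx₀ => ?_⟩, fun K' hK' => ?_, ρ₀, hρ₀, fun x₀ hx₀ => ?_⟩
  · obtain ⟨x, h1, h2, h3, h4⟩ := hloop x₀ (hsmall' hx₀)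
    refine ⟨x, fun t ht j => (hgain _ (h2 t ht).le j).2, h1, h3, h4 ▸ ENNReal.ofReal_lt_top,
      fun x' u' h' => ?_⟩
    rw [h4]
    exact hval.ofReal_le_cost hQ hR h' (hsmall' hx₀).1 (hsmall' hx₀).2
  · obtain ⟨hc', ρ', hρ', hopt⟩ := hK'
    obtain ⟨η, hη, hη0⟩ := ((eventually_continuousOn_feedback hc').and self_mem_nhdsWithin).exists
    refine gainSeries_injective (funext fun j => ?_)
    rw [gainConverges_iff_converges] at hc'
    refine eq_of_eval_eq (hc' j) ((gainConverges_iff_converges K).1 hK j) ?_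
    filter_upwards [hsmall, Metric.ball_mem_nhds (0 : Fin n → ℝ) hρ',
      Metric.ball_mem_nhds (0 : Fin n → ℝ) hη0, eventually_hasEval_gain hK,
      eventually_hasEval_gain ((gainConverges_iff_converges K').2 hc')] with x₀ h1 h2 h3 h4 h5
    -- The trajectory of the other optimal gain costs no more than the closed loop of `K`, that is,
    -- at most W(x₀). Its control is continuous at time 0, so it starts with the feedback of `K`. As
    -- x₀ varies, the two feedbacks agree near 0, and so do their power series.
    obtain ⟨x, -, hadm, -, -, hle⟩ := hopt x₀ (mem_ball_zero_iff.1 h2)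
    obtain ⟨y, hy, -, -, hy'⟩ := hloop x₀ h1
    have hcont : ContinuousWithinAt (fun t => feedback K' (x t)) (Ici 0) 0 := by
      refine ContinuousAt.comp_continuousWithinAt (g := feedback K') ?_
        (hadm.continuousOn 0 self_mem_Ici)
      rw [hadm.apply_zero]
      exact hη.continuousAt
        (mem_of_superset (Metric.isOpen_ball.mem_nhds h3) Metric.ball_subset_closedBall)
    have := hval.apply_zero_eq hQ hR hadm h1.1 h1.2 (hy' ▸ hle y _ hy) hcont
    rw [hadm.apply_zero] at this
    rw [(h4 j).1.eval_eq, (h5 j).1.eval_eq, this]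
  · rw [← (hquad x₀ (hsmall' hx₀).1.le).eval_eq]
    obtain ⟨x, h1, -, -, h4⟩ := hloop x₀ (hsmall' hx₀)
    refine ⟨⟨x, _, h1, h4.symm⟩, ?_⟩
    rintro J ⟨x', u', h', rfl⟩
    exact hval.ofReal_le_cost hQ hR h' (hsmall' hx₀).1 (hsmall' hx₀).2

theorem converges_rowSeries_vectorize (hP : Converges (biSeries P)) :
    Converges (rowSeries (vectorize P)) := by
  rw [rowSeries_vectorize]
  exact hP.diagHom

theorem tsum_vectorize_mul_sub {x y : Fin n → ℝ} (hx : pnorm ‖x‖₊ (rowSeries (vectorize P)) < ⊤)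
    (hy : pnorm ‖y‖₊ (rowSeries (vectorize P)) < ⊤) :
    ∑' γ, vectorize P γ * (lift x γ - lift y γ) =
      eval (rowSeries (vectorize P)) x - eval (rowSeries (vectorize P)) y := by
  simp only [mul_sub]
  exact ((hasSum_rowSeries hx).sub (hasSum_rowSeries hy)).tsum_eq

/-- A cost matrix fits the closed-loop data. -/
theorem IsCostMatrix.fitsData (hK : GainConverges K) (hS : S.Stabilizing K)
    (h : S.IsCostMatrix Q₁ R K P) : S.FitsData Q₁ R K P := by
  have hP : Converges (biSeries P) := h.converges hK hS
  have hV := converges_rowSeries_vectorize hP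
  obtain ⟨r, hr, hPr⟩ := hP
  refine ⟨h.1, ⟨r, NNReal.coe_pos.2 hr, (matSummable_iff r P).2 hPr⟩, ?_⟩
  obtain ⟨ρ, h0, h1, h2, h3, h4⟩ := (eventually_mem_nhdsWithin.and
    ((eventually_forall_norm_le hV.eventually_hasFDerivAt).and
    ((eventually_forall_norm_le hV.eventually_pnorm).and
    ((eventually_forall_norm_le (eventually_gradient_closedField hK hV h.lie_vectorize)).and
      (eventually_continuousOn_feedback hK))))).exists
  refine ⟨ρ, h0, fun x t τ hτ hx hball => ?_⟩
  have hle : t ≤ t + τ := by linarith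
  rw [tsum_vectorize_mul_sub (h2 _ (hball t ⟨le_rfl, hle⟩).le)
    (h2 _ (hball (t + τ) ⟨hle, le_rfl⟩).le)]
  have hxc : ContinuousOn x (Icc t (t + τ)) := fun s hs => (hx s hs).continuousWithinAt
  have hd : ∀ s ∈ Icc t (t + τ), HasDerivWithinAt (fun s => -eval (rowSeries (vectorize P)) (x s))
      (runningCost Q₁ R (x s) (feedback K (x s))) (Icc t (t + τ)) s := fun s hs => by
    have := ((h1 _ (hball s hs).le).comp_hasDerivWithinAt s (hx s hs)).fun_neg
    have e := h3 _ (hball s hs).le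
    rw [closedField] at e
    rwa [e, neg_neg] at this
  rw [intervalIntegral.integral_eq_sub_of_hasDerivAt_of_le hle
    (fun s hs => (hd s hs).continuousWithinAt)
    (fun s hs => (hd s (Ioo_subset_Icc_self hs)).hasDerivAt (Icc_mem_nhds hs.1 hs.2))]
  · ring
  · refine ContinuousOn.intervalIntegrable ?_
    rw [uIcc_of_le hle]
    exact continuous_runningCost.comp_continuousOn (hxc.prodMk (h4.comp hxc fun s hs =>
      mem_closedBall_zero_iff.2 (hball s hs).le))

/-- Data fix the derivative of the value function along the closed loop. -/
theorem FitsData.lie_eq (hK : GainConverges K) (h : S.FitsData Q₁ R K P) :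
    lie (S.field (gainSeries K)) (rowSeries (vectorize P)) =
      -stageSeries Q₁ R (gainSeries K) := by
  obtain ⟨-, ⟨r, hr, hPr⟩, ρ₀, hρ₀, hdata⟩ := h
  lift r to ℝ≥0 using hr.le
  have hV := converges_rowSeries_vectorize ⟨r, NNReal.coe_pos.1 hr, (matSummable_iff r P).1 hPr⟩
  have hKc := (gainConverges_iff_converges K).1 hK
  have hstage : Converges (-stageSeries Q₁ R (gainSeries K)) := by
    rw [← diagHom_costSeries, ← zero_sub, ← map_zero C]
    exact (converges_C 0).sub (converges_costSeries Q₁ R hKc).diagHom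
  have hlie : Converges (lie (S.field (gainSeries K)) (rowSeries (vectorize P))) :=
    Converges.sum fun l _ => (S.converges_field hKc l).mul (hV.pderiv l)
  obtain ⟨ρ, hρ, h1, h2, ⟨L, hL⟩, h4, hρ'⟩ := (eventually_mem_nhdsWithin.and
    ((eventually_forall_norm_le hV.eventually_hasFDerivAt).and
    ((eventually_forall_norm_le hV.eventually_pnorm).and
    ((eventually_lipschitzOnWith_closedField (S := S) hK).and
      ((eventually_continuousOn_feedback hK).and (Ioo_mem_nhdsGT hρ₀)))))).exists
  refine eq_of_eval_eq hlie hstage ?_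
  filter_upwards [Metric.ball_mem_nhds (0 : Fin n → ℝ) hρ, eventually_hasEval_field (S := S) hK,
    eventually_hasEval_stage hK, eventually_all.2 fun l => (hV.pderiv l).eventually_pnorm]
    with x₀ hx₀ h5 h6 h7
  rw [mem_ball_zero_iff] at hx₀
  rw [(hasEval_lie h5 h7).eval_eq, h6.neg.eval_eq]
  -- From every small x₀ a short trajectory exists; the data on [0, t] for all small t give the
  -- equation at x₀ by differentiation at t = 0.
  obtain ⟨x, hx0, hx⟩ := exists_solution_clamp (le_of_lt hρ) hL x₀
  have hcont : ContinuousOn x (Ici 0) := fun t ht => (hx t ht).continuousWithinAt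
  obtain ⟨T, hT, hball⟩ := mem_nhdsGE_iff_exists_Icc_subset.1
    ((hcont.norm 0 self_mem_Ici).eventually (gt_mem_nhds (by rwa [hx0] : ‖x 0‖ < ρ)))
  have hT : 0 < T := hT
  have hball : ∀ t ∈ Icc 0 T, ‖x t‖ < ρ := fun t ht => hball ht
  have htraj : ∀ t ∈ Icc 0 T, HasDerivWithinAt x (S.closedField K (x t)) (Icc 0 T) t :=
    fun t ht => by
      have := (hx t ht.1).mono (Icc_subset_Ici_self : Icc 0 T ⊆ Ici 0)
      rwa [clamp_eq (hball t ht).le] at this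
  have hrc : ContinuousOn (fun t => runningCost Q₁ R (x t) (feedback K (x t))) (Icc 0 T) := by
    have hxc := hcont.mono (Icc_subset_Ici_self : Icc 0 T ⊆ Ici 0)
    exact continuous_runningCost.comp_continuousOn (hxc.prodMk (h4.comp hxc fun s hs =>
      mem_closedBall_zero_iff.2 (hball s hs).le))
  have h0T : (0 : ℝ) ∈ Icc 0 T := ⟨le_rfl, hT.le⟩
  have hd1 : HasDerivWithinAt (fun t => eval (rowSeries (vectorize P)) (x t))
      (gradient (rowSeries (vectorize P)) x₀ (S.closedField K x₀)) (Icc 0 T) 0 := by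
    have := (h1 _ (hball 0 h0T).le).comp_hasDerivWithinAt 0 (htraj 0 h0T)
    rwa [hx0] at this
  have hd2 : HasDerivWithinAt (fun t => eval (rowSeries (vectorize P)) x₀ -
      ∫ s in (0 : ℝ)..t, runningCost Q₁ R (x s) (feedback K (x s)))
      (-runningCost Q₁ R x₀ (feedback K x₀)) (Icc 0 T) 0 := by
    have h8 : HasDerivWithinAt (fun t => ∫ s in (0 : ℝ)..t,
        runningCost Q₁ R (x s) (feedback K (x s))) (runningCost Q₁ R (x 0) (feedback K (x 0)))
        (Icc 0 T) 0 := by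
      have : Fact ((0 : ℝ) ∈ Icc 0 T) := ⟨h0T⟩
      exact intervalIntegral.integral_hasDerivWithinAt_right (by simp)
        (hrc.stronglyMeasurableAtFilter_nhdsWithin measurableSet_Icc 0) (hrc 0 h0T)
    rw [hx0] at h8
    simpa using h8.const_sub (eval (rowSeries (vectorize P)) x₀)
  refine (uniqueDiffOn_Icc hT 0 h0T).eq_deriv _ hd1 (hd2.congr_of_mem (fun t ht => ?_) h0T)
  rcases ht.1.eq_or_lt with rfl | ht0
  · simp [hx0]
  have hsub : Icc 0 t ⊆ Icc 0 T := Icc_subset_Icc_right ht.2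
  have h9 := hdata x 0 t ht0 (by
    rw [ClosedLoopTrajectory, zero_add]
    exact fun s hs => (htraj s (hsub hs)).mono hsub) (by
    rw [zero_add]
    exact fun s hs => (hball s (hsub hs)).trans hρ'.2)
  rw [zero_add, tsum_vectorize_mul_sub (h2 _ (hball 0 h0T).le) (h2 _ (hball t ht).le), hx0] at h9
  linarith

/-- The data determine the vectorization of the cost matrix. -/
theorem FitsData.rowSeries_vectorize_eq (hK : GainConverges K) (hS : S.Stabilizing K)
    {P' : Matrix (Idx n) (Idx n) ℝ} (h : S.FitsData Q₁ R K P') (hP : S.IsCostMatrix Q₁ R K P) :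
    rowSeries (vectorize P') = rowSeries (vectorize P) := by
  -- Uniqueness is used for series in x alone: the data fix the restriction of W to the diagonal,
  -- not the matrix.
  obtain ⟨N⟩ := exists_adaptedNorm ((S.stabilizing_iff K).1 hS)
  refine sub_eq_zero.1 (N.eq_zero_of_lie_eq_zero (S.constantCoeff_field (constantCoeff_gainSeries K))
    (S.converges_field ((gainConverges_iff_converges K).1 hK)) rfl ?_ ?_)
  · simp [constantCoeff_rowSeries]
  · rw [lie_sub, h.lie_eq hK, hP.lie_vectorize, sub_self]

variable {K₀ : Matrix (Fin k) (Idx n) ℝ} {PL : ℕ → Matrix (Idx n) (Idx n) ℝ}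
  {KL : ℕ → Matrix (Fin k) (Idx n) ℝ}

theorem LyapunovIteration.dataIteration (hQ : Q₁.PosDef) (hR : R.PosDef) (hK₀ : GainConverges K₀)
    (hS : S.Stabilizing K₀) (h : S.LyapunovIteration Q₁ R K₀ PL KL) :
    S.DataIteration Q₁ R K₀ PL KL :=
  ⟨h.start, fun i => (h.evaluate i).fitsData (h.stable hQ hR hK₀ hS i).1
    (h.stable hQ hR hK₀ hS i).2, h.improve⟩

/-- The data-driven iteration has the same value functions as the iteration of Lyapunov
equations. -/
theorem DataIteration.rowSeries_vectorize_eq (hQ : Q₁.PosDef) (hR : R.PosDef)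
    (hK₀ : GainConverges K₀) (hS : S.Stabilizing K₀) {PD : ℕ → Matrix (Idx n) (Idx n) ℝ}
    {KD : ℕ → Matrix (Fin k) (Idx n) ℝ} (hD : S.DataIteration Q₁ R K₀ PD KD)
    (h : S.LyapunovIteration Q₁ R K₀ PL KL) (i : ℕ) :
    rowSeries (vectorize (PD i)) = rowSeries (vectorize (PL i)) := by
  have hstep : ∀ i, KD i = KL i → rowSeries (vectorize (PD i)) = rowSeries (vectorize (PL i)) :=
    fun i hi => (hi ▸ hD.evaluate i).rowSeries_vectorize_eq (h.stable hQ hR hK₀ hS i).1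
      (h.stable hQ hR hK₀ hS i).2 (h.evaluate i)
  refine hstep i ?_
  induction i with
  | zero => rw [hD.start, h.start]
  | succ i ih =>
    -- Equal vectorizations of symmetric matrices give equal gains, although the matrices themselves
    -- may differ.
    refine gainSeries_injective ?_
    rw [hD.improve, h.improve, gainSeries_gain_eq_policy (hD.evaluate i).1,
      gainSeries_gain_eq_policy (h.evaluate i).1, hstep i ih]

end System

end
end Carleman

open scoped ENNReal NNReal
namespace Carleman
noncomputable section
open MvPowerSeries Filter Topology
open Finsupp (sumElim)

/-! ### Uniform convergence of the quadratic forms, and the theorem. -/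

namespace System

variable {n : ℕ}

/-- For x in the polydisc the difference is the value of a series whose norm is at most that of the
difference of the matrices. The bound does not depend on x, hence the convergence is uniform along
curves. -/
theorem abs_quadForm_sub_le {P P' : Matrix (Idx n) (Idx n) ℝ} {r : ℝ≥0} {x : Fin n → ℝ}
    (hx : ‖x‖ ≤ r) (hP : pnorm r (biSeries P) < ⊤) (hP' : pnorm r (biSeries P') < ⊤)
    (hd : pnorm r (biSeries P - biSeries P') < ⊤) :
    |quadForm P x - quadForm P' x| ≤ (pnorm r (biSeries P - biSeries P')).toReal := by
  have hx' : ‖x‖₊ ≤ r := NNReal.coe_le_coe.1 (by simpa using hx)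
  have h := (hasEval_quadForm ((pnorm_mono hx' _).trans_lt hP)).sub
    (hasEval_quadForm ((pnorm_mono hx' _).trans_lt hP'))
  rw [← h.eval_eq]
  refine (abs_eval_le h.fin).trans (ENNReal.toReal_mono hd.ne ?_)
  rw [rowSeries_vectorize, rowSeries_vectorize, ← map_sub]
  exact (pnorm_diagHom_le _ _).trans (pnorm_mono hx' _)

end System

end
end Carleman

theorem theorem6 {n k : ℕ} (S : Carleman.System n k)
    (Q₁ : Matrix (Fin n) (Fin n) ℝ) (hQ : Q₁.PosDef)
    (R : Matrix (Fin k) (Fin k) ℝ) (hR : R.PosDef)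
    (K₀ : Matrix (Fin k) (Carleman.Idx n) ℝ)
    (hK₀ : Carleman.GainConverges K₀) (hstab : S.Stabilizing K₀) :
    ∃ (Kstar : Matrix (Fin k) (Carleman.Idx n) ℝ)
      (Pstar : Matrix (Carleman.Idx n) (Carleman.Idx n) ℝ),
      -- the optimal gain, its cost matrix, and the optimal cost
      S.IsOptimalGain Q₁ R Kstar ∧
      (∀ K, S.IsOptimalGain Q₁ R K → K = Kstar) ∧
      S.IsCostMatrix Q₁ R Kstar Pstar ∧
      (∀ P, S.IsCostMatrix Q₁ R Kstar P → P = Pstar) ∧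
      Kstar = S.gain R Pstar ∧
      (∃ ρ > 0, ∀ x₀ : Fin n → ℝ, ‖x₀‖ < ρ →
        IsLeast {J | ∃ x u, S.Admissible x₀ x u ∧ J = Carleman.cost Q₁ R x u}
          (ENNReal.ofReal (Carleman.quadForm Pstar x₀))) ∧
      -- the iteration is well defined, and it satisfies the data-driven equations
      (∃! PK : (ℕ → Matrix (Carleman.Idx n) (Carleman.Idx n) ℝ) ×
          (ℕ → Matrix (Fin k) (Carleman.Idx n) ℝ),
        S.LyapunovIteration Q₁ R K₀ PK.1 PK.2) ∧
      (∀ P K, S.LyapunovIteration Q₁ R K₀ P K → S.DataIteration Q₁ R K₀ P K) ∧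
      -- convergence
      ∃ r > 0, Carleman.MatSummable r Pstar ∧
        (∀ P K, S.LyapunovIteration Q₁ R K₀ P K →
          (∀ i, Carleman.MatSummable r (P i)) ∧
          Filter.Tendsto (fun i => Carleman.matNorm r (P i - Pstar)) Filter.atTop (nhds 0)) ∧
        (∀ P K, S.DataIteration Q₁ R K₀ P K →
          (∀ i, Carleman.VecSummable r (Carleman.vectorize (P i))) ∧
          Filter.Tendsto (fun i => Carleman.vecNorm r
            (Carleman.vectorize (P i) - Carleman.vectorize Pstar)) Filter.atTop (nhds 0)) ∧
        (∀ P K, S.LyapunovIteration Q₁ R K₀ P K →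
          ∀ T > 0, ∀ x : ℝ → Fin n → ℝ, (∀ t ∈ Set.Icc 0 T, ‖x t‖ ≤ r) →
            TendstoUniformlyOn (fun i t => Carleman.quadForm (P i) (x t))
              (fun t => Carleman.quadForm Pstar (x t)) Filter.atTop (Set.Icc 0 T)) := by
  obtain ⟨⟨P, K⟩, hPK, huniq⟩ := Carleman.System.existsUnique_lyapunovIteration hQ hR hK₀ hstab
  obtain ⟨Kstar, Pstar, hK, hS, hP, hKP, r, hr, hPr, hPir, hlim⟩ :=
    Carleman.System.LyapunovIteration.exists_limit hQ hR hK₀ hstab hPK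
  -- The limit is constructed from `K₀`, but being the only optimal gain it does not depend on it.
  obtain ⟨h1, h2, h3⟩ := hP.isOptimalGain hQ hR hK hS hKP
  have hL : ∀ P' K', S.LyapunovIteration Q₁ R K₀ P' K' → P' = P := fun P' K' h =>
    congrArg Prod.fst (huniq (P', K') h)
  -- The real-valued norms are `toReal` of norms in [0,∞]; comparing them requires finiteness, which
  -- holds eventually.
  have hd : ∀ᶠ i in Filter.atTop,
      Carleman.pnorm r (Carleman.biSeries (P i) - Carleman.biSeries Pstar) < ⊤ :=
    hlim.eventually (gt_mem_nhds ENNReal.zero_lt_top)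
  have hlim' : Filter.Tendsto (fun i =>
      (Carleman.pnorm r (Carleman.biSeries (P i) - Carleman.biSeries Pstar)).toReal)
      Filter.atTop (nhds 0) := by
    have := (ENNReal.tendsto_toReal ENNReal.zero_ne_top).comp hlim
    rwa [ENNReal.toReal_zero] at this
  refine ⟨Kstar, Pstar, h1, h2, hP, fun P' hP' => hP'.unique hK hS hP, hKP, h3,
    ⟨(P, K), hPK, huniq⟩, fun P' K' h => h.dataIteration hQ hR hK₀ hstab, r, NNReal.coe_pos.2 hr,
    (Carleman.matSummable_iff r Pstar).2 hPr, fun P' K' h => ?_, fun P' K' h => ?_,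
    fun P' K' h T _ x hx => ?_⟩
  · obtain rfl := hL P' K' h
    refine ⟨fun i => (Carleman.matSummable_iff r _).2 (hPir i), ?_⟩
    simpa only [Carleman.matNorm_eq, Carleman.biSeries_sub] using hlim'
  · have hrow := h.rowSeries_vectorize_eq hQ hR hK₀ hstab hPK
    refine ⟨fun i => ?_, ?_⟩
    · rw [Carleman.vecSummable_iff, hrow, Carleman.rowSeries_vectorize]
      exact (Carleman.pnorm_diagHom_le r _).trans_lt (hPir i)
    · simp only [Carleman.vecNorm_eq, Carleman.rowSeries_sub, hrow, Carleman.rowSeries_vectorize,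
        ← map_sub]
      refine squeeze_zero' (Filter.Eventually.of_forall fun i => ENNReal.toReal_nonneg) ?_ hlim'
      filter_upwards [hd] with i hi
      exact ENNReal.toReal_mono hi.ne (Carleman.pnorm_diagHom_le r _)
  · obtain rfl := hL P' K' h
    refine Metric.tendstoUniformlyOn_iff.2 fun ε hε => ?_
    filter_upwards [hd, hlim'.eventually (gt_mem_nhds hε)] with i hi hiε t ht
    rw [dist_comm, Real.dist_eq]
    exact (Carleman.System.abs_quadForm_sub_le (hx t ht) (hPir i) hPr hi).trans_lt hiε
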